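/- Functions on $\mathbb T=\mathbb R/2\pi\mathbb Z$ are $2\pi$-periodic functions, $\langle x_1,\dots,x_n\rangle=\sqrt{1+x_1^2+\dots+x_n^2}$, $\mathbb N^\star=\{1,2,\dots\}$, and the Fourier transform in $v$ is $\widehat g(\eta)=\int_{\mathbb R}e^{-i\eta v}g(v)\,dv$. If $g$ is not Lebesgue integrable, "$G$ is the Fourier transform of $g$" means that $G$ is continuous and integrable and $g(v)=\frac1{2\pi}\int G(\eta)e^{i\eta v}d\eta$, and $\int g\,dv$ means $\lim_{\delta\to0+}\int e^{-\delta v^2}g(v)\,dv$. Let $\theta_0,C_0,\kappa_0>0$. Let $\mu:\mathbb R\to\mathbb R$ be real analytic with $\langle v\rangle^2\mu$ integrable and $$|\widehat{\langle v\rangle^2\mu}(\eta)|+|\widehat\mu(\eta)|\le C_0e^{-\theta_0|\eta|}\quad(\eta\in\mathbb R),$$ and assume the Penrose stability condition $$\inf_{k\in\mathbb Z\setminus\{0\},\ \Re\lambda\ge0}\Big|1+\int_0^\infty e^{-\lambda t}\,t\,\widehat\mu(kt)\,dt\Big|\ge\kappa_0 .$$ Consider, for complex-valued $f$, the perturbed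 Vlasov–Poisson system on $\mathbb T\times\mathbb R$ $$\partial_tf+v\,\partial_xf+E\,\partial_vf+E\,\partial_v\mu=0,\qquad \partial_xE=\rho=\int_{\mathbb R}f\,dv,\qquad \int_{\mathbb T}E\,dx=0 .$$ Then there is $\lambda_*>0$ (depending only on $\mu,\theta_0,C_0,\kappa_0$) such that for every $0<\lambda_0\le\lambda_*$ there are $\varepsilon_0,C_1,c>0$ such that the following holds for all integers $K\ge1$ and all real $L>0$ with $L\le C_0K$; in particular $\varepsilon_0,C_1,c$ do not depend on $K$ and $L$, which may be arbitrarily large. Let $f^0_{k,\eta}$, $(k,\eta)\in(\mathbb Z\setminus\{0\})\times\mathbb Z$, be (necessarily analytic) functions with $$|\widehat f^0_{k,\eta}(\eta')|\le e^{-2\lambda_0\langle k,\eta,\eta'\rangle}\quad\text{for all }k,\eta,\eta' .$$ Then there are functions $f_{k,\eta,p}(t,v)$, $(k,\eta,p)\in\mathbb Z\times\mathbb Z\times\mathbb N^\star$, $t\ge0$, analytic in $v$, with $$|\widehat f_{k,\eta,p}(t,\eta')|\le C_1^p\,e^{-\lambda_0\langle k,\eta,p,\eta'\rangle}\quad\text{for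 all }k,\eta,p,\eta'\text{ and }t\ge0,$$ such that for every $0<\varepsilon\le\varepsilon_0$ the system with initial datum $$f^0(x,v)=\sum_{(k,\eta)\in(\mathbb Z\setminus\{0\})\times\mathbb Z}\varepsilon f^0_{k,\eta}(v)\,e^{iKkx+iL\eta v}$$ has a global classical ($C^1$ on $[0,\infty)\times\mathbb T\times\mathbb R$) solution $f$, which is unique among the classical solutions that are analytic in $(x,v)$ locally uniformly in time (that is, whose Fourier transform in $(x,v)$ is, for each $k$, jointly continuous in $(t,\eta)$ and is, on each time interval $[0,T]$, bounded by $Ce^{-r(|k|+|\eta|)}$ for some $C$ and some $r>0$). For all $t\ge0$ it is given by the absolutely convergent series $$f(t,x,v)=\sum_{(k,\eta,p)\in\mathbb Z\times\mathbb Z\times\mathbb N^\star}\varepsilon^pf_{k,\eta,p}(t,v)\,e^{iKkx+i(L\eta-Kkt)v},$$ $$E(t,x)=\sum_{(k,\eta,p)\in(\mathbb Z\setminus\{0\})\times\mathbb Z\times\mathbb N^\star}\varepsilon^p\,\widehat f_{k,\eta,p}(t,Kkt-L\eta)\,\frac{e^{iKkx}}{iKk}.$$ The electric field $E(t,\cdot)$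 is smooth and decays exponentially in every Sobolev space: for all real $s\ge0$ and all $1\le q\le\infty$ there is $C$ such that $\|E(t)\|_{W^{s,q}(\mathbb T)}\le Ce^{-ct}$ for all $t\ge0$. -/

import Mathlib

open MeasureTheory Set Filter Topology
open scoped ENNReal ContDiff

namespace VlasovPoisson

noncomputable section

/-- The Fourier transform in the velocity variable, `ĝ(η) = ∫ e^{-iηv} g(v) dv`. -/
def fourierV (g : ℝ → ℂ) (η : ℝ) : ℂ :=
  ∫ v : ℝ, Complex.exp (-(Complex.I * η * v)) * g v

/-- `G` is the Fourier transform of `g`, where `G` is continuous and integrable.  This is expressed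
by the inversion formula `g(v) = (2π)⁻¹ ∫ G(η) e^{iηv} dη`, so that it also makes sense when `g`
itself is not Lebesgue integrable.  `G` is determined by `g`, and for integrable continuous `g`
with integrable transform it is `fourierV g`, see `isFourierTransform_fourierV`. -/
def IsFourierTransform (g G : ℝ → ℂ) : Prop :=
  Continuous G ∧ Integrable G ∧
    ∀ v : ℝ, g v = (2 * Real.pi : ℂ)⁻¹ * ∫ η : ℝ, G η * Complex.exp (Complex.I * η * v)

/-- `r` is the velocity integral `∫ g(v) dv`, understood as the limit of the integrals
`∫ e^{-δv²} g(v) dv` as `δ → 0+`.  For integrable `g` this is the Lebesgue integral, see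
`hasVelocityIntegral_of_integrable`. -/
def HasVelocityIntegral (g : ℝ → ℂ) (r : ℂ) : Prop :=
  (∀ δ : ℝ, 0 < δ → Integrable (fun v : ℝ => (Real.exp (-(δ * v ^ 2)) : ℂ) * g v)) ∧
    Tendsto (fun δ : ℝ => ∫ v : ℝ, (Real.exp (-(δ * v ^ 2)) : ℂ) * g v) (𝓝[>] 0) (𝓝 r)

/-- The assumptions on the equilibrium: `μ` is real analytic and
`|(⟨v⟩²μ)^(η)| + |μ̂(η)| ≤ C₀ e^{-θ₀|η|}`. -/
structure IsAnalyticEquilibrium (μ : ℝ → ℝ) (θ₀ C₀ : ℝ) : Prop where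
  analytic : AnalyticOnNhd ℝ μ univ
  integrable : Integrable (fun v : ℝ => (1 + v ^ 2) * μ v)
  decay : ∀ η : ℝ, ‖fourierV (fun v => (((1 + v ^ 2) * μ v : ℝ) : ℂ)) η‖ +
    ‖fourierV (fun v => (μ v : ℂ)) η‖ ≤ C₀ * Real.exp (-(θ₀ * |η|))

/-- The Penrose stability condition with constant `κ₀`. -/
def PenroseStable (μ : ℝ → ℝ) (κ₀ : ℝ) : Prop :=
  ∀ k : ℤ, k ≠ 0 → ∀ z : ℂ, 0 ≤ z.re →
    κ₀ ≤ ‖1 + ∫ t in Ioi (0 : ℝ),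
      Complex.exp (-(z * t)) * t * fourierV (fun v => (μ v : ℂ)) (k * t)‖

/-- `f` (with electric field `E`) is a global classical solution, on the torus of length `2π` in `x`
and the line in `v`, of
`∂ₜ f + v ∂ₓ f + E ∂ᵥ f + E ∂ᵥ μ = 0`, `∂ₓ E = ρ = ∫ f dv`, with initial datum `f⁰`.
Functions on the torus are `2π`-periodic functions, and `E` is normalised to have mean zero. -/
structure IsSolution (μ : ℝ → ℝ) (f₀ : ℝ → ℝ → ℂ) (f : ℝ → ℝ → ℝ → ℂ) (E : ℝ → ℝ → ℂ) :
    Prop where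
  initial : ∀ x v : ℝ, f 0 x v = f₀ x v
  periodic : ∀ t x v : ℝ, 0 ≤ t → f t (x + 2 * Real.pi) v = f t x v
  vlasov : ∃ ft fx fv : ℝ → ℝ → ℝ → ℂ,
    ContinuousOn (fun z : ℝ × ℝ × ℝ => ft z.1 z.2.1 z.2.2) {z | 0 ≤ z.1} ∧
    ContinuousOn (fun z : ℝ × ℝ × ℝ => fx z.1 z.2.1 z.2.2) {z | 0 ≤ z.1} ∧
    ContinuousOn (fun z : ℝ × ℝ × ℝ => fv z.1 z.2.1 z.2.2) {z | 0 ≤ z.1} ∧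
    ∀ t x v : ℝ, 0 ≤ t →
      HasDerivWithinAt (fun s => f s x v) (ft t x v) (Ici 0) t ∧
      HasDerivAt (fun y => f t y v) (fx t x v) x ∧
      HasDerivAt (fun w => f t x w) (fv t x v) v ∧
      ft t x v + v * fx t x v + E t x * fv t x v + E t x * ((deriv μ v : ℝ) : ℂ) = 0
  poisson : ∀ t x : ℝ, 0 ≤ t → ∃ ρ : ℂ,
    HasVelocityIntegral (fun v => f t x v) ρ ∧ HasDerivAt (E t) ρ x
  field_periodic : ∀ t x : ℝ, 0 ≤ t → E t (x + 2 * Real.pi) = E t x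
  field_mean : ∀ t : ℝ, 0 ≤ t → ∫ x in (0 : ℝ)..(2 * Real.pi), E t x = 0

/-- `f(t)` is analytic on the torus times the line, locally uniformly in time: its Fourier transform
`F t k η` in `(x, v)` is continuous in `(t, η)` and decays exponentially in `(k, η)`, with constants
that are uniform on compact time intervals. -/
def IsLocallyUniformlyAnalytic (f : ℝ → ℝ → ℝ → ℂ) : Prop :=
  ∃ F : ℝ → ℤ → ℝ → ℂ,
    (∀ k : ℤ, ContinuousOn (fun z : ℝ × ℝ => F z.1 k z.2) {z | 0 ≤ z.1}) ∧
    (∀ T : ℝ, 0 < T → ∃ C r : ℝ, 0 < r ∧ ∀ t ∈ Icc (0 : ℝ) T, ∀ (k : ℤ) (η : ℝ),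
      ‖F t k η‖ ≤ C * Real.exp (-(r * (|(k : ℝ)| + |η|)))) ∧
    ∀ t x v : ℝ, 0 ≤ t →
      HasSum (fun k : ℤ => (2 * Real.pi : ℂ)⁻¹ *
        ∫ η : ℝ, F t k η * Complex.exp (Complex.I * (k * x + η * v))) (f t x v)

/-- The norm of the Sobolev space `W^{s,q}` of the torus of length `2π`, for a smooth `2π`-periodic
function: the sum of the `L^q` norms of the derivatives up to order `⌊s⌋` and, when `s` is not an
integer, the Sobolev–Slobodeckij (for `q = ∞`, Hölder) seminorm of the derivative of order `⌊s⌋`. -/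
def sobolevNorm (s : ℝ) (q : ℝ≥0∞) (g : ℝ → ℂ) : ℝ≥0∞ :=
  (∑ j ∈ Finset.range (⌊s⌋₊ + 1),
    eLpNorm (iteratedDeriv j g) q (volume.restrict (Ioc 0 (2 * Real.pi)))) +
  if Int.fract s = 0 then 0 else
    eLpNorm (fun z : ℝ × ℝ =>
        ‖iteratedDeriv ⌊s⌋₊ g (z.1 + z.2) - iteratedDeriv ⌊s⌋₊ g z.1‖ /
          |z.2| ^ (Int.fract s + (1 / q).toReal)) q
      ((volume.restrict (Ioc 0 (2 * Real.pi))).prod (volume.restrict (Ioc (-Real.pi) Real.pi)))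

theorem isFourierTransform_fourierV {g : ℝ → ℂ} (hc : Continuous g) (hg : Integrable g)
    (hG : Integrable (fourierV g)) : IsFourierTransform g (fourierV g) := by
  have hF : ∀ η : ℝ, fourierV g η = FourierTransform.fourier g (η / (2 * Real.pi)) := by
    intro η
    rw [Real.fourier_eq', fourierV]
    congr 1
    ext v
    rw [smul_eq_mul]
    congr 2
    have : (Real.pi : ℂ) ≠ 0 := by exact_mod_cast Real.pi_ne_zero
    simp
    field_simp
  have hpi : (2 * Real.pi) ≠ 0 := by positivity
  have hF' : ∀ ξ : ℝ, FourierTransform.fourier g ξ = fourierV g (2 * Real.pi * ξ) := by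
    intro ξ
    rw [hF]
    field_simp
  have hI : Integrable (FourierTransform.fourier g) := by
    have := hG.comp_mul_left' hpi
    exact this.congr (Eventually.of_forall fun ξ => (hF' ξ).symm)
  refine ⟨?_, hG, fun v => ?_⟩
  · have h1 : Continuous (FourierTransform.fourier g) :=
      VectorFourier.fourierIntegral_continuous Real.continuous_fourierChar
        (by exact continuous_inner) hg
    have h2 : fourierV g = fun η => FourierTransform.fourier g (η / (2 * Real.pi)) := funext hF
    rw [h2]
    exact h1.comp (continuous_id.div_const _)
  · have h := congrFun (hc.fourierInv_fourier_eq hg hI) v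
    rw [← h, Real.fourierInv_eq']
    have h3 := Measure.integral_comp_mul_left
      (fun η : ℝ => fourierV g η * Complex.exp (Complex.I * η * v)) (2 * Real.pi)
    rw [abs_of_pos (by positivity)] at h3
    have h4 : (2 * Real.pi : ℂ)⁻¹ * ∫ η : ℝ, fourierV g η * Complex.exp (Complex.I * η * v) =
        (2 * Real.pi)⁻¹ • ∫ η : ℝ, fourierV g η * Complex.exp (Complex.I * η * v) := by
      rw [Complex.real_smul]; push_cast; rfl
    rw [h4, ← h3]
    congr 1
    ext ξ
    rw [hF' ξ, smul_eq_mul, mul_comm]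
    congr 2
    simp
    ring

theorem hasVelocityIntegral_of_integrable {g : ℝ → ℂ} (hg : Integrable g) :
    HasVelocityIntegral g (∫ v, g v) := by
  have hm : ∀ δ : ℝ, AEStronglyMeasurable
      (fun v : ℝ => (Real.exp (-(δ * v ^ 2)) : ℂ) * g v) := fun δ =>
    (by fun_prop : Continuous fun v : ℝ =>
      (Real.exp (-(δ * v ^ 2)) : ℂ)).aestronglyMeasurable.mul hg.1
  have hb : ∀ δ : ℝ, 0 < δ → ∀ v : ℝ, ‖(Real.exp (-(δ * v ^ 2)) : ℂ) * g v‖ ≤ ‖g v‖ := by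
    intro δ hδ v
    rw [norm_mul, Complex.norm_real, Real.norm_of_nonneg (Real.exp_pos _).le]
    refine mul_le_of_le_one_left (norm_nonneg _) (Real.exp_le_one_iff.2 ?_)
    have : 0 ≤ δ * v ^ 2 := by positivity
    linarith
  refine ⟨fun δ hδ => hg.mono (hm δ) (Eventually.of_forall (hb δ hδ)), ?_⟩
  refine tendsto_integral_filter_of_dominated_convergence (fun v => ‖g v‖)
    (Eventually.of_forall hm) ?_ hg.norm ?_
  · filter_upwards [self_mem_nhdsWithin] with δ hδ
    exact Eventually.of_forall (hb δ hδ)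
  · refine Eventually.of_forall fun v => ?_
    have hc : Continuous fun δ : ℝ => (Real.exp (-(δ * v ^ 2)) : ℂ) * g v := by fun_prop
    have := hc.tendsto 0
    simp only [zero_mul, neg_zero, Real.exp_zero, Complex.ofReal_one, one_mul] at this
    exact this.mono_left nhdsWithin_le_nhds

end

end VlasovPoisson

namespace VlasovPoisson

noncomputable section

/-! ### Exponential weights -/

/-! Along the free flow, the Fourier coefficients of the perturbation split into profiles `H k η n t
ξ`: `x`-frequency `K k`, `v`-frequency `L η + ξ`, coefficient of `ε ^ (n + 1)`. The density of such
a mode is the value of its profile at the moving frequency `resFreq = K k t - L η`. Matching powers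
of `ε` turns the equation into a hierarchy: each order solves a linearised equation, forced by
products of densities and profiles of lower order.

Linear part. Restricted to the resonant frequency, the linear equation is a Volterra equation for
the density with kernel `t μ̂(K k t)`. By the Penrose condition `1 + L k` stays away from zero
slightly to the left of the imaginary axis, so that the inverse Laplace transform of `-L k / (1 + L
k)` along a line to the left of the axis is an exponentially decaying resolvent
(`exists_resolvent`). Rescaling time by `|q|` makes this uniform in the frequency `q`
(`exists_density_resolvent`). Once the density is known, the profile follows by integration.

Nonlinear part. Profiles are measured by `exp (-radius t * z) * (1 + z)^(-20)`, where `z` is the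
size of the frequency including the order, and densities have in addition the decay `(1 + t)^(-3)`.
The radius decreases from `11/10 lam` to `lam`. In a product, sizes are subadditive, so the
exponentials combine and a negative power of the smaller of the two sizes remains. It makes the sums
over modes and orders converge, with a bound that does not grow with the order. For profiles, the
nonlinearity loses one factor `z`, which the decreasing radius recovers after integration in time
(`norm_integral_le_weight`). For densities, the dangerous factor is `|k| (t - s)`, the mechanism of
plasma echoes. It is controlled by a dichotomy (`sqrt_le_gain`): either `|k| (t - s)` is comparable
with `t` or larger, and then the radius has decreased enough, or `s` is close to `t` and both
interacting frequencies are large. Largeness comes from `abs_le_of_resonance`: since `L ≤ C₀ K`, a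
mode can be resonant at time `t` only if `η` is of size at least a multiple of `t`. All constants
therefore depend on `L / K` only through `C₀`. Induction on the order then gives geometric growth `B
^ (n + 1)` of the coefficients (`exists_echoBound`), hence convergence for `ε B ≤ 1`.

Summation and Landau damping. The summed coefficients together with `μ̂` solve the Vlasov–Poisson
system on the Fourier side (`EchoSeries.isFourierSolution`), and their synthesis is a classical
solution (`IsFourierSolution.isSolution`). The field only sees resonant frequencies, whose sizes are
at least a multiple of `t`; the exponential weight thus turns into exponential decay in time
(`EchoSeries.norm_P_le`).

Uniqueness. An analytic classical solution has coefficients that solve the same integral equation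
(`IsSolution.exists_isFourierSolution`). Two such families with the same data agree by a
Cauchy–Kovalevskaya argument with a radius that decreases linearly in time, iterated over short time
intervals (`IsFourierSolution.eq_of_eq_on_short`). -/

theorem summable_exp_neg_mul_abs_int {r : ℝ} (hr : 0 < r) :
    Summable fun j : ℤ => Real.exp (-(r * |(j : ℝ)|)) := by
  have h : Summable fun n : ℕ => Real.exp (-(r * (n : ℝ))) := by
    have := Real.summable_exp_nat_mul_iff (a := -r)|>.2 (by linarith)
    refine this.congr fun n => ?_
    congr 1; ring
  rw [summable_int_iff_summable_nat_and_neg]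
  refine ⟨h.congr fun n => ?_, h.congr fun n => ?_⟩
  · simp
  · simp

theorem integrable_exp_neg_mul_abs {r : ℝ} (hr : 0 < r) :
    Integrable fun ξ : ℝ => Real.exp (-(r * |ξ|)) := by
  rw [← integrableOn_univ, ← Iic_union_Ioi (a := (0 : ℝ)), integrableOn_union]
  constructor
  · have : IntegrableOn (fun ξ : ℝ => Real.exp (r * ξ)) (Iic 0) := by
      have := integrableOn_exp_mul_Iic hr 0
      exact this
    refine this.congr_fun (fun ξ hξ => ?_) measurableSet_Iic
    simp only [abs_of_nonpos (show ξ ≤ 0 from hξ)]; ring_nf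
  · have : IntegrableOn (fun ξ : ℝ => Real.exp (-r * ξ)) (Ioi 0) := by
      exact integrableOn_exp_mul_Ioi (by linarith) 0
    refine this.congr_fun (fun ξ hξ => ?_) measurableSet_Ioi
    simp only [abs_of_pos (show 0 < ξ from hξ)]; ring_nf

/-- One term of the exponential series. This is the means by which polynomial losses are paid for
with a small part of an exponential rate throughout. -/
theorem exists_one_add_pow_mul_exp_le (n : ℕ) {r : ℝ} (hr : 0 < r) :
    ∃ C : ℝ, 0 < C ∧ ∀ x : ℝ, 0 ≤ x → (1 + x) ^ n * Real.exp (-(r * x)) ≤ C := by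
  refine ⟨(n.factorial : ℝ) / r ^ n * Real.exp r, by positivity, fun x hx => ?_⟩
  have h1 := Real.pow_div_factorial_le_exp (r * (1 + x)) (by positivity) n
  have h2 : (1 + x) ^ n ≤ n.factorial / r ^ n * Real.exp (r * (1 + x)) := by
    rw [mul_pow, div_le_iff₀ (by positivity)] at h1
    rw [div_mul_eq_mul_div, le_div_iff₀ (by positivity)]
    linarith
  calc (1 + x) ^ n * Real.exp (-(r * x))
      ≤ n.factorial / r ^ n * Real.exp (r * (1 + x)) * Real.exp (-(r * x)) := by gcongr
    _ = n.factorial / r ^ n * Real.exp r := by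
      rw [mul_assoc, ← Real.exp_add]; ring_nf

/-! ### Integration over the frequencies `ℤ × ℝ` -/

/-- The dual Haar measure of the frequencies `ℤ × ℝ`. -/
def freqMeasure : Measure (ℤ × ℝ) := Measure.count.prod volume

instance : SFinite freqMeasure := by unfold freqMeasure; infer_instance

instance : freqMeasure.IsAddRightInvariant := by
  unfold freqMeasure; infer_instance

theorem integrable_exp_freq {r : ℝ} (hr : 0 < r) (C : ℝ) :
    Integrable (fun X : ℤ × ℝ => C * Real.exp (-(r * (|(X.1 : ℝ)| + |X.2|)))) freqMeasure := by
  have h1 : Integrable (fun j : ℤ => Real.exp (-(r * |(j : ℝ)|))) Measure.count := by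
    rw [integrable_count_iff]
    exact (summable_exp_neg_mul_abs_int hr).norm
  have := (h1.mul_prod (integrable_exp_neg_mul_abs hr)).const_mul C
  refine this.congr (Eventually.of_forall fun X => ?_)
  simp only [← Real.exp_add]; ring_nf

theorem measurable_freq {A : ℤ → ℝ → ℂ} (hA : ∀ j, Continuous (A j)) :
    Measurable fun X : ℤ × ℝ => A X.1 X.2 :=
  measurable_from_prod_countable_right fun j => (hA j).measurable

theorem integrable_freq {A : ℤ → ℝ → ℂ} (hA : ∀ j, Continuous (A j)) {C r : ℝ} (hr : 0 < r)
    (hb : ∀ j ξ, ‖A j ξ‖ ≤ C * Real.exp (-(r * (|(j : ℝ)| + |ξ|)))) :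
    Integrable (fun X : ℤ × ℝ => A X.1 X.2) freqMeasure :=
  (integrable_exp_freq hr C).mono' (measurable_freq hA).aestronglyMeasurable
    (Eventually.of_forall fun X => hb X.1 X.2)

theorem hasSum_integral_freq {A : ℤ → ℝ → ℂ}
    (hA : Integrable (fun X : ℤ × ℝ => A X.1 X.2) freqMeasure) :
    HasSum (fun j => ∫ ξ, A j ξ) (∫ X, A X.1 X.2 ∂freqMeasure) := by
  have h := hA
  unfold freqMeasure at h ⊢
  rw [integral_prod _ h]
  have h2 := h.integral_prod_left
  rw [integral_countable h2]
  have h3 := h2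
  rw [integrable_count_iff] at h3
  simp only [measureReal_def, Measure.count_singleton, ENNReal.toReal_one, one_smul]
  exact h3.of_norm.hasSum

theorem integral_freq_sub (A : ℤ → ℝ → ℂ) (l : ℤ) (a : ℝ) :
    ∫ X, A (X.1 - l) (X.2 - a) ∂freqMeasure = ∫ X, A X.1 X.2 ∂freqMeasure :=
  integral_sub_right_eq_self (μ := freqMeasure) (fun X : ℤ × ℝ => A X.1 X.2) (l, a)

theorem continuousAt_integral_freq {Y : Type*} [TopologicalSpace Y] [FirstCountableTopology Y]
    {A : Y → ℤ → ℝ → ℂ} {y₀ : Y} (hA : ∀ y j, Continuous (A y j)) {C r : ℝ} (hr : 0 < r)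
    (hb : ∀ᶠ y in 𝓝 y₀, ∀ j ξ, ‖A y j ξ‖ ≤ C * Real.exp (-(r * (|(j : ℝ)| + |ξ|))))
    (hc : ∀ j ξ, ContinuousAt (fun y => A y j ξ) y₀) :
    ContinuousAt (fun y => ∫ X, A y X.1 X.2 ∂freqMeasure) y₀ := by
  refine continuousAt_of_dominated
    (Eventually.of_forall fun y => (measurable_freq (hA y)).aestronglyMeasurable) ?_
    (integrable_exp_freq hr C) (Eventually.of_forall fun X => hc X.1 X.2)
  filter_upwards [hb] with y hy
  exact Eventually.of_forall fun X => hy X.1 X.2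

theorem hasDerivAt_integral_freq {A A' : ℝ → ℤ → ℝ → ℂ} {s₀ : ℝ}
    (hA : ∀ s j, Continuous (A s j)) (hA' : ∀ j, Continuous (A' s₀ j)) {C C' r : ℝ} (hr : 0 < r)
    (hd : ∀ s ∈ Metric.ball s₀ 1, ∀ j ξ, HasDerivAt (fun u => A u j ξ) (A' s j ξ) s)
    (hb : ∀ j ξ, ‖A s₀ j ξ‖ ≤ C * Real.exp (-(r * (|(j : ℝ)| + |ξ|))))
    (hb' : ∀ s ∈ Metric.ball s₀ 1, ∀ j ξ,
      ‖A' s j ξ‖ ≤ C' * Real.exp (-(r * (|(j : ℝ)| + |ξ|)))) :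
    HasDerivAt (fun s => ∫ X, A s X.1 X.2 ∂freqMeasure) (∫ X, A' s₀ X.1 X.2 ∂freqMeasure) s₀ :=
  (hasDerivAt_integral_of_dominated_loc_of_deriv_le (Metric.ball_mem_nhds s₀ one_pos)
    (Eventually.of_forall fun s => (measurable_freq (hA s)).aestronglyMeasurable)
    (integrable_freq (hA s₀) hr hb) (measurable_freq hA').aestronglyMeasurable
    (Eventually.of_forall fun X s hs => hb' s hs X.1 X.2) (integrable_exp_freq hr C')
    (Eventually.of_forall fun X s hs => hd s hs X.1 X.2)).2

/-! ### The Fourier transform of the equilibrium -/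

theorem hasDerivAt_fourierV {g : ℝ → ℂ} (hg : Integrable g)
    (hg' : Integrable fun v : ℝ => (v : ℂ) * g v) (η : ℝ) :
    HasDerivAt (fourierV g) (fourierV (fun v => -Complex.I * (v * g v)) η) η := by
  have hm : ∀ (η : ℝ) {u : ℝ → ℂ}, Integrable u →
      AEStronglyMeasurable (fun v : ℝ => Complex.exp (-(Complex.I * η * v)) * u v) := fun η u hu =>
    (by fun_prop : Continuous fun v : ℝ =>
      Complex.exp (-(Complex.I * η * v))).aestronglyMeasurable.mul hu.1
  have hn : ∀ η v : ℝ, ‖Complex.exp (-(Complex.I * η * v))‖ = 1 := fun η v => by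
    rw [Complex.norm_exp]; simp
  refine (hasDerivAt_integral_of_dominated_loc_of_deriv_le (𝕜 := ℝ)
    (F' := fun (η : ℝ) (v : ℝ) => Complex.exp (-(Complex.I * η * v)) *
      (-Complex.I * (v * g v)))
    (F := fun (η : ℝ) (v : ℝ) => Complex.exp (-(Complex.I * η * v)) * g v)
    (bound := fun v : ℝ => ‖(v : ℂ) * g v‖) univ_mem
    (Eventually.of_forall fun η => hm η hg) ?_ (hm η (hg'.const_mul (-Complex.I))) ?_ hg'.norm
    ?_).2
  · refine hg.mono (hm η hg) (Eventually.of_forall fun v => ?_)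
    rw [norm_mul, hn, one_mul]
  · refine Eventually.of_forall fun v η _ => ?_
    rw [norm_mul, hn, one_mul, norm_mul, norm_neg, Complex.norm_I, one_mul]
  · refine Eventually.of_forall fun v η _ => ?_
    have h1 : HasDerivAt (fun η : ℝ => -(Complex.I * η * v)) (-(Complex.I * v)) η := by
      have := ((Complex.ofRealCLM.hasDerivAt (x := η)).const_mul Complex.I).mul_const (v : ℂ)
      exact this.neg.congr_deriv (by simp)
    have := (h1.cexp).mul_const (g v)
    exact this.congr_deriv (by ring)

theorem continuous_fourierV {g : ℝ → ℂ} (hg : Integrable g) : Continuous (fourierV g) := by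
  refine continuous_of_dominated (bound := fun v => ‖g v‖) (fun η => ?_) (fun η => ?_) hg.norm ?_
  · exact (by fun_prop : Continuous fun v : ℝ =>
      Complex.exp (-(Complex.I * η * v))).aestronglyMeasurable.mul hg.1
  · refine Eventually.of_forall fun v => ?_
    rw [norm_mul, Complex.norm_exp]; simp
  · exact Eventually.of_forall fun v => by fun_prop

/-- The Fourier transform `μ̂` of the equilibrium. -/
def equilibriumHat (μ : ℝ → ℝ) : ℝ → ℂ := fourierV fun v => (μ v : ℂ)

section

variable {μ : ℝ → ℝ} {θ₀ C₀ : ℝ}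

theorem IsAnalyticEquilibrium.integrable_weight (hμ : IsAnalyticEquilibrium μ θ₀ C₀)
    {w : ℝ → ℂ} (hw : Continuous w) (hb : ∀ v, ‖w v‖ ≤ 1 + v ^ 2) :
    Integrable fun v : ℝ => w v * (μ v : ℂ) := by
  have hc : Continuous μ := continuousOn_univ.1 hμ.analytic.continuousOn
  refine hμ.integrable.mono (hw.mul (Complex.continuous_ofReal.comp hc)).aestronglyMeasurable
    (Eventually.of_forall fun v => ?_)
  rw [norm_mul, norm_mul, Complex.norm_real]
  gcongr
  exact (hb v).trans (le_abs_self _)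

theorem IsAnalyticEquilibrium.continuous (hμ : IsAnalyticEquilibrium μ θ₀ C₀) : Continuous μ :=
  continuousOn_univ.1 hμ.analytic.continuousOn

theorem IsAnalyticEquilibrium.integrable_ofReal (hμ : IsAnalyticEquilibrium μ θ₀ C₀) :
    Integrable fun v : ℝ => (μ v : ℂ) := by
  have := hμ.integrable_weight (w := fun _ => 1) continuous_const
    (fun v => by simp; positivity)
  simpa using this

theorem IsAnalyticEquilibrium.norm_equilibriumHat_le (hμ : IsAnalyticEquilibrium μ θ₀ C₀)
    (η : ℝ) : ‖equilibriumHat μ η‖ ≤ C₀ * Real.exp (-(θ₀ * |η|)) :=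
  (le_add_of_nonneg_left (norm_nonneg _)).trans (hμ.decay η)

theorem IsAnalyticEquilibrium.continuous_equilibriumHat (hμ : IsAnalyticEquilibrium μ θ₀ C₀) :
    Continuous (equilibriumHat μ) :=
  continuous_fourierV hμ.integrable_ofReal

/-- `μ̂` is twice differentiable, and its derivatives decay exponentially. -/
theorem IsAnalyticEquilibrium.exists_deriv_equilibriumHat (hμ : IsAnalyticEquilibrium μ θ₀ C₀)
    (hθ₀ : 0 < θ₀) : ∃ h₁ h₂ : ℝ → ℂ,
      (∀ η, HasDerivAt (equilibriumHat μ) (h₁ η) η) ∧ (∀ η, HasDerivAt h₁ (h₂ η) η) ∧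
      Continuous h₂ ∧
      (∀ η, ‖h₁ η‖ ≤ 3 * C₀ * Real.exp (-(θ₀ * |η|))) ∧
      (∀ η, ‖h₂ η‖ ≤ C₀ * Real.exp (-(θ₀ * |η|))) := by
  have i0 := hμ.integrable_ofReal
  have i1 : Integrable fun v : ℝ => (v : ℂ) * (μ v : ℂ) :=
    hμ.integrable_weight (w := fun v => (v : ℂ)) (by fun_prop) fun v => by
      rw [Complex.norm_real, Real.norm_eq_abs]; nlinarith [sq_nonneg (|v| - 1), sq_abs v]
  have i2 : Integrable fun v : ℝ => (v : ℂ) * ((v : ℂ) * (μ v : ℂ)) := by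
    have := hμ.integrable_weight (w := fun v => (v : ℂ) ^ 2) (by fun_prop) fun v => by
      rw [norm_pow, Complex.norm_real, Real.norm_eq_abs, sq_abs]; linarith
    exact this.congr (Eventually.of_forall fun v => by simp only; ring)
  have i3 : Integrable fun v : ℝ => (((1 + v ^ 2) * μ v : ℝ) : ℂ) := hμ.integrable.ofReal
  set h₁ : ℝ → ℂ := fourierV (fun v => -Complex.I * (v * (μ v : ℂ))) with hh₁
  set h₂ : ℝ → ℂ := fourierV (fun v => -Complex.I * (v * (-Complex.I * (v * (μ v : ℂ))))) with hh₂
  have d1 : ∀ η, HasDerivAt (equilibriumHat μ) (h₁ η) η := fun η => hasDerivAt_fourierV i0 i1 η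
  have j2 : Integrable fun v : ℝ => (v : ℂ) * (-Complex.I * (v * (μ v : ℂ))) :=
    (i2.const_mul (-Complex.I)).congr (Eventually.of_forall fun v => by simp only; ring)
  have d2 : ∀ η, HasDerivAt h₁ (h₂ η) η := fun η =>
    hasDerivAt_fourierV (i1.const_mul (-Complex.I)) j2 η
  have hint : ∀ (η : ℝ) {u : ℝ → ℂ}, Integrable u →
      Integrable (fun v : ℝ => Complex.exp (-(Complex.I * η * v)) * u v) := fun η u hu => by
    refine hu.mono ((by fun_prop : Continuous fun v : ℝ =>
      Complex.exp (-(Complex.I * η * v))).aestronglyMeasurable.mul hu.1)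
      (Eventually.of_forall fun v => ?_)
    rw [norm_mul, Complex.norm_exp]; simp
  -- Since `-v² μ = μ - ⟨v⟩² μ`, both assumed transforms together control the second derivative.
  have e2 : ∀ η, h₂ η = equilibriumHat μ η -
      fourierV (fun v => (((1 + v ^ 2) * μ v : ℝ) : ℂ)) η := by
    intro η
    rw [hh₂, equilibriumHat, fourierV, fourierV, fourierV,
      ← integral_sub (hint η i0) (hint η i3)]
    congr 1
    ext v
    push_cast
    linear_combination (Complex.exp (-(Complex.I * η * v)) * v ^ 2 * μ v) * Complex.I_sq
  have b2 : ∀ η, ‖h₂ η‖ ≤ C₀ * Real.exp (-(θ₀ * |η|)) := fun η => by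
    rw [e2]
    refine (norm_sub_le _ _).trans ?_
    rw [add_comm]
    exact hμ.decay η
  refine ⟨h₁, h₂, d1, d2, continuous_fourierV (j2.const_mul _), fun η => ?_, b2⟩
  have hC₀ : 0 ≤ C₀ := by
    have := (norm_nonneg _).trans (b2 0)
    simpa using this
  -- The first derivative is not controlled by the assumptions and is interpolated between `μ̂` and
  -- `μ̂''` by a Taylor expansion on a unit interval. The interval points away from the origin, in
  -- the direction `σ`, so that the exponential bounds at `η` hold on all of it.
  obtain ⟨σ, hσ1, hσ⟩ : ∃ σ : ℝ, |σ| = 1 ∧ ∀ s : ℝ, 0 ≤ s → |η| ≤ |η + σ * s| := by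
    rcases le_total 0 η with h | h
    · exact ⟨1, by simp, fun s hs => by rw [abs_of_nonneg h, abs_of_nonneg] <;> linarith⟩
    · refine ⟨-1, by simp, fun s hs => by rw [abs_of_nonpos h, abs_of_nonpos] <;> linarith⟩
  have hσs : ∀ (u : ℝ → ℂ) (u' : ℝ → ℂ), (∀ η, HasDerivAt u (u' η) η) → ∀ s : ℝ,
      HasDerivAt (fun s => u (η + σ * s)) (σ * u' (η + σ * s)) s := by
    intro u u' hu s
    have h := ((hasDerivAt_id s).const_mul σ).const_add η
    simp only [mul_one, id] at h
    have := (hu (η + σ * s)).scomp s h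
    rw [Complex.real_smul] at this
    exact this
  set M := C₀ * Real.exp (-(θ₀ * |η|)) with hM
  have hM0 : 0 ≤ M := by positivity
  have hmono : ∀ s : ℝ, 0 ≤ s → C₀ * Real.exp (-(θ₀ * |η + σ * s|)) ≤ M := fun s hs => by
    have := hσ s hs
    rw [hM]; gcongr
  have k1 : ∀ s ∈ Icc (0 : ℝ) 1, ‖h₁ (η + σ * s) - h₁ η‖ ≤ M := by
    intro s hs
    have := (convex_Icc (0 : ℝ) 1).norm_image_sub_le_of_norm_hasDerivWithin_le
      (f := fun s => h₁ (η + σ * s)) (f' := fun s => σ * h₂ (η + σ * s)) (C := M) (x := 0) (y := s)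
      (fun x _ => (hσs _ _ d2 x).hasDerivWithinAt) (fun x hx => ?_) (by simp) hs
    · simp only [mul_zero, add_zero, sub_zero] at this
      refine this.trans ?_
      rw [Real.norm_of_nonneg hs.1]
      exact mul_le_of_le_one_right hM0 hs.2
    · rw [norm_mul, Complex.norm_real, Real.norm_eq_abs, hσ1, one_mul]
      exact (b2 _).trans (hmono x hx.1)
  have k2 : ‖(equilibriumHat μ (η + σ * 1) - σ * 1 * h₁ η) -
      (equilibriumHat μ η)‖ ≤ M := by
    have := (convex_Icc (0 : ℝ) 1).norm_image_sub_le_of_norm_hasDerivWithin_le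
      (f := fun s : ℝ => equilibriumHat μ (η + σ * s) - σ * s * h₁ η)
      (f' := fun s => σ * h₁ (η + σ * s) - σ * h₁ η) (C := M) (x := 0) (y := 1)
      (fun x _ => ?_) (fun x hx => ?_) (by simp) (by simp)
    · simpa using this
    · refine ((hσs _ _ d1 x).sub ?_).hasDerivWithinAt
      have := ((Complex.ofRealCLM.hasDerivAt (x := x)).const_mul (σ : ℂ)).mul_const (h₁ η)
      simpa using this
    · rw [← mul_sub, norm_mul, Complex.norm_real, Real.norm_eq_abs, hσ1, one_mul]
      exact k1 x hx
  have k3 : ‖(σ : ℂ) * h₁ η‖ ≤ M + M + M := by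
    have e : (σ : ℂ) * h₁ η = equilibriumHat μ (η + σ * 1) - equilibriumHat μ η -
      ((equilibriumHat μ (η + σ * 1) - σ * 1 * h₁ η) - (equilibriumHat μ η)) := by ring
    rw [e]
    refine (norm_sub_le _ _).trans (add_le_add ((norm_sub_le _ _).trans (add_le_add ?_ ?_)) k2)
    · exact (hμ.norm_equilibriumHat_le _).trans (hmono 1 zero_le_one)
    · exact hμ.norm_equilibriumHat_le _
  rw [norm_mul, Complex.norm_real, Real.norm_eq_abs, hσ1, one_mul] at k3
  linarith

theorem IsAnalyticEquilibrium.integrable_equilibriumHat (hμ : IsAnalyticEquilibrium μ θ₀ C₀)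
    (hθ₀ : 0 < θ₀) : Integrable (equilibriumHat μ) :=
  ((integrable_exp_neg_mul_abs hθ₀).const_mul C₀).mono'
    hμ.continuous_equilibriumHat.aestronglyMeasurable
    (Eventually.of_forall hμ.norm_equilibriumHat_le)

end

/-! ### The resolvent of a Volterra equation -/

/-- The Laplace transform of `k`. -/
def laplace (k : ℝ → ℂ) (z : ℂ) : ℂ := ∫ t in Ioi (0 : ℝ), Complex.exp (-(z * t)) * k t

section laplace

variable {k k₁ k₂ : ℝ → ℂ} {C θ : ℝ}

theorem norm_exp_neg_mul (z : ℂ) (t : ℝ) :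
    ‖Complex.exp (-(z * t))‖ = Real.exp (-(z.re * t)) := by
  rw [Complex.norm_exp]; simp

theorem norm_laplace_integrand_le (hb : ∀ t, 0 ≤ t → ‖k t‖ ≤ C * Real.exp (-(θ * t)))
    (z : ℂ) {t : ℝ} (ht : 0 ≤ t) :
    ‖Complex.exp (-(z * t)) * k t‖ ≤ C * Real.exp (-(z.re + θ) * t) := by
  rw [norm_mul, norm_exp_neg_mul]
  calc _ ≤ Real.exp (-(z.re * t)) * (C * Real.exp (-(θ * t))) := by gcongr; exact hb t ht
    _ = C * Real.exp (-(z.re + θ) * t) := by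
      rw [mul_left_comm, ← Real.exp_add]; ring_nf

theorem integrableOn_laplace (hk : Continuous k)
    (hb : ∀ t, 0 ≤ t → ‖k t‖ ≤ C * Real.exp (-(θ * t))) {z : ℂ} (hz : -θ < z.re) :
    IntegrableOn (fun t : ℝ => Complex.exp (-(z * t)) * k t) (Ioi 0) := by
  have h : IntegrableOn (fun t : ℝ => C * Real.exp (-(z.re + θ) * t)) (Ioi 0) :=
    (integrableOn_exp_mul_Ioi (by linarith) 0).const_mul C
  refine h.mono' (by fun_prop : Continuous _).aestronglyMeasurable ?_
  rw [ae_restrict_iff' measurableSet_Ioi]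
  exact Eventually.of_forall fun t ht => norm_laplace_integrand_le hb z (le_of_lt ht)

theorem integral_exp_neg_mul_Ioi {a : ℝ} (ha : 0 < a) :
    ∫ t in Ioi (0 : ℝ), Real.exp (-a * t) = 1 / a := by
  rw [integral_exp_mul_Ioi (by linarith) 0]
  simp

theorem norm_laplace_le (hk : Continuous k)
    (hb : ∀ t, 0 ≤ t → ‖k t‖ ≤ C * Real.exp (-(θ * t))) {z : ℂ} (hz : -θ < z.re) :
    ‖laplace k z‖ ≤ C * (1 / (z.re + θ)) := by
  rw [← integral_exp_neg_mul_Ioi (show 0 < z.re + θ by linarith), ← integral_const_mul]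
  refine (norm_integral_le_integral_norm _).trans (setIntegral_mono_on
    (integrableOn_laplace hk hb hz).norm ?_ measurableSet_Ioi fun t ht =>
      norm_laplace_integrand_le hb z (le_of_lt ht))
  exact (integrableOn_exp_mul_Ioi (by linarith) 0).const_mul C

theorem differentiableAt_laplace (hk : Continuous k)
    (hb : ∀ t, 0 ≤ t → ‖k t‖ ≤ C * Real.exp (-(θ * t))) {z : ℂ} (hz : -θ < z.re) :
    DifferentiableAt ℂ (laplace k) z := by
  have hC : 0 ≤ C := by
    have := (norm_nonneg _).trans (hb 0 le_rfl)
    simpa using this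
  -- Half of the distance to the line `Re = -θ` is spent on staying in a ball around `z`, a quarter
  -- on absorbing the factor `t` of the derivative.
  set d := (z.re + θ) / 2 with hd
  have hd0 : 0 < d := by rw [hd]; linarith
  obtain ⟨M, hM, hMb⟩ := exists_one_add_pow_mul_exp_le 1 (half_pos hd0)
  refine (hasDerivAt_integral_of_dominated_loc_of_deriv_le (𝕜 := ℂ)
    (F := fun (z : ℂ) (t : ℝ) => Complex.exp (-(z * t)) * k t)
    (F' := fun (z : ℂ) (t : ℝ) => -t * Complex.exp (-(z * t)) * k t)
    (bound := fun t : ℝ => M * C * Real.exp (-(d / 2) * t))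
    (Metric.ball_mem_nhds z hd0)
    (Eventually.of_forall fun η => ?_) (integrableOn_laplace hk hb hz) ?_ ?_ ?_
    ?_).2.differentiableAt
  · exact (by fun_prop : Continuous _).aestronglyMeasurable
  · exact (by fun_prop : Continuous _).aestronglyMeasurable
  · rw [ae_restrict_iff' measurableSet_Ioi]
    refine Eventually.of_forall fun t ht w hw => ?_
    have ht' : 0 ≤ t := le_of_lt ht
    have h1 := norm_laplace_integrand_le hb w ht'
    have h2 : z.re - d < w.re := by
      have := (Complex.abs_re_le_norm (w - z)).trans_lt (mem_ball_iff_norm.1 hw)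
      rw [abs_lt, Complex.sub_re] at this
      linarith
    have h3 := hMb t ht'
    rw [mul_assoc, norm_mul, norm_neg, Complex.norm_real, Real.norm_of_nonneg ht']
    calc t * ‖Complex.exp (-(w * t)) * k t‖
        ≤ (1 + t) ^ 1 * (C * Real.exp (-(w.re + θ) * t)) := by
          rw [pow_one]; gcongr; linarith
      _ ≤ (1 + t) ^ 1 * (C * (Real.exp (-(d / 2 * t)) * Real.exp (-(d / 2) * t))) := by
          rw [← Real.exp_add]
          gcongr
          nlinarith
      _ = ((1 + t) ^ 1 * Real.exp (-(d / 2 * t))) * (C * Real.exp (-(d / 2) * t)) := by ring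
      _ ≤ M * (C * Real.exp (-(d / 2) * t)) := by gcongr
      _ = _ := by ring
  · exact (integrableOn_exp_mul_Ioi (by linarith) 0).const_mul _
  · refine Eventually.of_forall fun t w _ => ?_
    have h1 : HasDerivAt (fun w : ℂ => -(w * t)) (-(1 * (t : ℂ))) w :=
      ((hasDerivAt_id w).mul_const (t : ℂ)).neg
    exact ((h1.cexp).mul_const (k t)).congr_deriv (by ring)

/-- Integrating by parts twice. -/
theorem sq_mul_laplace (d₁ : ∀ t, HasDerivAt k (k₁ t) t) (d₂ : ∀ t, HasDerivAt k₁ (k₂ t) t)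
    (hk₂ : Continuous k₂) (hk0 : k 0 = 0)
    (hb : ∀ t, 0 ≤ t → ‖k t‖ ≤ C * Real.exp (-(θ * t)))
    (hb₁ : ∀ t, 0 ≤ t → ‖k₁ t‖ ≤ C * Real.exp (-(θ * t)))
    (hb₂ : ∀ t, 0 ≤ t → ‖k₂ t‖ ≤ C * Real.exp (-(θ * t))) {z : ℂ} (hz : -θ < z.re) :
    z ^ 2 * laplace k z = k₁ 0 + laplace k₂ z := by
  have hk : Continuous k := continuous_iff_continuousAt.2 fun t => (d₁ t).continuousAt
  have i0 := integrableOn_laplace hk hb hz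
  have i2 := integrableOn_laplace hk₂ hb₂ hz
  have hT : Tendsto (fun t : ℝ => C * Real.exp (-(z.re + θ) * t)) atTop (𝓝 0) := by
    have := (Real.tendsto_exp_atBot.comp
      (tendsto_id.const_mul_atTop_of_neg (show -(z.re + θ) < 0 by linarith))).const_mul C
    simpa using this
  have hlim : ∀ {u : ℝ → ℂ}, (∀ t, 0 ≤ t → ‖u t‖ ≤ C * Real.exp (-(θ * t))) →
      Tendsto (fun t : ℝ => Complex.exp (-(z * t)) * u t) atTop (𝓝 0) := fun hu =>
    squeeze_zero_norm' (eventually_ge_atTop 0 |>.mono fun t ht =>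
      norm_laplace_integrand_le hu z ht) hT
  have h := integral_Ioi_of_hasDerivAt_of_tendsto
    (f := fun t : ℝ => Complex.exp (-(z * t)) * (z * k t + k₁ t))
    (f' := fun t : ℝ => Complex.exp (-(z * t)) * k₂ t - z ^ 2 * (Complex.exp (-(z * t)) * k t))
    (a := 0) (m := 0) ?_ ?_ (i2.sub (i0.const_mul _)) ?_
  · rw [integral_sub i2 (i0.const_mul _), integral_const_mul] at h
    simp only [hk0, Complex.ofReal_zero, mul_zero, neg_zero, Complex.exp_zero, zero_add,
      one_mul, zero_sub] at h
    unfold laplace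
    linear_combination -h
  · have : Continuous k₁ := continuous_iff_continuousAt.2 fun t => (d₂ t).continuousAt
    exact (by fun_prop : Continuous _).continuousWithinAt
  · intro t _
    have h1 : HasDerivAt (fun t : ℝ => -(z * t)) (-z) t := by
      have := ((Complex.ofRealCLM.hasDerivAt (x := t)).const_mul z).neg
      exact this.congr_deriv (by simp)
    have := h1.cexp.mul (((d₁ t).const_mul z).add (d₂ t))
    exact this.congr_deriv (by simp only [Pi.add_apply]; ring)
  · have := ((hlim hb).const_mul z).add (hlim hb₁)
    simp only [mul_zero, add_zero] at this
    refine this.congr fun t => ?_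
    ring

/-- Two integrations by parts, in which `k 0 = 0` removes the boundary term of order `z`. Quadratic
decay in `Im z` makes inverse Laplace integrals along vertical lines absolutely convergent. -/
theorem norm_laplace_mul_le (d₁ : ∀ t, HasDerivAt k (k₁ t) t) (d₂ : ∀ t, HasDerivAt k₁ (k₂ t) t)
    (hk₂ : Continuous k₂) (hk0 : k 0 = 0) (hθ : 0 < θ)
    (hb : ∀ t, 0 ≤ t → ‖k t‖ ≤ C * Real.exp (-(θ * t)))
    (hb₁ : ∀ t, 0 ≤ t → ‖k₁ t‖ ≤ C * Real.exp (-(θ * t)))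
    (hb₂ : ∀ t, 0 ≤ t → ‖k₂ t‖ ≤ C * Real.exp (-(θ * t))) {z : ℂ} (hz : -(θ / 2) ≤ z.re) :
    (1 + z.im ^ 2) * ‖laplace k z‖ ≤ C + 4 * C / θ := by
  have hk : Continuous k := continuous_iff_continuousAt.2 fun t => (d₁ t).continuousAt
  have hC : 0 ≤ C := by
    have := (norm_nonneg _).trans (hb 0 le_rfl)
    simpa using this
  have hz' : -θ < z.re := by linarith
  have hle : ∀ {u : ℝ → ℂ}, Continuous u → (∀ t, 0 ≤ t → ‖u t‖ ≤ C * Real.exp (-(θ * t))) →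
      ‖laplace u z‖ ≤ 2 * C / θ := fun hu hub => by
    refine (norm_laplace_le hu hub hz').trans ?_
    rw [mul_one_div, div_le_div_iff₀ (by linarith) hθ]
    nlinarith
  have h0 := hle hk hb
  have h1 : ‖z ^ 2 * laplace k z‖ ≤ C + 2 * C / θ := by
    rw [sq_mul_laplace d₁ d₂ hk₂ hk0 hb hb₁ hb₂ hz']
    refine (norm_add_le _ _).trans (add_le_add ?_ (hle hk₂ hb₂))
    simpa using hb₁ 0 le_rfl
  rw [norm_mul, norm_pow] at h1
  have h2 : z.im ^ 2 ≤ ‖z‖ ^ 2 := by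
    rw [← sq_abs z.im]
    gcongr
    exact Complex.abs_im_le_norm z
  have : (1 + z.im ^ 2) * ‖laplace k z‖ ≤ ‖laplace k z‖ + ‖z‖ ^ 2 * ‖laplace k z‖ := by
    nlinarith [norm_nonneg (laplace k z)]
  have e : C + 4 * C / θ = 2 * C / θ + (C + 2 * C / θ) := by ring
  linarith

/-- The lower bound on `1 + L k` extends to a slightly larger half plane. -/
theorem half_le_norm_one_add_laplace (hk : Continuous k)
    (hb : ∀ t, 0 ≤ t → ‖k t‖ ≤ C * Real.exp (-(θ * t))) (hθ : 0 < θ) {κ θ₁ : ℝ}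
    (hP : ∀ z : ℂ, 0 ≤ z.re → κ ≤ ‖1 + laplace k z‖) (hκ : 0 < κ)
    (hθ₁ : 0 < θ₁) (hθ₁θ : θ₁ ≤ θ / 2) (hθ₁κ : 2 * C * θ₁ / θ ^ 2 ≤ κ / 2) {z : ℂ}
    (hz : -θ₁ ≤ z.re) : κ / 2 ≤ ‖1 + laplace k z‖ := by
  have hC : 0 ≤ C := by
    have := (norm_nonneg _).trans (hb 0 le_rfl)
    simpa using this
  rcases le_total 0 z.re with h | h
  · exact (half_le_self hκ.le).trans (hP z h)
  -- Comparison with the point of the imaginary axis at the same height: the transforms differ by at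
  -- most the integral of `C (e^{θ₁ t} - 1) e^{-θ t}`, which is small with `θ₁`.
  set w : ℂ := ⟨0, z.im⟩ with hw
  have i1 := integrableOn_laplace hk hb (show -θ < z.re by linarith)
  have i2 := integrableOn_laplace hk hb (show -θ < w.re by simp [hw, hθ])
  have hdiff : ‖laplace k z - laplace k w‖ ≤ κ / 2 := by
    unfold laplace
    rw [← integral_sub i1 i2]
    have j1 : IntegrableOn (fun t : ℝ => C * Real.exp (-(θ - θ₁) * t)) (Ioi 0) :=
      (integrableOn_exp_mul_Ioi (by linarith) 0).const_mul _
    have j2 : IntegrableOn (fun t : ℝ => C * Real.exp (-θ * t)) (Ioi 0) :=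
      (integrableOn_exp_mul_Ioi (by linarith) 0).const_mul _
    calc _ ≤ ∫ t in Ioi (0 : ℝ), (C * Real.exp (-(θ - θ₁) * t) - C * Real.exp (-θ * t)) := by
          refine (norm_integral_le_integral_norm _).trans (setIntegral_mono_on
            (i1.sub i2).norm (j1.sub j2) measurableSet_Ioi fun t ht => ?_)
          have ht' : 0 ≤ t := le_of_lt ht
          have e : Complex.exp (-(z * t)) * k t - Complex.exp (-(w * t)) * k t =
              Complex.exp (-(w * t)) * ((Real.exp (-(z.re * t)) - 1 : ℝ) : ℂ) * k t := by
            have : -(z * t) = -(w * t) + ((-(z.re * t) : ℝ) : ℂ) := by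
              apply Complex.ext <;> simp [hw]
            rw [this, Complex.exp_add]
            push_cast
            ring
          have hge : 1 ≤ Real.exp (-(z.re * t)) := Real.one_le_exp (by nlinarith)
          have hle : Real.exp (-(z.re * t)) ≤ Real.exp (θ₁ * t) :=
            Real.exp_le_exp.2 (by nlinarith)
          rw [e, norm_mul, norm_mul, norm_exp_neg_mul, Complex.norm_real,
            Real.norm_of_nonneg (by linarith)]
          calc _ ≤ 1 * (Real.exp (θ₁ * t) - 1) * (C * Real.exp (-(θ * t))) := by
                have h0 : Real.exp (-(w.re * t)) = 1 := by simp [hw]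
                rw [h0]
                gcongr
                · linarith
                · exact hb t ht'
            _ = C * (Real.exp (θ₁ * t) * Real.exp (-(θ * t))) - C * Real.exp (-(θ * t)) := by ring
            _ = _ := by rw [← Real.exp_add]; ring_nf
      _ = C * (1 / (θ - θ₁)) - C * (1 / θ) := by
          rw [integral_sub j1 j2, integral_const_mul, integral_const_mul,
            integral_exp_neg_mul_Ioi (by linarith), integral_exp_neg_mul_Ioi hθ]
      _ = C * θ₁ / ((θ - θ₁) * θ) := by
          have : θ - θ₁ ≠ 0 := by linarith
          field_simp
          ring
      _ ≤ C * θ₁ / (θ / 2 * θ) := by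
          gcongr
          linarith
      _ = 2 * C * θ₁ / θ ^ 2 := by field_simp
      _ ≤ κ / 2 := hθ₁κ
  have h1 := hP w (by simp [hw])
  have h2 : ‖1 + laplace k w‖ ≤ ‖1 + laplace k z‖ + ‖laplace k z - laplace k w‖ := by
    have : 1 + laplace k w = (1 + laplace k z) - (laplace k z - laplace k w) := by ring
    rw [this]
    exact norm_sub_le _ _
  linarith

end laplace

theorem integrable_inv_one_add_sq_mul {g : ℝ → ℂ} (hg : Continuous g) {M : ℝ}
    (hb : ∀ y, (1 + y ^ 2) * ‖g y‖ ≤ M) : Integrable g := by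
  refine (integrable_inv_one_add_sq.const_mul M).mono' hg.aestronglyMeasurable
    (Eventually.of_forall fun y => ?_)
  rw [← div_eq_mul_inv, le_div_iff₀ (by positivity), mul_comm]
  exact hb y

/-- A function that is holomorphic and decays in a right half plane has a vanishing inverse Laplace
transform at negative times. -/
theorem integral_vertical_line_eq_zero {R : ℂ → ℂ} {a M τ : ℝ}
    (hR : ∀ z : ℂ, a ≤ z.re → DifferentiableAt ℂ R z)
    (hb : ∀ z : ℂ, a ≤ z.re → (1 + z.im ^ 2) * ‖R z‖ ≤ M) (hτ : τ < 0) :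
    ∫ y : ℝ, R (a + y * Complex.I) * Complex.exp ((a + y * Complex.I) * τ) = 0 := by
  set f : ℂ → ℂ := fun z => R z * Complex.exp (z * τ) with hf
  have hM : 0 ≤ M := (mul_nonneg (by positivity) (norm_nonneg _)).trans (hb a (by simp))
  have hfn : ∀ z : ℂ, ‖f z‖ = ‖R z‖ * Real.exp (z.re * τ) := fun z => by
    rw [hf, norm_mul, Complex.norm_exp]; simp
  have hfb : ∀ z : ℂ, a ≤ z.re → ‖f z‖ ≤ M / (1 + z.im ^ 2) * Real.exp (z.re * τ) := fun z hz => by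
    rw [hfn]
    gcongr
    rw [le_div_iff₀ (by positivity), mul_comm]
    exact hb z hz
  have hd : ∀ z : ℂ, a ≤ z.re → DifferentiableAt ℂ f z := fun z hz =>
    (hR z hz).mul (by fun_prop)
  have hcont : Continuous fun y : ℝ => f (a + y * Complex.I) := by
    refine continuous_iff_continuousAt.2 fun y => ?_
    refine ContinuousAt.comp (f := fun y : ℝ => (a + y * Complex.I : ℂ))
      (hd _ (by simp)).continuousAt (by fun_prop)
  have hint : Integrable fun y : ℝ => f (a + y * Complex.I) := by
    refine integrable_inv_one_add_sq_mul hcont (M := M * Real.exp (a * τ)) fun y => ?_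
    have := hfb (a + y * Complex.I) (by simp)
    simp only [Complex.add_re, Complex.ofReal_re, Complex.mul_re, Complex.I_re, mul_zero,
      Complex.ofReal_im, Complex.I_im, mul_one, sub_self, add_zero, Complex.add_im, Complex.mul_im,
      zero_add] at this
    calc _ ≤ (1 + y ^ 2) * (M / (1 + y ^ 2) * Real.exp (a * τ)) := by gcongr
      _ = _ := by field_simp
  have hlim := intervalIntegral_tendsto_integral hint tendsto_neg_atTop_atBot tendsto_id
  refine tendsto_nhds_unique hlim (squeeze_zero_norm' (a := fun T : ℝ =>
    (4 * M * Real.exp (a * τ) + 4 * M / τ ^ 2) / T) ?_ (tendsto_const_nhds.div_atTop tendsto_id))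
  filter_upwards [eventually_ge_atTop (max 1 |a|)] with T hT
  have hT1 : 1 ≤ T := (le_max_left _ _).trans hT
  have hTa : |a| ≤ T := (le_max_right _ _).trans hT
  have haT : a ≤ T := (le_abs_self a).trans hTa
  have haT' : -T ≤ a := by linarith [neg_abs_le a]
  -- Cauchy's theorem on `[a, T] × [-T, T]`. The three other sides are `O(1 / T)`: the horizontal
  -- ones by the quadratic decay of `R`, the right one because `e^{T τ}` is small for `τ < 0`.
  have hrect := Complex.integral_boundary_rect_eq_zero_of_differentiableOn f
    (⟨a, -T⟩ : ℂ) (⟨T, T⟩ : ℂ) (fun z hz => (hd z ?_).differentiableWithinAt)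
  swap
  · have := hz.1
    simp only [mem_preimage, uIcc_of_le haT] at this
    exact this.1
  simp only at hrect
  have hhor : ∀ s : ℝ, |s| = T →
      ‖∫ x in a..T, f (x + s * Complex.I)‖ ≤ 2 * M * Real.exp (a * τ) / T := by
    intro s hs
    have h1 : ∀ x ∈ Set.uIoc a T, ‖f (x + s * Complex.I)‖ ≤ M / (1 + T ^ 2) * Real.exp (a * τ) := by
      intro x hx
      rw [uIoc_of_le haT] at hx
      have := hfb (x + s * Complex.I) (by simpa using hx.1.le)
      simp only [Complex.add_re, Complex.ofReal_re, Complex.mul_re, Complex.I_re, mul_zero,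
        Complex.ofReal_im, Complex.I_im, mul_one, sub_self, add_zero, Complex.add_im,
        Complex.mul_im, zero_add] at this
      rw [← sq_abs s, hs] at this
      refine this.trans ?_
      have : x * τ ≤ a * τ := by nlinarith [hx.1]
      gcongr
    refine (intervalIntegral.norm_integral_le_of_norm_le_const h1).trans ?_
    rw [abs_of_nonneg (by linarith), le_div_iff₀ (by linarith)]
    have h2 : (T - a) * T ≤ 2 * (1 + T ^ 2) := by nlinarith
    calc _ = M * Real.exp (a * τ) / (1 + T ^ 2) * ((T - a) * T) := by ring
      _ ≤ M * Real.exp (a * τ) / (1 + T ^ 2) * (2 * (1 + T ^ 2)) := by gcongr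
      _ = _ := by field_simp
  have hright : ‖∫ y in (-T)..T, f (T + y * Complex.I)‖ ≤ 4 * M / τ ^ 2 / T := by
    have h1 : ∀ y ∈ Set.uIoc (-T) T, ‖f (T + y * Complex.I)‖ ≤ M * Real.exp (T * τ) := by
      intro y _
      have := hfb (T + y * Complex.I) (by simpa using haT)
      simp only [Complex.add_re, Complex.ofReal_re, Complex.mul_re, Complex.I_re, mul_zero,
        Complex.ofReal_im, Complex.I_im, mul_one, sub_self, add_zero, Complex.add_im,
        Complex.mul_im, zero_add] at this
      refine this.trans ?_
      gcongr
      exact div_le_self hM (by nlinarith [sq_nonneg y])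
    refine (intervalIntegral.norm_integral_le_of_norm_le_const h1).trans ?_
    have h2 : Real.exp (T * τ) ≤ 2 / (T * τ) ^ 2 := by
      have h3 := Real.quadratic_le_exp_of_nonneg (x := -(T * τ)) (by nlinarith)
      have h4 : 0 < (T * τ) ^ 2 := by
        have : T * τ ≠ 0 := mul_ne_zero (by linarith) hτ.ne
        positivity
      rw [show Real.exp (T * τ) = 1 / Real.exp (-(T * τ)) by rw [Real.exp_neg, one_div, inv_inv],
        div_le_div_iff₀ (Real.exp_pos _) h4]
      nlinarith
    rw [abs_of_nonneg (by linarith)]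
    calc M * Real.exp (T * τ) * (T - -T) ≤ M * (2 / (T * τ) ^ 2) * (T - -T) := by
          gcongr
          linarith
      _ = _ := by field_simp; ring
  have hb1 := hhor (-T) (by rw [abs_neg, abs_of_nonneg (by linarith)])
  have hb2 := hhor T (abs_of_nonneg (by linarith))
  have hleft : ∫ y in (-T)..T, f (a + y * Complex.I) = -Complex.I *
      ((∫ x in a..T, f (x + (-T : ℝ) * Complex.I)) - (∫ x in a..T, f (x + T * Complex.I)) +
        Complex.I * ∫ y in (-T)..T, f (T + y * Complex.I)) := by
    simp only [smul_eq_mul] at hrect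
    linear_combination Complex.I * hrect + (∫ y in (-T)..T, f (a + y * Complex.I)) * Complex.I_sq
  simp only [id]
  rw [hleft, norm_mul, norm_neg, Complex.norm_I, one_mul]
  have hright' : ‖Complex.I * ∫ y in (-T)..T, f (T + y * Complex.I)‖ ≤ 4 * M / τ ^ 2 / T := by
    rwa [norm_mul, Complex.norm_I, one_mul]
  refine (norm_add_le _ _).trans ((add_le_add ((norm_sub_le _ _).trans (add_le_add hb1 hb2))
    hright').trans (le_of_eq ?_))
  ring

set_option maxHeartbeats 800000 in
/-- The resolvent of a Volterra kernel that satisfies the Penrose condition decays exponentially. -/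
theorem exists_resolvent {k k₁ k₂ : ℝ → ℂ} {C θ κ θ₁ : ℝ}
    (d₁ : ∀ t, HasDerivAt k (k₁ t) t) (d₂ : ∀ t, HasDerivAt k₁ (k₂ t) t)
    (hk₂ : Continuous k₂) (hk0 : k 0 = 0) (hθ : 0 < θ)
    (hb : ∀ t, 0 ≤ t → ‖k t‖ ≤ C * Real.exp (-(θ * t)))
    (hb₁ : ∀ t, 0 ≤ t → ‖k₁ t‖ ≤ C * Real.exp (-(θ * t)))
    (hb₂ : ∀ t, 0 ≤ t → ‖k₂ t‖ ≤ C * Real.exp (-(θ * t)))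
    (hP : ∀ z : ℂ, 0 ≤ z.re → κ ≤ ‖1 + laplace k z‖) (hκ : 0 < κ)
    (hθ₁ : 0 < θ₁) (hθ₁θ : θ₁ ≤ θ / 2) (hθ₁κ : 2 * C * θ₁ / θ ^ 2 ≤ κ / 2) :
    ∃ r : ℝ → ℂ, Continuous r ∧
      (∀ t, 0 ≤ t → ‖r t‖ ≤ 2 / κ * (C + 4 * C / θ) * Real.exp (-(θ₁ * t))) ∧
      ∀ t, 0 ≤ t → r t + ∫ s in (0 : ℝ)..t, k (t - s) * r s = -k t := by
  have hk : Continuous k := continuous_iff_continuousAt.2 fun t => (d₁ t).continuousAt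
  set M := 2 / κ * (C + 4 * C / θ) with hM
  -- The resolvent equation reads `R + (L k) R = -L k` after a Laplace transform. The resolvent `r`
  -- is the inverse transform along the line `Re z = -θ₁`, which gives its decay rate.
  set R : ℂ → ℂ := fun z => -laplace k z / (1 + laplace k z) with hR
  have hlow : ∀ z : ℂ, -θ₁ ≤ z.re → κ / 2 ≤ ‖1 + laplace k z‖ := fun z hz =>
    half_le_norm_one_add_laplace hk hb hθ hP hκ hθ₁ hθ₁θ hθ₁κ hz
  have hne : ∀ z : ℂ, -θ₁ ≤ z.re → 1 + laplace k z ≠ 0 := fun z hz =>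
    norm_pos_iff.1 ((half_pos hκ).trans_le (hlow z hz))
  have hLb : ∀ z : ℂ, -θ₁ ≤ z.re → (1 + z.im ^ 2) * ‖laplace k z‖ ≤ C + 4 * C / θ := fun z hz =>
    norm_laplace_mul_le d₁ d₂ hk₂ hk0 hθ hb hb₁ hb₂ (by linarith)
  have hLd : ∀ z : ℂ, -θ₁ ≤ z.re → DifferentiableAt ℂ (laplace k) z := fun z hz =>
    differentiableAt_laplace hk hb (by linarith)
  have hRd : ∀ z : ℂ, -θ₁ ≤ z.re → DifferentiableAt ℂ R z := fun z hz =>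
    (hLd z hz).neg.div ((hLd z hz).const_add 1) (hne z hz)
  have hRb : ∀ z : ℂ, -θ₁ ≤ z.re → (1 + z.im ^ 2) * ‖R z‖ ≤ M := fun z hz => by
    rw [hR, norm_div, norm_neg]
    calc (1 + z.im ^ 2) * (‖laplace k z‖ / ‖1 + laplace k z‖)
        = ((1 + z.im ^ 2) * ‖laplace k z‖) / ‖1 + laplace k z‖ := by ring
      _ ≤ (C + 4 * C / θ) / (κ / 2) := by
          have := (mul_nonneg (show 0 ≤ 1 + z.im ^ 2 by positivity)
            (norm_nonneg (laplace k z))).trans (hLb z hz)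
          exact div_le_div₀ this (hLb z hz) (by positivity) (hlow z hz)
      _ = M := by rw [hM]; field_simp
  have hM0 : 0 ≤ M := (mul_nonneg (by positivity) (norm_nonneg _)).trans (hRb 0 (by simp [hθ₁.le]))
  let ζ : ℝ → ℂ := fun y => ((-θ₁ : ℝ) : ℂ) + y * Complex.I
  have hζre : ∀ y, (ζ y).re = -θ₁ := fun y => by simp [ζ]
  have hζim : ∀ y, (ζ y).im = y := fun y => by simp [ζ]
  have hζc : Continuous ζ := by fun_prop
  have hRc : Continuous fun y => R (ζ y) := continuous_iff_continuousAt.2 fun y =>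
    ContinuousAt.comp (f := ζ) (hRd _ (hζre y).ge).continuousAt hζc.continuousAt
  have hLc : Continuous fun y => laplace k (ζ y) := continuous_iff_continuousAt.2 fun y =>
    ContinuousAt.comp (f := ζ) (hLd _ (hζre y).ge).continuousAt hζc.continuousAt
  have hRM : ∀ y, (1 + y ^ 2) * ‖R (ζ y)‖ ≤ M := fun y => by
    have := hRb (ζ y) (hζre y).ge
    rwa [hζim] at this
  have hRi : Integrable fun y => R (ζ y) := integrable_inv_one_add_sq_mul hRc hRM
  have hLi : Integrable fun y => laplace k (ζ y) :=
    integrable_inv_one_add_sq_mul hLc (M := C + 4 * C / θ) fun y => by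
      have := hLb (ζ y) (hζre y).ge
      rwa [hζim] at this
  have hexpn : ∀ (y τ : ℝ), ‖Complex.exp (ζ y * τ)‖ = Real.exp (-(θ₁ * τ)) := fun y τ => by
    rw [Complex.norm_exp]
    simp [ζ]
  set r : ℝ → ℂ := fun τ => (2 * Real.pi : ℂ)⁻¹ * ∫ y : ℝ, R (ζ y) * Complex.exp (ζ y * τ) with hr
  have hRint : ∀ τ : ℝ, Integrable fun y => R (ζ y) * Complex.exp (ζ y * τ) := fun τ => by
    refine (hRi.norm.mul_const (Real.exp (-(θ₁ * τ)))).mono'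
      (hRc.mul (by fun_prop)).aestronglyMeasurable (Eventually.of_forall fun y => ?_)
    rw [norm_mul, hexpn]
  have hrb : ∀ τ, ‖r τ‖ ≤ M * Real.exp (-(θ₁ * τ)) := fun τ => by
    have h1 : ‖∫ y : ℝ, R (ζ y) * Complex.exp (ζ y * τ)‖ ≤
        ∫ y : ℝ, M * Real.exp (-(θ₁ * τ)) * (1 + y ^ 2)⁻¹ := by
      refine (norm_integral_le_integral_norm _).trans (integral_mono (hRint τ).norm
        (integrable_inv_one_add_sq.const_mul _) fun y => ?_)
      simp only
      rw [norm_mul, hexpn, mul_right_comm]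
      gcongr
      rw [← div_eq_mul_inv, le_div_iff₀ (by positivity), mul_comm]
      exact hRM y
    rw [integral_const_mul, integral_univ_inv_one_add_sq] at h1
    rw [hr, norm_mul, norm_inv]
    have h2 : ‖(2 * Real.pi : ℂ)‖ = 2 * Real.pi := by
      rw [norm_mul, Complex.norm_real, Real.norm_of_nonneg Real.pi_pos.le]; simp
    rw [h2]
    calc _ ≤ (2 * Real.pi)⁻¹ * (M * Real.exp (-(θ₁ * τ)) * Real.pi) := by gcongr
      _ = 2⁻¹ * (M * Real.exp (-(θ₁ * τ))) := by
        have := Real.pi_ne_zero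
        field_simp
      _ ≤ _ := by
        have : 0 ≤ M * Real.exp (-(θ₁ * τ)) := by positivity
        linarith
  -- Causality of the resolvent. It allows the convolution over `[0, t]` to be replaced by one over
  -- the half line, where the Laplace transform of `k` appears.
  have hr0 : ∀ τ, τ < 0 → r τ = 0 := fun τ hτ => by
    rw [hr]
    simp only
    rw [integral_vertical_line_eq_zero hRd hRb hτ, mul_zero]
  have hrc : Continuous r := by
    have e : r = fun τ : ℝ => (2 * Real.pi : ℂ)⁻¹ * (Complex.exp (-(θ₁ * τ)) *
        ∫ y : ℝ, R (ζ y) * Complex.exp (Complex.I * y * τ)) := by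
      ext τ
      rw [hr, ← integral_const_mul]
      simp only
      congr 2
      ext y
      rw [mul_left_comm, ← Complex.exp_add]
      congr 2
      simp only [ζ]
      push_cast
      ring
    rw [e]
    refine continuous_const.mul ((by fun_prop : Continuous _).mul ?_)
    refine continuous_of_dominated (bound := fun y => ‖R (ζ y)‖) (fun τ => ?_) (fun τ => ?_)
      hRi.norm (Eventually.of_forall fun y => by fun_prop)
    · exact (hRc.mul (by fun_prop)).aestronglyMeasurable
    · refine Eventually.of_forall fun y => ?_
      rw [norm_mul, Complex.norm_exp]; simp
  refine ⟨r, hrc, fun t _ => hrb t, fun t ht => ?_⟩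
  -- the convolution as an integral over the half line
  have hku : IntegrableOn (fun u : ℝ => C * Real.exp (-(θ - θ₁) * u)) (Ioi 0) :=
    (integrableOn_exp_mul_Ioi (by linarith) 0).const_mul _
  have e1 : ∫ s in (0 : ℝ)..t, k (t - s) * r s = ∫ u in Ioi (0 : ℝ), k u * r (t - u) := by
    have h1 : ∫ s in (0 : ℝ)..t, k (t - s) * r s = ∫ u in (0 : ℝ)..t, k u * r (t - u) := by
      have := intervalIntegral.integral_comp_sub_left (a := 0) (b := t)
        (fun u => k u * r (t - u)) t
      simp only [sub_sub_cancel, sub_self, sub_zero] at this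
      exact this
    rw [h1, intervalIntegral.integral_of_le ht]
    refine (setIntegral_eq_of_subset_of_forall_sdiff_eq_zero measurableSet_Ioi
      Ioc_subset_Ioi_self fun u hu => ?_).symm
    have : t < u := by
      by_contra h
      exact hu.2 ⟨hu.1, not_lt.1 h⟩
    rw [hr0 _ (by linarith), mul_zero]
  have e2 : ∫ u in Ioi (0 : ℝ), k u * r (t - u) = (2 * Real.pi : ℂ)⁻¹ *
      ∫ y : ℝ, R (ζ y) * laplace k (ζ y) * Complex.exp (ζ y * t) := by
    have h1 : ∀ u, k u * r (t - u) = (2 * Real.pi : ℂ)⁻¹ * ∫ y : ℝ,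
        R (ζ y) * Complex.exp (ζ y * t) * (Complex.exp (-(ζ y * u)) * k u) := fun u => by
      rw [hr]
      simp only
      rw [mul_left_comm, ← integral_const_mul]
      congr 2
      ext y
      rw [show ζ y * ((t - u : ℝ) : ℂ) = ζ y * t + -(ζ y * u) by push_cast; ring, Complex.exp_add]
      ring
    simp only [h1]
    rw [integral_const_mul, integral_integral_swap]
    · congr 2
      ext y
      rw [integral_const_mul, laplace]
      ring
    · have hprod := (hku.integrable.mul_prod (hRi.norm.mul_const (Real.exp (-(θ₁ * t)))))
      refine hprod.mono' ?_ ?_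
      · exact (((hRc.comp continuous_snd).mul (by fun_prop)).mul
          (by fun_prop)).aestronglyMeasurable
      · have hae : ∀ᵐ z : ℝ × ℝ ∂((volume.restrict (Ioi (0 : ℝ))).prod volume), 0 < z.1 :=
          Measure.quasiMeasurePreserving_fst.ae (ae_restrict_mem measurableSet_Ioi)
        filter_upwards [hae] with z hz
        have h2 := norm_laplace_integrand_le hb (ζ z.2) hz.le
        rw [hζre, show -(-θ₁ + θ) = -(θ - θ₁) by ring] at h2
        simp only [Function.uncurry]
        rw [norm_mul, norm_mul, hexpn, mul_comm]
        gcongr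
  -- Laplace inversion on the line `Re z = -θ₁` is Fourier inversion for `e^{θ₁ u} k(u)`, extended
  -- by zero to `u < 0`. The extension is continuous because `k 0 = 0`.
  have e3 : k t = (2 * Real.pi : ℂ)⁻¹ * ∫ y : ℝ, laplace k (ζ y) * Complex.exp (ζ y * t) := by
    set g : ℝ → ℂ := fun u => Complex.exp (θ₁ * u) * (k (max u 0)) *
      (if 0 ≤ u then 1 else 0) with hg
    have hg1 : ∀ u, 0 ≤ u → g u = Complex.exp (θ₁ * u) * k u := fun u hu => by
      simp [hg, hu]
    have hg2 : ∀ u, u ≤ 0 → g u = 0 := fun u hu => by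
      simp [hg, max_eq_right hu, hk0]
    have hg3 : g = fun u : ℝ => Complex.exp (θ₁ * u) * (k (max u 0)) := by
      ext u
      rcases le_total 0 u with h | h
      · rw [hg1 u h, max_eq_left h]
      · rw [hg2 u h, max_eq_right h, hk0, mul_zero]
    have hgc : Continuous g := by rw [hg3]; fun_prop
    have hgi : ∀ y : ℝ, IntegrableOn (fun u : ℝ => Complex.exp (-(ζ y * u)) * k u) (Ioi 0) :=
      fun y => integrableOn_laplace hk hb (by rw [hζre]; linarith)
    have hgu : ∀ (y u : ℝ), Complex.exp (-(Complex.I * y * u)) * g u =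
        (Ioi (0 : ℝ)).indicator (fun u : ℝ => Complex.exp (-(ζ y * u)) * k u) u := by
      intro y u
      by_cases hu : u ∈ Ioi (0 : ℝ)
      · rw [indicator_of_mem hu, hg1 u (le_of_lt hu), ← mul_assoc, ← Complex.exp_add]
        congr 2
        simp only [ζ]
        push_cast
        ring
      · rw [indicator_of_notMem hu, hg2 u (not_lt.1 hu), mul_zero]
    have hgI : Integrable g := by
      have h1 : ∀ u, g u = (Ioi (0 : ℝ)).indicator
          (fun u : ℝ => Complex.exp (-(ζ 0 * u)) * k u) u := fun u => by
        rw [← hgu 0 u]; simp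
      rw [show g = _ from funext h1]
      exact (hgi 0).integrable_indicator measurableSet_Ioi
    have hgF : fourierV g = fun y => laplace k (ζ y) := by
      ext y
      rw [fourierV]
      simp only [hgu]
      rw [integral_indicator measurableSet_Ioi, laplace]
    have := (isFourierTransform_fourierV hgc hgI (by rw [hgF]; exact hLi)).2.2 t
    rw [hgF, hg1 t ht] at this
    have h3 : k t = Complex.exp (-(θ₁ * t)) * (Complex.exp (θ₁ * t) * k t) := by
      rw [← mul_assoc, ← Complex.exp_add]; simp
    rw [h3, this, mul_left_comm, ← integral_const_mul]
    congr 2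
    ext y
    rw [mul_left_comm, ← Complex.exp_add]
    congr 2
    simp only [ζ]
    push_cast
    ring
  have hRL : Integrable fun y => R (ζ y) * laplace k (ζ y) * Complex.exp (ζ y * t) := by
    refine ((hLi.norm.const_mul M).mul_const (Real.exp (-(θ₁ * t)))).mono'
      ((hRc.mul hLc).mul (by fun_prop)).aestronglyMeasurable (Eventually.of_forall fun y => ?_)
    rw [norm_mul, norm_mul, hexpn]
    gcongr
    have := hRM y
    nlinarith [norm_nonneg (R (ζ y)), sq_nonneg y]
  -- All three terms are now integrals along the same line, and their integrands satisfy the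
  -- algebraic identity that defines `R`.
  rw [e1, e2, e3, hr, ← mul_add, ← integral_add (hRint t) hRL, ← mul_neg, ← integral_neg]
  congr 2
  ext y
  have := hne (ζ y) (hζre y).ge
  simp only [hR]
  field_simp
  ring

theorem intervalIntegral_triangle_swap {F : ℝ → ℝ → ℂ} (hF : Continuous (Function.uncurry F))
    {t : ℝ} (ht : 0 ≤ t) :
    ∫ s in (0 : ℝ)..t, ∫ u in (0 : ℝ)..s, F s u = ∫ u in (0 : ℝ)..t, ∫ s in u..t, F s u := by
  set T : Set (ℝ × ℝ) := {z | z.2 ≤ z.1} with hT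
  have hTm : MeasurableSet T := measurableSet_le measurable_snd measurable_fst
  set I : ℝ → ℝ → ℂ := fun s u => T.indicator (Function.uncurry F) (s, u) with hI
  have h1 : ∫ s in (0 : ℝ)..t, ∫ u in (0 : ℝ)..s, F s u =
      ∫ s in (0 : ℝ)..t, ∫ u in (0 : ℝ)..t, I s u := by
    refine intervalIntegral.integral_congr fun s hs => ?_
    rw [uIcc_of_le ht] at hs
    rw [intervalIntegral.integral_of_le hs.1, intervalIntegral.integral_of_le ht]
    rw [← integral_indicator measurableSet_Ioc, ← integral_indicator measurableSet_Ioc]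
    congr 1
    ext u
    by_cases hu : u ∈ Ioc 0 s
    · rw [indicator_of_mem hu, indicator_of_mem (show u ∈ Ioc 0 t from ⟨hu.1, hu.2.trans hs.2⟩), hI]
      simp [hT, hu.2]
    · rw [indicator_of_notMem hu]
      by_cases hu' : u ∈ Ioc 0 t
      · rw [indicator_of_mem hu', hI]
        have : ¬ u ≤ s := fun h => hu ⟨hu'.1, h⟩
        simp [hT, this]
      · rw [indicator_of_notMem hu']
  have h2 : ∫ u in (0 : ℝ)..t, ∫ s in u..t, F s u =
      ∫ u in (0 : ℝ)..t, ∫ s in (0 : ℝ)..t, I s u := by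
    refine intervalIntegral.integral_congr fun u hu => ?_
    rw [uIcc_of_le ht] at hu
    rw [intervalIntegral.integral_of_le hu.2, intervalIntegral.integral_of_le ht,
      ← integral_Icc_eq_integral_Ioc,
      ← integral_indicator measurableSet_Icc, ← integral_indicator measurableSet_Ioc]
    refine integral_congr_ae ?_
    have : ∀ᵐ s : ℝ, s ≠ 0 := by simp [ae_iff, measure_singleton]
    filter_upwards [this] with s hs0
    by_cases hs : s ∈ Icc u t
    · rw [indicator_of_mem hs, indicator_of_mem
        (show s ∈ Ioc 0 t from ⟨(hu.1.trans hs.1).lt_of_ne hs0.symm, hs.2⟩), hI]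
      simp [hT, hs.1]
    · rw [indicator_of_notMem hs]
      by_cases hs' : s ∈ Ioc 0 t
      · rw [indicator_of_mem hs', hI]
        have : ¬ u ≤ s := fun h => hs ⟨h, hs'.2⟩
        simp [hT, this]
      · rw [indicator_of_notMem hs']
  rw [h1, h2, intervalIntegral_intervalIntegral_swap]
  have hc : IntegrableOn (Function.uncurry F) (uIcc 0 t ×ˢ uIcc 0 t) :=
    hF.continuousOn.integrableOn_compact (isCompact_uIcc.prod isCompact_uIcc)
  have hc2 : IntegrableOn (Function.uncurry F) (uIoc 0 t ×ˢ uIoc 0 t) :=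
    hc.mono_set (prod_mono uIoc_subset_uIcc uIoc_subset_uIcc)
  have := hc2.integrable.indicator hTm
  exact this

/-- A Volterra equation is solved by convolution with the resolvent. -/
theorem volterra_solution {κ G S : ℝ → ℂ} (hκ : Continuous κ) (hG : Continuous G)
    (hS : Continuous S)
    (hres : ∀ t, 0 ≤ t → G t + ∫ s in (0 : ℝ)..t, κ (t - s) * G s = -κ t) {t : ℝ} (ht : 0 ≤ t) :
    (S t + ∫ s in (0 : ℝ)..t, G (t - s) * S s) +
      ∫ s in (0 : ℝ)..t, κ (t - s) * (S s + ∫ u in (0 : ℝ)..s, G (s - u) * S u) = S t := by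
  -- Associativity of convolution together with the resolvent equation: `κ * (G * S) = (κ * G) * S =
  -- (-κ - G) * S`.
  have h1 : ∫ s in (0 : ℝ)..t, κ (t - s) * ∫ u in (0 : ℝ)..s, G (s - u) * S u =
      ∫ u in (0 : ℝ)..t, (-κ (t - u) - G (t - u)) * S u := by
    have e1 : ∫ s in (0 : ℝ)..t, κ (t - s) * ∫ u in (0 : ℝ)..s, G (s - u) * S u =
        ∫ s in (0 : ℝ)..t, ∫ u in (0 : ℝ)..s, κ (t - s) * (G (s - u) * S u) := by
      simp only [intervalIntegral.integral_const_mul]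
    rw [e1, intervalIntegral_triangle_swap (F := fun s u => κ (t - s) * (G (s - u) * S u))
      (by simp only [Function.uncurry_def]; fun_prop) ht]
    refine intervalIntegral.integral_congr fun u hu => ?_
    rw [uIcc_of_le ht] at hu
    have := hres (t - u) (by linarith [hu.2])
    rw [show -κ (t - u) - G (t - u) = ∫ s in (0 : ℝ)..(t - u), κ (t - u - s) * G s by
      rw [← this]; ring]
    have h2 := intervalIntegral.integral_comp_sub_right (a := u) (b := t)
      (fun s => κ (t - u - s) * G s) u
    rw [sub_self] at h2
    rw [← h2, ← intervalIntegral.integral_mul_const]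
    refine intervalIntegral.integral_congr fun s _ => ?_
    rw [show t - u - (s - u) = t - s by ring, mul_assoc]
  have hc : Continuous fun s => ∫ u in (0 : ℝ)..s, G (s - u) * S u := by fun_prop
  have i1 : IntervalIntegrable (fun s => κ (t - s) * S s) volume 0 t :=
    (by fun_prop : Continuous _).intervalIntegrable _ _
  have i2 : IntervalIntegrable (fun s => κ (t - s) * ∫ u in (0 : ℝ)..s, G (s - u) * S u)
      volume 0 t := (by fun_prop : Continuous _).intervalIntegrable _ _
  have i3 : IntervalIntegrable (fun s => G (t - s) * S s) volume 0 t :=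
    (by fun_prop : Continuous _).intervalIntegrable _ _
  simp only [mul_add]
  rw [intervalIntegral.integral_add i1 i2, h1]
  have e2 : ∫ u in (0 : ℝ)..t, (-κ (t - u) - G (t - u)) * S u =
      -(∫ u in (0 : ℝ)..t, κ (t - u) * S u) - ∫ u in (0 : ℝ)..t, G (t - u) * S u := by
    rw [← intervalIntegral.integral_neg]
    refine Eq.trans ?_ (intervalIntegral.integral_sub i1.neg i3)
    refine intervalIntegral.integral_congr fun u _ => ?_
    ring
  rw [e2]
  ring

/-- The resolvents of the density equations decay exponentially, uniformly in the frequency. -/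
theorem exists_density_resolvent {μ : ℝ → ℝ} {θ₀ C₀ κ₀ : ℝ} (hθ₀ : 0 < θ₀) (hκ₀ : 0 < κ₀)
    (hμ : IsAnalyticEquilibrium μ θ₀ C₀) (hP : PenroseStable μ κ₀) :
    ∃ θ₁ M : ℝ, 0 < θ₁ ∧ θ₁ ≤ θ₀ / 4 ∧ 0 < M ∧ ∀ q : ℤ, q ≠ 0 → ∃ G : ℝ → ℂ, Continuous G ∧
      (∀ t, 0 ≤ t → ‖G t‖ ≤ M * |(q : ℝ)| * Real.exp (-(θ₁ * |(q : ℝ)| * t))) ∧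
      ∀ t : ℝ, 0 ≤ t → G t + ∫ s in (0 : ℝ)..t,
        ((t - s : ℝ) : ℂ) * equilibriumHat μ (q * (t - s)) * G s =
          -((t : ℂ) * equilibriumHat μ (q * t)) := by
  obtain ⟨h₁, h₂, d₁, d₂, hc₂, b₁, b₂⟩ := hμ.exists_deriv_equilibriumHat hθ₀
  obtain ⟨Cm, hCm, hm⟩ := exists_one_add_pow_mul_exp_le 1 (half_pos hθ₀)
  have b₀ := hμ.norm_equilibriumHat_le
  have hC₀ : 0 ≤ C₀ := by
    have := (norm_nonneg _).trans (b₀ 0)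
    simpa using this
  set C := 6 * (C₀ + 1) * Cm with hC
  have hCpos : 0 < C := by positivity
  -- The rescaled kernels decay at rate `θ₀ / 2`. The two entries are the requirements of
  -- `exists_resolvent` for that rate: `θ₁` is at most half of it, and small enough to lose only
  -- half of `κ₀`.
  set θ₁ := min (θ₀ / 4) (κ₀ * (θ₀ / 2) ^ 2 / (4 * C)) with hθ₁
  have hθ₁0 : 0 < θ₁ := lt_min (by positivity) (by positivity)
  refine ⟨θ₁, 2 / κ₀ * (C + 4 * C / (θ₀ / 2)), hθ₁0, min_le_left _ _, by positivity,
    fun q hq => ?_⟩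
  set a : ℝ := |(q : ℝ)| with ha
  have ha1 : 1 ≤ a := by
    rw [ha]; exact_mod_cast Int.one_le_abs hq
  have ha0 : 0 < a := by linarith
  obtain ⟨σ, hσ, hσ2⟩ : ∃ σ : ℝ, (q : ℝ) = a * σ ∧ |σ| = 1 := by
    rcases le_total 0 (q : ℝ) with h | h
    · exact ⟨1, by rw [ha, abs_of_nonneg h, mul_one], by simp⟩
    · exact ⟨-1, by rw [ha, abs_of_nonpos h]; ring, by simp⟩
  have hσ2' : (σ : ℂ) * σ = 1 := by
    have : σ * σ = 1 := by rw [← abs_mul_abs_self, hσ2, one_mul]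
    exact_mod_cast this
  have hcomp : ∀ {u u' : ℝ → ℂ}, (∀ η, HasDerivAt u (u' η) η) → ∀ s : ℝ,
      HasDerivAt (fun s => u (σ * s)) (σ * u' (σ * s)) s := by
    intro u u' hu s
    have h := (hasDerivAt_id s).const_mul σ
    simp only [mul_one, id] at h
    have := (hu (σ * s)).scomp s h
    rw [Complex.real_smul] at this
    exact this
  set h := equilibriumHat μ with hh
  -- In the time variable `τ = a t` the kernel `t μ̂(q t)` becomes `a k(a t)`, where `k` and its
  -- derivatives are bounded uniformly because `a ≥ 1`. The Penrose condition for `q` at `z a` is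
  -- the one for `k` at `z`, and undoing the scaling multiplies both the size and the decay rate of
  -- the resolvent by `a`.
  set k : ℝ → ℂ := fun τ => (a ^ 2 : ℂ)⁻¹ * (τ * h (σ * τ)) with hk
  set k₁ : ℝ → ℂ := fun τ => (a ^ 2 : ℂ)⁻¹ * (h (σ * τ) + τ * (σ * h₁ (σ * τ))) with hk₁
  set k₂ : ℝ → ℂ := fun τ => (a ^ 2 : ℂ)⁻¹ * (2 * (σ * h₁ (σ * τ)) + τ * h₂ (σ * τ)) with hk₂
  have hid : ∀ t : ℝ, HasDerivAt (fun t : ℝ => (t : ℂ)) 1 t := fun t =>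
    Complex.ofRealCLM.hasDerivAt
  have D₁ : ∀ t, HasDerivAt k (k₁ t) t := fun t => by
    refine (((hid t).mul (hcomp d₁ t)).const_mul _).congr_deriv ?_
    rw [hk₁, one_mul]
  have D₂ : ∀ t, HasDerivAt k₁ (k₂ t) t := fun t => by
    refine (((hcomp d₁ t).add ((hid t).mul ((hcomp d₂ t).const_mul (σ : ℂ)))).const_mul
      _).congr_deriv ?_
    rw [hk₂]
    simp only
    linear_combination ((a : ℂ) ^ 2)⁻¹ * t * h₂ (σ * t) * hσ2'
  have hc1 : Continuous h₁ := continuous_iff_continuousAt.2 fun t => (d₂ t).continuousAt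
  have hc0 : Continuous h := continuous_iff_continuousAt.2 fun t => (d₁ t).continuousAt
  have hkc₂ : Continuous k₂ := by fun_prop
  have hscale : ∀ {t : ℝ} {w : ℂ}, 0 ≤ t →
      ‖w‖ ≤ 6 * (C₀ + 1) * (1 + t) * Real.exp (-(θ₀ * t)) →
      ‖(a ^ 2 : ℂ)⁻¹ * w‖ ≤ C * Real.exp (-(θ₀ / 2 * t)) := by
    intro t w ht hw
    have h1 : ‖(a ^ 2 : ℂ)⁻¹‖ ≤ 1 := by
      rw [norm_inv, norm_pow, Complex.norm_real, Real.norm_of_nonneg ha0.le]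
      exact inv_le_one_of_one_le₀ (one_le_pow₀ ha1)
    rw [norm_mul]
    calc _ ≤ 1 * (6 * (C₀ + 1) * (1 + t) * Real.exp (-(θ₀ * t))) := by gcongr
      _ = 6 * (C₀ + 1) * ((1 + t) ^ 1 * Real.exp (-(θ₀ / 2 * t))) * Real.exp (-(θ₀ / 2 * t)) := by
          have : Real.exp (-(θ₀ * t)) = Real.exp (-(θ₀ / 2 * t)) * Real.exp (-(θ₀ / 2 * t)) := by
            rw [← Real.exp_add]; ring_nf
          rw [this]; ring
      _ ≤ 6 * (C₀ + 1) * Cm * Real.exp (-(θ₀ / 2 * t)) := by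
          gcongr
          exact hm t ht
  have habs : ∀ t, 0 ≤ t → |σ * t| = t := fun t ht => by
    rw [abs_mul, hσ2, one_mul, abs_of_nonneg ht]
  have nσ : ‖(σ : ℂ)‖ = 1 := by rw [Complex.norm_real, Real.norm_eq_abs, hσ2]
  have nt : ∀ t : ℝ, 0 ≤ t → ‖(t : ℂ)‖ = t := fun t ht => by
    rw [Complex.norm_real, Real.norm_of_nonneg ht]
  have B₀ : ∀ t, 0 ≤ t → ‖k t‖ ≤ C * Real.exp (-(θ₀ / 2 * t)) := fun t ht => by
    refine hscale ht ?_
    have e0 := b₀ (σ * t)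
    rw [habs t ht] at e0
    rw [norm_mul, nt t ht]
    nlinarith [Real.exp_pos (-(θ₀ * t)), mul_nonneg ht (Real.exp_pos (-(θ₀ * t))).le,
      mul_nonneg hC₀ (mul_nonneg ht (Real.exp_pos (-(θ₀ * t))).le),
      mul_nonneg hC₀ (Real.exp_pos (-(θ₀ * t))).le]
  have B₁ : ∀ t, 0 ≤ t → ‖k₁ t‖ ≤ C * Real.exp (-(θ₀ / 2 * t)) := fun t ht => by
    refine hscale ht ((norm_add_le _ _).trans ?_)
    have e0 := b₀ (σ * t)
    have e1 := b₁ (σ * t)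
    rw [habs t ht] at e0 e1
    rw [norm_mul, norm_mul, nt t ht, nσ, one_mul]
    nlinarith [Real.exp_pos (-(θ₀ * t)), mul_nonneg ht (Real.exp_pos (-(θ₀ * t))).le,
      mul_nonneg hC₀ (mul_nonneg ht (Real.exp_pos (-(θ₀ * t))).le),
      mul_nonneg hC₀ (Real.exp_pos (-(θ₀ * t))).le]
  have B₂ : ∀ t, 0 ≤ t → ‖k₂ t‖ ≤ C * Real.exp (-(θ₀ / 2 * t)) := fun t ht => by
    refine hscale ht ((norm_add_le _ _).trans ?_)
    have e1 := b₁ (σ * t)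
    have e2 := b₂ (σ * t)
    rw [habs t ht] at e1 e2
    rw [norm_mul, norm_mul, norm_mul, nt t ht, nσ, one_mul, Complex.norm_ofNat]
    nlinarith [Real.exp_pos (-(θ₀ * t)), mul_nonneg ht (Real.exp_pos (-(θ₀ * t))).le,
      mul_nonneg hC₀ (mul_nonneg ht (Real.exp_pos (-(θ₀ * t))).le),
      mul_nonneg hC₀ (Real.exp_pos (-(θ₀ * t))).le]
  have hka : ∀ t : ℝ, (a : ℂ) * k (a * t) = t * h (q * t) := fun t => by
    have : (a : ℂ) ≠ 0 := by exact_mod_cast ha0.ne'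
    rw [hk, hσ]
    simp only
    rw [show a * σ * t = σ * (a * t) by ring]
    push_cast
    field_simp
  have hPk : ∀ z : ℂ, 0 ≤ z.re → κ₀ ≤ ‖1 + laplace k z‖ := by
    intro z hz
    have hz' : 0 ≤ (z * a).re := by
      simp only [Complex.mul_re, Complex.ofReal_re, Complex.ofReal_im, mul_zero, sub_zero]
      positivity
    refine (hP q hq (z * a) hz').trans (le_of_eq ?_)
    congr 2
    have := integral_comp_mul_left_Ioi (fun τ : ℝ => Complex.exp (-(z * τ)) * k τ) 0 ha0
    rw [mul_zero] at this
    rw [laplace]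
    have h2 : ∫ τ in Ioi (0 : ℝ), Complex.exp (-(z * τ)) * k τ =
        (a : ℂ) * ∫ t in Ioi (0 : ℝ), Complex.exp (-(z * ((a * t : ℝ) : ℂ))) * k (a * t) := by
      rw [this, Complex.real_smul, ← mul_assoc]
      push_cast
      rw [mul_inv_cancel₀ (by exact_mod_cast ha0.ne'), one_mul]
    rw [h2, ← integral_const_mul]
    congr 1
    ext t
    have h3 := hka t
    rw [hh, equilibriumHat] at h3
    rw [mul_left_comm, h3, mul_assoc]
    push_cast
    ring_nf
  obtain ⟨r, hrc, hrb, hr⟩ := exists_resolvent D₁ D₂ hkc₂ (by simp [hk]) (half_pos hθ₀) B₀ B₁ B₂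
    hPk hκ₀ hθ₁0 ((min_le_left _ _).trans (by linarith)) (by
      have := min_le_right (θ₀ / 4) (κ₀ * (θ₀ / 2) ^ 2 / (4 * C))
      rw [← hθ₁, le_div_iff₀ (by positivity)] at this
      rw [div_le_div_iff₀ (by positivity) two_pos]
      linarith)
  refine ⟨fun t => a * r (a * t), by fun_prop, fun t ht => ?_, fun t ht => ?_⟩
  · rw [norm_mul, nt a ha0.le]
    have := hrb (a * t) (by positivity)
    rw [← mul_assoc θ₁] at this
    calc _ ≤ a * (2 / κ₀ * (C + 4 * C / (θ₀ / 2)) * Real.exp (-(θ₁ * a * t))) := by gcongr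
      _ = _ := by ring
  · have h1 := hr (a * t) (by positivity)
    have h2 := intervalIntegral.smul_integral_comp_mul_left (a := 0) (b := t)
      (fun s => k (a * t - s) * r s) a
    rw [mul_zero] at h2
    rw [← h2, Complex.real_smul] at h1
    have h3 : ∫ s in (0 : ℝ)..t, ((t - s : ℝ) : ℂ) * h (q * (t - s)) * (a * r (a * s)) =
        a * ((a : ℂ) * ∫ s in (0 : ℝ)..t, k (a * t - a * s) * r (a * s)) := by
      rw [← intervalIntegral.integral_const_mul, ← intervalIntegral.integral_const_mul]
      refine intervalIntegral.integral_congr fun s _ => ?_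
      rw [← hka (t - s), mul_sub]
      ring
    rw [h3, ← hka t]
    linear_combination (a : ℂ) * h1

/-! ### Time dependent analytic weights -/

/-- The radius of analyticity at time `t`, which decreases from `11/10 * lam` to `lam`. -/
def radius (lam t : ℝ) : ℝ := lam * (1 + 1 / (10 * √(1 + t)))

/-- The weight of a frequency of size `x` at time `t`. -/
def weight (lam t x : ℝ) : ℝ := Real.exp (-(radius lam t * x)) * ((1 + x) ^ 20)⁻¹

/-- The decay rate of the density. -/
def densityDecay (t : ℝ) : ℝ := ((1 + t) ^ 3)⁻¹

/-- The size of the frequency `(k, η, ξ)` at order `n`. -/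
def freqSize (k η : ℤ) (n : ℕ) (ξ : ℝ) : ℝ := |(k : ℝ)| + |(η : ℝ)| + (n + 1) + |ξ|

/-- Summable weights on the frequencies `(k, η)` and the orders `n`. -/
def summableWeight (k η : ℤ) (n : ℕ) : ℝ :=
  ((1 + |(k : ℝ)|) ^ 2 * (1 + |(η : ℝ)|) ^ 2 * (1 + (n : ℝ)) ^ 2)⁻¹

section weights

variable {lam : ℝ}

theorem le_radius (hl : 0 < lam) (t : ℝ) : lam ≤ radius lam t := by
  unfold radius
  have : 0 ≤ 1 / (10 * √(1 + t)) := by positivity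
  nlinarith

theorem radius_pos (hl : 0 < lam) (t : ℝ) : 0 < radius lam t := hl.trans_le (le_radius hl t)

theorem radius_anti (hl : 0 < lam) {s t : ℝ} (hs : 0 ≤ s) (hst : s ≤ t) :
    radius lam t ≤ radius lam s := by
  unfold radius
  have : 0 < √(1 + s) := Real.sqrt_pos.2 (by linarith)
  gcongr

theorem radius_le (hl : 0 < lam) {t : ℝ} (ht : 0 ≤ t) : radius lam t ≤ 11 / 10 * lam := by
  refine (radius_anti hl le_rfl ht).trans (le_of_eq ?_)
  simp [radius]
  ring

/-- The radius has derivative `-(lam / 20) (1 + t)^(-3/2)`, whose size decreases, so the slope at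
the later time bounds the drop from below. -/
theorem sub_le_radius_sub (hl : 0 < lam) {s t : ℝ} (hs : 0 ≤ s) (hst : s ≤ t) :
    lam / 20 * ((t - s) / ((1 + t) * √(1 + t))) ≤ radius lam s - radius lam t := by
  unfold radius
  set u := √(1 + s) with hu
  set v := √(1 + t) with hv
  have hu0 : 0 < u := Real.sqrt_pos.2 (by linarith)
  have huv : u ≤ v := Real.sqrt_le_sqrt (by linarith)
  have hv0 : 0 < v := hu0.trans_le huv
  have hu2 : u ^ 2 = 1 + s := Real.sq_sqrt (by linarith)
  have hv2 : v ^ 2 = 1 + t := Real.sq_sqrt (by linarith)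
  have h1 : t - s = (v - u) * (v + u) := by linear_combination hu2 - hv2
  have h2 : (t - s) / ((1 + t) * v) ≤ 2 * (1 / u - 1 / v) := by
    rw [← hv2, h1, div_sub_div _ _ hu0.ne' hv0.ne', ← mul_div_assoc,
      div_le_div_iff₀ (by positivity) (by positivity)]
    have h3 : u * (v + u) ≤ 2 * v ^ 2 := by nlinarith
    have h4 : 0 ≤ v - u := by linarith
    nlinarith [mul_le_mul_of_nonneg_left h3 (mul_nonneg h4 hv0.le)]
  have h5 : lam * (1 + 1 / (10 * u)) - lam * (1 + 1 / (10 * v)) = lam / 10 * (1 / u - 1 / v) := by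
    field_simp
    ring
  rw [h5]
  nlinarith

theorem weight_pos (t : ℝ) {x : ℝ} (hx : 0 ≤ x) : 0 < weight lam t x := by
  unfold weight; positivity

/-- The larger of `x`, `y` is at least `z / 2`, so its algebraic factor already controls that of
`z`; the algebraic factor of the smaller one is left over as a gain. Its twenty powers are spent
later: six on summability over modes and orders, fourteen on the resonant factor in the density
equation. -/
theorem weight_mul_weight_le (hl : 0 < lam) (s : ℝ) {x y z : ℝ} (hx : 0 ≤ x) (hy : 0 ≤ y)
    (hz : 0 ≤ z) (hxy : z ≤ x + y) :
    weight lam s x * weight lam s y ≤ 2 ^ 20 * weight lam s z * ((1 + min x y) ^ 20)⁻¹ := by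
  have hr := radius_pos hl s
  have hm : 0 ≤ min x y := le_min hx hy
  have h1 : (1 + z) * (1 + min x y) ≤ 2 * ((1 + x) * (1 + y)) := by
    rcases le_total x y with h | h
    · rw [min_eq_left h]; nlinarith
    · rw [min_eq_right h]; nlinarith
  have h2 : ((1 + x) ^ 20)⁻¹ * ((1 + y) ^ 20)⁻¹ ≤
      2 ^ 20 * (((1 + z) ^ 20)⁻¹ * ((1 + min x y) ^ 20)⁻¹) := by
    rw [← mul_inv, ← mul_inv, ← mul_pow, ← mul_pow, ← div_eq_mul_inv, ← one_div,
      div_le_div_iff₀ (by positivity) (by positivity), one_mul, ← mul_pow]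
    gcongr
  have h3 : Real.exp (-(radius lam s * x)) * Real.exp (-(radius lam s * y)) ≤
      Real.exp (-(radius lam s * z)) := by
    rw [← Real.exp_add]
    gcongr
    nlinarith
  unfold weight
  calc _ = (Real.exp (-(radius lam s * x)) * Real.exp (-(radius lam s * y))) *
        (((1 + x) ^ 20)⁻¹ * ((1 + y) ^ 20)⁻¹) := by ring
    _ ≤ Real.exp (-(radius lam s * z)) *
        (2 ^ 20 * (((1 + z) ^ 20)⁻¹ * ((1 + min x y) ^ 20)⁻¹)) := by gcongr
    _ = _ := by ring

/-- The price of moving a frequency by `ζ`. It is paid by the exponential decay of the resolvents or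
of `μ̂`, whose rates are at least twice `11 / 10 * lam`. -/
theorem weight_shift_le (hl : 0 < lam) {s t : ℝ} (hs : 0 ≤ s) (hst : s ≤ t) {x z ζ : ℝ}
    (hx : 0 ≤ x) (hz : 0 ≤ z) (hζ : 0 ≤ ζ) (h : z ≤ x + ζ) :
    weight lam s x ≤ weight lam t z * (Real.exp (11 / 10 * lam * ζ) * (1 + ζ) ^ 20) := by
  have h1 : ((1 + x) ^ 20)⁻¹ ≤ ((1 + z) ^ 20)⁻¹ * (1 + ζ) ^ 20 := by
    rw [inv_mul_eq_div, ← one_div, div_le_div_iff₀ (by positivity) (by positivity), one_mul,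
      ← mul_pow]
    gcongr
    nlinarith
  have h2 : Real.exp (-(radius lam s * x)) ≤
      Real.exp (-(radius lam t * z)) * Real.exp (11 / 10 * lam * ζ) := by
    rw [← Real.exp_add]
    gcongr
    have e1 := radius_anti hl hs hst
    have e2 := radius_le hl hs
    have e3 := radius_pos hl s
    nlinarith
  unfold weight
  calc _ ≤ (Real.exp (-(radius lam t * z)) * Real.exp (11 / 10 * lam * ζ)) *
        (((1 + z) ^ 20)⁻¹ * (1 + ζ) ^ 20) := by gcongr
    _ = _ := by ring

theorem densityDecay_pos {t : ℝ} (ht : 0 ≤ t) : 0 < densityDecay t := by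
  unfold densityDecay; positivity

theorem densityDecay_le {s t : ℝ} (hs : 0 ≤ s) (hst : s ≤ t) :
    densityDecay s ≤ densityDecay t * (1 + (t - s)) ^ 3 := by
  unfold densityDecay
  have : 0 ≤ t - s := by linarith
  have : 0 ≤ t := by linarith
  rw [inv_mul_eq_div, ← one_div, div_le_div_iff₀ (by positivity) (by positivity), one_mul,
    ← mul_pow]
  gcongr
  nlinarith

theorem freqSize_pos (k η : ℤ) (n : ℕ) (ξ : ℝ) : 0 < freqSize k η n ξ := by
  unfold freqSize; positivity

theorem one_le_freqSize (k η : ℤ) (n : ℕ) (ξ : ℝ) : 1 ≤ freqSize k η n ξ := by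
  unfold freqSize
  have := abs_nonneg (k : ℝ)
  have := abs_nonneg (η : ℝ)
  have := abs_nonneg ξ
  have : (0 : ℝ) ≤ n := Nat.cast_nonneg n
  linarith

/-- The order `n` enters the size as `n + 1`, its power of `ε`. This makes the orders add up without
loss: `(i + 1) + (j + 1) = (i + j + 1) + 1`. -/
theorem freqSize_le_add (k η l η₁ : ℤ) (i j : ℕ) (ξ ξ₁ : ℝ) :
    freqSize k η (i + j + 1) ξ ≤ freqSize l η₁ i ξ₁ + freqSize (k - l) (η - η₁) j (ξ - ξ₁) := by
  unfold freqSize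
  have h1 := abs_add_le (l : ℝ) (k - l)
  have h2 := abs_add_le (η₁ : ℝ) (η - η₁)
  have h3 := abs_add_le ξ₁ (ξ - ξ₁)
  rw [add_sub_cancel] at h1 h2 h3
  push_cast
  linarith

theorem freqSize_le_add_abs (k η : ℤ) (n : ℕ) (ξ ξ' : ℝ) :
    freqSize k η n ξ ≤ freqSize k η n ξ' + |ξ - ξ'| := by
  unfold freqSize
  have := abs_add_le ξ' (ξ - ξ')
  rw [add_sub_cancel] at this
  linarith

theorem summableWeight_nonneg (k η : ℤ) (n : ℕ) : 0 ≤ summableWeight k η n := by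
  unfold summableWeight; positivity

/-- Six powers of the size buy two powers for each of the three summation variables. -/
theorem inv_pow_le_summableWeight (k η : ℤ) (n : ℕ) (ξ : ℝ) :
    ((1 + freqSize k η n ξ) ^ 6)⁻¹ ≤ summableWeight k η n := by
  unfold summableWeight
  have h0 : (0 : ℝ) ≤ n := Nat.cast_nonneg n
  have h1 := abs_nonneg (k : ℝ)
  have h2 := abs_nonneg (η : ℝ)
  have h3 := abs_nonneg ξ
  have e1 : 1 + |(k : ℝ)| ≤ 1 + freqSize k η n ξ := by unfold freqSize; linarith
  have e2 : 1 + |(η : ℝ)| ≤ 1 + freqSize k η n ξ := by unfold freqSize; linarith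
  have e3 : 1 + (n : ℝ) ≤ 1 + freqSize k η n ξ := by unfold freqSize; linarith
  have := freqSize_pos k η n ξ
  gcongr
  calc _ ≤ (1 + freqSize k η n ξ) ^ 2 * (1 + freqSize k η n ξ) ^ 2 *
      (1 + freqSize k η n ξ) ^ 2 := by gcongr
    _ = _ := by ring

theorem inv_min_pow_le_summableWeight (k η : ℤ) (n : ℕ) (ξ : ℝ) (k' η' : ℤ) (n' : ℕ) (ξ' : ℝ) :
    ((1 + min (freqSize k η n ξ) (freqSize k' η' n' ξ')) ^ 6)⁻¹ ≤
      summableWeight k η n + summableWeight k' η' n' := by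
  rcases le_total (freqSize k η n ξ) (freqSize k' η' n' ξ') with h | h
  · rw [min_eq_left h]
    exact (inv_pow_le_summableWeight k η n ξ).trans
      (le_add_of_nonneg_right (summableWeight_nonneg _ _ _))
  · rw [min_eq_right h]
    exact (inv_pow_le_summableWeight k' η' n' ξ').trans
      (le_add_of_nonneg_left (summableWeight_nonneg _ _ _))

theorem summable_inv_one_add_abs_sq : Summable fun k : ℤ => ((1 + |(k : ℝ)|) ^ 2)⁻¹ := by
  have h : Summable fun n : ℕ => ((1 + (n : ℝ)) ^ 2)⁻¹ := by
    have := (summable_nat_add_iff 1).2 (Real.summable_nat_pow_inv.2 one_lt_two)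
    refine this.congr fun n => ?_
    push_cast
    rw [add_comm]
  rw [summable_int_iff_summable_nat_and_neg]
  exact ⟨h.congr fun n => by simp, h.congr fun n => by simp⟩

theorem summable_summableWeight : Summable fun m : (ℤ × ℤ) × ℕ =>
    summableWeight m.1.1 m.1.2 m.2 := by
  have h : Summable fun n : ℕ => ((1 + (n : ℝ)) ^ 2)⁻¹ := by
    have := (summable_nat_add_iff 1).2 (Real.summable_nat_pow_inv.2 one_lt_two)
    refine this.congr fun n => ?_
    push_cast
    rw [add_comm]
  have := (summable_inv_one_add_abs_sq.mul_of_nonneg summable_inv_one_add_abs_sq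
    (fun _ => by positivity) (fun _ => by positivity)).mul_of_nonneg h
    (fun _ => by positivity) (fun _ => by positivity)
  refine this.congr fun m => ?_
  unfold summableWeight
  rw [mul_inv, mul_inv]

/-- A frequency cannot be resonant unless `η` is large. -/
theorem abs_le_of_resonance {K L C₀ : ℝ} (hK : 1 ≤ K) (hL : 0 < L) (hLK : L ≤ C₀ * K) (a η : ℝ) :
    |a| ≤ (1 + C₀) * (|η| + |K * a - L * η|) := by
  have hC : 0 < C₀ := by
    by_contra h
    nlinarith
  have h1 : |K * a| ≤ |K * a - L * η| + |L * η| := by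
    have := abs_add_le (K * a - L * η) (L * η)
    rwa [sub_add_cancel] at this
  rw [abs_mul, abs_mul L, abs_of_pos hL, abs_of_pos (by linarith : 0 < K)] at h1
  have h2 : K * |a| ≤ K * (|K * a - L * η| + C₀ * |η|) := by
    have e1 := abs_nonneg (K * a - L * η)
    have e2 := mul_le_mul_of_nonneg_right hLK (abs_nonneg η)
    nlinarith
  have h3 := le_of_mul_le_mul_left h2 (by linarith)
  nlinarith [abs_nonneg (K * a - L * η), abs_nonneg η,
    mul_nonneg hC.le (abs_nonneg (K * a - L * η))]

/-- The gain in the density equation: either the interacting frequencies are both large, or the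
radius of analyticity has decreased sufficiently. -/
theorem sqrt_le_gain (hl : 0 < lam) {M : ℝ} (hM : 1 ≤ M) {κ s t x y z : ℝ} (hκ : 1 ≤ κ)
    (hs : 0 ≤ s) (hst : s ≤ t) (hx : 0 ≤ x) (hy : 0 ≤ y) (hz : κ ≤ z) (hzt : κ * t ≤ M * z)
    (hsx : s ≤ M * x) (hsy : κ * (t - s) ≤ M * y ∨ s - κ * (t - s) ≤ M * y) :
    min (min 1 (lam / (40 * (1 + M)))) (1 / M) * √(1 + κ * (t - s)) ≤
      (1 + min x y) * (1 + (radius lam s - radius lam t) * z) := by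
  set D := κ * (t - s) with hD
  have hts : 0 ≤ t - s := by linarith
  have hDts : t - s ≤ D := by rw [hD]; nlinarith
  have hD0 : 0 ≤ D := hts.trans hDts
  have ht : 0 ≤ t := hs.trans hst
  have hm : 0 ≤ min x y := le_min hx hy
  have hM0 : 0 < M := by linarith
  have hz0 : 0 < z := by linarith
  set c₂ := min 1 (lam / (40 * (1 + M))) with hc₂
  have hc₂0 : 0 ≤ c₂ := le_min zero_le_one (by positivity)
  set w := √(1 + D) with hw
  have hw1 : 1 ≤ w := by rw [hw]; exact Real.one_le_sqrt.2 (by linarith)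
  have hw2 : w ^ 2 = 1 + D := Real.sq_sqrt (by linarith)
  have hrad := sub_le_radius_sub hl hs hst
  have hθ0 : 0 ≤ (radius lam s - radius lam t) * z :=
    mul_nonneg (sub_nonneg.2 (radius_anti hl hs hst)) hz0.le
  -- If `D ≥ t / 4`, the drop of the radius between `s` and `t`, multiplied by `z ≥ κ (1 + t) / (1 +
  -- M)`, is at least a multiple of `D / √(1 + D)`. If `D < t / 4`, then `s` exceeds `3 D`, so `x`,
  -- and `y` in either case of `hsy`, are at least `D / M`.
  rcases le_or_gt (t / 4) D with hcase | hcase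
  · have hv : √(1 + t) ≤ 2 * w := by
      rw [hw, show (2 : ℝ) = √4 by rw [show (4 : ℝ) = 2 ^ 2 by norm_num]; simp,
        ← Real.sqrt_mul (by norm_num)]
      exact Real.sqrt_le_sqrt (by linarith)
    have hv0 : 0 < √(1 + t) := Real.sqrt_pos.2 (by linarith)
    have h1 : lam / (40 * (1 + M)) * (D / w) ≤ (radius lam s - radius lam t) * z := by
      have e1 : κ * (1 + t) / (1 + M) ≤ z := by
        rw [div_le_iff₀ (by linarith)]
        nlinarith
      calc lam / (40 * (1 + M)) * (D / w) = lam / 20 / (1 + M) * (D / (2 * w)) := by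
            field_simp; ring
        _ ≤ lam / 20 / (1 + M) * (D / √(1 + t)) := by gcongr
        _ = lam / 20 * ((t - s) / ((1 + t) * √(1 + t))) * (κ * (1 + t) / (1 + M)) := by
            rw [hD]; field_simp
        _ ≤ (radius lam s - radius lam t) * z := by
            refine mul_le_mul hrad e1 (by positivity) ?_
            exact sub_nonneg.2 (radius_anti hl hs hst)
    have h2 : w - 1 ≤ D / w := by
      rw [le_div_iff₀ (by linarith)]
      nlinarith
    have h3 : c₂ * w ≤ 1 + (radius lam s - radius lam t) * z := by
      have e1 : c₂ * (w - 1) ≤ lam / (40 * (1 + M)) * (D / w) := by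
        have : c₂ ≤ lam / (40 * (1 + M)) := min_le_right _ _
        gcongr
      have e2 : c₂ ≤ 1 := min_le_left _ _
      nlinarith
    calc _ ≤ c₂ * w := by gcongr; exact min_le_left _ _
      _ ≤ 1 + (radius lam s - radius lam t) * z := h3
      _ ≤ _ := le_mul_of_one_le_left (by linarith) (by linarith)
  · have h1 : D ≤ M * min x y := by
      rcases le_total x y with h | h
      · rw [min_eq_left h]; linarith
      · rw [min_eq_right h]; rcases hsy with h' | h' <;> linarith
    calc _ ≤ 1 / M * w := by gcongr; exact min_le_right _ _
      _ ≤ 1 + min x y := by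
          rw [one_div, inv_mul_le_iff₀ hM0]
          nlinarith
      _ ≤ _ := le_mul_of_one_le_right (by linarith) (by linarith)

/-- The consequence of `sqrt_le_gain` for the integrand of the density equation. -/
theorem exists_density_gain (hl : 0 < lam) {M : ℝ} (hM : 1 ≤ M) :
    ∃ C : ℝ, 0 < C ∧ ∀ {κ s t x y z : ℝ}, 1 ≤ κ → 0 ≤ s → s ≤ t → 0 ≤ x → 0 ≤ y → κ ≤ z →
      κ * t ≤ M * z → s ≤ M * x → (κ * (t - s) ≤ M * y ∨ s - κ * (t - s) ≤ M * y) →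
      κ * (t - s) * densityDecay s * weight lam s z * ((1 + min x y) ^ 14)⁻¹ ≤
        C * (densityDecay t * weight lam t z * ((1 + (t - s)) ^ 2)⁻¹) := by
  -- Fourteen powers of the gain `√(1 + D)` give `(1 + D) ^ 7`. Six of the seven are needed: one for
  -- the factor `D`, three to move the time decay from `s` to `t`, two for integrability in `t - s`.
  obtain ⟨E, hE, hEb⟩ := exists_one_add_pow_mul_exp_le 14 one_pos
  set c := min (min 1 (lam / (40 * (1 + M)))) (1 / M) with hc
  have hc0 : 0 < c := lt_min (lt_min one_pos (by positivity)) (by positivity)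
  refine ⟨E * (c ^ 14)⁻¹, by positivity, fun {κ s t x y z} hκ hs hst hx hy hz hzt hsx hsy => ?_⟩
  have hgain := sqrt_le_gain hl hM hκ hs hst hx hy hz hzt hsx hsy
  rw [← hc] at hgain
  set D := κ * (t - s) with hD
  have hts : 0 ≤ t - s := by linarith
  have hDts : t - s ≤ D := by rw [hD]; nlinarith
  have hD0 : 0 ≤ D := hts.trans hDts
  have hm : 0 ≤ min x y := le_min hx hy
  have hz0 : 0 < z := by linarith
  set θ := (radius lam s - radius lam t) * z with hθ
  have hθ0 : 0 ≤ θ := mul_nonneg (sub_nonneg.2 (radius_anti hl hs hst)) hz0.le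
  have h1 : c ^ 14 * (1 + D) ^ 7 ≤ (1 + min x y) ^ 14 * (1 + θ) ^ 14 := by
    have e : (√(1 + D)) ^ 14 = (1 + D) ^ 7 := by
      rw [show 14 = 2 * 7 by norm_num, pow_mul, Real.sq_sqrt (by linarith)]
    rw [← e, ← mul_pow, ← mul_pow]
    gcongr
  have h2 : Real.exp (-θ) ≤ E * ((1 + θ) ^ 14)⁻¹ := by
    have := hEb θ hθ0
    rw [one_mul] at this
    rw [← div_eq_mul_inv, le_div_iff₀ (by positivity)]
    linarith
  have h3 : Real.exp (-θ) * ((1 + min x y) ^ 14)⁻¹ ≤ E * (c ^ 14)⁻¹ * ((1 + D) ^ 7)⁻¹ := by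
    calc _ ≤ E * ((1 + θ) ^ 14)⁻¹ * ((1 + min x y) ^ 14)⁻¹ := by gcongr
      _ = E * ((1 + min x y) ^ 14 * (1 + θ) ^ 14)⁻¹ := by rw [mul_inv]; ring
      _ ≤ E * (c ^ 14 * (1 + D) ^ 7)⁻¹ := by gcongr
      _ = _ := by rw [mul_inv]; ring
  have h4 : weight lam s z = weight lam t z * Real.exp (-θ) := by
    unfold weight
    rw [mul_right_comm, ← Real.exp_add, hθ]
    ring_nf
  have h5 := densityDecay_le hs hst
  have hb := densityDecay_pos (hs.trans hst)
  have hb' := densityDecay_pos hs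
  have hw := weight_pos (lam := lam) t hz0.le
  have h6 : D * (1 + (t - s)) ^ 3 * ((1 + D) ^ 7)⁻¹ ≤ ((1 + (t - s)) ^ 2)⁻¹ := by
    rw [← div_eq_mul_inv, ← one_div, div_le_div_iff₀ (by positivity) (by positivity), one_mul]
    calc D * (1 + (t - s)) ^ 3 * (1 + (t - s)) ^ 2 ≤ (1 + D) * (1 + D) ^ 3 * (1 + D) ^ 2 := by
          gcongr
          linarith
      _ = (1 + D) ^ 6 := by ring
      _ ≤ (1 + D) ^ 7 := pow_le_pow_right₀ (by linarith) (by norm_num)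
  rw [h4]
  calc D * densityDecay s * (weight lam t z * Real.exp (-θ)) * ((1 + min x y) ^ 14)⁻¹
      = D * weight lam t z * densityDecay s * (Real.exp (-θ) * ((1 + min x y) ^ 14)⁻¹) := by ring
    _ ≤ D * weight lam t z * (densityDecay t * (1 + (t - s)) ^ 3) *
        (E * (c ^ 14)⁻¹ * ((1 + D) ^ 7)⁻¹) := by gcongr
    _ = E * (c ^ 14)⁻¹ * (densityDecay t * weight lam t z) *
        (D * (1 + (t - s)) ^ 3 * ((1 + D) ^ 7)⁻¹) := by ring
    _ ≤ E * (c ^ 14)⁻¹ * (densityDecay t * weight lam t z) * ((1 + (t - s)) ^ 2)⁻¹ := by gcongr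
    _ = _ := by ring

/-! ### Time integrals of the weights -/

theorem hasDerivAt_exp_radius {s : ℝ} (hs : 0 ≤ s) (z : ℝ) :
    HasDerivAt (fun s => Real.exp (-(radius lam s * z)))
      (lam / 20 * z * (1 / ((1 + s) * √(1 + s))) * Real.exp (-(radius lam s * z))) s := by
  have hp : 0 < 1 + s := by linarith
  have hv : √(1 + s) ≠ 0 := (Real.sqrt_pos.2 hp).ne'
  have hv2 : √(1 + s) ^ 2 = 1 + s := Real.sq_sqrt hp.le
  have h1 : HasDerivAt (fun s => √(1 + s)) (1 / (2 * √(1 + s))) s :=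
    ((hasDerivAt_id s).const_add 1).sqrt hp.ne'
  have h2 : HasDerivAt (fun s => radius lam s) (-(lam / 20 * (1 / ((1 + s) * √(1 + s))))) s := by
    have := (((h1.const_mul 10).fun_inv (mul_ne_zero (by norm_num) hv)).const_add 1).const_mul lam
    refine (this.congr_deriv ?_).congr_of_eventuallyEq (Eventually.of_forall fun u => ?_)
    · generalize √(1 + s) = v at hv hv2 ⊢
      rw [← hv2]
      field_simp
      ring
    · simp [radius]
  exact ((h2.mul_const z).neg.exp).congr_deriv (by simp only [Pi.neg_apply]; ring)

/-- The factor `1 + z` is the loss of one derivative. As the radius decreases, `exp (-radius s * z)`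
has the time derivative `lam / 20 * z * (1 + s)^(-3/2)` times itself. This dominates the integrand,
which decays like `(1 + s)^(-2)`, and integrates exactly. -/
theorem norm_integral_le_weight (hl : 0 < lam) {F : ℝ → ℂ} {A t z : ℝ} (hA : 0 ≤ A)
    (ht : 0 ≤ t) (hz : 1 ≤ z) (hb : ∀ s, 0 ≤ s → s ≤ t →
      ‖F s‖ ≤ A * (((1 + s) ^ 2)⁻¹ * ((1 + z) * weight lam s z))) :
    ‖∫ s in (0 : ℝ)..t, F s‖ ≤ A * (40 / lam) * weight lam t z := by
  set B := A * (40 / lam) * ((1 + z) ^ 20)⁻¹ with hB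
  have hB0 : 0 ≤ B := by positivity
  set g : ℝ → ℝ := fun s => B * (lam / 20 * z * (1 / ((1 + s) * √(1 + s))) *
    Real.exp (-(radius lam s * z))) with hg
  have hd : ∀ s, 0 ≤ s → HasDerivAt (fun s => B * Real.exp (-(radius lam s * z))) (g s) s :=
    fun s hs => (hasDerivAt_exp_radius hs z).const_mul B
  have hgc : ContinuousOn g (Icc 0 t) := by
    have h0 : ∀ s ∈ Icc 0 t, √(1 + s) ≠ 0 := fun s hs =>
      (Real.sqrt_pos.2 (by linarith [hs.1])).ne'
    have hr : ContinuousOn (fun s => radius lam s) (Icc 0 t) := by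
      unfold radius
      refine continuousOn_const.mul (continuousOn_const.add (continuousOn_const.div
        (by fun_prop) fun s hs => mul_ne_zero (by norm_num) (h0 s hs)))
    refine continuousOn_const.mul (((continuousOn_const.mul (continuousOn_const.div
        (by fun_prop) fun s hs => mul_ne_zero ?_ (h0 s hs)))).mul ?_)
    · linarith [hs.1]
    · exact Real.continuous_exp.comp_continuousOn (hr.mul continuousOn_const).neg
  have hgi : IntervalIntegrable g volume 0 t := by
    refine ContinuousOn.intervalIntegrable ?_
    rwa [uIcc_of_le ht]
  have hFTC : ∫ s in (0 : ℝ)..t, g s = B * Real.exp (-(radius lam t * z)) -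
      B * Real.exp (-(radius lam 0 * z)) :=
    intervalIntegral.integral_eq_sub_of_hasDerivAt
      (fun s hs => hd s (by rw [uIcc_of_le ht] at hs; exact hs.1)) hgi
  have hle : ‖∫ s in (0 : ℝ)..t, F s‖ ≤ ∫ s in (0 : ℝ)..t, g s := by
    refine intervalIntegral.norm_integral_le_of_norm_le ht (Eventually.of_forall fun s hs => ?_) hgi
    have hs0 : 0 ≤ s := hs.1.le
    refine (hb s hs0 hs.2).trans ?_
    have e1 : ((1 + s) ^ 2)⁻¹ ≤ 1 / ((1 + s) * √(1 + s)) := by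
      rw [← one_div]
      have : 0 < √(1 + s) := Real.sqrt_pos.2 (by linarith)
      have h2 : √(1 + s) ≤ 1 + s := Real.sqrt_le_iff.2 ⟨by linarith, by nlinarith⟩
      rw [sq]
      gcongr
    rw [hg, hB]
    unfold weight
    calc A * (((1 + s) ^ 2)⁻¹ * ((1 + z) * (Real.exp (-(radius lam s * z)) * ((1 + z) ^ 20)⁻¹)))
        ≤ A * ((1 / ((1 + s) * √(1 + s))) * ((2 * z) *
          (Real.exp (-(radius lam s * z)) * ((1 + z) ^ 20)⁻¹))) := by
          gcongr
          linarith
      _ = _ := by field_simp; ring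
  refine hle.trans ?_
  rw [hFTC, hB]
  unfold weight
  have : 0 ≤ B * Real.exp (-(radius lam 0 * z)) := by positivity
  have e : A * (40 / lam) * (Real.exp (-(radius lam t * z)) * ((1 + z) ^ 20)⁻¹) =
    A * (40 / lam) * ((1 + z) ^ 20)⁻¹ * Real.exp (-(radius lam t * z)) := by ring
  rw [e]
  linarith

/-- The bound on the integrand is the derivative of `A / (1 + q (t - s))`, whence a constant
independent of `q` and `t`. -/
theorem norm_integral_le_of_inv_sq {F : ℝ → ℂ} {A q t : ℝ} (hA : 0 ≤ A) (hq : 0 < q) (ht : 0 ≤ t)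
    (hb : ∀ s, 0 ≤ s → s ≤ t → ‖F s‖ ≤ A * (q * ((1 + q * (t - s)) ^ 2)⁻¹)) :
    ‖∫ s in (0 : ℝ)..t, F s‖ ≤ A := by
  have hne : ∀ s ∈ uIcc 0 t, 1 + q * (t - s) ≠ 0 := fun s hs => by
    rw [uIcc_of_le ht] at hs
    have := mul_nonneg hq.le (sub_nonneg.2 hs.2)
    linarith
  have hgi : IntervalIntegrable (fun s => A * (q * ((1 + q * (t - s)) ^ 2)⁻¹)) volume 0 t := by
    refine ContinuousOn.intervalIntegrable (continuousOn_const.mul (continuousOn_const.mul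
      (ContinuousOn.inv₀ (by fun_prop) fun s hs => pow_ne_zero 2 (hne s hs))))
  have hd : ∀ s ∈ uIcc 0 t, HasDerivAt (fun s => A * (1 + q * (t - s))⁻¹)
      (A * (q * ((1 + q * (t - s)) ^ 2)⁻¹)) s := fun s hs => by
    have h1 : HasDerivAt (fun s : ℝ => 1 + q * (t - s)) (q * (-1)) s :=
      (((hasDerivAt_id s).const_sub t).const_mul q).const_add 1
    refine ((h1.fun_inv (hne s hs)).const_mul A).congr_deriv ?_
    rw [mul_neg, neg_neg, mul_one, div_eq_mul_inv]
  refine (intervalIntegral.norm_integral_le_of_norm_le ht (Eventually.of_forall fun s hs =>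
    hb s hs.1.le hs.2) hgi).trans ?_
  rw [intervalIntegral.integral_eq_sub_of_hasDerivAt hd hgi]
  have : 0 ≤ A * (1 + q * (t - 0))⁻¹ := by
    have : 0 ≤ q * (t - 0) := mul_nonneg hq.le (by linarith)
    positivity
  simp only [sub_self, mul_zero, add_zero, inv_one, mul_one]
  linarith

theorem norm_integral_le_of_inv_one_add_sq {F : ℝ → ℂ} {A t : ℝ} (hA : 0 ≤ A) (ht : 0 ≤ t)
    (hb : ∀ s, 0 ≤ s → s ≤ t → ‖F s‖ ≤ A * ((1 + s) ^ 2)⁻¹) :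
    ‖∫ s in (0 : ℝ)..t, F s‖ ≤ A := by
  have h := intervalIntegral.integral_comp_sub_left (a := 0) (b := t) F t
  rw [sub_self, sub_zero] at h
  rw [← h]
  refine norm_integral_le_of_inv_sq (q := 1) hA one_pos ht fun s hs hst => ?_
  simpa using hb (t - s) (by linarith) (by linarith)

end weights

/-! ### The quadratic interaction -/

/-- The frequency `K k t - L η` at which the density of the mode `(k, η)` is read off
(for `t ≥ 0`). -/
def resFreq (K L : ℝ) (k η : ℤ) (t : ℝ) : ℝ := K * k * max t 0 - L * η

/-- The interaction of the density mode `m` with the mode `(k, η) - m` of the profile. -/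
def interactionTerm (K L : ℝ) (P : ℤ → ℤ → ℝ → ℂ) (H : ℤ → ℤ → ℝ → ℝ → ℂ) (k η : ℤ) (s ξ : ℝ)
    (m : ℤ × ℤ) : ℂ :=
  -(P m.1 m.2 s / (K * m.1)) * ((ξ - resFreq K L k η s : ℝ) : ℂ) *
    H (k - m.1) (η - m.2) s (ξ - resFreq K L m.1 m.2 s)

/-- The interaction of a density with a profile. -/
def interaction (K L : ℝ) (P : ℤ → ℤ → ℝ → ℂ) (H : ℤ → ℤ → ℝ → ℝ → ℂ) (k η : ℤ) (s ξ : ℝ) : ℂ :=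
  ∑' m : ℤ × ℤ, interactionTerm K L P H k η s ξ m

/-- A density of order `n` that is bounded by `A` in the weighted norm. -/
structure DensityBound (lam K L A : ℝ) (n : ℕ) (P : ℤ → ℤ → ℝ → ℂ) : Prop where
  continuous : ∀ k η, Continuous (P k η)
  zero : ∀ η t, P 0 η t = 0
  max_zero : ∀ k η t, P k η (max t 0) = P k η t
  bound : ∀ k η t, 0 ≤ t → ‖P k η t‖ ≤
    A * (densityDecay t * weight lam t (freqSize k η n (resFreq K L k η t)))

/-- A profile of order `n` that is bounded by `A` in the weighted norm. -/
structure ProfileBound (lam A : ℝ) (n : ℕ) (H : ℤ → ℤ → ℝ → ℝ → ℂ) : Prop where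
  continuous : ∀ k η, Continuous fun z : ℝ × ℝ => H k η z.1 z.2
  max_zero : ∀ k η t ξ, H k η (max t 0) ξ = H k η t ξ
  bound : ∀ k η t ξ, 0 ≤ t → ‖H k η t ξ‖ ≤ A * weight lam t (freqSize k η n ξ)

section interaction

variable {lam K L C₀ A₁ A₂ : ℝ} {i j : ℕ} {P : ℤ → ℤ → ℝ → ℂ} {H : ℤ → ℤ → ℝ → ℝ → ℂ}

theorem continuous_resFreq (K L : ℝ) (k η : ℤ) : Continuous (resFreq K L k η) := by
  unfold resFreq; fun_prop

theorem resFreq_max_zero (K L : ℝ) (k η : ℤ) (t : ℝ) :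
    resFreq K L k η (max t 0) = resFreq K L k η t := by
  unfold resFreq; simp

theorem resFreq_sub (K L : ℝ) (k η l η₁ : ℤ) (t : ℝ) :
    resFreq K L k η t - resFreq K L l η₁ t = resFreq K L (k - l) (η - η₁) t := by
  unfold resFreq; push_cast; ring

theorem DensityBound.nonneg (hP : DensityBound lam K L A₁ i P) : 0 ≤ A₁ := by
  have h := (norm_nonneg _).trans (hP.bound 0 0 0 le_rfl)
  have h1 := densityDecay_pos (le_refl (0 : ℝ))
  have h2 := weight_pos (lam := lam) 0 (freqSize_pos 0 0 i (resFreq K L 0 0 0)).le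
  exact nonneg_of_mul_nonneg_left h (mul_pos h1 h2)

theorem ProfileBound.nonneg (hH : ProfileBound lam A₂ j H) : 0 ≤ A₂ := by
  have h := (norm_nonneg _).trans (hH.bound 0 0 0 0 le_rfl)
  exact nonneg_of_mul_nonneg_left h (weight_pos (lam := lam) 0 (freqSize_pos 0 0 j 0).le)

/-- The common first step for profiles and densities, which uses only subadditivity of the sizes.
The multiplier `|ξ - resFreq| / K` is kept, since it behaves differently in the two cases. -/
theorem norm_interactionTerm_le_aux (hl : 0 < lam) (hK : 1 ≤ K)
    (hP : DensityBound lam K L A₁ i P) (hH : ProfileBound lam A₂ j H) (k η : ℤ) {s : ℝ}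
    (hs : 0 ≤ s) (ξ : ℝ) (m : ℤ × ℤ) :
    ‖interactionTerm K L P H k η s ξ m‖ ≤ A₁ * A₂ * 2 ^ 20 *
      ((|ξ - resFreq K L k η s| / K) * densityDecay s *
        weight lam s (freqSize k η (i + j + 1) ξ) *
        ((1 + min (freqSize m.1 m.2 i (resFreq K L m.1 m.2 s))
          (freqSize (k - m.1) (η - m.2) j (ξ - resFreq K L m.1 m.2 s))) ^ 20)⁻¹) := by
  have hA₁ := hP.nonneg
  have hA₂ := hH.nonneg
  have hK0 : 0 < K := by linarith
  set x := freqSize m.1 m.2 i (resFreq K L m.1 m.2 s) with hx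
  set y := freqSize (k - m.1) (η - m.2) j (ξ - resFreq K L m.1 m.2 s) with hy
  set z := freqSize k η (i + j + 1) ξ with hz
  have hx0 : 0 < x := freqSize_pos _ _ _ _
  have hy0 : 0 < y := freqSize_pos _ _ _ _
  have hz0 : 0 < z := freqSize_pos _ _ _ _
  have hw := weight_mul_weight_le hl s hx0.le hy0.le hz0.le (freqSize_le_add _ _ _ _ _ _ _ _)
  have hwx := weight_pos (lam := lam) s hx0.le
  have hwy := weight_pos (lam := lam) s hy0.le
  have hwz := weight_pos (lam := lam) s hz0.le
  have hb := densityDecay_pos hs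
  have hm0 : 0 ≤ min x y := le_min hx0.le hy0.le
  rcases eq_or_ne m.1 0 with h0 | h0
  · unfold interactionTerm
    rw [h0, hP.zero]
    simp only [zero_div, neg_zero, zero_mul, norm_zero]
    positivity
  have hl1 : (1 : ℝ) ≤ |(m.1 : ℝ)| := by exact_mod_cast Int.one_le_abs h0
  have h1 := hP.bound m.1 m.2 s hs
  have h2 := hH.bound (k - m.1) (η - m.2) s (ξ - resFreq K L m.1 m.2 s) hs
  rw [← hx] at h1
  rw [← hy] at h2
  unfold interactionTerm
  rw [norm_mul, norm_mul, norm_neg, norm_div, norm_mul, Complex.norm_real, Complex.norm_real,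
    Complex.norm_intCast, Real.norm_eq_abs, Real.norm_eq_abs, abs_of_pos hK0]
  calc ‖P m.1 m.2 s‖ / (K * |(m.1 : ℝ)|) * |ξ - resFreq K L k η s| *
        ‖H (k - m.1) (η - m.2) s (ξ - resFreq K L m.1 m.2 s)‖
      ≤ (A₁ * (densityDecay s * weight lam s x)) / (K * 1) * |ξ - resFreq K L k η s| *
        (A₂ * weight lam s y) := by gcongr
    _ = A₁ * A₂ * ((|ξ - resFreq K L k η s| / K) * densityDecay s) *
        (weight lam s x * weight lam s y) := by field_simp
    _ ≤ A₁ * A₂ * ((|ξ - resFreq K L k η s| / K) * densityDecay s) *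
        (2 ^ 20 * weight lam s z * ((1 + min x y) ^ 20)⁻¹) := by gcongr
    _ = _ := by ring

/-- The weights of the two factors, summed over all interactions. -/
def pairWeight (k η : ℤ) (i j : ℕ) (m : ℤ × ℤ) : ℝ :=
  summableWeight m.1 m.2 i + summableWeight (k - m.1) (η - m.2) j

theorem pairWeight_nonneg (k η : ℤ) (i j : ℕ) (m : ℤ × ℤ) : 0 ≤ pairWeight k η i j m :=
  add_nonneg (summableWeight_nonneg _ _ _) (summableWeight_nonneg _ _ _)

/-- At a general `ξ` the multiplier is a derivative in velocity. It costs one of the three powers of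
time decay and one factor of the size `y` of the profile frequency, which is at most `(1 + z) (1 +
min x y)`. -/
theorem norm_interactionTerm_le (hl : 0 < lam) (hK : 1 ≤ K) (hL : 0 < L) (hLK : L ≤ C₀ * K)
    (hP : DensityBound lam K L A₁ i P) (hH : ProfileBound lam A₂ j H) (k η : ℤ) {s : ℝ}
    (hs : 0 ≤ s) (ξ : ℝ) (m : ℤ × ℤ) :
    ‖interactionTerm K L P H k η s ξ m‖ ≤ A₁ * A₂ * (2 ^ 20 * (1 + C₀)) *
      (((1 + s) ^ 2)⁻¹ * ((1 + freqSize k η (i + j + 1) ξ) *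
        weight lam s (freqSize k η (i + j + 1) ξ))) * pairWeight k η i j m := by
  refine (norm_interactionTerm_le_aux hl hK hP hH k η hs ξ m).trans ?_
  have hA₁ := hP.nonneg
  have hA₂ := hH.nonneg
  have hK0 : 0 < K := by linarith
  have hC₀ : 0 < C₀ := by
    by_contra h
    nlinarith
  have hpair := inv_min_pow_le_summableWeight m.1 m.2 i (resFreq K L m.1 m.2 s) (k - m.1)
    (η - m.2) j (ξ - resFreq K L m.1 m.2 s)
  have hyz : freqSize (k - m.1) (η - m.2) j (ξ - resFreq K L m.1 m.2 s) ≤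
      freqSize k η (i + j + 1) ξ + freqSize m.1 m.2 i (resFreq K L m.1 m.2 s) := by
    unfold freqSize
    have e1 := abs_sub (k : ℝ) m.1
    have e2 := abs_sub (η : ℝ) m.2
    have e3 := abs_sub ξ (resFreq K L m.1 m.2 s)
    have e4 : (0 : ℝ) ≤ i := Nat.cast_nonneg i
    push_cast
    linarith
  -- The multiplier equals the frequency of the profile factor minus the resonant frequency of that
  -- factor. The resonant part is at most `K` times an expression in `s`, `C₀` and the mode by `L ≤
  -- C₀ K`, so dividing by `K` removes the wave numbers.
  have hfac : |ξ - resFreq K L k η s| / K ≤ (1 + C₀) * (1 + s) *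
      freqSize (k - m.1) (η - m.2) j (ξ - resFreq K L m.1 m.2 s) := by
    rw [div_le_iff₀ hK0]
    set ξ' := ξ - resFreq K L m.1 m.2 s with hξ'
    have e1 : ξ - resFreq K L k η s = ξ' - resFreq K L (k - m.1) (η - m.2) s := by
      rw [← resFreq_sub]; ring
    rw [e1]
    refine (abs_sub _ _).trans ?_
    have e2 : |resFreq K L (k - m.1) (η - m.2) s| ≤
        K * (s * |((k - m.1 : ℤ) : ℝ)| + C₀ * |((η - m.2 : ℤ) : ℝ)|) := by
      unfold resFreq
      rw [max_eq_left hs]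
      refine (abs_sub _ _).trans ?_
      rw [abs_mul, abs_mul, abs_mul, abs_of_pos hK0, abs_of_pos hL, abs_of_nonneg hs]
      have := mul_le_mul_of_nonneg_right hLK (abs_nonneg ((η - m.2 : ℤ) : ℝ))
      linarith
    unfold freqSize
    have a1 := abs_nonneg ((k - m.1 : ℤ) : ℝ)
    have a2 := abs_nonneg ((η - m.2 : ℤ) : ℝ)
    have a3 := abs_nonneg ξ'
    have a4 : (0 : ℝ) ≤ j := Nat.cast_nonneg j
    set a := |((k - m.1 : ℤ) : ℝ)|
    set b := |((η - m.2 : ℤ) : ℝ)|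
    set c := |ξ'|
    have : c + (s * a + C₀ * b) ≤ (1 + C₀) * (1 + s) * (a + b + (j + 1) + c) := by
      have : 0 ≤ s * a := mul_nonneg hs a1
      have : 0 ≤ s * b := mul_nonneg hs a2
      have : 0 ≤ s * c := mul_nonneg hs a3
      have : 0 ≤ C₀ * (s * a) := by positivity
      have : 0 ≤ C₀ * (s * b) := by positivity
      have : 0 ≤ C₀ * (s * c) := by positivity
      have : 0 ≤ C₀ * a := by positivity
      have : 0 ≤ C₀ * c := by positivity
      have : 0 ≤ (1 + C₀) * (1 + s) * (j + 1 : ℝ) := by positivity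
      nlinarith
    calc c + |resFreq K L (k - m.1) (η - m.2) s| ≤ K * c + K * (s * a + C₀ * b) :=
          add_le_add (le_mul_of_one_le_left a3 hK) e2
      _ = (c + (s * a + C₀ * b)) * K := by ring
      _ ≤ _ := by gcongr
  set x := freqSize m.1 m.2 i (resFreq K L m.1 m.2 s) with hx
  set y := freqSize (k - m.1) (η - m.2) j (ξ - resFreq K L m.1 m.2 s) with hy
  set z := freqSize k η (i + j + 1) ξ with hz
  have hx0 : 0 < x := freqSize_pos _ _ _ _
  have hy0 : 0 < y := freqSize_pos _ _ _ _
  have hz0 : 0 < z := freqSize_pos _ _ _ _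
  have hwz := weight_pos (lam := lam) s hz0.le
  have hm0 : 0 ≤ min x y := le_min hx0.le hy0.le
  have hy2 : y ≤ (1 + z) * (1 + min x y) := by
    rcases le_total x y with h | h
    · rw [min_eq_left h]; nlinarith
    · rw [min_eq_right h]; nlinarith
  have hm : y * ((1 + min x y) ^ 20)⁻¹ ≤ (1 + z) * pairWeight k η i j m := by
    calc y * ((1 + min x y) ^ 20)⁻¹ ≤ ((1 + z) * (1 + min x y)) * ((1 + min x y) ^ 20)⁻¹ := by gcongr
      _ = (1 + z) * ((1 + min x y) ^ 19)⁻¹ := by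
          rw [pow_succ (1 + min x y) 19, mul_inv]
          field_simp
      _ ≤ (1 + z) * ((1 + min x y) ^ 6)⁻¹ := by
          gcongr
          · linarith
          · norm_num
      _ ≤ _ := by
          unfold pairWeight
          gcongr
  have hdec : (1 + s) * densityDecay s = ((1 + s) ^ 2)⁻¹ := by
    unfold densityDecay
    rw [pow_succ (1 + s) 2, mul_inv]
    field_simp
  have hb := densityDecay_pos hs
  calc _ ≤ A₁ * A₂ * 2 ^ 20 * (((1 + C₀) * (1 + s) * y) * densityDecay s * weight lam s z *
        ((1 + min x y) ^ 20)⁻¹) := by gcongr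
    _ = A₁ * A₂ * (2 ^ 20 * (1 + C₀)) * (((1 + s) * densityDecay s) * weight lam s z) *
        (y * ((1 + min x y) ^ 20)⁻¹) := by ring
    _ ≤ A₁ * A₂ * (2 ^ 20 * (1 + C₀)) * (((1 + s) * densityDecay s) * weight lam s z) *
        ((1 + z) * pairWeight k η i j m) := by gcongr
    _ = _ := by rw [hdec]; ring

/-- On the resonant frequencies the multiplier divided by `K` is exactly `|k| (t - s)`, the growth
behind plasma echoes. Non-resonance supplies the lower bounds on the three sizes that
`exists_density_gain` needs. -/
theorem exists_norm_interactionTerm_resFreq_le (hl : 0 < lam) (hC₀ : 0 < C₀) :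
    ∃ C : ℝ, 0 < C ∧ ∀ {K L A₁ A₂ : ℝ} {i j : ℕ} {P : ℤ → ℤ → ℝ → ℂ} {H : ℤ → ℤ → ℝ → ℝ → ℂ},
      1 ≤ K → 0 < L → L ≤ C₀ * K → DensityBound lam K L A₁ i P → ProfileBound lam A₂ j H →
      ∀ (k η : ℤ) {s t : ℝ}, k ≠ 0 → 0 ≤ s → s ≤ t → ∀ m : ℤ × ℤ,
      ‖interactionTerm K L P H k η s (resFreq K L k η t) m‖ ≤ A₁ * A₂ * C *
        (densityDecay t * weight lam t (freqSize k η (i + j + 1) (resFreq K L k η t)) *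
          ((1 + (t - s)) ^ 2)⁻¹) * pairWeight k η i j m := by
  obtain ⟨C, hC, hgain⟩ := exists_density_gain (lam := lam) hl (M := 1 + C₀) (by linarith)
  refine ⟨2 ^ 20 * C, by positivity, fun {K L A₁ A₂ i j P H} hK hL hLK hP hH k η {s t} hk hs hst m
    => ?_⟩
  have hA₁ := hP.nonneg
  have hA₂ := hH.nonneg
  have hK0 : 0 < K := by linarith
  have ht := hs.trans hst
  have hz0 : 0 < freqSize k η (i + j + 1) (resFreq K L k η t) := freqSize_pos _ _ _ _
  have hwz := weight_pos (lam := lam) t hz0.le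
  have hbt := densityDecay_pos ht
  have hts : 0 ≤ t - s := by linarith
  rcases eq_or_ne m.1 0 with h0 | h0
  · unfold interactionTerm
    rw [h0, hP.zero]
    simp only [zero_div, neg_zero, zero_mul, norm_zero]
    have := pairWeight_nonneg k η i j m
    positivity
  refine (norm_interactionTerm_le_aux hl hK hP hH k η hs _ m).trans ?_
  have hpair := inv_min_pow_le_summableWeight m.1 m.2 i (resFreq K L m.1 m.2 s) (k - m.1)
    (η - m.2) j (resFreq K L k η t - resFreq K L m.1 m.2 s)
  have hl1 : (1 : ℝ) ≤ |(m.1 : ℝ)| := by exact_mod_cast Int.one_le_abs h0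
  have hk1 : (1 : ℝ) ≤ |(k : ℝ)| := by exact_mod_cast Int.one_le_abs hk
  have hfac : |resFreq K L k η t - resFreq K L k η s| / K = |(k : ℝ)| * (t - s) := by
    unfold resFreq
    rw [max_eq_left hs, max_eq_left ht, show K * k * t - L * η - (K * k * s - L * η) =
      K * (k * (t - s)) by ring, abs_mul, abs_mul, abs_of_pos hK0, abs_of_nonneg hts]
    field_simp
  have hkz : |(k : ℝ)| ≤ freqSize k η (i + j + 1) (resFreq K L k η t) := by
    unfold freqSize
    have := abs_nonneg (η : ℝ)
    have := abs_nonneg (resFreq K L k η t)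
    have : (0 : ℝ) ≤ ((i + j + 1 : ℕ) : ℝ) := Nat.cast_nonneg _
    linarith
  have hktz : |(k : ℝ)| * t ≤ (1 + C₀) * freqSize k η (i + j + 1) (resFreq K L k η t) := by
    have h := abs_le_of_resonance hK hL hLK (k * t) η
    rw [abs_mul, abs_of_nonneg ht, ← mul_assoc] at h
    refine h.trans ?_
    unfold freqSize resFreq
    rw [max_eq_left ht]
    have := abs_nonneg (k : ℝ)
    have : (0 : ℝ) ≤ ((i + j + 1 : ℕ) : ℝ) := Nat.cast_nonneg _
    gcongr
    linarith
  have hsx : s ≤ (1 + C₀) * freqSize m.1 m.2 i (resFreq K L m.1 m.2 s) := by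
    have h := abs_le_of_resonance hK hL hLK (m.1 * s) m.2
    rw [abs_mul, abs_of_nonneg hs, ← mul_assoc] at h
    refine (le_mul_of_one_le_left hs hl1).trans (h.trans ?_)
    unfold freqSize resFreq
    rw [max_eq_left hs]
    have := abs_nonneg (m.1 : ℝ)
    have : (0 : ℝ) ≤ (i : ℝ) := Nat.cast_nonneg _
    gcongr
    linarith
  have hy : |(k : ℝ) * t - m.1 * s| ≤ (1 + C₀) *
      freqSize (k - m.1) (η - m.2) j (resFreq K L k η t - resFreq K L m.1 m.2 s) := by
    have h := abs_le_of_resonance hK hL hLK (k * t - m.1 * s) ((η - m.2 : ℤ) : ℝ)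
    refine h.trans ?_
    unfold freqSize resFreq
    rw [max_eq_left hs, max_eq_left ht]
    have e : K * ((k : ℝ) * t - m.1 * s) - L * ((η - m.2 : ℤ) : ℝ) =
      K * k * t - L * η - (K * m.1 * s - L * m.2) := by push_cast; ring
    rw [e]
    have := abs_nonneg ((k - m.1 : ℤ) : ℝ)
    have : (0 : ℝ) ≤ (j : ℝ) := Nat.cast_nonneg _
    gcongr
    linarith
  -- The profile frequency has size at least a multiple of `|k t - l s|`, where `l = m.1`. For `l =
  -- k` this is `|k| (t - s)`; otherwise it is `|(k - l) s + k (t - s)|` with `|k - l| ≥ 1`.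
  have hsy : |(k : ℝ)| * (t - s) ≤ (1 + C₀) *
        freqSize (k - m.1) (η - m.2) j (resFreq K L k η t - resFreq K L m.1 m.2 s) ∨
      s - |(k : ℝ)| * (t - s) ≤ (1 + C₀) *
        freqSize (k - m.1) (η - m.2) j (resFreq K L k η t - resFreq K L m.1 m.2 s) := by
    rcases eq_or_ne k m.1 with hkm | hkm
    · left
      rw [← hkm, ← mul_sub, abs_mul, abs_of_nonneg hts] at hy
      rw [← hkm]
      exact hy
    · right
      refine le_trans ?_ hy
      have h1 : (1 : ℝ) ≤ |((k - m.1 : ℤ) : ℝ)| := by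
        exact_mod_cast Int.one_le_abs (sub_ne_zero.2 hkm)
      have h2 : |((k - m.1 : ℤ) : ℝ) * s| ≤ |(k : ℝ) * t - m.1 * s| + |(k : ℝ) * (t - s)| := by
        have := abs_sub ((k : ℝ) * t - m.1 * s) ((k : ℝ) * (t - s))
        refine le_trans (le_of_eq ?_) this
        congr 1
        push_cast
        ring
      rw [abs_mul, abs_mul (k : ℝ), abs_of_nonneg hs, abs_of_nonneg hts] at h2
      nlinarith
  have hg := hgain hk1 hs hst (freqSize_pos m.1 m.2 i (resFreq K L m.1 m.2 s)).le
    (freqSize_pos (k - m.1) (η - m.2) j (resFreq K L k η t - resFreq K L m.1 m.2 s)).le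
    hkz hktz hsx hsy
  rw [hfac]
  set x := freqSize m.1 m.2 i (resFreq K L m.1 m.2 s) with hx
  set y := freqSize (k - m.1) (η - m.2) j (resFreq K L k η t - resFreq K L m.1 m.2 s) with hy
  set z := freqSize k η (i + j + 1) (resFreq K L k η t) with hz
  have hx0 : 0 < x := freqSize_pos _ _ _ _
  have hy0 : 0 < y := freqSize_pos _ _ _ _
  have hm0 : 0 ≤ min x y := le_min hx0.le hy0.le
  have hsplit : ((1 + min x y) ^ 20)⁻¹ = ((1 + min x y) ^ 14)⁻¹ * ((1 + min x y) ^ 6)⁻¹ := by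
    rw [← mul_inv, ← pow_add]
  calc _ = A₁ * A₂ * 2 ^ 20 * (|(k : ℝ)| * (t - s) * densityDecay s * weight lam s z *
        ((1 + min x y) ^ 14)⁻¹) * ((1 + min x y) ^ 6)⁻¹ := by rw [hsplit]; ring
    _ ≤ A₁ * A₂ * 2 ^ 20 * (C * (densityDecay t * weight lam t z * ((1 + (t - s)) ^ 2)⁻¹)) *
        pairWeight k η i j m := by
        unfold pairWeight
        gcongr
    _ = _ := by ring

/-- The sum of the weights of order `n`. -/
def orderWeight (n : ℕ) : ℝ := ∑' m : ℤ × ℤ, summableWeight m.1 m.2 n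

theorem summable_summableWeight_order (n : ℕ) :
    Summable fun m : ℤ × ℤ => summableWeight m.1 m.2 n :=
  (summable_summableWeight.comp_injective (i := fun m : ℤ × ℤ => (m, n))
    fun _ _ h => (Prod.ext_iff.1 h).1)

theorem orderWeight_nonneg (n : ℕ) : 0 ≤ orderWeight n :=
  tsum_nonneg fun _ => summableWeight_nonneg _ _ _

theorem summable_orderWeight : Summable orderWeight :=
  (summable_summableWeight.prod_symm).prod

theorem hasSum_pairWeight (k η : ℤ) (i j : ℕ) :
    HasSum (pairWeight k η i j) (orderWeight i + orderWeight j) := by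
  refine (summable_summableWeight_order i).hasSum.add ?_
  exact (Equiv.subLeft ((k, η) : ℤ × ℤ)).hasSum_iff.2 (summable_summableWeight_order j).hasSum

/-- The number of ways to split an order grows with `n`, but the total weight does not. This is what
keeps the growth of the coefficients geometric with a closed induction. -/
theorem sum_orderWeight_le (n : ℕ) : ∑ i : Fin (n + 1), (orderWeight i + orderWeight (n - i)) ≤
    2 * ∑' n, orderWeight n := by
  rw [Finset.sum_add_distrib, two_mul]
  rw [Fin.sum_univ_eq_sum_range (fun i => orderWeight i) (n + 1),
    Fin.sum_univ_eq_sum_range (fun i => orderWeight (n - i)) (n + 1),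
    show ∑ i ∈ Finset.range (n + 1), orderWeight (n - i) =
      ∑ i ∈ Finset.range (n + 1), orderWeight i by
      have := Finset.sum_range_reflect orderWeight (n + 1)
      simpa using this]
  have := summable_orderWeight.sum_le_tsum (Finset.range (n + 1))
    (fun i _ => orderWeight_nonneg i)
  linarith

theorem weight_bound_le_one (hl : 0 < lam) {s z : ℝ} (hs : 0 ≤ s) (hz : 0 ≤ z) :
    ((1 + s) ^ 2)⁻¹ * ((1 + z) * weight lam s z) ≤ 1 := by
  have h1 : ((1 + s) ^ 2)⁻¹ ≤ 1 := inv_le_one_of_one_le₀ (one_le_pow₀ (by linarith))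
  have h2 : (1 + z) * weight lam s z ≤ 1 := by
    unfold weight
    have e1 : Real.exp (-(radius lam s * z)) ≤ 1 := by
      rw [Real.exp_le_one_iff]
      have := mul_nonneg (radius_pos hl s).le hz
      linarith
    have e2 : (1 + z) * ((1 + z) ^ 20)⁻¹ ≤ 1 := by
      rw [← div_eq_mul_inv, div_le_one (by positivity)]
      exact le_self_pow₀ (by linarith) (by norm_num)
    calc _ = Real.exp (-(radius lam s * z)) * ((1 + z) * ((1 + z) ^ 20)⁻¹) := by ring
      _ ≤ 1 * 1 := by gcongr
      _ = 1 := one_mul 1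
  have h3 := (weight_pos (lam := lam) s hz).le
  exact mul_le_one₀ h1 (by positivity) h2

theorem interactionTerm_max_zero (hP : DensityBound lam K L A₁ i P) (hH : ProfileBound lam A₂ j H)
    (k η : ℤ) (s ξ : ℝ) (m : ℤ × ℤ) :
    interactionTerm K L P H k η (max s 0) ξ m = interactionTerm K L P H k η s ξ m := by
  unfold interactionTerm
  rw [hP.max_zero, hH.max_zero, resFreq_max_zero, resFreq_max_zero]

theorem norm_interactionTerm_le_const (hl : 0 < lam) (hK : 1 ≤ K) (hL : 0 < L) (hLK : L ≤ C₀ * K)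
    (hP : DensityBound lam K L A₁ i P) (hH : ProfileBound lam A₂ j H) (k η : ℤ) (s ξ : ℝ)
    (m : ℤ × ℤ) : ‖interactionTerm K L P H k η s ξ m‖ ≤
      A₁ * A₂ * (2 ^ 20 * (1 + C₀)) * pairWeight k η i j m := by
  have hC₀ : 0 < C₀ := by
    by_contra h
    nlinarith
  have hA₁ := hP.nonneg
  have hA₂ := hH.nonneg
  rw [← interactionTerm_max_zero hP hH]
  refine (norm_interactionTerm_le hl hK hL hLK hP hH k η (le_max_right s 0) ξ m).trans ?_
  refine mul_le_mul_of_nonneg_right ?_ (pairWeight_nonneg _ _ _ _ _)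
  refine mul_le_of_le_one_right (by positivity) ?_
  exact weight_bound_le_one hl (le_max_right _ _) (freqSize_pos _ _ _ _).le

theorem continuous_interaction (hl : 0 < lam) (hK : 1 ≤ K) (hL : 0 < L) (hLK : L ≤ C₀ * K)
    (hP : DensityBound lam K L A₁ i P) (hH : ProfileBound lam A₂ j H) (k η : ℤ) :
    Continuous fun z : ℝ × ℝ => interaction K L P H k η z.1 z.2 := by
  unfold interaction
  refine continuous_tsum (fun m => ?_) ((hasSum_pairWeight k η i j).summable.mul_left _)
    fun m z => norm_interactionTerm_le_const hl hK hL hLK hP hH k η z.1 z.2 m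
  unfold interactionTerm
  have h1 := hP.continuous m.1 m.2
  have h2 := continuous_resFreq K L k η
  have h3 := continuous_resFreq K L m.1 m.2
  have h4 := hH.continuous (k - m.1) (η - m.2)
  have h5 : Continuous fun z : ℝ × ℝ =>
      H (k - m.1) (η - m.2) z.1 (z.2 - resFreq K L m.1 m.2 z.1) :=
    h4.comp (by fun_prop : Continuous fun z : ℝ × ℝ => (z.1, z.2 - resFreq K L m.1 m.2 z.1))
  have h6 : Continuous fun z : ℝ × ℝ => -(P m.1 m.2 z.1 / (K * m.1)) :=
    ((h1.comp continuous_fst).div_const _).neg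
  exact (h6.mul (by fun_prop)).mul h5

theorem norm_interaction_le (hl : 0 < lam) (hK : 1 ≤ K) (hL : 0 < L) (hLK : L ≤ C₀ * K)
    (hP : DensityBound lam K L A₁ i P) (hH : ProfileBound lam A₂ j H) (k η : ℤ) {s : ℝ}
    (hs : 0 ≤ s) (ξ : ℝ) :
    ‖interaction K L P H k η s ξ‖ ≤ A₁ * A₂ * (2 ^ 20 * (1 + C₀)) *
      (orderWeight i + orderWeight j) *
      (((1 + s) ^ 2)⁻¹ * ((1 + freqSize k η (i + j + 1) ξ) *
        weight lam s (freqSize k η (i + j + 1) ξ))) := by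
  refine (tsum_of_norm_bounded ((hasSum_pairWeight k η i j).mul_left _)
    (norm_interactionTerm_le hl hK hL hLK hP hH k η hs ξ)).trans (le_of_eq ?_)
  ring

end interaction

/-! ### One step of the echo expansion -/

/-- The source of the linear density equation, with initial datum `init` and forcing `N`. -/
def densitySource (K L : ℝ) (init : ℤ → ℤ → ℝ → ℂ) (N : ℤ → ℤ → ℝ → ℝ → ℂ) (k η : ℤ) (t : ℝ) : ℂ :=
  init k η (resFreq K L k η t) + ∫ s in (0 : ℝ)..max t 0, N k η s (resFreq K L k η t)

/-- The solution of the linear density equation by means of the resolvents `G`. -/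
def density (K L : ℝ) (G : ℤ → ℝ → ℂ) (init : ℤ → ℤ → ℝ → ℂ) (N : ℤ → ℤ → ℝ → ℝ → ℂ)
    (k η : ℤ) (t : ℝ) : ℂ :=
  if k = 0 then 0 else densitySource K L init N k η t +
    ∫ s in (0 : ℝ)..max t 0, G k (max t 0 - s) * densitySource K L init N k η s

/-- The interaction of a density with the equilibrium, whose Fourier transform is `h`. -/
def linearTerm (K L : ℝ) (h : ℝ → ℂ) (P : ℤ → ℤ → ℝ → ℂ) (k η : ℤ) (s ξ : ℝ) : ℂ :=
  -(P k η s / (K * k)) * ((ξ - resFreq K L k η s : ℝ) : ℂ) * h (ξ - resFreq K L k η s)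

/-- The profile that is generated by the forcing `N` and the density `P`. -/
def profile (K L : ℝ) (h : ℝ → ℂ) (init : ℤ → ℤ → ℝ → ℂ) (N : ℤ → ℤ → ℝ → ℝ → ℂ)
    (P : ℤ → ℤ → ℝ → ℂ) (k η : ℤ) (t ξ : ℝ) : ℂ :=
  init k η ξ + ∫ s in (0 : ℝ)..max t 0, (N k η s ξ + linearTerm K L h P k η s ξ)

/-- The data of the echo expansion: the wave numbers `K` and `L`, the transform `h` of the
equilibrium, the resolvents `G` of the linear density equations and the initial datum. -/
structure EchoContext (lam C₀ θ₀ θ₁ M K L : ℝ) (h : ℝ → ℂ) (G : ℤ → ℝ → ℂ)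
    (data : ℤ → ℤ → ℝ → ℂ) : Prop where
  one_le_K : 1 ≤ K
  L_pos : 0 < L
  L_le : L ≤ C₀ * K
  h_continuous : Continuous h
  h_bound : ∀ ζ, ‖h ζ‖ ≤ C₀ * Real.exp (-(θ₀ * |ζ|))
  G_continuous : ∀ k, Continuous (G k)
  G_bound : ∀ k t, k ≠ 0 → 0 ≤ t →
    ‖G k t‖ ≤ M * (K * |(k : ℝ)|) * Real.exp (-(θ₁ * (K * |(k : ℝ)|) * t))
  G_resolvent : ∀ (k : ℤ) (t : ℝ), k ≠ 0 → 0 ≤ t →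
    G k t + ∫ s in (0 : ℝ)..t, ((t - s : ℝ) : ℂ) * h (K * k * (t - s)) * G k s =
      -((t : ℂ) * h (K * k * t))
  data_continuous : ∀ k η, Continuous (data k η)
  data_zero : ∀ η ξ, data 0 η ξ = 0
  data_bound : ∀ (k η : ℤ) (ξ : ℝ),
    ‖data k η ξ‖ ≤ Real.exp (-(2 * lam * √(1 + (k : ℝ) ^ 2 + (η : ℝ) ^ 2 + ξ ^ 2)))

section step

variable {lam C₀ θ₀ θ₁ M K L A : ℝ} {h : ℝ → ℂ} {G : ℤ → ℝ → ℂ} {data : ℤ → ℤ → ℝ → ℂ}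

/-- For three variables the Euclidean norm is at least `1 / √3 > 23 / 40` times the sum, and `2 * 23
/ 40 = 23 / 20` exceeds `11 / 10`. The excess `lam / 20` pays for 23 powers: twenty for the weight,
three for the time decay of the density. The bracket does not see the summand `n + 1 = 1` of the
size, which costs a constant. -/
theorem exists_exp_bracket_le (hl : 0 < lam) : ∃ D : ℝ, 0 < D ∧ ∀ (k η : ℤ) (ξ : ℝ),
    Real.exp (-(2 * lam * √(1 + (k : ℝ) ^ 2 + (η : ℝ) ^ 2 + ξ ^ 2))) ≤
      D * (Real.exp (-(11 / 10 * lam * freqSize k η 0 ξ)) *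
        ((1 + freqSize k η 0 ξ) ^ 23)⁻¹) := by
  obtain ⟨E, hE, hEb⟩ := exists_one_add_pow_mul_exp_le 23 (show 0 < lam / 20 by positivity)
  refine ⟨E * Real.exp (23 / 20 * lam), by positivity, fun k η ξ => ?_⟩
  set S := freqSize k η 0 ξ with hS
  have hS0 : 0 < S := freqSize_pos _ _ _ _
  have h1 : 23 / 40 * (S - 1) ≤ √(1 + (k : ℝ) ^ 2 + (η : ℝ) ^ 2 + ξ ^ 2) := by
    refine Real.le_sqrt_of_sq_le ?_
    have e : S - 1 = |(k : ℝ)| + |(η : ℝ)| + |ξ| := by rw [hS]; unfold freqSize; simp; ring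
    rw [e, ← sq_abs (k : ℝ), ← sq_abs (η : ℝ), ← sq_abs ξ]
    nlinarith [sq_nonneg (|(k : ℝ)| - |(η : ℝ)|), sq_nonneg (|(k : ℝ)| - |ξ|),
      sq_nonneg (|(η : ℝ)| - |ξ|), sq_nonneg |(k : ℝ)|, sq_nonneg |(η : ℝ)|, sq_nonneg |ξ|]
  have h2 := hEb S hS0.le
  rw [← le_div_iff₀' (by positivity)] at h2
  calc _ ≤ Real.exp (23 / 20 * lam + (-(11 / 10 * lam * S) + -(lam / 20 * S))) := by
        gcongr
        nlinarith
    _ = Real.exp (23 / 20 * lam) * (Real.exp (-(11 / 10 * lam * S)) *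
        Real.exp (-(lam / 20 * S))) := by rw [Real.exp_add, Real.exp_add]
    _ ≤ Real.exp (23 / 20 * lam) * (Real.exp (-(11 / 10 * lam * S)) * (E / (1 + S) ^ 23)) := by
        gcongr
    _ = _ := by ring

theorem exp_mul_inv_pow_le_weight (hl : 0 < lam) {t z : ℝ} (ht : 0 ≤ t) (hz : 0 ≤ z) :
    Real.exp (-(11 / 10 * lam * z)) * ((1 + z) ^ 23)⁻¹ ≤ weight lam t z * ((1 + z) ^ 3)⁻¹ := by
  unfold weight
  rw [mul_assoc (Real.exp (-(radius lam t * z))), ← mul_inv, ← pow_add]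
  have := radius_le hl ht
  gcongr

/-- A resonant frequency of a mode `k ≠ 0` has size at least `t / (1 + C₀)`, so powers of the size
are powers of time. -/
theorem densityDecay_ge_of_resonance (hK : 1 ≤ K) (hL : 0 < L) (hLK : L ≤ C₀ * K) {k : ℤ}
    (hk : k ≠ 0) (η : ℤ) {t : ℝ} (ht : 0 ≤ t) (n : ℕ) :
    ((1 + freqSize k η n (resFreq K L k η t)) ^ 3)⁻¹ ≤ (2 + C₀) ^ 3 * densityDecay t := by
  have hC₀ : 0 < C₀ := by
    by_contra h
    nlinarith
  set z := freqSize k η n (resFreq K L k η t) with hz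
  have hz0 : 0 < z := freqSize_pos _ _ _ _
  have hk1 : (1 : ℝ) ≤ |(k : ℝ)| := by exact_mod_cast Int.one_le_abs hk
  have h1 : t ≤ (1 + C₀) * z := by
    have h := abs_le_of_resonance hK hL hLK (k * t) η
    rw [abs_mul, abs_of_nonneg ht, ← mul_assoc] at h
    refine (le_mul_of_one_le_left ht hk1).trans (h.trans ?_)
    rw [hz]
    unfold freqSize resFreq
    rw [max_eq_left ht]
    have := abs_nonneg (k : ℝ)
    have : (0 : ℝ) ≤ (n : ℝ) := Nat.cast_nonneg _
    gcongr
    linarith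
  unfold densityDecay
  rw [← div_eq_mul_inv, ← one_div, div_le_div_iff₀ (by positivity) (by positivity), one_mul,
    ← mul_pow]
  gcongr
  nlinarith

theorem abs_resFreq_sub (hK : 1 ≤ K) (k η : ℤ) {s t : ℝ} (hs : 0 ≤ s) (hst : s ≤ t) :
    |resFreq K L k η t - resFreq K L k η s| = K * |(k : ℝ)| * (t - s) := by
  unfold resFreq
  rw [max_eq_left hs, max_eq_left (hs.trans hst), show K * k * t - L * η - (K * k * s - L * η) =
    K * k * (t - s) by ring, abs_mul, abs_mul, abs_of_pos (by linarith : 0 < K),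
    abs_of_nonneg (by linarith : 0 ≤ t - s)]

/-- The solution operator of the linear density equation is bounded in the weighted norm. -/
theorem exists_norm_resolvent_integral_le (hl : 0 < lam) (hθ₁ : 0 < θ₁)
    (hlθ : 11 / 10 * lam ≤ θ₁ / 2) (hM : 0 < M) :
    ∃ C : ℝ, 0 < C ∧ ∀ {K L A : ℝ} {g S : ℝ → ℂ} {k η : ℤ} {n : ℕ} {t : ℝ},
      1 ≤ K → 0 ≤ A → k ≠ 0 → 0 ≤ t →
      (∀ u, 0 ≤ u → ‖g u‖ ≤ M * (K * |(k : ℝ)|) * Real.exp (-(θ₁ * (K * |(k : ℝ)|) * u))) →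
      (∀ s, 0 ≤ s → s ≤ t → ‖S s‖ ≤
        A * (densityDecay s * weight lam s (freqSize k η n (resFreq K L k η s)))) →
      ‖∫ s in (0 : ℝ)..t, g (t - s) * S s‖ ≤
        C * A * (densityDecay t * weight lam t (freqSize k η n (resFreq K L k η t))) := by
  -- Here `25 = 20 + 3 + 2`: the shift of the algebraic weight, the shift of the time decay and
  -- integrability. The variable `ζ = K |k| (t - s)` is both the distance between the resonant
  -- frequencies at `s` and `t` and the variable in which the resolvent decays.
  obtain ⟨E, hE, hEb⟩ := exists_one_add_pow_mul_exp_le 25 (show 0 < θ₁ / 2 by positivity)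
  refine ⟨M * E, by positivity, fun {K L A g S k η n t} hK hA hk ht hg hS => ?_⟩
  have hk1 : (1 : ℝ) ≤ |(k : ℝ)| := by exact_mod_cast Int.one_le_abs hk
  set q := K * |(k : ℝ)| with hq
  have hq1 : 1 ≤ q := by rw [hq]; nlinarith
  have hz0 : 0 < freqSize k η n (resFreq K L k η t) := freqSize_pos _ _ _ _
  have hwt := weight_pos (lam := lam) t hz0.le
  have hbt := densityDecay_pos ht
  refine norm_integral_le_of_inv_sq (q := q) (by positivity) (by linarith) ht fun s hs hst => ?_
  have hts : 0 ≤ t - s := by linarith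
  set ζ := q * (t - s) with hζ
  have hζ0 : 0 ≤ ζ := mul_nonneg (by linarith) hts
  have hb0 : 0 < 1 + ζ := by linarith
  have h4 : Real.exp (-(θ₁ * ζ)) * Real.exp (11 / 10 * lam * ζ) ≤ Real.exp (-(θ₁ / 2 * ζ)) := by
    rw [← Real.exp_add]
    gcongr
    have := mul_le_mul_of_nonneg_right hlθ hζ0
    linarith
  have h1 : weight lam s (freqSize k η n (resFreq K L k η s)) ≤
      weight lam t (freqSize k η n (resFreq K L k η t)) *
        (Real.exp (11 / 10 * lam * ζ) * (1 + ζ) ^ 20) := by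
    refine weight_shift_le hl hs hst (freqSize_pos _ _ _ _).le hz0.le hζ0 ?_
    rw [hζ, hq, ← abs_resFreq_sub (L := L) hK k η hs hst]
    exact freqSize_le_add_abs _ _ _ _ _
  have h2 : densityDecay s ≤ densityDecay t * (1 + ζ) ^ 3 := by
    refine (densityDecay_le hs hst).trans ?_
    have : t - s ≤ ζ := le_mul_of_one_le_left hts hq1
    gcongr
  have h3 := hg (t - s) hts
  rw [mul_assoc θ₁ q, ← hζ] at h3
  have h5 := hEb ζ hζ0
  have h6 : (1 + ζ) ^ 23 * Real.exp (-(θ₁ / 2 * ζ)) ≤ E * ((1 + ζ) ^ 2)⁻¹ := by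
    rw [← div_eq_mul_inv, le_div_iff₀ (by positivity)]
    rw [mul_right_comm, ← pow_add]
    exact h5
  set w := weight lam t (freqSize k η n (resFreq K L k η t)) with hw
  obtain ⟨b, hb⟩ : ∃ b, b = 1 + ζ := ⟨_, rfl⟩
  rw [← hb] at h1 h2 h6 hb0 ⊢
  rw [norm_mul]
  calc ‖g (t - s)‖ * ‖S s‖ ≤ (M * q * Real.exp (-(θ₁ * ζ))) *
        (A * ((densityDecay t * b ^ 3) *
          (w * (Real.exp (11 / 10 * lam * ζ) * b ^ 20)))) := by
        refine mul_le_mul h3 ((hS s hs hst).trans ?_) (norm_nonneg _) (by positivity)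
        have := weight_pos (lam := lam) s (freqSize_pos k η n (resFreq K L k η s)).le
        gcongr
    _ = M * A * (densityDecay t * w) * q * (b ^ 23 *
        (Real.exp (-(θ₁ * ζ)) * Real.exp (11 / 10 * lam * ζ))) := by ring
    _ ≤ M * A * (densityDecay t * w) * q * (b ^ 23 * Real.exp (-(θ₁ / 2 * ζ))) := by gcongr
    _ ≤ M * A * (densityDecay t * w) * q * (E * (b ^ 2)⁻¹) := by gcongr
    _ = _ := by ring

/-- The contribution of the equilibrium to the profile is bounded by the density. -/
theorem exists_norm_integral_linearTerm_le (hl : 0 < lam) (hθ₀ : 0 < θ₀)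
    (hlθ : 11 / 10 * lam ≤ θ₀ / 2) (hC₀ : 0 < C₀) :
    ∃ C : ℝ, 0 < C ∧ ∀ {K L A : ℝ} {h : ℝ → ℂ} {P : ℤ → ℤ → ℝ → ℂ} {n : ℕ},
      1 ≤ K → (∀ ζ, ‖h ζ‖ ≤ C₀ * Real.exp (-(θ₀ * |ζ|))) → DensityBound lam K L A n P →
      ∀ (k η : ℤ) (ξ : ℝ) {t : ℝ}, 0 ≤ t →
      ‖∫ s in (0 : ℝ)..t, linearTerm K L h P k η s ξ‖ ≤
        C * A * weight lam t (freqSize k η n ξ) := by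
  -- Here `21 = 20 + 1`: the shift of the algebraic weight and the multiplier `ζ`. There is no loss
  -- of `z`, because the decay of `μ̂` controls the multiplier.
  obtain ⟨E, hE, hEb⟩ := exists_one_add_pow_mul_exp_le 21 (show 0 < θ₀ / 2 by positivity)
  refine ⟨C₀ * E, by positivity, fun {K L A h P n} hK hh hP k η ξ {t} ht => ?_⟩
  have hA := hP.nonneg
  have hK0 : 0 < K := by linarith
  have hz0 : 0 < freqSize k η n ξ := freqSize_pos _ _ _ _
  have hwt := weight_pos (lam := lam) t hz0.le
  refine norm_integral_le_of_inv_one_add_sq (by positivity) ht fun s hs hst => ?_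
  unfold linearTerm
  rcases eq_or_ne k 0 with rfl | hk
  · rw [hP.zero]
    simp only [zero_div, neg_zero, zero_mul, norm_zero]
    positivity
  have hk1 : (1 : ℝ) ≤ |(k : ℝ)| := by exact_mod_cast Int.one_le_abs hk
  set ζ := |ξ - resFreq K L k η s| with hζ
  have hζ0 : 0 ≤ ζ := abs_nonneg _
  have hb0 : 0 < 1 + ζ := by linarith
  have h7 : ζ ≤ 1 + ζ := by linarith
  have h4 : Real.exp (-(θ₀ * ζ)) * Real.exp (11 / 10 * lam * ζ) ≤ Real.exp (-(θ₀ / 2 * ζ)) := by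
    rw [← Real.exp_add]
    gcongr
    have := mul_le_mul_of_nonneg_right hlθ hζ0
    linarith
  have h1 : weight lam s (freqSize k η n (resFreq K L k η s)) ≤
      weight lam t (freqSize k η n ξ) * (Real.exp (11 / 10 * lam * ζ) * (1 + ζ) ^ 20) :=
    weight_shift_le hl hs hst (freqSize_pos _ _ _ _).le hz0.le hζ0 (freqSize_le_add_abs _ _ _ _ _)
  have h2 : densityDecay s ≤ ((1 + s) ^ 2)⁻¹ := by
    unfold densityDecay
    gcongr
    · linarith
    · norm_num
  have h3 := hP.bound k η s hs
  have h5 := hEb ζ hζ0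
  set w := weight lam t (freqSize k η n ξ) with hw
  have hws := weight_pos (lam := lam) s (freqSize_pos k η n (resFreq K L k η s)).le
  rw [norm_mul, norm_mul, norm_neg, norm_div, norm_mul, Complex.norm_real, Complex.norm_real,
    Complex.norm_intCast, Real.norm_eq_abs, Real.norm_eq_abs, abs_of_pos hK0, ← hζ]
  have h6 : ‖P k η s‖ / (K * |(k : ℝ)|) ≤ ‖P k η s‖ :=
    div_le_self (norm_nonneg _) (one_le_mul_of_one_le_of_one_le hK hk1)
  obtain ⟨b, hb⟩ : ∃ b, b = 1 + ζ := ⟨_, rfl⟩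
  rw [← hb] at h1 h5 h7 hb0
  calc ‖P k η s‖ / (K * |(k : ℝ)|) * ζ * ‖h (ξ - resFreq K L k η s)‖
      ≤ (A * (((1 + s) ^ 2)⁻¹ * (w * (Real.exp (11 / 10 * lam * ζ) * b ^ 20)))) * b *
        (C₀ * Real.exp (-(θ₀ * ζ))) := by
        have := (h6.trans h3).trans (show A * (densityDecay s *
          weight lam s (freqSize k η n (resFreq K L k η s))) ≤
          A * (((1 + s) ^ 2)⁻¹ * (w * (Real.exp (11 / 10 * lam * ζ) * b ^ 20))) by
            gcongr)
        gcongr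
        exact hh _
    _ = C₀ * A * w * ((1 + s) ^ 2)⁻¹ * (b ^ 21 *
        (Real.exp (-(θ₀ * ζ)) * Real.exp (11 / 10 * lam * ζ))) := by ring
    _ ≤ C₀ * A * w * ((1 + s) ^ 2)⁻¹ * (b ^ 21 * Real.exp (-(θ₀ / 2 * ζ))) := by gcongr
    _ ≤ C₀ * A * w * ((1 + s) ^ 2)⁻¹ * E := by gcongr
    _ = _ := by ring

theorem continuous_densitySource {init : ℤ → ℤ → ℝ → ℂ} {N : ℤ → ℤ → ℝ → ℝ → ℂ}
    (hi : ∀ k η, Continuous (init k η)) (hN : ∀ k η, Continuous fun z : ℝ × ℝ => N k η z.1 z.2)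
    (k η : ℤ) : Continuous (densitySource K L init N k η) := by
  unfold densitySource
  have h1 := continuous_resFreq K L k η
  have h2 : Continuous (Function.uncurry fun t s : ℝ => N k η s (resFreq K L k η t)) :=
    (hN k η).comp (by fun_prop : Continuous fun z : ℝ × ℝ => (z.2, resFreq K L k η z.1))
  exact ((hi k η).comp h1).add
    (intervalIntegral.continuous_parametric_intervalIntegral_of_continuous h2 (by fun_prop))

theorem continuous_density (hG : ∀ k, Continuous (G k))
    {init : ℤ → ℤ → ℝ → ℂ} {N : ℤ → ℤ → ℝ → ℝ → ℂ}
    (hi : ∀ k η, Continuous (init k η)) (hN : ∀ k η, Continuous fun z : ℝ × ℝ => N k η z.1 z.2)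
    (k η : ℤ) : Continuous (density K L G init N k η) := by
  have h1 := continuous_densitySource (K := K) (L := L) hi hN k η
  have h2 := hG k
  unfold density
  split_ifs
  · exact continuous_const
  · refine h1.add (intervalIntegral.continuous_parametric_intervalIntegral_of_continuous
      (f := fun t s => G k (max t 0 - s) * densitySource K L init N k η s) ?_ (by fun_prop))
    simp only [Function.uncurry_def]
    fun_prop

theorem continuous_linearTerm (hh : Continuous h) {P : ℤ → ℤ → ℝ → ℂ} {k η : ℤ}
    (hP : Continuous (P k η)) : Continuous fun z : ℝ × ℝ => linearTerm K L h P k η z.1 z.2 := by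
  unfold linearTerm
  have h1 := continuous_resFreq K L k η
  have h6 : Continuous fun z : ℝ × ℝ => -(P k η z.1 / (K * k)) :=
    ((hP.comp continuous_fst).div_const _).neg
  exact (h6.mul (by fun_prop)).mul (by fun_prop)

theorem continuous_profile (hh : Continuous h)
    {init : ℤ → ℤ → ℝ → ℂ} {N : ℤ → ℤ → ℝ → ℝ → ℂ} {P : ℤ → ℤ → ℝ → ℂ}
    (hi : ∀ k η, Continuous (init k η)) (hN : ∀ k η, Continuous fun z : ℝ × ℝ => N k η z.1 z.2)
    (hP : ∀ k η, Continuous (P k η)) (k η : ℤ) :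
    Continuous fun z : ℝ × ℝ => profile K L h init N P k η z.1 z.2 := by
  unfold profile
  have h1 := continuous_linearTerm (K := K) (L := L) hh (hP k η)
  have h2 : Continuous (Function.uncurry fun (z : ℝ × ℝ) (s : ℝ) =>
      N k η s z.2 + linearTerm K L h P k η s z.2) :=
    ((hN k η).add h1).comp (by fun_prop : Continuous fun z : (ℝ × ℝ) × ℝ => (z.2, z.1.2))
  exact ((hi k η).comp continuous_snd).add
    (intervalIntegral.continuous_parametric_intervalIntegral_of_continuous h2 (by fun_prop))

theorem density_max_zero (init : ℤ → ℤ → ℝ → ℂ) (N : ℤ → ℤ → ℝ → ℝ → ℂ) (k η : ℤ) (t : ℝ) :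
    density K L G init N k η (max t 0) = density K L G init N k η t := by
  unfold density
  split_ifs
  · rfl
  · simp only [densitySource, resFreq_max_zero, max_assoc, max_self]

theorem profile_max_zero (init : ℤ → ℤ → ℝ → ℂ) (N : ℤ → ℤ → ℝ → ℝ → ℂ) (P : ℤ → ℤ → ℝ → ℂ)
    (k η : ℤ) (t ξ : ℝ) :
    profile K L h init N P k η (max t 0) ξ = profile K L h init N P k η t ξ := by
  unfold profile
  simp only [max_assoc, max_self]

/-- The density is the restriction of the profile to the resonant frequencies. -/
theorem EchoContext.profile_resFreq (ctx : EchoContext lam C₀ θ₀ θ₁ M K L h G data)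
    {init : ℤ → ℤ → ℝ → ℂ} {N : ℤ → ℤ → ℝ → ℝ → ℂ}
    (hi : ∀ k η, Continuous (init k η)) (hi0 : ∀ η ξ, init 0 η ξ = 0)
    (hN : ∀ k η, Continuous fun z : ℝ × ℝ => N k η z.1 z.2)
    (hN0 : ∀ η s, N 0 η s (resFreq K L 0 η s) = 0) (k η : ℤ) (t : ℝ) :
    profile K L h init N (density K L G init N) k η t (resFreq K L k η t) =
      density K L G init N k η t := by
  rcases eq_or_ne k 0 with rfl | hk
  -- For `k = 0` the resonant frequency does not depend on time and all forcing vanishes there: the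
  -- mean density is conserved, and it starts from zero.
  · unfold profile linearTerm
    have e : resFreq K L 0 η t = resFreq K L 0 η 0 := by simp [resFreq]
    have e' : ∀ s, resFreq K L 0 η t = resFreq K L 0 η s := fun s => by simp [resFreq]
    have h1 : ∀ s, N 0 η s (resFreq K L 0 η t) = 0 := fun s => by rw [e' s]; exact hN0 η s
    simp [hi0, h1, density]
  set S := densitySource K L init N k η with hS
  have hSc : Continuous S := continuous_densitySource hi hN k η
  have hdc := continuous_density (K := K) (L := L) ctx.G_continuous hi hN k η
  have hlc := continuous_linearTerm (K := K) (L := L) ctx.h_continuous hdc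
  have hK0 : (K : ℂ) ≠ 0 := by
    have := ctx.one_le_K
    exact_mod_cast (by linarith : K ≠ 0)
  have hk0 : (k : ℂ) ≠ 0 := by exact_mod_cast hk
  set τ := max t 0 with hτ
  have hτ0 : 0 ≤ τ := le_max_right _ _
  have hdens : ∀ s, 0 ≤ s → density K L G init N k η s =
      S s + ∫ u in (0 : ℝ)..s, G k (s - u) * S u := fun s hs => by
    unfold density
    rw [if_neg hk, max_eq_left hs]
  have hsol := volterra_solution (κ := fun t : ℝ => (t : ℂ) * h (K * k * t)) (G := G k) (S := S)
    (by have := ctx.h_continuous; fun_prop) (ctx.G_continuous k) hSc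
    (fun t ht => ctx.G_resolvent k t hk ht) hτ0
  -- On the resonant frequency the multiplier is `K k (τ - s)`, and its factor `K k` cancels the
  -- denominator of the field. What remains is the Volterra kernel `t μ̂(K k t)`.
  have e1 : ∫ s in (0 : ℝ)..τ, linearTerm K L h (density K L G init N) k η s (resFreq K L k η t) =
      -∫ s in (0 : ℝ)..τ, ((τ - s : ℝ) : ℂ) * h (K * k * (τ - s)) *
        (S s + ∫ u in (0 : ℝ)..s, G k (s - u) * S u) := by
    rw [← intervalIntegral.integral_neg]
    refine intervalIntegral.integral_congr fun s hs => ?_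
    rw [uIcc_of_le hτ0] at hs
    have e2 : resFreq K L k η t - resFreq K L k η s = K * k * (τ - s) := by
      unfold resFreq
      rw [max_eq_left hs.1, ← hτ]
      ring
    rw [linearTerm, e2, hdens s hs.1]
    push_cast
    field_simp
  have i1 : IntervalIntegrable (fun s => N k η s (resFreq K L k η t)) volume 0 τ :=
    ((hN k η).comp (by fun_prop : Continuous fun s : ℝ =>
      (s, resFreq K L k η t))).intervalIntegrable _ _
  have i2 : IntervalIntegrable (fun s => linearTerm K L h (density K L G init N) k η s
      (resFreq K L k η t)) volume 0 τ :=
    (hlc.comp (by fun_prop : Continuous fun s : ℝ =>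
      (s, resFreq K L k η t))).intervalIntegrable _ _
  have e3 : S t = S τ := by
    rw [hS]; unfold densitySource; rw [hτ, resFreq_max_zero, max_assoc, max_self]
  have e4 : density K L G init N k η t = S τ + ∫ u in (0 : ℝ)..τ, G k (τ - u) * S u := by
    rw [← density_max_zero, hdens _ hτ0]
  unfold profile
  rw [← hτ, intervalIntegral.integral_add i1 i2, e1, e4, ← add_assoc]
  have e5 : init k η (resFreq K L k η t) + ∫ s in (0 : ℝ)..τ, N k η s (resFreq K L k η t) = S τ := by
    rw [← e3]
    rfl
  rw [e5]
  linear_combination -hsol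

end step

/-! ### The echo expansion -/

/-- The densities and profiles of all orders: order `n` is the coefficient of `ε ^ (n + 1)`. -/
def echo (K L : ℝ) (h : ℝ → ℂ) (G : ℤ → ℝ → ℂ) (data : ℤ → ℤ → ℝ → ℂ) :
    ℕ → (ℤ → ℤ → ℝ → ℂ) × (ℤ → ℤ → ℝ → ℝ → ℂ)
  | 0 => (density K L G data 0, profile K L h data 0 (density K L G data 0))
  | n + 1 =>
    (density K L G 0 fun k η s ξ => ∑ i : Fin (n + 1),
      interaction K L (echo K L h G data i).1 (echo K L h G data (n - i)).2 k η s ξ,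
    profile K L h 0 (fun k η s ξ => ∑ i : Fin (n + 1),
      interaction K L (echo K L h G data i).1 (echo K L h G data (n - i)).2 k η s ξ)
      (density K L G 0 fun k η s ξ => ∑ i : Fin (n + 1),
        interaction K L (echo K L h G data i).1 (echo K L h G data (n - i)).2 k η s ξ))
  decreasing_by all_goals omega

/-- The density of order `n`. -/
def echoDensity (K L : ℝ) (h : ℝ → ℂ) (G : ℤ → ℝ → ℂ) (data : ℤ → ℤ → ℝ → ℂ) (n : ℕ) :
    ℤ → ℤ → ℝ → ℂ := (echo K L h G data n).1

/-- The profile of order `n`. -/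
def echoProfile (K L : ℝ) (h : ℝ → ℂ) (G : ℤ → ℝ → ℂ) (data : ℤ → ℤ → ℝ → ℂ) (n : ℕ) :
    ℤ → ℤ → ℝ → ℝ → ℂ := (echo K L h G data n).2

/-- The initial datum of order `n`. -/
def echoInit (data : ℤ → ℤ → ℝ → ℂ) (n : ℕ) : ℤ → ℤ → ℝ → ℂ := if n = 0 then data else 0

/-- The quadratic forcing of order `n`. -/
def echoForcing (K L : ℝ) (h : ℝ → ℂ) (G : ℤ → ℝ → ℂ) (data : ℤ → ℤ → ℝ → ℂ) :
    ℕ → ℤ → ℤ → ℝ → ℝ → ℂ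
  | 0 => 0
  | n + 1 => fun k η s ξ => ∑ i : Fin (n + 1),
      interaction K L (echoDensity K L h G data i) (echoProfile K L h G data (n - i)) k η s ξ

section echo

variable {lam C₀ θ₀ θ₁ M K L A₁ A₂ B : ℝ} {h : ℝ → ℂ} {G : ℤ → ℝ → ℂ} {data : ℤ → ℤ → ℝ → ℂ}

theorem echoDensity_eq (n : ℕ) : echoDensity K L h G data n =
    density K L G (echoInit data n) (echoForcing K L h G data n) := by
  cases n <;> (unfold echoDensity; rw [echo]; rfl)

theorem echoProfile_eq (n : ℕ) : echoProfile K L h G data n =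
    profile K L h (echoInit data n) (echoForcing K L h G data n) (echoDensity K L h G data n) := by
  cases n <;> (unfold echoDensity echoProfile; rw [echo]; rfl)

theorem EchoContext.continuous_echoInit (ctx : EchoContext lam C₀ θ₀ θ₁ M K L h G data) (n : ℕ)
    (k η : ℤ) : Continuous (echoInit data n k η) := by
  unfold echoInit
  split_ifs
  · exact ctx.data_continuous k η
  · exact continuous_const

/-- The bounds that are propagated by the recursion. -/
def EchoBound (lam K L A₁ A₂ B : ℝ) (h : ℝ → ℂ) (G : ℤ → ℝ → ℂ) (data : ℤ → ℤ → ℝ → ℂ)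
    (n : ℕ) : Prop :=
  DensityBound lam K L (A₁ * B ^ (n + 1)) n (echoDensity K L h G data n) ∧
    ProfileBound lam (A₂ * B ^ (n + 1)) n (echoProfile K L h G data n)

theorem EchoContext.continuous_echoForcing (ctx : EchoContext lam C₀ θ₀ θ₁ M K L h G data)
    (hl : 0 < lam) {n : ℕ} (hb : ∀ i < n, EchoBound lam K L A₁ A₂ B h G data i) (k η : ℤ) :
    Continuous fun z : ℝ × ℝ => echoForcing K L h G data n k η z.1 z.2 := by
  cases n with
  | zero => exact continuous_const
  | succ n =>
    refine continuous_finsetSum _ fun i _ => ?_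
    exact continuous_interaction hl ctx.one_le_K ctx.L_pos ctx.L_le (hb i (by omega)).1
      (hb (n - i) (by omega)).2 k η

/-- Order `i` carries `B ^ (i + 1)`, so the powers of `B` multiply to precisely the one of the
target order. The product `A₁ * A₂` takes the place of a single constant, and its smallness closes
the induction. -/
theorem EchoContext.norm_echoForcing_le (ctx : EchoContext lam C₀ θ₀ θ₁ M K L h G data)
    (hl : 0 < lam) {n : ℕ} (hb : ∀ i < n, EchoBound lam K L A₁ A₂ B h G data i)
    (hA₁ : 0 ≤ A₁) (hA₂ : 0 ≤ A₂) (hB : 0 ≤ B) (hC₀ : 0 < C₀)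
    (k η : ℤ) {s : ℝ} (hs : 0 ≤ s) (ξ : ℝ) :
    ‖echoForcing K L h G data n k η s ξ‖ ≤
      A₁ * A₂ * B ^ (n + 1) * (2 ^ 20 * (1 + C₀)) * (2 * ∑' n, orderWeight n) *
        (((1 + s) ^ 2)⁻¹ * ((1 + freqSize k η n ξ) * weight lam s (freqSize k η n ξ))) := by
  have hΓ : 0 ≤ ∑' n, orderWeight n := tsum_nonneg orderWeight_nonneg
  have hz := freqSize_pos k η n ξ
  have hw := weight_pos (lam := lam) s hz.le
  cases n with
  | zero =>
    simp only [echoForcing, Pi.zero_apply, norm_zero]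
    positivity
  | succ n =>
    simp only [echoForcing]
    have h1 : ∀ i : Fin (n + 1), ‖interaction K L (echoDensity K L h G data i)
        (echoProfile K L h G data (n - i)) k η s ξ‖ ≤ (A₁ * A₂ * B ^ (n + 1 + 1) *
          (2 ^ 20 * (1 + C₀)) * (((1 + s) ^ 2)⁻¹ * ((1 + freqSize k η (n + 1) ξ) *
          weight lam s (freqSize k η (n + 1) ξ)))) * (orderWeight i + orderWeight (n - i)) := by
      intro i
      have hi : (i : ℕ) + (n - i) + 1 = n + 1 := by omega
      have := norm_interaction_le hl ctx.one_le_K ctx.L_pos ctx.L_le (hb i (by omega)).1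
        (hb (n - i) (by omega)).2 k η hs ξ
      rw [hi] at this
      refine this.trans (le_of_eq ?_)
      have e : B ^ (n + 1 + 1) = B ^ ((i : ℕ) + 1) * B ^ (n - i + 1) := by
        rw [← pow_add]; congr 1; omega
      rw [e]
      ring
    refine (norm_sum_le _ _).trans ((Finset.sum_le_sum fun i _ => h1 i).trans ?_)
    rw [← Finset.mul_sum]
    calc _ ≤ (A₁ * A₂ * B ^ (n + 1 + 1) * (2 ^ 20 * (1 + C₀)) * (((1 + s) ^ 2)⁻¹ *
          ((1 + freqSize k η (n + 1) ξ) * weight lam s (freqSize k η (n + 1) ξ)))) *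
          (2 * ∑' n, orderWeight n) := by
          refine mul_le_mul_of_nonneg_left (sum_orderWeight_le n) (by positivity)
      _ = _ := by ring

theorem exists_norm_echoForcing_resFreq_le (hl : 0 < lam) (hC₀ : 0 < C₀) :
    ∃ C : ℝ, 0 < C ∧ ∀ {θ₀ θ₁ M K L A₁ A₂ B : ℝ} {h : ℝ → ℂ} {G : ℤ → ℝ → ℂ}
      {data : ℤ → ℤ → ℝ → ℂ}, EchoContext lam C₀ θ₀ θ₁ M K L h G data →
      ∀ {n : ℕ}, (∀ i < n, EchoBound lam K L A₁ A₂ B h G data i) →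
      0 ≤ A₁ → 0 ≤ A₂ → 0 ≤ B → ∀ {k : ℤ} (η : ℤ) {s t : ℝ}, k ≠ 0 → 0 ≤ s → s ≤ t →
      ‖echoForcing K L h G data n k η s (resFreq K L k η t)‖ ≤ A₁ * A₂ * B ^ (n + 1) * C *
        (densityDecay t * weight lam t (freqSize k η n (resFreq K L k η t))) *
          ((1 + (t - s)) ^ 2)⁻¹ := by
  obtain ⟨C, hC, hCb⟩ := exists_norm_interactionTerm_resFreq_le (lam := lam) hl hC₀
  have hΓ : 0 ≤ ∑' n, orderWeight n := tsum_nonneg orderWeight_nonneg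
  refine ⟨C * (2 * ∑' n, orderWeight n + 1), by positivity,
    fun {θ₀ θ₁ M K L A₁ A₂ B h G data} ctx {n} hb hA₁ hA₂ hB {k} η {s t} hk hs hst => ?_⟩
  have hw := weight_pos (lam := lam) t (freqSize_pos k η n (resFreq K L k η t)).le
  have hd := densityDecay_pos (hs.trans hst)
  cases n with
  | zero =>
    simp only [echoForcing, Pi.zero_apply, norm_zero]
    positivity
  | succ n =>
    simp only [echoForcing]
    set X := densityDecay t * weight lam t (freqSize k η (n + 1) (resFreq K L k η t)) *
      ((1 + (t - s)) ^ 2)⁻¹ with hX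
    have hX0 : 0 ≤ X := by positivity
    have h1 : ∀ i : Fin (n + 1), ‖interaction K L (echoDensity K L h G data i)
        (echoProfile K L h G data (n - i)) k η s (resFreq K L k η t)‖ ≤
          (A₁ * A₂ * B ^ (n + 1 + 1) * C * X) * (orderWeight i + orderWeight (n - i)) := by
      intro i
      have hi : (i : ℕ) + (n - i) + 1 = n + 1 := by omega
      have h2 := hCb ctx.one_le_K ctx.L_pos ctx.L_le (hb i (by omega)).1
        (hb (n - i) (by omega)).2 k η hk hs hst
      rw [hi, ← hX] at h2
      refine (tsum_of_norm_bounded ((hasSum_pairWeight k η i (n - i)).mul_left _) h2).trans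
        (le_of_eq ?_)
      have e : B ^ (n + 1 + 1) = B ^ ((i : ℕ) + 1) * B ^ (n - i + 1) := by
        rw [← pow_add]; congr 1; omega
      rw [e]
      ring
    refine (norm_sum_le _ _).trans ((Finset.sum_le_sum fun i _ => h1 i).trans ?_)
    rw [← Finset.mul_sum]
    calc _ ≤ (A₁ * A₂ * B ^ (n + 1 + 1) * C * X) * (2 * ∑' n, orderWeight n + 1) := by
          refine mul_le_mul_of_nonneg_left ((sum_orderWeight_le n).trans ?_) (by positivity)
          linarith
      _ = _ := by rw [hX]; ring

/-- The coefficients of the echo expansion grow at most geometrically with the order, uniformly in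
the wave numbers. -/
theorem exists_echoBound (hl : 0 < lam) (hC₀ : 0 < C₀) (hθ₀ : 0 < θ₀) (hθ₁ : 0 < θ₁) (hM : 0 < M)
    (hlθ₀ : 11 / 10 * lam ≤ θ₀ / 2) (hlθ₁ : 11 / 10 * lam ≤ θ₁ / 2) :
    ∃ A₁ A₂ B : ℝ, 0 < A₁ ∧ 0 < A₂ ∧ A₂ ≤ 1 ∧ 1 ≤ B ∧
      ∀ {K L : ℝ} {h : ℝ → ℂ} {G : ℤ → ℝ → ℂ} {data : ℤ → ℤ → ℝ → ℂ},
      EchoContext lam C₀ θ₀ θ₁ M K L h G data → ∀ n, EchoBound lam K L A₁ A₂ B h G data n := by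
  obtain ⟨D, hD, hDb⟩ := exists_exp_bracket_le hl
  obtain ⟨Cr, hCr, hCrb⟩ := exists_norm_resolvent_integral_le hl hθ₁ hlθ₁ hM
  obtain ⟨Cm, hCm, hCmb⟩ := exists_norm_integral_linearTerm_le hl hθ₀ hlθ₀ hC₀
  obtain ⟨CR, hCR, hCRb⟩ := exists_norm_echoForcing_resFreq_le hl hC₀
  set Γ := ∑' n, orderWeight n with hΓ
  have hΓ0 : 0 ≤ Γ := tsum_nonneg orderWeight_nonneg
  set CF := 2 ^ 20 * (1 + C₀) * (2 * Γ) * (40 / lam) with hCF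
  have hCF0 : 0 ≤ CF := by positivity
  set D' := D * (2 + C₀) ^ 3 with hD'
  have hD'0 : 0 < D' := by positivity
  -- The constants are chosen in this order: `A₂` small makes the quadratic forcing of the density
  -- harmless compared with `A₁`; `A₁` small compared with `A₂` does the same for the quadratic and
  -- the linear forcing of the profile; `B` large absorbs the initial datum, which enters only at
  -- order zero.
  set A₂ := min 1 (1 / ((1 + Cr) * CR)) with hA₂
  have hA₂0 : 0 < A₂ := lt_min one_pos (by positivity)
  set A₁ := A₂ / (2 * (CF + Cm + 1)) with hA₁
  have hA₁0 : 0 < A₁ := by positivity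
  set B := max 1 (max (2 * D / A₂) ((1 + Cr) * D' / A₁)) with hB
  have hB1 : 1 ≤ B := le_max_left _ _
  have hB0 : 0 < B := by linarith
  have c1 : (1 + Cr) * CR * A₂ ≤ 1 := by
    have := min_le_right 1 (1 / ((1 + Cr) * CR))
    rw [← hA₂, le_div_iff₀ (by positivity)] at this
    linarith
  have c2 : CF * A₁ * A₂ + Cm * A₁ ≤ A₂ / 2 := by
    have e1 : A₂ ≤ 1 := min_le_left _ _
    have e2 : A₁ * (CF + Cm + 1) = A₂ / 2 := by
      rw [hA₁]; field_simp
    have e3 : CF * A₁ * A₂ ≤ CF * A₁ := mul_le_of_le_one_right (by positivity) e1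
    nlinarith
  have c3 : D ≤ A₂ / 2 * B := by
    have : 2 * D / A₂ ≤ B := (le_max_left _ _).trans (le_max_right _ _)
    rw [div_le_iff₀ hA₂0] at this
    linarith
  have c4 : (1 + Cr) * D' ≤ A₁ * B := by
    have : (1 + Cr) * D' / A₁ ≤ B := (le_max_right _ _).trans (le_max_right _ _)
    rw [div_le_iff₀ hA₁0] at this
    linarith
  refine ⟨A₁, A₂, B, hA₁0, hA₂0, min_le_left _ _, hB1, fun {K L h G data} ctx n => ?_⟩
  induction n using Nat.strong_induction_on with
  | _ n ih =>
    have hNc := ctx.continuous_echoForcing hl ih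
    have hic := ctx.continuous_echoInit n
    have hdc : ∀ k η, Continuous (echoDensity K L h G data n k η) := fun k η => by
      rw [echoDensity_eq]
      exact continuous_density ctx.G_continuous hic hNc k η
    -- the source of the density equation
    have hS : ∃ a : ℝ, 0 ≤ a ∧ (1 + Cr) * a ≤ A₁ * B ^ (n + 1) ∧ ∀ (k η : ℤ) (t : ℝ), k ≠ 0 → 0 ≤ t →
        ‖densitySource K L (echoInit data n) (echoForcing K L h G data n) k η t‖ ≤
          a * (densityDecay t * weight lam t (freqSize k η n (resFreq K L k η t))) := by
      cases n with
      | zero =>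
        refine ⟨D', hD'0.le, by simpa using c4, fun k η t hk ht => ?_⟩
        have e : densitySource K L (echoInit data 0) (echoForcing K L h G data 0) k η t =
            data k η (resFreq K L k η t) := by
          simp [densitySource, echoInit, echoForcing]
        rw [e]
        refine (ctx.data_bound _ _ _).trans ((hDb _ _ _).trans ?_)
        have e1 := exp_mul_inv_pow_le_weight hl ht (freqSize_pos k η 0 (resFreq K L k η t)).le
        have e2 := densityDecay_ge_of_resonance ctx.one_le_K ctx.L_pos ctx.L_le hk η ht 0
        have hw := weight_pos (lam := lam) t (freqSize_pos k η 0 (resFreq K L k η t)).le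
        calc _ ≤ D * (weight lam t (freqSize k η 0 (resFreq K L k η t)) *
              ((2 + C₀) ^ 3 * densityDecay t)) :=
              mul_le_mul_of_nonneg_left (e1.trans (mul_le_mul_of_nonneg_left e2 hw.le)) hD.le
          _ = _ := by rw [hD']; ring
      | succ n =>
        refine ⟨A₁ * A₂ * B ^ (n + 1 + 1) * CR, by positivity, ?_, fun k η t hk ht => ?_⟩
        · calc _ = ((1 + Cr) * CR * A₂) * (A₁ * B ^ (n + 1 + 1)) := by ring
            _ ≤ 1 * (A₁ * B ^ (n + 1 + 1)) := by gcongr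
            _ = _ := one_mul _
        · have hd := densityDecay_pos ht
          have hw := weight_pos (lam := lam) t (freqSize_pos k η (n + 1) (resFreq K L k η t)).le
          unfold densitySource
          rw [max_eq_left ht]
          simp only [echoInit, Nat.succ_ne_zero, if_false, Pi.zero_apply, zero_add]
          refine norm_integral_le_of_inv_sq (q := 1) (by positivity) one_pos ht fun s hs hst => ?_
          have := hCRb ctx ih hA₁0.le hA₂0.le hB0.le η hk hs hst
          simpa using this
    have hDens : DensityBound lam K L (A₁ * B ^ (n + 1)) n (echoDensity K L h G data n) := by
      refine ⟨hdc, fun η t => ?_, fun k η t => ?_, fun k η t ht => ?_⟩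
      · rw [echoDensity_eq]; simp [density]
      · rw [echoDensity_eq, density_max_zero]
      · obtain ⟨a, ha, haA, hSb⟩ := hS
        have hd := densityDecay_pos ht
        have hw := weight_pos (lam := lam) t (freqSize_pos k η n (resFreq K L k η t)).le
        rw [echoDensity_eq]
        unfold density
        split_ifs with hk
        · rw [norm_zero]; positivity
        rw [max_eq_left ht]
        refine (norm_add_le _ _).trans ((add_le_add (hSb k η t hk ht)
          (hCrb (n := n) (L := L) (η := η) ctx.one_le_K ha hk ht
            (fun u hu => ctx.G_bound k u hk hu) (fun s hs _ => hSb k η s hk hs))).trans ?_)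
        calc _ = (1 + Cr) * a * (densityDecay t *
              weight lam t (freqSize k η n (resFreq K L k η t))) := by ring
          _ ≤ _ := by gcongr
    refine ⟨hDens, fun k η => ?_, fun k η t ξ => ?_, fun k η t ξ ht => ?_⟩
    · rw [echoProfile_eq]
      exact continuous_profile ctx.h_continuous hic hNc hdc k η
    · rw [echoProfile_eq, profile_max_zero]
    have hw := weight_pos (lam := lam) t (freqSize_pos k η n ξ).le
    rw [echoProfile_eq]
    unfold profile
    rw [max_eq_left ht]
    have hlc := continuous_linearTerm (K := K) (L := L) ctx.h_continuous (hdc k η)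
    have i1 : IntervalIntegrable (fun s => echoForcing K L h G data n k η s ξ) volume 0 t :=
      ((hNc k η).comp (by fun_prop : Continuous fun s : ℝ => (s, ξ))).intervalIntegrable _ _
    have i2 : IntervalIntegrable (fun s => linearTerm K L h (echoDensity K L h G data n) k η s ξ)
        volume 0 t :=
      (hlc.comp (by fun_prop : Continuous fun s : ℝ => (s, ξ))).intervalIntegrable _ _
    rw [intervalIntegral.integral_add i1 i2]
    have b0 : ‖echoInit data n k η ξ‖ ≤ A₂ / 2 * B ^ (n + 1) * weight lam t (freqSize k η n ξ) := by
      unfold echoInit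
      split_ifs with hn
      · subst hn
        refine (ctx.data_bound _ _ _).trans ((hDb _ _ _).trans ?_)
        have e1 := exp_mul_inv_pow_le_weight hl ht (freqSize_pos k η 0 ξ).le
        have e2 : ((1 + freqSize k η 0 ξ) ^ 3)⁻¹ ≤ 1 :=
          inv_le_one_of_one_le₀ (one_le_pow₀ (by linarith [freqSize_pos k η 0 ξ]))
        have e3 := e1.trans (mul_le_of_le_one_right hw.le e2)
        rw [zero_add, pow_one]
        calc _ ≤ D * weight lam t (freqSize k η 0 ξ) := by gcongr
          _ ≤ _ := by gcongr
      · rw [Pi.zero_apply, Pi.zero_apply, Pi.zero_apply, norm_zero]; positivity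
    have b1 : ‖∫ s in (0 : ℝ)..t, echoForcing K L h G data n k η s ξ‖ ≤
        CF * A₁ * A₂ * B ^ (n + 1) * weight lam t (freqSize k η n ξ) := by
      refine (norm_integral_le_weight hl (A := A₁ * A₂ * B ^ (n + 1) * (2 ^ 20 * (1 + C₀)) *
        (2 * Γ)) (by positivity) ht (one_le_freqSize k η n ξ) fun s hs _ =>
        ctx.norm_echoForcing_le hl ih hA₁0.le hA₂0.le hB0.le hC₀ k η hs ξ).trans (le_of_eq ?_)
      rw [hCF]; ring
    have b2 := hCmb ctx.one_le_K ctx.h_bound hDens k η ξ ht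
    have b3 : (CF * A₁ * A₂ + Cm * A₁) * (B ^ (n + 1) * weight lam t (freqSize k η n ξ)) ≤
        A₂ / 2 * (B ^ (n + 1) * weight lam t (freqSize k η n ξ)) := by gcongr
    have e0 : A₂ * B ^ (n + 1) * weight lam t (freqSize k η n ξ) =
      A₂ / 2 * B ^ (n + 1) * weight lam t (freqSize k η n ξ) +
        A₂ / 2 * (B ^ (n + 1) * weight lam t (freqSize k η n ξ)) := by ring
    have e1 : (CF * A₁ * A₂ + Cm * A₁) * (B ^ (n + 1) * weight lam t (freqSize k η n ξ)) =
      CF * A₁ * A₂ * B ^ (n + 1) * weight lam t (freqSize k η n ξ) +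
        Cm * (A₁ * B ^ (n + 1)) * weight lam t (freqSize k η n ξ) := by ring
    rw [e0]
    refine (norm_add_le _ _).trans (add_le_add b0 ((norm_add_le _ _).trans ?_))
    exact (add_le_add b1 b2).trans (e1.symm.le.trans b3)

theorem EchoContext.echoProfile_resFreq (ctx : EchoContext lam C₀ θ₀ θ₁ M K L h G data)
    (hl : 0 < lam) (hb : ∀ i, EchoBound lam K L A₁ A₂ B h G data i) (n : ℕ) (k η : ℤ) (t : ℝ) :
    echoProfile K L h G data n k η t (resFreq K L k η t) = echoDensity K L h G data n k η t := by
  rw [echoProfile_eq, echoDensity_eq]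
  refine ctx.profile_resFreq (ctx.continuous_echoInit n) (fun η ξ => ?_)
    (ctx.continuous_echoForcing hl fun i _ => hb i) (fun η s => ?_) k η t
  · unfold echoInit
    split_ifs
    · exact ctx.data_zero η ξ
    · rfl
  · cases n with
    | zero => rfl
    | succ n =>
      refine Finset.sum_eq_zero fun i _ => ?_
      unfold interaction interactionTerm
      simp

end echo

/-! ### Fourier synthesis on the torus times the line -/

/-- The plane wave of frequency `(j, ξ)`. -/
def wave (x v : ℝ) (j : ℤ) (ξ : ℝ) : ℂ := Complex.exp (Complex.I * (j * x + ξ * v))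

theorem norm_wave (x v : ℝ) (j : ℤ) (ξ : ℝ) : ‖wave x v j ξ‖ = 1 := by
  unfold wave
  rw [show Complex.I * (j * x + ξ * v) = ((j * x + ξ * v : ℝ) : ℂ) * Complex.I by
    push_cast; ring]
  exact Complex.norm_exp_ofReal_mul_I _

theorem continuous_wave (j : ℤ) : Continuous fun z : (ℝ × ℝ) × ℝ => wave z.1.1 z.1.2 j z.2 := by
  unfold wave; fun_prop

theorem continuous_wave_right (x v : ℝ) (j : ℤ) : Continuous (wave x v j) := by
  unfold wave; fun_prop

/-- The function on the torus times the line with Fourier coefficients `Φ`. -/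
def synth (Φ : ℤ → ℝ → ℂ) (x v : ℝ) : ℂ :=
  (2 * Real.pi : ℂ)⁻¹ * ∫ X, Φ X.1 X.2 * wave x v X.1 X.2 ∂freqMeasure

/-- Families of Fourier coefficients (depending on `max t 0`) that are continuous and decay
exponentially, locally uniformly in time. -/
structure IsDecaying (W : ℝ → ℤ → ℝ → ℂ) : Prop where
  continuous : ∀ j, Continuous fun z : ℝ × ℝ => W z.1 j z.2
  max_zero : ∀ t j ξ, W (max t 0) j ξ = W t j ξ
  bound : ∀ T : ℝ, 0 < T → ∃ C r : ℝ, 0 < C ∧ 0 < r ∧ ∀ t ≤ T, ∀ (j : ℤ) (ξ : ℝ),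
    ‖W t j ξ‖ ≤ C * Real.exp (-(r * (|(j : ℝ)| + |ξ|)))

/-- One term of the Fourier transform of `-E ∂ᵥ g`, along the free flow, where `U` are the
coefficients of the distribution that generates the field and `V` those of `g`. -/
def transportTerm (U V : ℝ → ℤ → ℝ → ℂ) (s : ℝ) (j : ℤ) (ξ : ℝ) (l : ℤ) : ℂ :=
  -(U s l (l * max s 0) / l) * ((ξ - j * max s 0 : ℝ) : ℂ) * V s (j - l) (ξ - l * max s 0)

/-- The Fourier transform of `-E ∂ᵥ g` along the free flow. -/
def transport (U V : ℝ → ℤ → ℝ → ℂ) (s : ℝ) (j : ℤ) (ξ : ℝ) : ℂ :=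
  ∑' l : ℤ, transportTerm U V s j ξ l

/-- The Fourier coefficients of the field that is generated by the coefficients `W`. -/
def fieldCoeff (W : ℝ → ℤ → ℝ → ℂ) (s : ℝ) (l : ℤ) : ℂ := W s l (l * max s 0) / (Complex.I * l)

/-- The field that is generated by the coefficients `W`. -/
def field (W : ℝ → ℤ → ℝ → ℂ) (s x : ℝ) : ℂ :=
  ∑' l : ℤ, fieldCoeff W s l * Complex.exp (Complex.I * l * x)

section

variable {U V W : ℝ → ℤ → ℝ → ℂ}

theorem abs_sub_mul_max_le (s : ℝ) (j : ℤ) (ξ : ℝ) :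
    |ξ - j * max s 0| ≤ (1 + max s 0) * (|(j : ℝ)| + |ξ|) := by
  have h0 : 0 ≤ max s 0 := le_max_right _ _
  refine (abs_sub _ _).trans ?_
  rw [abs_mul, abs_of_nonneg h0]
  nlinarith [abs_nonneg (j : ℝ), abs_nonneg ξ]

/-- It includes `l = 0`, where the quotient is zero. The same convention removes the mean of the
field in `fieldCoeff` and `transportTerm`. -/
theorem norm_div_intCast_le (z : ℂ) (l : ℤ) : ‖z / l‖ ≤ ‖z‖ := by
  rcases eq_or_ne l 0 with h | h
  · simp [h]
  · rw [norm_div, Complex.norm_intCast]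
    exact div_le_self (norm_nonneg _) (by exact_mod_cast Int.one_le_abs h)

theorem norm_transportTerm_le (s : ℝ) (j : ℤ) (ξ : ℝ) (l : ℤ) :
    ‖transportTerm U V s j ξ l‖ ≤ (1 + max s 0) * (|(j : ℝ)| + |ξ|) *
      (‖U s l (l * max s 0)‖ * ‖V s (j - l) (ξ - l * max s 0)‖) := by
  unfold transportTerm
  rw [norm_mul, norm_mul, norm_neg, Complex.norm_real, Real.norm_eq_abs]
  have h1 := abs_sub_mul_max_le s j ξ
  have h2 := norm_div_intCast_le (U s l (l * max s 0)) l
  calc _ ≤ ‖U s l (l * max s 0)‖ * ((1 + max s 0) * (|(j : ℝ)| + |ξ|)) *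
        ‖V s (j - l) (ξ - l * max s 0)‖ := by gcongr
    _ = _ := by ring

theorem abs_add_abs_le_split (j l : ℤ) (ξ a : ℝ) :
    |(j : ℝ)| + |ξ| ≤ (|(l : ℝ)| + |a|) + (|((j - l : ℤ) : ℝ)| + |ξ - a|) := by
  have h1 := abs_add_le (l : ℝ) ((j - l : ℤ) : ℝ)
  have h2 := abs_add_le a (ξ - a)
  rw [show (l : ℝ) + ((j - l : ℤ) : ℝ) = j by push_cast; ring] at h1
  rw [show a + (ξ - a) = ξ by ring] at h2
  linarith

theorem IsDecaying.continuous_right (hW : IsDecaying W) (t : ℝ) (j : ℤ) : Continuous (W t j) :=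
  (hW.continuous j).comp (by fun_prop : Continuous fun ξ : ℝ => (t, ξ))

theorem IsDecaying.continuous_left (hW : IsDecaying W) (j : ℤ) (ξ : ℝ) :
    Continuous fun s => W s j ξ :=
  (hW.continuous j).comp (by fun_prop : Continuous fun s : ℝ => (s, ξ))

theorem IsDecaying.continuous_swap (hW : IsDecaying W) (j : ℤ) :
    Continuous (Function.uncurry fun ξ s : ℝ => W s j ξ) :=
  (hW.continuous j).comp (by fun_prop : Continuous fun z : ℝ × ℝ => (z.2, z.1))

/-- Exponential bounds on the terms of the transport nonlinearity. -/
theorem exists_norm_transportTerm_le (hU : IsDecaying U) (hV : IsDecaying V) {T : ℝ} (hT : 0 < T) :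
    ∃ C r : ℝ, 0 < C ∧ 0 < r ∧ ∀ s ≤ T, ∀ (j : ℤ) (ξ : ℝ) (l : ℤ), ‖transportTerm U V s j ξ l‖ ≤
      C * Real.exp (-(r * (|(j : ℝ)| + |ξ|))) * Real.exp (-(r * |(l : ℝ)|)) := by
  obtain ⟨A, a, hA, ha, hUb⟩ := hU.bound T hT
  obtain ⟨B, b, hB, hb, hVb⟩ := hV.bound T hT
  set r := min a b with hr
  have hr0 : 0 < r := lt_min ha hb
  -- One quarter of the rate absorbs the derivative factor, one is kept as decay in `(j, ξ)` and one
  -- gives summability in `l`.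
  obtain ⟨D, hD, hDb⟩ := exists_one_add_pow_mul_exp_le 1 (show 0 < r / 4 by positivity)
  refine ⟨(1 + T) * (A * B) * D, r / 4, by positivity, by positivity, fun s hs j ξ l => ?_⟩
  have hs1 : max s 0 ≤ T := max_le hs hT.le
  refine (norm_transportTerm_le s j ξ l).trans ?_
  have h1 := hUb s hs l (l * max s 0)
  have h2 := hVb s hs (j - l) (ξ - l * max s 0)
  have h3 := abs_add_abs_le_split j l ξ (l * max s 0)
  set x := |(l : ℝ)| + |(l * max s 0 : ℝ)| with hx
  set y := |((j - l : ℤ) : ℝ)| + |ξ - l * max s 0| with hy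
  set z := |(j : ℝ)| + |ξ| with hz
  have hx0 : 0 ≤ x := by positivity
  have hy0 : 0 ≤ y := by positivity
  have hz0 : 0 ≤ z := by positivity
  have hlx : |(l : ℝ)| ≤ x := le_add_of_nonneg_right (abs_nonneg _)
  have e1 : Real.exp (-(a * x)) * Real.exp (-(b * y)) ≤
      Real.exp (-(r / 4 * z)) * (Real.exp (-(r / 4 * z)) * Real.exp (-(r / 4 * |(l : ℝ)|))) := by
    rw [← Real.exp_add, ← Real.exp_add, ← Real.exp_add]
    refine Real.exp_le_exp.2 ?_
    have i1 : r * x ≤ a * x := by gcongr; exact min_le_left _ _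
    have i2 : r * y ≤ b * y := by gcongr; exact min_le_right _ _
    have i3 : r * z ≤ r * x + r * y := by rw [← mul_add]; gcongr
    have i4 : r * |(l : ℝ)| ≤ r * x := by gcongr
    have i5 : 0 ≤ r * y := by positivity
    have i6 : 0 ≤ r * x := by positivity
    linarith
  have e2 : z * Real.exp (-(r / 4 * z)) ≤ D := by
    refine le_trans ?_ (hDb z hz0)
    rw [pow_one]; gcongr; linarith
  calc _ ≤ (1 + T) * z * ((A * Real.exp (-(a * x))) * (B * Real.exp (-(b * y)))) := by gcongr
    _ = (1 + T) * z * (A * B) * (Real.exp (-(a * x)) * Real.exp (-(b * y))) := by ring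
    _ ≤ (1 + T) * z * (A * B) * (Real.exp (-(r / 4 * z)) *
        (Real.exp (-(r / 4 * z)) * Real.exp (-(r / 4 * |(l : ℝ)|)))) := by gcongr
    _ = (1 + T) * (A * B) * (z * Real.exp (-(r / 4 * z))) * Real.exp (-(r / 4 * z)) *
        Real.exp (-(r / 4 * |(l : ℝ)|)) := by ring
    _ ≤ _ := by gcongr

theorem continuous_transportTerm (hU : IsDecaying U) (hV : IsDecaying V) (j l : ℤ) :
    Continuous fun z : ℝ × ℝ => transportTerm U V z.1 j z.2 l := by
  unfold transportTerm
  have h1 : Continuous fun z : ℝ × ℝ => U z.1 l (l * max z.1 0) :=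
    (hU.continuous l).comp (by fun_prop : Continuous fun z : ℝ × ℝ => (z.1, (l : ℝ) * max z.1 0))
  have h2 : Continuous fun z : ℝ × ℝ => V z.1 (j - l) (z.2 - l * max z.1 0) :=
    (hV.continuous (j - l)).comp
      (by fun_prop : Continuous fun z : ℝ × ℝ => (z.1, z.2 - (l : ℝ) * max z.1 0))
  have h3 : Continuous fun z : ℝ × ℝ => ((z.2 - j * max z.1 0 : ℝ) : ℂ) := by fun_prop
  exact ((h1.div_const _).neg.mul h3).mul h2

theorem summable_transportTerm (hU : IsDecaying U) (hV : IsDecaying V) (s : ℝ) (j : ℤ) (ξ : ℝ) :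
    Summable (transportTerm U V s j ξ) := by
  obtain ⟨C, r, hC, hr, hb⟩ := exists_norm_transportTerm_le hU hV
    (show 0 < max s 0 + 1 by positivity)
  exact .of_norm_bounded ((summable_exp_neg_mul_abs_int hr).mul_left _)
    (hb s ((le_max_left _ _).trans (by linarith)) j ξ)

theorem transportTerm_max_zero (hU : IsDecaying U) (hV : IsDecaying V) (s : ℝ) (j : ℤ) (ξ : ℝ)
    (l : ℤ) : transportTerm U V (max s 0) j ξ l = transportTerm U V s j ξ l := by
  unfold transportTerm
  rw [hU.max_zero, hV.max_zero, max_eq_left (le_max_right s 0)]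

/-- The derivative in the nonlinearity costs part of the exponential rate only, and the class of
decaying families asks for some positive rate. -/
theorem isDecaying_transport (hU : IsDecaying U) (hV : IsDecaying V) :
    IsDecaying (transport U V) where
  continuous j := by
    refine continuous_iff_continuousAt.2 fun z => ?_
    obtain ⟨C, r, hC, hr, hb⟩ := exists_norm_transportTerm_le hU hV
      (show 0 < max z.1 0 + 1 by positivity)
    have h : ContinuousOn (fun z : ℝ × ℝ => ∑' l, transportTerm U V z.1 j z.2 l)
        {y | y.1 < max z.1 0 + 1} := by
      refine continuousOn_tsum (fun l => (continuous_transportTerm hU hV j l).continuousOn)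
        ((summable_exp_neg_mul_abs_int hr).mul_left C) fun l y hy => ?_
      refine (hb y.1 (le_of_lt hy) j y.2 l).trans ?_
      refine mul_le_mul_of_nonneg_right (mul_le_of_le_one_right hC.le ?_) (Real.exp_pos _).le
      rw [Real.exp_le_one_iff, neg_nonpos]
      positivity
    exact h.continuousAt ((isOpen_lt continuous_fst continuous_const).mem_nhds
      (by simp only [mem_ofPred_eq]; linarith [le_max_left z.1 0]))
  max_zero s j ξ := tsum_congr fun l => transportTerm_max_zero hU hV s j ξ l
  bound T hT := by
    obtain ⟨C, r, hC, hr, hb⟩ := exists_norm_transportTerm_le hU hV hT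
    have hs := summable_exp_neg_mul_abs_int hr
    have hpos : 0 < ∑' l : ℤ, Real.exp (-(r * |(l : ℝ)|)) :=
      hs.tsum_pos (fun _ => (Real.exp_pos _).le) 0 (Real.exp_pos _)
    refine ⟨C * ∑' l : ℤ, Real.exp (-(r * |(l : ℝ)|)), r, by positivity, hr, fun t ht j ξ => ?_⟩
    refine (tsum_of_norm_bounded (hs.hasSum.mul_left _) (hb t ht j ξ)).trans (le_of_eq ?_)
    ring

theorem IsDecaying.summable_fieldCoeff (hW : IsDecaying W) (s : ℝ) :
    Summable fun l => ‖fieldCoeff W s l‖ := by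
  obtain ⟨C, r, hC, hr, hb⟩ := hW.bound (max s 0 + 1) (by positivity)
  refine .of_nonneg_of_le (fun _ => norm_nonneg _) (fun l => ?_)
    ((summable_exp_neg_mul_abs_int hr).mul_left C)
  unfold fieldCoeff
  rw [mul_comm Complex.I, ← div_div, norm_div, Complex.norm_I, div_one]
  refine (norm_div_intCast_le _ _).trans ((hb s ?_ l _).trans ?_)
  · linarith [le_max_left s 0]
  · gcongr
    exact le_add_of_nonneg_right (abs_nonneg _)

theorem norm_exp_I_mul (a b : ℝ) : ‖Complex.exp (Complex.I * a * b)‖ = 1 := by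
  rw [Complex.norm_exp]; simp

theorem norm_exp_I_intCast_mul (l : ℤ) (x : ℝ) : ‖Complex.exp (Complex.I * l * x)‖ = 1 := by
  have := norm_exp_I_mul l x
  push_cast at this
  exact this

theorem IsDecaying.hasSum_field (hW : IsDecaying W) (s x : ℝ) :
    HasSum (fun l : ℤ => fieldCoeff W s l * Complex.exp (Complex.I * l * x)) (field W s x) := by
  refine (Summable.of_norm ((hW.summable_fieldCoeff s).congr fun l => ?_)).hasSum
  rw [norm_mul, norm_exp_I_intCast_mul, mul_one]

theorem wave_add (x v : ℝ) (j l : ℤ) (ξ s : ℝ) :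
    wave x v (j + l) (ξ + l * s) = wave x v j ξ * Complex.exp (Complex.I * l * ((x + s * v : ℝ))) := by
  unfold wave
  rw [← Complex.exp_add]
  push_cast
  ring_nf

theorem IsDecaying.integrable (hW : IsDecaying W) (s x v : ℝ) :
    Integrable (fun X : ℤ × ℝ => W s X.1 X.2 * wave x v X.1 X.2) freqMeasure := by
  obtain ⟨C, r, hC, hr, hb⟩ := hW.bound (max s 0 + 1) (by positivity)
  refine integrable_freq (A := fun j ξ => W s j ξ * wave x v j ξ) (C := C)
    (fun j => (hW.continuous_right s j).mul (continuous_wave_right x v j)) hr fun j ξ => ?_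
  rw [norm_mul, norm_wave, mul_one]
  exact hb s (by linarith [le_max_left s 0]) j ξ

/-- In physical space the transport nonlinearity is the product of the field and the derivative in
`v` along the free flow. -/
theorem synth_transport (hU : IsDecaying U) (hV : IsDecaying V) (s x v : ℝ) :
    synth (transport U V s) x v = -(field U s (x + max s 0 * v) * ((2 * Real.pi : ℂ)⁻¹ *
      ∫ X, V s X.1 X.2 * (Complex.I * ((X.2 - X.1 * max s 0 : ℝ) : ℂ)) * wave x v X.1 X.2
        ∂freqMeasure)) := by
  set J := ∫ X, V s X.1 X.2 * (Complex.I * ((X.2 - X.1 * max s 0 : ℝ) : ℂ)) * wave x v X.1 X.2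
        ∂freqMeasure with hJ
  obtain ⟨C, r, hC, hr, hb⟩ := exists_norm_transportTerm_le hU hV
    (show 0 < max s 0 + 1 by positivity)
  have hs : s ≤ max s 0 + 1 := by linarith [le_max_left s 0]
  have hcont : ∀ l j, Continuous fun ξ => transportTerm U V s j ξ l * wave x v j ξ := fun l j =>
    ((continuous_transportTerm hU hV j l).comp
      (by fun_prop : Continuous fun ξ : ℝ => (s, ξ))).mul (continuous_wave_right x v j)
  have hbl : ∀ l j ξ, ‖transportTerm U V s j ξ l * wave x v j ξ‖ ≤
      (C * Real.exp (-(r * |(l : ℝ)|))) * Real.exp (-(r * (|(j : ℝ)| + |ξ|))) := fun l j ξ => by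
    rw [norm_mul, norm_wave, mul_one]
    exact (hb s hs j ξ l).trans (le_of_eq (by ring))
  have h1 : HasSum (fun l => ∫ X, transportTerm U V s X.1 X.2 l * wave x v X.1 X.2 ∂freqMeasure)
      (∫ X, transport U V s X.1 X.2 * wave x v X.1 X.2 ∂freqMeasure) := by
    have := hasSum_integral_of_summable_integral_norm (μ := freqMeasure)
      (F := fun (l : ℤ) (X : ℤ × ℝ) => transportTerm U V s X.1 X.2 l * wave x v X.1 X.2)
      (fun l => integrable_freq (A := fun j ξ => transportTerm U V s j ξ l * wave x v j ξ)
        (hcont l) hr (hbl l)) ?_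
    · simp only [tsum_mul_right] at this
      exact this
    · refine .of_nonneg_of_le (fun l => by positivity) (fun l => ?_)
        ((summable_exp_neg_mul_abs_int hr).mul_right
          (C * ∫ X : ℤ × ℝ, Real.exp (-(r * (|(X.1 : ℝ)| + |X.2|))) ∂freqMeasure))
      rw [← integral_const_mul, ← integral_const_mul]
      refine integral_mono_of_nonneg (Eventually.of_forall fun X => norm_nonneg _)
        ((((integrable_exp_freq hr 1).congr (Eventually.of_forall fun X => one_mul _)).const_mul
          _).const_mul _)
        (Eventually.of_forall fun X => (hbl l X.1 X.2).trans (le_of_eq ?_))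
      simp only
      ring
  -- Translation of the frequencies by `(l, l s)` leaves the Haar measure invariant and splits off
  -- the factor `e^{i l (x + s v)}`, the plane wave of the field along the free flow.
  have h2 : ∀ l : ℤ, ∫ X, transportTerm U V s X.1 X.2 l * wave x v X.1 X.2 ∂freqMeasure =
      -(fieldCoeff U s l * Complex.exp (Complex.I * l * ((x + max s 0 * v : ℝ)))) * J := by
    intro l
    rw [hJ, ← integral_const_mul, ← integral_freq_sub (fun j ξ =>
      -(fieldCoeff U s l * Complex.exp (Complex.I * l * ((x + max s 0 * v : ℝ)))) *
      (V s j ξ * (Complex.I * ((ξ - j * max s 0 : ℝ) : ℂ)) * wave x v j ξ)) l (l * max s 0)]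
    congr 1
    ext X
    have e := wave_add x v (X.1 - l) l (X.2 - l * max s 0) (max s 0)
    rw [sub_add_cancel, sub_add_cancel] at e
    rw [e]
    unfold transportTerm fieldCoeff
    rw [show X.2 - l * max s 0 - ((X.1 - l : ℤ) : ℝ) * max s 0 = X.2 - X.1 * max s 0 by
      push_cast; ring]
    rcases eq_or_ne l 0 with h | h
    · simp [h]
    · have hl : (l : ℂ) ≠ 0 := by exact_mod_cast h
      field_simp [Complex.I_ne_zero]
  simp only [h2] at h1
  have h3 := ((hU.hasSum_field s (x + max s 0 * v)).neg.mul_right J)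
  unfold synth
  rw [h1.unique h3]
  ring

end

/-! ### Trigonometric series with exponentially decaying coefficients -/

section trigSeries

variable {c : ℤ → ℂ} {C r : ℝ}

/-- The trigonometric series with coefficients `c`. -/
def trigSeries (c : ℤ → ℂ) (x : ℝ) : ℂ := ∑' l : ℤ, c l * Complex.exp (Complex.I * l * x)

theorem hasDerivAt_exp_I_mul (l : ℤ) (x : ℝ) :
    HasDerivAt (fun y : ℝ => Complex.exp (Complex.I * l * y))
      (Complex.I * l * Complex.exp (Complex.I * l * x)) x := by
  have h1 : HasDerivAt (fun y : ℝ => Complex.I * l * y) (Complex.I * l) x := by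
    have := (Complex.ofRealCLM.hasDerivAt (x := x)).const_mul (Complex.I * l)
    simpa using this
  exact h1.cexp.congr_deriv (by ring)

theorem exists_norm_pow_mul_le (hr : 0 < r) (n : ℕ) : ∃ D : ℝ, 0 < D ∧ ∀ (c : ℤ → ℂ) (C : ℝ), 0 ≤ C →
    (∀ l, ‖c l‖ ≤ C * Real.exp (-(r * |(l : ℝ)|))) →
    ∀ l, ‖c l * (Complex.I * l) ^ n‖ ≤ C * D * Real.exp (-(r / 2 * |(l : ℝ)|)) := by
  obtain ⟨D, hD, hDb⟩ := exists_one_add_pow_mul_exp_le n (half_pos hr)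
  refine ⟨D, hD, fun c C hC hc l => ?_⟩
  rw [norm_mul, norm_pow, norm_mul, Complex.norm_I, one_mul, Complex.norm_intCast]
  have h1 := hDb |(l : ℝ)| (abs_nonneg _)
  have h2 : |(l : ℝ)| ^ n ≤ (1 + |(l : ℝ)|) ^ n := by gcongr; linarith
  calc _ ≤ C * Real.exp (-(r * |(l : ℝ)|)) * (1 + |(l : ℝ)|) ^ n := by
        gcongr; exact hc l
    _ = C * ((1 + |(l : ℝ)|) ^ n * Real.exp (-(r / 2 * |(l : ℝ)|))) *
        Real.exp (-(r / 2 * |(l : ℝ)|)) := by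
        rw [show -(r * |(l : ℝ)|) = -(r / 2 * |(l : ℝ)|) + -(r / 2 * |(l : ℝ)|) by ring,
          Real.exp_add]
        ring
    _ ≤ _ := by gcongr

theorem summable_trigSeries (hr : 0 < r) (hc : ∀ l, ‖c l‖ ≤ C * Real.exp (-(r * |(l : ℝ)|)))
    (x : ℝ) : Summable fun l : ℤ => c l * Complex.exp (Complex.I * l * x) :=
  .of_norm_bounded ((summable_exp_neg_mul_abs_int hr).mul_left C) fun l => by
    rw [norm_mul, norm_exp_I_intCast_mul, mul_one]; exact hc l

theorem norm_trigSeries_le (hr : 0 < r) (hc : ∀ l, ‖c l‖ ≤ C * Real.exp (-(r * |(l : ℝ)|)))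
    (x : ℝ) : ‖trigSeries c x‖ ≤ C * ∑' l : ℤ, Real.exp (-(r * |(l : ℝ)|)) :=
  tsum_of_norm_bounded ((summable_exp_neg_mul_abs_int hr).hasSum.mul_left C) fun l => by
    rw [norm_mul, norm_exp_I_intCast_mul, mul_one]; exact hc l

theorem hasDerivAt_trigSeries (hr : 0 < r) (hC : 0 ≤ C)
    (hc : ∀ l, ‖c l‖ ≤ C * Real.exp (-(r * |(l : ℝ)|))) (x : ℝ) :
    HasDerivAt (trigSeries c) (trigSeries (fun l => c l * (Complex.I * l)) x) x := by
  obtain ⟨D, hD, hDb⟩ := exists_norm_pow_mul_le hr 1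
  have hb := hDb c C hC hc
  simp only [pow_one] at hb
  have := hasDerivAt_tsum (g := fun (l : ℤ) (y : ℝ) => c l * Complex.exp (Complex.I * l * y))
    (g' := fun (l : ℤ) (y : ℝ) => c l * (Complex.I * l) * Complex.exp (Complex.I * l * y))
    (u := fun l : ℤ => C * D * Real.exp (-(r / 2 * |(l : ℝ)|))) (y₀ := 0)
    ((summable_exp_neg_mul_abs_int (half_pos hr)).mul_left _)
    (fun l y => ((hasDerivAt_exp_I_mul l y).const_mul (c l)).congr_deriv (by ring))
    (fun l y => by rw [norm_mul, norm_exp_I_intCast_mul, mul_one]; exact hb l)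
    (summable_trigSeries hr hc 0) x
  exact this

theorem iteratedDeriv_trigSeries (hr : 0 < r) (hC : 0 ≤ C)
    (hc : ∀ l, ‖c l‖ ≤ C * Real.exp (-(r * |(l : ℝ)|))) (n : ℕ) :
    iteratedDeriv n (trigSeries c) = trigSeries fun l => c l * (Complex.I * l) ^ n := by
  induction n with
  | zero => simp
  | succ n ih =>
    obtain ⟨D, hD, hDb⟩ := exists_norm_pow_mul_le hr n
    ext x
    rw [iteratedDeriv_succ, ih,
      (hasDerivAt_trigSeries (half_pos hr) (by positivity) (hDb c C hC hc) x).deriv]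
    simp only [pow_succ, mul_assoc]

theorem contDiff_trigSeries (hr : 0 < r) (hC : 0 ≤ C)
    (hc : ∀ l, ‖c l‖ ≤ C * Real.exp (-(r * |(l : ℝ)|))) : ContDiff ℝ ∞ (trigSeries c) := by
  refine contDiff_of_differentiable_iteratedDeriv fun n _ => ?_
  rw [iteratedDeriv_trigSeries hr hC hc]
  obtain ⟨D, hD, hDb⟩ := exists_norm_pow_mul_le hr n
  exact fun x => (hasDerivAt_trigSeries (half_pos hr) (by positivity)
    (hDb c C hC hc) x).differentiableAt

theorem exp_I_intCast_mul_add_two_pi (l : ℤ) (x : ℝ) :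
    Complex.exp (Complex.I * l * ((x + 2 * Real.pi : ℝ) : ℂ)) = Complex.exp (Complex.I * l * x) := by
  rw [← Complex.exp_periodic.int_mul l (Complex.I * l * x)]
  congr 1
  push_cast
  ring

theorem trigSeries_add_two_pi (c : ℤ → ℂ) (x : ℝ) :
    trigSeries c (x + 2 * Real.pi) = trigSeries c x :=
  tsum_congr fun l => by rw [exp_I_intCast_mul_add_two_pi]

theorem integral_exp_I_intCast_mul (l : ℤ) :
    ∫ x in (0 : ℝ)..(2 * Real.pi), Complex.exp (Complex.I * l * x) =
      if l = 0 then (2 * Real.pi : ℂ) else 0 := by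
  split_ifs with h
  · simp [h]
  · have hl : Complex.I * l ≠ 0 := mul_ne_zero Complex.I_ne_zero (by exact_mod_cast h)
    rw [integral_exp_mul_complex hl]
    have := exp_I_intCast_mul_add_two_pi l 0
    rw [zero_add] at this
    rw [this, sub_self, zero_div]

/-- The Fourier coefficients of a trigonometric series. -/
theorem integral_trigSeries_mul_exp (hr : 0 < r)
    (hc : ∀ l, ‖c l‖ ≤ C * Real.exp (-(r * |(l : ℝ)|))) (j : ℤ) :
    ∫ x in (0 : ℝ)..(2 * Real.pi), trigSeries c x * Complex.exp (Complex.I * (-j : ℤ) * x) =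
      2 * Real.pi * c j := by
  have h := intervalIntegral.hasSum_intervalIntegral_of_summable_norm (a := 0) (b := 2 * Real.pi)
    (f := fun l : ℤ => (⟨fun x : ℝ => c l * Complex.exp (Complex.I * l * x) *
      Complex.exp (Complex.I * (-j : ℤ) * x), by fun_prop⟩ : C(ℝ, ℂ))) ?_
  · simp only [ContinuousMap.coe_mk, tsum_mul_right] at h
    refine h.unique ?_
    have e : ∀ l : ℤ, ∫ x in (0 : ℝ)..(2 * Real.pi), c l * Complex.exp (Complex.I * l * x) *
        Complex.exp (Complex.I * (-j : ℤ) * x) = if l = j then 2 * Real.pi * c j else 0 := by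
      intro l
      have : ∀ x : ℝ, c l * Complex.exp (Complex.I * l * x) *
          Complex.exp (Complex.I * (-j : ℤ) * x) =
          c l * Complex.exp (Complex.I * (l - j : ℤ) * x) := fun x => by
        rw [mul_assoc, ← Complex.exp_add]; push_cast; ring_nf
      simp only [this]
      rw [intervalIntegral.integral_const_mul, integral_exp_I_intCast_mul]
      by_cases hlj : l = j
      · simp [hlj, mul_comm]
      · simp [hlj, sub_eq_zero]
    simp only [e]
    exact hasSum_ite_eq j _
  · refine .of_nonneg_of_le (fun l => norm_nonneg _) (fun l => ?_)
      ((summable_exp_neg_mul_abs_int hr).mul_left C)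
    rw [ContinuousMap.norm_le _ ((norm_nonneg _).trans (hc l))]
    intro x
    simp only [ContinuousMap.restrict_apply, ContinuousMap.coe_mk]
    rw [norm_mul, norm_mul, norm_exp_I_intCast_mul, norm_exp_I_intCast_mul, mul_one, mul_one]
    exact hc l

end trigSeries

/-! ### Gaussian regularisation of the velocity integral -/

/-- An inverse Fourier transform has the velocity integral that is given by the value of its
Fourier transform at the origin. -/
theorem hasVelocityIntegral_of_fourier {g G : ℝ → ℂ} (hG : IsFourierTransform g G) :
    HasVelocityIntegral g (G 0) := by
  obtain ⟨hGc, hGi, hg⟩ := hG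
  have hn : ∀ η v : ℝ, ‖Complex.exp (Complex.I * η * v)‖ = 1 := norm_exp_I_mul
  have hgc : Continuous g := by
    rw [show g = fun v : ℝ => (2 * Real.pi : ℂ)⁻¹ * ∫ η : ℝ, G η * Complex.exp (Complex.I * η * v)
      from funext hg]
    refine continuous_const.mul (continuous_of_dominated (bound := fun η => ‖G η‖)
      (fun v => (by fun_prop : Continuous _).aestronglyMeasurable)
      (fun v => Eventually.of_forall fun η => ?_) hGi.norm
      (Eventually.of_forall fun η => by fun_prop))
    rw [norm_mul, hn, mul_one]
  have hgb : ∀ v, ‖g v‖ ≤ ‖(2 * Real.pi : ℂ)⁻¹‖ * ∫ η, ‖G η‖ := fun v => by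
    rw [hg v, norm_mul]
    gcongr
    refine (norm_integral_le_integral_norm _).trans (le_of_eq ?_)
    congr 1
    ext η
    rw [norm_mul, hn, mul_one]
  have hgauss : ∀ δ : ℝ, 0 < δ → Integrable fun v : ℝ => (Real.exp (-(δ * v ^ 2)) : ℂ) :=
    fun δ hδ => by
      have := (integrable_exp_neg_mul_sq hδ).ofReal (𝕜 := ℂ)
      simpa [neg_mul] using this
  refine ⟨fun δ hδ => (hgauss δ hδ).mul_bdd hgc.aestronglyMeasurable
    (Eventually.of_forall hgb), ?_⟩
  -- By Fubini, the integral of `e^{-δ v²} g` is the integral of `G` against a normalised Gaussian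
  -- that concentrates at the origin as `δ → 0`. The parameter `1 / (4 π² δ)` converts between the
  -- two normalisations of the Fourier transform.
  have key := Real.tendsto_integral_gaussian_smul' hGi (v := 0) hGc.continuousAt
  have hlim : Tendsto (fun δ : ℝ => 1 / (4 * Real.pi ^ 2) * δ⁻¹) (𝓝[>] 0) atTop :=
    tendsto_inv_nhdsGT_zero.const_mul_atTop (by positivity)
  refine (key.comp hlim).congr' ?_
  filter_upwards [self_mem_nhdsWithin] with δ hδ
  have hδ0 : (0 : ℝ) < δ := hδ
  have hδc : (δ : ℂ) ≠ 0 := by exact_mod_cast hδ0.ne'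
  have hπ : (Real.pi : ℂ) ≠ 0 := by exact_mod_cast Real.pi_ne_zero
  have hfub : ∫ v : ℝ, (Real.exp (-(δ * v ^ 2)) : ℂ) * g v = (2 * Real.pi : ℂ)⁻¹ *
      ∫ η : ℝ, (∫ v : ℝ, Complex.exp (Complex.I * η * v) *
        Complex.exp (-(δ : ℂ) * (v : ℂ) ^ 2)) * G η := by
    rw [← integral_const_mul]
    simp only [← integral_mul_const, ← integral_const_mul]
    rw [integral_integral_swap]
    · refine integral_congr_ae (Eventually.of_forall fun v => ?_)
      simp only
      rw [hg v, ← integral_const_mul, ← integral_const_mul]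
      refine integral_congr_ae (Eventually.of_forall fun η => ?_)
      simp only
      push_cast
      ring_nf
    · have := ((hGi.mul_prod (hgauss δ hδ0)).const_mul ((2 * Real.pi : ℂ)⁻¹))
      refine this.mono (by
        refine Continuous.aestronglyMeasurable ?_
        unfold Function.uncurry
        fun_prop) (Eventually.of_forall fun z => le_of_eq ?_)
      simp only [Function.uncurry]
      rw [norm_mul, norm_mul, norm_mul, hn, one_mul, norm_mul, norm_mul, mul_comm (‖G z.1‖)]
      push_cast
      rw [neg_mul]
  rw [hfub, ← integral_const_mul]
  refine integral_congr_ae (Eventually.of_forall fun w => ?_)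
  simp only
  rw [fourierIntegral_gaussian (by simpa using hδ0), zero_sub, norm_neg, smul_eq_mul]
  have eA : ((Real.pi : ℂ) * ((1 / (4 * Real.pi ^ 2) * δ⁻¹ : ℝ) : ℂ)) ^
      ((Module.finrank ℝ ℝ : ℂ) / 2) = (2 * Real.pi : ℂ)⁻¹ * (Real.pi / δ : ℂ) ^ (1 / 2 : ℂ) := by
    have e1 : ((Module.finrank ℝ ℝ : ℂ) / 2) = ((1 / 2 : ℝ) : ℂ) := by simp
    have e2 : (Real.pi : ℂ) * ((1 / (4 * Real.pi ^ 2) * δ⁻¹ : ℝ) : ℂ) =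
        ((Real.pi * (1 / (4 * Real.pi ^ 2) * δ⁻¹) : ℝ) : ℂ) := by push_cast; ring
    have e3 : (Real.pi : ℂ) / δ = ((Real.pi / δ : ℝ) : ℂ) := by push_cast; ring
    have e4 : (1 / 2 : ℂ) = ((1 / 2 : ℝ) : ℂ) := by push_cast; ring
    rw [e1, e2, e3, e4, ← Complex.ofReal_cpow (by positivity), ← Complex.ofReal_cpow (by positivity),
      ← Real.sqrt_eq_rpow, ← Real.sqrt_eq_rpow]
    have e5 : √(Real.pi * (1 / (4 * Real.pi ^ 2) * δ⁻¹)) = (2 * Real.pi)⁻¹ * √(Real.pi / δ) := by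
      rw [show Real.pi * (1 / (4 * Real.pi ^ 2) * δ⁻¹) = ((2 * Real.pi)⁻¹) ^ 2 * (Real.pi / δ) by
        have := Real.pi_ne_zero
        field_simp
        ring, Real.sqrt_mul (by positivity), Real.sqrt_sq (by positivity)]
    rw [e5]
    push_cast
    ring
  have eB : Complex.exp (-Real.pi ^ 2 * ((1 / (4 * Real.pi ^ 2) * δ⁻¹ : ℝ) : ℂ) *
      ((‖w‖ : ℝ) : ℂ) ^ 2) = Complex.exp (-(w : ℂ) ^ 2 / (4 * δ)) := by
    congr 1
    rw [Real.norm_eq_abs]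
    have : ((|w| : ℝ) : ℂ) ^ 2 = (w : ℂ) ^ 2 := by
      rw [← Complex.ofReal_pow, sq_abs, Complex.ofReal_pow]
    rw [this]
    push_cast
    field_simp
  rw [eA, eB]
  ring

/-! ### From Fourier coefficients to classical solutions -/

/-- The distribution with Fourier coefficients `W` along the free flow. -/
def distr (W : ℝ → ℤ → ℝ → ℂ) (t x v : ℝ) : ℂ := synth (W t) (x - t * v) v

/-- `W` solves the Vlasov–Poisson system along the free flow on the Fourier side.  Here `W` contains
the contribution of the equilibrium. -/
structure IsFourierSolution (W : ℝ → ℤ → ℝ → ℂ) : Prop where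
  decaying : IsDecaying W
  eq : ∀ t j ξ, 0 ≤ t → W t j ξ = W 0 j ξ + ∫ s in (0 : ℝ)..t, transport W W s j ξ

/-- The Fourier coefficients of the equilibrium. -/
def equilibriumCoeff (μ : ℝ → ℝ) (_ : ℝ) (j : ℤ) (ξ : ℝ) : ℂ := if j = 0 then equilibriumHat μ ξ else 0

section

variable {U V W : ℝ → ℤ → ℝ → ℂ} {μ : ℝ → ℝ} {θ₀ C₀ : ℝ}

theorem IsDecaying.mul {p : ℝ → ℤ → ℝ → ℂ} (hW : IsDecaying W)
    (hp : ∀ j, Continuous fun z : ℝ × ℝ => p z.1 j z.2) (hm : ∀ t j ξ, p (max t 0) j ξ = p t j ξ)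
    (hb : ∀ t j ξ, ‖p t j ξ‖ ≤ (1 + max t 0) * (|(j : ℝ)| + |ξ|)) :
    IsDecaying fun t j ξ => p t j ξ * W t j ξ where
  continuous j := (hp j).mul (hW.continuous j)
  max_zero t j ξ := by rw [hm, hW.max_zero]
  bound T hT := by
    obtain ⟨C, r, hC, hr, h⟩ := hW.bound T hT
    obtain ⟨D, hD, hDb⟩ := exists_one_add_pow_mul_exp_le 1 (half_pos hr)
    refine ⟨(1 + T) * C * D, r / 2, by positivity, by positivity, fun t ht j ξ => ?_⟩
    have h0 : 0 ≤ max t 0 := le_max_right _ _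
    have h1 := h t ht j ξ
    have h2 := hb t j ξ
    set x := |(j : ℝ)| + |ξ| with hx
    have hx0 : 0 ≤ x := by positivity
    have h3 : x * Real.exp (-(r / 2 * x)) ≤ D := by
      refine le_trans ?_ (hDb x hx0)
      rw [pow_one]; gcongr; linarith
    have h4 : max t 0 ≤ T := max_le ht hT.le
    rw [norm_mul]
    calc _ ≤ ((1 + T) * x) * (C * Real.exp (-(r * x))) := by
          refine mul_le_mul (h2.trans (by gcongr)) h1 (norm_nonneg _) (by positivity)
      _ = (1 + T) * C * (x * Real.exp (-(r / 2 * x))) * Real.exp (-(r / 2 * x)) := by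
          rw [show -(r * x) = -(r / 2 * x) + -(r / 2 * x) by ring, Real.exp_add]; ring
      _ ≤ _ := by gcongr

theorem IsDecaying.sub (hV : IsDecaying V) (hW : IsDecaying W) :
    IsDecaying fun t j ξ => V t j ξ - W t j ξ where
  continuous j := (hV.continuous j).sub (hW.continuous j)
  max_zero t j ξ := by rw [hV.max_zero, hW.max_zero]
  bound T hT := by
    obtain ⟨A, a, hA, ha, h1⟩ := hV.bound T hT
    obtain ⟨B, b, hB, hb, h2⟩ := hW.bound T hT
    refine ⟨A + B, min a b, by positivity, lt_min ha hb, fun t ht j ξ => ?_⟩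
    rw [add_mul]
    refine (norm_sub_le _ _).trans (add_le_add ((h1 t ht j ξ).trans ?_) ((h2 t ht j ξ).trans ?_))
    · gcongr; exact min_le_left _ _
    · gcongr; exact min_le_right _ _

theorem IsDecaying.add (hV : IsDecaying V) (hW : IsDecaying W) :
    IsDecaying fun t j ξ => V t j ξ + W t j ξ where
  continuous j := (hV.continuous j).add (hW.continuous j)
  max_zero t j ξ := by rw [hV.max_zero, hW.max_zero]
  bound T hT := by
    obtain ⟨A, a, hA, ha, h1⟩ := hV.bound T hT
    obtain ⟨B, b, hB, hb, h2⟩ := hW.bound T hT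
    refine ⟨A + B, min a b, by positivity, lt_min ha hb, fun t ht j ξ => ?_⟩
    rw [add_mul]
    refine (norm_add_le _ _).trans (add_le_add ((h1 t ht j ξ).trans ?_) ((h2 t ht j ξ).trans ?_))
    · gcongr; exact min_le_left _ _
    · gcongr; exact min_le_right _ _

theorem IsDecaying.exists_bound (hW : IsDecaying W) (t : ℝ) : ∃ C r : ℝ, 0 < C ∧ 0 < r ∧
    ∀ (j : ℤ) (ξ : ℝ), ‖W t j ξ‖ ≤ C * Real.exp (-(r * (|(j : ℝ)| + |ξ|))) := by
  obtain ⟨C, r, hC, hr, h⟩ := hW.bound (max t 0 + 1) (by positivity)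
  exact ⟨C, r, hC, hr, h t (by linarith [le_max_left t 0])⟩

/-- Multiplication by the Fourier multiplier of `∂ₓ`. -/
theorem IsDecaying.mul_x (hW : IsDecaying W) :
    IsDecaying fun t j ξ => Complex.I * (j : ℂ) * W t j ξ :=
  hW.mul (p := fun _ j _ => Complex.I * (j : ℂ)) (fun _ => continuous_const) (fun _ _ _ => rfl)
    fun t j ξ => by
      rw [norm_mul, Complex.norm_I, one_mul, Complex.norm_intCast]
      have : 0 ≤ max t 0 := le_max_right _ _
      nlinarith [abs_nonneg (j : ℝ), abs_nonneg ξ]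

/-- Multiplication by the Fourier multiplier of `∂ᵥ`, along the free flow. -/
theorem IsDecaying.mul_v (hW : IsDecaying W) :
    IsDecaying fun t j ξ => Complex.I * ((ξ - j * max t 0 : ℝ) : ℂ) * W t j ξ :=
  hW.mul (p := fun t j ξ => Complex.I * ((ξ - j * max t 0 : ℝ) : ℂ))
    (fun _ => by fun_prop)
    (fun t j ξ => by simp) fun t j ξ => by
      rw [norm_mul, Complex.norm_I, one_mul, Complex.norm_real, Real.norm_eq_abs]
      exact abs_sub_mul_max_le t j ξ

theorem synth_add (hV : IsDecaying V) (hW : IsDecaying W) (t x v : ℝ) :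
    synth (fun j ξ => V t j ξ + W t j ξ) x v = synth (V t) x v + synth (W t) x v := by
  unfold synth
  rw [← mul_add, ← integral_add (hV.integrable t x v) (hW.integrable t x v)]
  simp only [add_mul]

theorem synth_sub (hV : IsDecaying V) (hW : IsDecaying W) (t x v : ℝ) :
    synth (fun j ξ => V t j ξ - W t j ξ) x v = synth (V t) x v - synth (W t) x v := by
  unfold synth
  rw [← mul_sub, ← integral_sub (hV.integrable t x v) (hW.integrable t x v)]
  simp only [sub_mul]

theorem synth_const_mul (Φ : ℤ → ℝ → ℂ) (a : ℂ) (x v : ℝ) :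
    synth (fun j ξ => a * Φ j ξ) x v = a * synth Φ x v := by
  unfold synth
  have h : ∀ X : ℤ × ℝ, a * Φ X.1 X.2 * wave x v X.1 X.2 = a * (Φ X.1 X.2 * wave x v X.1 X.2) :=
    fun X => mul_assoc _ _ _
  simp only [h, integral_const_mul]
  ring

theorem IsDecaying.continuous_distr (hW : IsDecaying W) :
    Continuous fun z : ℝ × ℝ × ℝ => distr W z.1 z.2.1 z.2.2 := by
  refine continuous_iff_continuousAt.2 fun z => ?_
  obtain ⟨C, r, hC, hr, hb⟩ := hW.bound (max z.1 0 + 1) (by positivity)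
  refine (continuousAt_const (y := (2 * Real.pi : ℂ)⁻¹)).mul (continuousAt_integral_freq
    (A := fun (y : ℝ × ℝ × ℝ) j ξ => W y.1 j ξ * wave (y.2.1 - y.1 * y.2.2) y.2.2 j ξ) (C := C)
    (fun y j => (hW.continuous_right y.1 j).mul (continuous_wave_right _ _ j)) hr ?_
    fun j ξ => Continuous.continuousAt ?_)
  · have : ∀ᶠ y : ℝ × ℝ × ℝ in 𝓝 z, y.1 < max z.1 0 + 1 :=
      (isOpen_lt continuous_fst continuous_const).mem_nhds
        (by simp only [mem_ofPred_eq]; linarith [le_max_left z.1 0])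
    filter_upwards [this] with y hy j ξ
    rw [norm_mul, norm_wave, mul_one]
    exact hb y.1 hy.le j ξ
  · exact ((hW.continuous j).comp (by fun_prop : Continuous fun y : ℝ × ℝ × ℝ => (y.1, ξ))).mul
      ((continuous_wave j).comp
        (by fun_prop : Continuous fun y : ℝ × ℝ × ℝ => ((y.2.1 - y.1 * y.2.2, y.2.2), ξ)))

theorem hasDerivAt_wave (x v a b : ℝ) (j : ℤ) (ξ s : ℝ) :
    HasDerivAt (fun s : ℝ => wave (x + s * a) (v + s * b) j ξ)
      (Complex.I * (j * a + ξ * b) * wave (x + s * a) (v + s * b) j ξ) s := by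
  unfold wave
  have h1 : HasDerivAt (fun s : ℝ => Complex.I * (j * ((x + s * a : ℝ) : ℂ) +
      ξ * ((v + s * b : ℝ) : ℂ))) (Complex.I * (j * a + ξ * b)) s := by
    have h := (((Complex.ofRealCLM.hasDerivAt (x := s)).mul_const
      (Complex.I * (j * a + ξ * b))).const_add (Complex.I * (j * x + ξ * v)))
    refine (h.congr_of_eventuallyEq (Eventually.of_forall fun u => ?_)).congr_deriv (by simp)
    simp only [Complex.ofRealCLM_apply]
    push_cast
    ring
  exact h1.cexp.congr_deriv (by ring)

/-- Derivative of a distribution along a line in phase space. -/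
theorem IsDecaying.hasDerivAt_synth (hW : IsDecaying W) (t x v a b s₀ : ℝ) :
    HasDerivAt (fun s : ℝ => synth (W t) (x + s * a) (v + s * b))
      (synth (fun j ξ => Complex.I * (j * a + ξ * b) * W t j ξ) (x + s₀ * a) (v + s₀ * b)) s₀ := by
  obtain ⟨C, r, hC, hr, hb⟩ := hW.exists_bound t
  obtain ⟨D, hD, hDb⟩ := exists_one_add_pow_mul_exp_le 1 (half_pos hr)
  have h := hasDerivAt_integral_freq (s₀ := s₀)
    (A := fun s j ξ => W t j ξ * wave (x + s * a) (v + s * b) j ξ)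
    (A' := fun s j ξ => Complex.I * (j * a + ξ * b) * W t j ξ * wave (x + s * a) (v + s * b) j ξ)
    (fun s j => (hW.continuous_right t j).mul (continuous_wave_right _ _ j))
    (fun j => (((by fun_prop : Continuous fun ξ : ℝ => Complex.I * ((j : ℂ) * a + ξ * b))).mul
      (hW.continuous_right t j)).mul (continuous_wave_right _ _ j))
    (C := C) (C' := (|a| + |b|) * C * D) (half_pos hr)
    (fun s _ j ξ => ((hasDerivAt_wave x v a b j ξ s).const_mul (W t j ξ)).congr_deriv (by ring))
    (fun j ξ => ?_) fun s _ j ξ => ?_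
  · exact h.const_mul _
  · rw [norm_mul, norm_wave, mul_one]
    refine (hb j ξ).trans ?_
    gcongr
    linarith
  · have h1 := hb j ξ
    have hx : ‖Complex.I * ((j : ℂ) * a + ξ * b)‖ ≤ (|a| + |b|) * (|(j : ℝ)| + |ξ|) := by
      rw [norm_mul, Complex.norm_I, one_mul]
      refine (norm_add_le _ _).trans ?_
      rw [norm_mul, norm_mul, Complex.norm_intCast, Complex.norm_real, Complex.norm_real,
        Complex.norm_real, Real.norm_eq_abs, Real.norm_eq_abs, Real.norm_eq_abs]
      nlinarith [abs_nonneg (j : ℝ), abs_nonneg ξ, abs_nonneg a, abs_nonneg b,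
        mul_nonneg (abs_nonneg (j : ℝ)) (abs_nonneg b), mul_nonneg (abs_nonneg ξ) (abs_nonneg a)]
    set z := |(j : ℝ)| + |ξ| with hz
    have hz0 : 0 ≤ z := by positivity
    have h3 : z * Real.exp (-(r / 2 * z)) ≤ D := by
      refine le_trans ?_ (hDb z hz0)
      rw [pow_one]; gcongr; linarith
    rw [norm_mul, norm_wave, mul_one, norm_mul]
    calc _ ≤ ((|a| + |b|) * z) * (C * Real.exp (-(r * z))) := by gcongr
      _ = (|a| + |b|) * C * (z * Real.exp (-(r / 2 * z))) * Real.exp (-(r / 2 * z)) := by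
          rw [show -(r * z) = -(r / 2 * z) + -(r / 2 * z) by ring, Real.exp_add]; ring
      _ ≤ _ := by gcongr

theorem IsDecaying.hasDerivAt_distr_x (hW : IsDecaying W) (t x v : ℝ) :
    HasDerivAt (fun y => distr W t y v)
      (distr (fun t j ξ => Complex.I * (j : ℂ) * W t j ξ) t x v) x := by
  have h := hW.hasDerivAt_synth t (-(t * v)) v 1 0 x
  simp only [mul_one, mul_zero, add_zero, Complex.ofReal_one, Complex.ofReal_zero] at h
  unfold distr
  simpa only [neg_add_eq_sub] using h

theorem IsDecaying.hasDerivAt_distr_v (hW : IsDecaying W) {t : ℝ} (ht : 0 ≤ t) (x v : ℝ) :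
    HasDerivAt (fun w => distr W t x w)
      (distr (fun t j ξ => Complex.I * ((ξ - j * max t 0 : ℝ) : ℂ) * W t j ξ) t x v) v := by
  have h := hW.hasDerivAt_synth t x 0 (-t) 1 v
  simp only [mul_one, zero_add, Complex.ofReal_one] at h
  unfold distr
  simp only [max_eq_left ht]
  have e : ∀ w, x - t * w = x + w * -t := fun w => by ring
  simp only [e]
  refine h.congr_deriv ?_
  congr 1
  ext j ξ
  push_cast
  ring

/-- The evolution of the coefficients `W`, extended to negative times. -/
def timeExtension (W : ℝ → ℤ → ℝ → ℂ) (t : ℝ) (j : ℤ) (ξ : ℝ) : ℂ :=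
  W 0 j ξ + ∫ s in (0 : ℝ)..t, transport W W s j ξ

theorem IsDecaying.hasDerivAt_timeExtension (hW : IsDecaying W) (t : ℝ) (j : ℤ) (ξ : ℝ) :
    HasDerivAt (fun s => timeExtension W s j ξ) (transport W W t j ξ) t := by
  have hc : Continuous fun s => transport W W s j ξ :=
    (isDecaying_transport hW hW).continuous_left j ξ
  exact (hc.integral_hasStrictDerivAt 0 t).hasDerivAt.const_add _

/-- The product rule for the coefficients and the plane waves along `x - t v`. Differentiating under
the integral needs a full neighbourhood of `t`, also at `t = 0`; `timeExtension` continues the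
coefficients to negative times and agrees with them on `t ≥ 0`. -/
theorem IsFourierSolution.hasDerivAt_distr_t (hW : IsFourierSolution W) {t : ℝ} (ht : 0 ≤ t)
    (x v : ℝ) : HasDerivWithinAt (fun s => distr W s x v)
      (distr (transport W W) t x v - v * distr (fun t j ξ => Complex.I * (j : ℂ) * W t j ξ) t x v)
      (Ici 0) t := by
  have hd := hW.decaying
  have hN := isDecaying_transport hd hd
  obtain ⟨A, a, hA, ha, hAb⟩ := hd.exists_bound 0
  obtain ⟨B, b, hB, hb, hBb⟩ := hN.bound (t + 1) (by positivity)
  set r := min a b with hr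
  have hr0 : 0 < r := lt_min ha hb
  obtain ⟨D, hD, hDb⟩ := exists_one_add_pow_mul_exp_le 1 (half_pos hr0)
  set C := A + B * (t + 1) with hC
  have hC0 : 0 < C := by positivity
  have hext : ∀ s ∈ Metric.ball t 1, ∀ (j : ℤ) (ξ : ℝ),
      ‖timeExtension W s j ξ‖ ≤ C * Real.exp (-(r * (|(j : ℝ)| + |ξ|))) := by
    intro s hs j ξ
    rw [Real.ball_eq_Ioo, mem_Ioo] at hs
    have hs1 : |s| ≤ t + 1 := abs_le.2 ⟨by linarith, hs.2.le⟩
    refine (norm_add_le _ _).trans ?_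
    have h1 := hAb j ξ
    have h2 : ‖∫ u in (0 : ℝ)..s, transport W W u j ξ‖ ≤
        B * Real.exp (-(b * (|(j : ℝ)| + |ξ|))) * |s - 0| := by
      refine intervalIntegral.norm_integral_le_of_norm_le_const fun u hu => hBb u ?_ j ξ
      rw [mem_uIoc] at hu
      rcases hu with hu | hu <;> linarith [hs.2]
    rw [sub_zero] at h2
    have e1 : Real.exp (-(a * (|(j : ℝ)| + |ξ|))) ≤ Real.exp (-(r * (|(j : ℝ)| + |ξ|))) := by
      gcongr; exact min_le_left _ _
    have e2 : Real.exp (-(b * (|(j : ℝ)| + |ξ|))) ≤ Real.exp (-(r * (|(j : ℝ)| + |ξ|))) := by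
      gcongr; exact min_le_right _ _
    calc _ ≤ A * Real.exp (-(a * (|(j : ℝ)| + |ξ|))) +
          B * Real.exp (-(b * (|(j : ℝ)| + |ξ|))) * |s| := add_le_add h1 h2
      _ ≤ A * Real.exp (-(r * (|(j : ℝ)| + |ξ|))) +
          B * Real.exp (-(r * (|(j : ℝ)| + |ξ|))) * (t + 1) := by gcongr
      _ = _ := by rw [hC]; ring
  have hextc : ∀ s j, Continuous (timeExtension W s j) := fun s j => by
    refine (hd.continuous_right 0 j).add ?_
    exact intervalIntegral.continuous_parametric_intervalIntegral_of_continuous'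
      (hN.continuous_swap j) 0 s
  have hz : ∀ z : ℝ, 0 ≤ z → Real.exp (-(r * z)) ≤ Real.exp (-(r / 2 * z)) ∧
      z * Real.exp (-(r * z)) ≤ D * Real.exp (-(r / 2 * z)) := fun z hz => by
    constructor
    · gcongr; linarith
    · rw [show -(r * z) = -(r / 2 * z) + -(r / 2 * z) by ring, Real.exp_add, ← mul_assoc]
      gcongr
      refine le_trans ?_ (hDb z hz)
      rw [pow_one]; gcongr; linarith
  have key := hasDerivAt_integral_freq (s₀ := t)
    (A := fun s j ξ => timeExtension W s j ξ * wave (x + s * (-v)) (v + s * 0) j ξ)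
    (A' := fun s j ξ => (transport W W s j ξ + Complex.I * (j * ((-v : ℝ) : ℂ) + ξ * ((0 : ℝ) : ℂ)) *
      timeExtension W s j ξ) * wave (x + s * (-v)) (v + s * 0) j ξ)
    (fun s j => (hextc s j).mul (continuous_wave_right _ _ j))
    (fun j => ((hN.continuous_right t j).add ((by fun_prop : Continuous fun ξ : ℝ =>
      Complex.I * ((j : ℂ) * ((-v : ℝ) : ℂ) + ξ * ((0 : ℝ) : ℂ))).mul (hextc t j))).mul
        (continuous_wave_right _ _ j))
    (C := C) (C' := B + |v| * (C * D)) (half_pos hr0)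
    (fun s _ j ξ => ((hd.hasDerivAt_timeExtension s j ξ).mul
      (hasDerivAt_wave x v (-v) 0 j ξ s)).congr_deriv (by ring))
    (fun j ξ => ?_) fun s hs j ξ => ?_
  · have e1 : ∀ s, 0 ≤ s → timeExtension W s = W s := fun s hs => by
      ext j ξ; exact (hW.eq s j ξ hs).symm
    have h1 := (key.const_mul ((2 * Real.pi : ℂ)⁻¹)).hasDerivWithinAt (s := Ici 0)
    refine (h1.congr (fun s hs => ?_) ?_).congr_deriv ?_
    · simp only [e1 s hs]
      simp only [distr, synth, mul_zero, add_zero, mul_neg, ← sub_eq_add_neg]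
    · simp only [e1 t ht]
      simp only [distr, synth, mul_zero, add_zero, mul_neg, ← sub_eq_add_neg]
    · simp only [e1 t ht]
      have h2 := synth_sub hN (V := transport W W) (W := fun t j ξ => (v : ℂ) *
        (Complex.I * (j : ℂ) * W t j ξ)) ⟨fun j => continuous_const.mul (hd.mul_x.continuous j),
          fun t j ξ => by rw [hd.max_zero], fun T hT => by
            obtain ⟨C, r, hC, hr, h⟩ := hd.mul_x.bound T hT
            refine ⟨(|v| + 1) * C, r, by positivity, hr, fun t ht j ξ => ?_⟩
            rw [norm_mul, Complex.norm_real, Real.norm_eq_abs]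
            exact (mul_le_mul (by linarith : |v| ≤ |v| + 1) (h t ht j ξ) (norm_nonneg _)
              (by positivity)).trans (le_of_eq (by ring))⟩ t (x - t * v) v
      rw [synth_const_mul] at h2
      unfold distr
      rw [← h2]
      unfold synth
      congr 2
      ext X
      simp only [mul_zero, add_zero, mul_neg, ← sub_eq_add_neg, Complex.ofReal_neg,
        Complex.ofReal_zero]
      ring
  · rw [norm_mul, norm_wave, mul_one]
    refine (hext t (Metric.mem_ball_self one_pos) j ξ).trans ?_
    exact mul_le_mul_of_nonneg_left (hz (|(j : ℝ)| + |ξ|) (by positivity)).1 hC0.le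
  · rw [norm_mul, norm_wave, mul_one]
    have h1 := hext s hs j ξ
    have hs' := hs
    rw [Real.ball_eq_Ioo, mem_Ioo] at hs'
    have h2 := hBb s hs'.2.le j ξ
    have h0 := hz (|(j : ℝ)| + |ξ|) (by positivity)
    have h3 : ‖Complex.I * ((j : ℂ) * ((-v : ℝ) : ℂ) + ξ * ((0 : ℝ) : ℂ))‖ ≤
        |v| * (|(j : ℝ)| + |ξ|) := by
      rw [Complex.ofReal_zero, mul_zero, add_zero, norm_mul, norm_mul, Complex.norm_I, one_mul,
        Complex.norm_intCast, Complex.norm_real, Real.norm_eq_abs, abs_neg, mul_comm]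
      gcongr
      linarith [abs_nonneg ξ]
    set z := |(j : ℝ)| + |ξ| with hz
    have hz0 : 0 ≤ z := by positivity
    have e2 : Real.exp (-(b * z)) ≤ Real.exp (-(r * z)) := by
      gcongr; exact min_le_right _ _
    calc _ ≤ B * Real.exp (-(b * z)) + |v| * z * (C * Real.exp (-(r * z))) := by
          refine (norm_add_le _ _).trans (add_le_add h2 ?_)
          rw [norm_mul]
          exact mul_le_mul h3 h1 (norm_nonneg _) (by positivity)
      _ ≤ B * Real.exp (-(r * z)) + |v| * z * (C * Real.exp (-(r * z))) := by gcongr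
      _ = B * Real.exp (-(r * z)) + |v| * C * (z * Real.exp (-(r * z))) := by ring
      _ ≤ B * Real.exp (-(r / 2 * z)) + |v| * C * (D * Real.exp (-(r / 2 * z))) := by
          exact add_le_add (mul_le_mul_of_nonneg_left h0.1 hB.le)
            (mul_le_mul_of_nonneg_left h0.2 (by positivity))
      _ = _ := by ring

end

/-- The change between Fourier coefficients in phase space (`σ = 1`) and along the free flow
(`σ = -1`). -/
def shear (σ : ℝ) (W : ℝ → ℤ → ℝ → ℂ) (t : ℝ) (j : ℤ) (ξ : ℝ) : ℂ := W t j (ξ + σ * (j * max t 0))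

/-! ### Coefficients in phase space, the density and the Poisson equation -/

section

variable {U V W : ℝ → ℤ → ℝ → ℂ} {μ : ℝ → ℝ} {θ₀ C₀ : ℝ}

/-- Up to time `T` the inverse shear of the frequencies expands by at most `1 + T`, so the rate only
drops by this factor. -/
theorem IsDecaying.shear (hW : IsDecaying W) {σ : ℝ} (hσ : |σ| ≤ 1) : IsDecaying (shear σ W) where
  continuous j := (hW.continuous j).comp
    (by fun_prop : Continuous fun z : ℝ × ℝ => (z.1, z.2 + σ * (j * max z.1 0)))
  max_zero t j ξ := by unfold VlasovPoisson.shear; rw [hW.max_zero, max_eq_left (le_max_right t 0)]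
  bound T hT := by
    obtain ⟨C, r, hC, hr, h⟩ := hW.bound T hT
    refine ⟨C, r / (1 + T), hC, by positivity, fun t ht j ξ => (h t ht j _).trans ?_⟩
    have h0 : 0 ≤ max t 0 := le_max_right _ _
    have hm : max t 0 ≤ T := max_le ht hT.le
    have h1 : |ξ| ≤ |ξ + σ * (j * max t 0)| + T * |(j : ℝ)| := by
      have h2 := abs_sub (ξ + σ * (j * max t 0)) (σ * (j * max t 0))
      rw [add_sub_cancel_right, abs_mul σ, abs_mul, abs_of_nonneg h0] at h2
      refine h2.trans (add_le_add_right ?_ _)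
      calc |σ| * (|(j : ℝ)| * max t 0) ≤ 1 * (|(j : ℝ)| * T) := by gcongr
        _ = _ := by ring
    have h2 : r / (1 + T) * (|(j : ℝ)| + |ξ|) ≤ r * (|(j : ℝ)| + |ξ + σ * (j * max t 0)|) := by
      rw [div_mul_eq_mul_div, div_le_iff₀ (by positivity), mul_assoc]
      gcongr
      nlinarith [abs_nonneg (ξ + σ * (j * max t 0)), abs_nonneg (j : ℝ)]
    gcongr

theorem shear_shear (W : ℝ → ℤ → ℝ → ℂ) (σ : ℝ) : shear (-σ) (shear σ W) = W := by
  ext t j ξ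
  unfold shear
  congr 1
  ring

theorem hasSum_synth (hW : IsDecaying W) (t x v : ℝ) :
    HasSum (fun j : ℤ => (2 * Real.pi : ℂ)⁻¹ * ∫ η, W t j η * wave x v j η) (synth (W t) x v) :=
  (hasSum_integral_freq (A := fun j ξ => W t j ξ * wave x v j ξ) (hW.integrable t x v)).mul_left _

theorem distr_eq_synth (hW : IsDecaying W) {t : ℝ} (ht : 0 ≤ t) (x v : ℝ) :
    distr W t x v = synth (shear 1 W t) x v := by
  refine (hasSum_synth hW t (x - t * v) v).unique ?_
  have h := hasSum_synth (hW.shear (σ := 1) (by simp)) t x v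
  refine h.congr_fun fun j => ?_
  congr 1
  rw [← integral_add_right_eq_self (fun η => W t j η * wave (x - t * v) v j η) (j * t)]
  congr 1
  ext η
  unfold shear wave
  rw [max_eq_left ht, one_mul]
  congr 2
  push_cast
  ring

theorem IsDecaying.isLocallyUniformlyAnalytic (hW : IsDecaying W) :
    IsLocallyUniformlyAnalytic (distr W) := by
  have h := hW.shear (σ := 1) (by simp)
  refine ⟨VlasovPoisson.shear 1 W, fun k => (h.continuous k).continuousOn, fun T hT => ?_,
    fun t x v ht => ?_⟩
  · obtain ⟨C, r, _, hr, hb⟩ := h.bound T hT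
    exact ⟨C, r, hr, fun t ht k η => hb t ht.2 k η⟩
  · rw [distr_eq_synth hW ht]
    exact hasSum_synth h t x v

theorem continuous_trigSeries_coeff {F : ℤ → ℝ → ℂ} (hF : ∀ j, Continuous (F j)) {C r : ℝ} (hr : 0 < r)
    (hb : ∀ j ξ, ‖F j ξ‖ ≤ C * Real.exp (-(r * (|(j : ℝ)| + |ξ|)))) (x : ℝ) :
    Continuous fun η => trigSeries (fun j => F j η) x := by
  have hC : 0 ≤ C := nonneg_of_mul_nonneg_left ((norm_nonneg _).trans (hb 0 0)) (Real.exp_pos _)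
  refine continuous_tsum (fun j => (hF j).mul continuous_const)
    ((summable_exp_neg_mul_abs_int hr).mul_left C) fun j η => ?_
  rw [norm_mul, norm_exp_I_intCast_mul, mul_one]
  refine (hb j η).trans ?_
  gcongr
  exact le_add_of_nonneg_right (abs_nonneg _)

/-- Summing over `j` before integrating over `ξ` exhibits the transform in `v` at fixed `x`; its
value at zero frequency is the density. -/
theorem IsDecaying.isFourierTransform_synth (hW : IsDecaying W) (t x : ℝ) :
    IsFourierTransform (synth (W t) x) fun η => trigSeries (fun j => W t j η) x := by
  obtain ⟨C, r, hC, hr, hb⟩ := hW.exists_bound t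
  have hs := summable_exp_neg_mul_abs_int hr
  have hc := continuous_trigSeries_coeff (hW.continuous_right t) hr hb x
  have hbe : ∀ (j : ℤ) (ξ : ℝ), ‖W t j ξ‖ ≤
      C * Real.exp (-(r * |ξ|)) * Real.exp (-(r * |(j : ℝ)|)) := fun j ξ => by
    refine (hb j ξ).trans (le_of_eq ?_)
    rw [mul_assoc, ← Real.exp_add]; ring_nf
  refine ⟨hc, ?_, fun v => ?_⟩
  · refine (((integrable_exp_neg_mul_abs hr).const_mul C).mul_const
      (∑' j : ℤ, Real.exp (-(r * |(j : ℝ)|)))).mono' hc.aestronglyMeasurable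
      (Eventually.of_forall fun η => norm_trigSeries_le hr (fun j => hbe j η) x)
  · unfold synth
    congr 1
    refine (hasSum_integral_freq (A := fun j ξ => W t j ξ * wave x v j ξ)
      (hW.integrable t x v)).unique ?_
    have hint : ∀ j, Integrable fun ξ => W t j ξ * wave x v j ξ := fun j => by
      refine ((integrable_exp_neg_mul_abs hr).const_mul C).mono'
        ((hW.continuous_right t j).mul (continuous_wave_right x v j)).aestronglyMeasurable
        (Eventually.of_forall fun ξ => ?_)
      rw [norm_mul, norm_wave, mul_one]
      refine (hb j ξ).trans ?_
      gcongr
      exact le_add_of_nonneg_left (abs_nonneg _)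
    have h := hasSum_integral_of_summable_integral_norm hint ?_
    · have e : ∀ η : ℝ, trigSeries (fun j => W t j η) x * Complex.exp (Complex.I * η * v) =
          ∑' j, W t j η * wave x v j η := fun η => by
        unfold trigSeries wave
        rw [← tsum_mul_right]
        refine tsum_congr fun j => ?_
        rw [mul_assoc, ← Complex.exp_add]
        ring_nf
      simp only [e]
      exact h
    · refine .of_nonneg_of_le (fun j => by positivity) (fun j => ?_)
        (hs.mul_left (C * ∫ ξ : ℝ, Real.exp (-(r * |ξ|))))
      rw [mul_assoc, mul_comm (∫ ξ : ℝ, Real.exp (-(r * |ξ|))), ← integral_const_mul,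
        ← integral_const_mul]
      refine integral_mono_of_nonneg (Eventually.of_forall fun ξ => norm_nonneg _)
        (((integrable_exp_neg_mul_abs hr).const_mul _).const_mul _)
        (Eventually.of_forall fun ξ => ?_)
      simp only
      rw [norm_mul, norm_wave, mul_one]
      exact (hbe j ξ).trans (le_of_eq (by ring))

/-- The density of a distribution. -/
theorem IsDecaying.hasVelocityIntegral_distr (hW : IsDecaying W) {t : ℝ} (ht : 0 ≤ t) (x : ℝ) :
    HasVelocityIntegral (fun v => distr W t x v) (trigSeries (fun j => W t j (j * max t 0)) x) := by
  have h := hasVelocityIntegral_of_fourier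
    ((hW.shear (σ := 1) (by simp)).isFourierTransform_synth t x)
  simp only [distr_eq_synth hW ht]
  have e : (fun j : ℤ => VlasovPoisson.shear 1 W t j 0) = fun j : ℤ => W t j (j * max t 0) := by
    ext j; unfold VlasovPoisson.shear; rw [zero_add, one_mul]
  rw [← e]
  exact h

theorem IsAnalyticEquilibrium.isDecaying (hμ : IsAnalyticEquilibrium μ θ₀ C₀) (hθ₀ : 0 < θ₀)
    (hC₀ : 0 < C₀) : IsDecaying (equilibriumCoeff μ) where
  continuous j := by
    unfold equilibriumCoeff
    split_ifs
    · exact hμ.continuous_equilibriumHat.comp continuous_snd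
    · exact continuous_const
  max_zero _ _ _ := rfl
  bound T _ := by
    refine ⟨C₀, θ₀, hC₀, hθ₀, fun t _ j ξ => ?_⟩
    unfold equilibriumCoeff
    split_ifs with h
    · subst h
      simpa using hμ.norm_equilibriumHat_le ξ
    · rw [norm_zero]; positivity

theorem IsAnalyticEquilibrium.synth_equilibriumCoeff (hμ : IsAnalyticEquilibrium μ θ₀ C₀)
    (hθ₀ : 0 < θ₀) (hC₀ : 0 < C₀) (t x v : ℝ) : synth (equilibriumCoeff μ t) x v = μ v := by
  have h := hasSum_synth (hμ.isDecaying hθ₀ hC₀) t x v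
  refine h.unique ?_
  have hf := (isFourierTransform_fourierV (Complex.continuous_ofReal.comp hμ.continuous)
    hμ.integrable_ofReal (hμ.integrable_equilibriumHat hθ₀)).2.2 v
  have h0 : (2 * Real.pi : ℂ)⁻¹ * ∫ η, equilibriumCoeff μ t 0 η * wave x v 0 η = μ v := by
    rw [show (μ v : ℂ) = (Complex.ofReal ∘ μ) v from rfl, hf]
    unfold equilibriumCoeff wave equilibriumHat
    simp [mul_assoc]
    rfl
  rw [← h0]
  refine hasSum_single 0 fun j hj => ?_
  unfold equilibriumCoeff
  simp [hj]

theorem IsAnalyticEquilibrium.distr_sub (hμ : IsAnalyticEquilibrium μ θ₀ C₀)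
    (hθ₀ : 0 < θ₀) (hC₀ : 0 < C₀) (hW : IsDecaying W) (t x v : ℝ) :
    distr (fun t j ξ => W t j ξ - equilibriumCoeff μ t j ξ) t x v = distr W t x v - μ v := by
  unfold distr
  rw [synth_sub hW (hμ.isDecaying hθ₀ hC₀), hμ.synth_equilibriumCoeff hθ₀ hC₀]

theorem IsDecaying.exists_norm_fieldCoeff_le (hW : IsDecaying W) (t : ℝ) : ∃ C r : ℝ, 0 < C ∧ 0 < r ∧
    ∀ l, ‖fieldCoeff W t l‖ ≤ C * Real.exp (-(r * |(l : ℝ)|)) := by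
  obtain ⟨C, r, hC, hr, hb⟩ := hW.exists_bound t
  refine ⟨C, r, hC, hr, fun l => ?_⟩
  unfold fieldCoeff
  rw [mul_comm Complex.I, ← div_div, norm_div, Complex.norm_I, div_one]
  refine (norm_div_intCast_le _ _).trans ((hb l _).trans ?_)
  gcongr
  exact le_add_of_nonneg_right (abs_nonneg _)

/-- Conservation of the total charge: the multiplier `ξ - j s` vanishes at the origin. With the
initial value `μ̂(0)` it makes the density of the perturbation have mean zero, as the Poisson
equation requires. -/
theorem IsFourierSolution.zero_mode (hW : IsFourierSolution W) {t : ℝ} (ht : 0 ≤ t) :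
    W t 0 0 = W 0 0 0 := by
  rw [hW.eq t 0 0 ht]
  have : ∀ s, transport W W s 0 0 = 0 := fun s => by
    unfold transport transportTerm
    simp
  simp [this]

theorem field_eq_trigSeries (W : ℝ → ℤ → ℝ → ℂ) (t : ℝ) : field W t = trigSeries (fieldCoeff W t) :=
  rfl

theorem IsDecaying.hasDerivAt_field (hW : IsDecaying W) (t x : ℝ) {d : ℤ → ℂ} (h0 : d 0 = 0)
    (hd : ∀ l ≠ 0, d l = W t l (l * max t 0)) : HasDerivAt (field W t) (trigSeries d x) x := by
  obtain ⟨C, r, hC, hr, hb⟩ := hW.exists_norm_fieldCoeff_le t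
  rw [field_eq_trigSeries]
  refine (hasDerivAt_trigSeries hr hC.le hb x).congr_deriv ?_
  congr 1
  ext l
  unfold fieldCoeff
  rcases eq_or_ne l 0 with hl | hl
  · subst hl
    simp [h0]
  · have : (l : ℂ) ≠ 0 := by exact_mod_cast hl
    rw [hd l hl]
    field_simp [Complex.I_ne_zero]

theorem IsDecaying.integral_field (hW : IsDecaying W) (t : ℝ) :
    ∫ x in (0 : ℝ)..(2 * Real.pi), field W t x = 0 := by
  obtain ⟨C, r, hC, hr, hb⟩ := hW.exists_norm_fieldCoeff_le t
  have h := integral_trigSeries_mul_exp hr hb 0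
  simp only [neg_zero, Int.cast_zero, mul_zero, zero_mul, Complex.exp_zero, mul_one] at h
  rw [field_eq_trigSeries, h]
  simp [fieldCoeff]

theorem distr_transport (hU : IsDecaying U) (hV : IsDecaying V) {t : ℝ} (ht : 0 ≤ t) (x v : ℝ) :
    distr (transport U V) t x v = -(field U t x *
      distr (fun t j ξ => Complex.I * ((ξ - j * max t 0 : ℝ) : ℂ) * V t j ξ) t x v) := by
  have h := synth_transport hU hV t (x - t * v) v
  rw [max_eq_left ht, sub_add_cancel] at h
  unfold distr
  rw [h]
  unfold synth
  simp only [max_eq_left ht, mul_comm (V t _ _)]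

/-- Solutions on the Fourier side are classical solutions. -/
theorem IsFourierSolution.isSolution (hW : IsFourierSolution W)
    (hμ : IsAnalyticEquilibrium μ θ₀ C₀) (hθ₀ : 0 < θ₀) (hC₀ : 0 < C₀)
    (h0 : W 0 0 0 = equilibriumHat μ 0) :
    IsSolution μ (fun x v => distr W 0 x v - μ v) (fun t x v => distr W t x v - μ v) (field W) := by
  have hd := hW.decaying
  have hdμ := hd.sub (hμ.isDecaying hθ₀ hC₀)
  have hN := isDecaying_transport hd hd
  have hμd : ∀ v, HasDerivAt (fun w => ((μ w : ℝ) : ℂ)) ((deriv μ v : ℝ) : ℂ) v := fun v =>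
    ((hμ.analytic v (mem_univ v)).differentiableAt.hasDerivAt).ofReal_comp
  have hμc : Continuous fun v => ((deriv μ v : ℝ) : ℂ) :=
    Complex.continuous_ofReal.comp
      (continuousOn_univ.1 (AnalyticOnNhd.deriv hμ.analytic).continuousOn)
  set fx := distr fun t j ξ => Complex.I * (j : ℂ) * W t j ξ with hfx
  set fv := distr fun t j ξ => Complex.I * ((ξ - j * max t 0 : ℝ) : ℂ) * W t j ξ with hfv
  refine ⟨fun x v => rfl, fun t x v ht => ?_, ⟨fun t x v => distr (transport W W) t x v - v * fx t x v,
    fx, fun t x v => fv t x v - ((deriv μ v : ℝ) : ℂ), ?_, ?_, ?_, fun t x v ht => ⟨?_, ?_, ?_, ?_⟩⟩,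
    fun t x ht => ?_, fun t x ht => ?_, fun t ht => ?_⟩
  · congr 1
    unfold distr synth
    congr 2
    ext X
    congr 1
    unfold wave
    rw [← Complex.exp_periodic.int_mul X.1 (Complex.I * (X.1 * ((x - t * v : ℝ) : ℂ) + X.2 * v))]
    congr 1
    push_cast
    ring
  · refine Continuous.continuousOn ?_
    exact hN.continuous_distr.sub ((by fun_prop : Continuous fun z : ℝ × ℝ × ℝ => (z.2.2 : ℂ)).mul
      hd.mul_x.continuous_distr)
  · exact hd.mul_x.continuous_distr.continuousOn
  · exact (hd.mul_v.continuous_distr.sub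
      (hμc.comp (by fun_prop : Continuous fun z : ℝ × ℝ × ℝ => z.2.2))).continuousOn
  · exact (hW.hasDerivAt_distr_t ht x v).sub_const _
  · exact (hd.hasDerivAt_distr_x t x v).sub_const _
  · exact (hd.hasDerivAt_distr_v ht x v).sub (hμd v)
  · have h := distr_transport hd hd ht x v
    simp only [h]
    ring
  · have hv := hdμ.hasVelocityIntegral_distr ht x
    simp only [hμ.distr_sub hθ₀ hC₀ hd] at hv
    refine ⟨_, hv, ?_⟩
    refine hd.hasDerivAt_field t x ?_ fun l hl => ?_
    · simp [equilibriumCoeff, hW.zero_mode ht, h0]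
    · simp [equilibriumCoeff, hl]
  · exact trigSeries_add_two_pi _ x
  · exact hd.integral_field t

end

/-! ### From classical solutions to Fourier coefficients -/

theorem two_pi_ne_zero : (2 * Real.pi : ℂ) ≠ 0 := by exact_mod_cast Real.two_pi_pos.ne'

/-- A family of coefficients is determined by its Fourier synthesis. -/
theorem eq_zero_of_synth_eq_zero {Φ : ℤ → ℝ → ℂ} (hΦ : ∀ j, Continuous (Φ j)) {C r : ℝ} (hr : 0 < r)
    (hb : ∀ j ξ, ‖Φ j ξ‖ ≤ C * Real.exp (-(r * (|(j : ℝ)| + |ξ|))))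
    (h0 : ∀ x v, synth Φ x v = 0) (j : ℤ) (ξ : ℝ) : Φ j ξ = 0 := by
  have hC : 0 ≤ C := nonneg_of_mul_nonneg_left ((norm_nonneg _).trans (hb 0 0)) (Real.exp_pos _)
  have hint : ∀ j, Integrable (Φ j) := fun j => by
    refine ((integrable_exp_neg_mul_abs hr).const_mul C).mono' (hΦ j).aestronglyMeasurable
      (Eventually.of_forall fun ξ => (hb j ξ).trans ?_)
    gcongr
    exact le_add_of_nonneg_left (abs_nonneg _)
  -- Uniqueness in two stages: at fixed `v` the coefficients of a trigonometric series in `x`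
  -- vanish, then each of them, as a function of `v`, determines `Φ j` by Fourier inversion.
  have hcoef : ∀ v : ℝ, ∫ ξ, Φ j ξ * Complex.exp (Complex.I * ξ * v) = 0 := by
    intro v
    set c : ℤ → ℂ := fun j => ∫ ξ, Φ j ξ * Complex.exp (Complex.I * ξ * v) with hc
    have hcb : ∀ l, ‖c l‖ ≤ (C * ∫ ξ : ℝ, Real.exp (-(r * |ξ|))) * Real.exp (-(r * |(l : ℝ)|)) := by
      intro l
      rw [mul_right_comm, ← integral_const_mul]
      refine norm_integral_le_of_norm_le ((integrable_exp_neg_mul_abs hr).const_mul _)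
        (Eventually.of_forall fun ξ => ?_)
      rw [norm_mul, norm_exp_I_mul, mul_one]
      refine (hb l ξ).trans (le_of_eq ?_)
      rw [mul_assoc, ← Real.exp_add]
      ring_nf
    have hz : ∀ x, trigSeries c x = 0 := by
      intro x
      have h1 := hasSum_integral_freq (A := fun j ξ => Φ j ξ * wave x v j ξ)
        (integrable_freq (A := fun j ξ => Φ j ξ * wave x v j ξ)
          (fun j => (hΦ j).mul (continuous_wave_right x v j)) hr
          fun j ξ => by rw [norm_mul, norm_wave, mul_one]; exact hb j ξ)
      have h2 := h0 x v
      unfold synth at h2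
      have hπ := inv_ne_zero two_pi_ne_zero
      rw [(mul_eq_zero.1 h2).resolve_left hπ] at h1
      unfold trigSeries
      rw [← h1.tsum_eq]
      refine tsum_congr fun l => ?_
      rw [hc, ← integral_mul_const]
      congr 1
      ext ξ
      unfold wave
      rw [mul_assoc, ← Complex.exp_add]
      ring_nf
    have h3 := integral_trigSeries_mul_exp hr hcb j
    simp only [hz, zero_mul, intervalIntegral.integral_zero] at h3
    exact (mul_eq_zero.1 h3.symm).resolve_left two_pi_ne_zero
  have hF : fourierV (Φ j) = 0 := by
    ext η
    have := hcoef (-η)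
    rw [Pi.zero_apply, ← this]
    unfold fourierV
    congr 1
    ext ξ
    push_cast
    ring_nf
  have h := (isFourierTransform_fourierV (hΦ j) (hint j) (by rw [hF]; exact integrable_zero _ _ _)).2.2 ξ
  rw [h, hF]
  simp

theorem HasVelocityIntegral.unique {g : ℝ → ℂ} {a b : ℂ} (ha : HasVelocityIntegral g a)
    (hb : HasVelocityIntegral g b) : a = b :=
  tendsto_nhds_unique ha.2 hb.2

section

variable {U V W : ℝ → ℤ → ℝ → ℂ} {μ : ℝ → ℝ} {θ₀ C₀ : ℝ}

/-- Fubini's theorem for the synthesis of time integrals. -/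
theorem IsDecaying.integral_synth (hW : IsDecaying W) {t : ℝ} (ht : 0 ≤ t) (x v : ℝ) :
    ∫ s in (0 : ℝ)..t, synth (W s) x v = synth (fun j ξ => ∫ s in (0 : ℝ)..t, W s j ξ) x v := by
  obtain ⟨C, r, hC, hr, hb⟩ := hW.bound (t + 1) (by positivity)
  unfold synth
  rw [intervalIntegral.integral_const_mul]
  congr 1
  simp only [intervalIntegral.integral_of_le ht]
  rw [integral_integral_swap]
  · simp only [integral_mul_const]
  · have hm : Measurable fun z : ℤ × (ℝ × ℝ) => W z.2.1 z.1 z.2.2 * wave x v z.1 z.2.2 := by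
      refine measurable_from_prod_countable_right fun j => Continuous.measurable ?_
      exact (hW.continuous j).mul ((continuous_wave_right x v j).comp continuous_snd)
    have hm2 : Measurable fun z : ℝ × (ℤ × ℝ) => W z.1 z.2.1 z.2.2 * wave x v z.2.1 z.2.2 :=
      hm.comp (by fun_prop : Measurable fun z : ℝ × (ℤ × ℝ) => (z.2.1, (z.1, z.2.2)))
    have hi : Integrable (fun z : ℝ × (ℤ × ℝ) => (1 : ℝ) *
        (C * Real.exp (-(r * (|(z.2.1 : ℝ)| + |z.2.2|)))))
        ((volume.restrict (Ioc 0 t)).prod freqMeasure) :=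
      (integrable_const (1 : ℝ)).mul_prod (integrable_exp_freq hr C)
    refine hi.mono' hm2.aestronglyMeasurable ?_
    have h1 : ∀ᵐ z ∂((volume.restrict (Ioc 0 t)).prod freqMeasure), z.1 ∈ Ioc 0 t :=
      Measure.quasiMeasurePreserving_fst.ae (ae_restrict_mem measurableSet_Ioc)
    filter_upwards [h1] with z hz
    rw [one_mul, Function.uncurry, norm_mul, norm_wave, mul_one]
    exact hb z.1 (by linarith [hz.2]) z.2.1 z.2.2

theorem IsLocallyUniformlyAnalytic.exists_coeff {f : ℝ → ℝ → ℝ → ℂ}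
    (hf : IsLocallyUniformlyAnalytic f) : ∃ U, IsDecaying U ∧
      ∀ t x v, 0 ≤ t → distr U t x v = f t x v := by
  obtain ⟨F, hFc, hFb, hF⟩ := hf
  have hd : IsDecaying fun t j ξ => F (max t 0) j ξ := by
    refine ⟨fun j => ?_, fun t j ξ => by rw [max_eq_left (le_max_right t 0)], fun T hT => ?_⟩
    · exact (hFc j).comp_continuous (f := fun z : ℝ × ℝ => (max z.1 0, z.2)) (by fun_prop)
        fun z => by simp
    · obtain ⟨C, r, hr, hb⟩ := hFb T hT
      refine ⟨|C| + 1, r, by positivity, hr, fun t ht j ξ =>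
        (hb _ ⟨le_max_right _ _, max_le ht hT.le⟩ j ξ).trans ?_⟩
      gcongr
      linarith [le_abs_self C]
  have hU := hd.shear (σ := -1) (by simp)
  refine ⟨_, hU, fun t x v ht => ?_⟩
  rw [distr_eq_synth hU ht, show shear 1 (shear (-1) fun t j ξ => F (max t 0) j ξ) =
    fun t j ξ => F (max t 0) j ξ by
      have := shear_shear (fun t j ξ => F (max t 0) j ξ) (-1)
      rwa [neg_neg] at this]
  have h := hasSum_synth hd t x v
  simp only [max_eq_left ht] at h
  simp only [max_eq_left ht]
  exact h.unique (hF t x v ht)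

/-- The chain rule along the free flow, for continuous partial derivatives. -/
theorem hasDerivWithinAt_freeFlow {f ft fx : ℝ → ℝ → ℝ → ℂ}
    (hfx : ContinuousOn (fun z : ℝ × ℝ × ℝ => fx z.1 z.2.1 z.2.2) {z | 0 ≤ z.1})
    (hdt : ∀ t x v : ℝ, 0 ≤ t → HasDerivWithinAt (fun s => f s x v) (ft t x v) (Ici 0) t)
    (hdx : ∀ t x v : ℝ, 0 ≤ t → HasDerivAt (fun y => f t y v) (fx t x v) x)
    {t : ℝ} (ht : 0 ≤ t) (x v : ℝ) :
    HasDerivWithinAt (fun s => f s (x + s * v) v)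
      (ft t (x + t * v) v + v * fx t (x + t * v) v) (Ici 0) t := by
  set y := x + t * v with hy
  set c := fx t y v with hc
  -- The motion is split into the change of `x` at time `s` and the change of time at the fixed
  -- point `y`. The first is compared with `c` by the mean value inequality on the segment, where
  -- continuity of `fx` in all variables is needed.
  have h1 : HasDerivWithinAt (fun s => f s (x + s * v) v - f s y v) (v * c) (Ici 0) t := by
    rw [hasDerivWithinAt_iff_isLittleO, Asymptotics.isLittleO_iff]
    intro ε hε
    have hcont : Tendsto (fun z : ℝ × ℝ × ℝ => fx z.1 z.2.1 z.2.2) (𝓝[{z | 0 ≤ z.1}] (t, y, v))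
        (𝓝 c) := hfx (t, y, v) ht
    have hε' : 0 < ε / (|v| + 1) := by positivity
    obtain ⟨δ, hδ, hδb⟩ := Metric.mem_nhdsWithin_iff.1 (hcont (Metric.ball_mem_nhds c hε'))
    have hδ' : 0 < δ / (|v| + 1) := by positivity
    filter_upwards [inter_mem_nhdsWithin _ (Metric.ball_mem_nhds t hδ')] with s hs
    obtain ⟨hs0, hst⟩ := hs
    rw [Metric.mem_ball, Real.dist_eq, lt_div_iff₀ (by positivity)] at hst
    have hs1 : |s - t| < δ := by nlinarith [abs_nonneg (s - t), abs_nonneg v]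
    have hs2 : |s - t| * |v| < δ := by nlinarith [abs_nonneg (s - t), abs_nonneg v]
    have hmv := (convex_segment y (x + s * v)).norm_image_sub_le_of_norm_hasDerivWithin_le
      (f := fun y' : ℝ => f s y' v - y' * c) (f' := fun y' => fx s y' v - c)
      (C := ε / (|v| + 1)) (fun y' _ => ?_) (fun y' hy' => ?_)
      (left_mem_segment ℝ y (x + s * v)) (right_mem_segment ℝ y (x + s * v))
    · have e1 : x + s * v - y = (s - t) * v := by rw [hy]; ring
      have e2 : f s (x + s * v) v - f s y v - (f t (x + t * v) v - f t y v) - (s - t) • (v * c) =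
          f s (x + s * v) v - ((x + s * v : ℝ) : ℂ) * c - (f s y v - y * c) := by
        rw [hy, Complex.real_smul]
        push_cast
        ring
      rw [e2]
      refine hmv.trans ?_
      rw [e1, norm_mul, ← mul_assoc, Real.norm_eq_abs v, mul_right_comm]
      refine mul_le_mul_of_nonneg_right ?_ (norm_nonneg _)
      rw [div_mul_eq_mul_div, div_le_iff₀ (by positivity)]
      nlinarith [abs_nonneg v]
    · refine ((hdx s y' v hs0).sub ?_).hasDerivWithinAt
      have := (Complex.ofRealCLM.hasDerivAt (x := y')).mul_const c
      simpa using this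
    · have h3 : |y' - y| ≤ |s - t| * |v| := by
        rw [segment_eq_uIcc] at hy'
        have := abs_sub_left_of_mem_uIcc hy'
        rwa [show x + s * v - y = (s - t) * v by rw [hy]; ring, abs_mul] at this
      have h4 : ((s, y', v) : ℝ × ℝ × ℝ) ∈ Metric.ball (t, y, v) δ ∩ {z | 0 ≤ z.1} := by
        refine ⟨?_, hs0⟩
        rw [Metric.mem_ball, Prod.dist_eq, Prod.dist_eq, dist_self, Real.dist_eq, Real.dist_eq]
        exact max_lt hs1 (max_lt (h3.trans_lt hs2) hδ)
      have h5 := hδb h4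
      rw [mem_preimage, Metric.mem_ball, dist_eq_norm] at h5
      exact h5.le
  have h2 := (hdt t y v ht).add h1
  refine h2.congr_of_eventuallyEq (Eventually.of_forall fun s => ?_) ?_ <;> simp

/-- Classical solutions that are analytic are solutions on the Fourier side. -/
theorem IsSolution.exists_isFourierSolution (hμ : IsAnalyticEquilibrium μ θ₀ C₀) (hθ₀ : 0 < θ₀)
    (hC₀ : 0 < C₀) {f₀ : ℝ → ℝ → ℂ} {f : ℝ → ℝ → ℝ → ℂ} {E : ℝ → ℝ → ℂ}
    (hs : IsSolution μ f₀ f E) (ha : IsLocallyUniformlyAnalytic f) :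
    ∃ W, IsFourierSolution W ∧ ∀ t x v, 0 ≤ t →
      distr W t x v = f t x v + μ v ∧ field W t x = E t x := by
  obtain ⟨U, hU, hUf⟩ := ha.exists_coeff
  have hm := hμ.isDecaying hθ₀ hC₀
  set W := fun t j ξ => U t j ξ + equilibriumCoeff μ t j ξ with hW
  have hd : IsDecaying W := hU.add hm
  have hN := isDecaying_transport hd hd
  have hWf : ∀ t x v, 0 ≤ t → distr W t x v = f t x v + μ v := fun t x v ht => by
    rw [← hUf t x v ht, ← hμ.synth_equilibriumCoeff hθ₀ hC₀ t (x - t * v) v]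
    exact synth_add hU hm t (x - t * v) v
  have hE : ∀ t x, 0 ≤ t → field W t x = E t x := by
    intro t x ht
    set d : ℤ → ℂ := fun j => U t j (j * max t 0) with hdd
    have hED : ∀ x, HasDerivAt (E t) (trigSeries d x) x := fun x => by
      obtain ⟨ρ, hρ, hρE⟩ := hs.poisson t x ht
      have h1 := hU.hasVelocityIntegral_distr ht x
      simp only [fun v => hUf t x v ht] at h1
      rwa [hρ.unique h1] at hρE
    obtain ⟨C, r, hC, hr, hb⟩ := hU.exists_bound t
    have hdb : ∀ l, ‖d l‖ ≤ C * Real.exp (-(r * |(l : ℝ)|)) := fun l => by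
      refine (hb l _).trans ?_
      gcongr
      exact le_add_of_nonneg_right (abs_nonneg _)
    have hdc : Continuous (trigSeries d) := (contDiff_trigSeries hr hC.le hdb).continuous
    -- The mean of the density is the increment of the periodic `E` over one period.
    have hd0 : d 0 = 0 := by
      have h1 := integral_trigSeries_mul_exp hr hdb 0
      simp only [neg_zero, Int.cast_zero, mul_zero, zero_mul, Complex.exp_zero, mul_one] at h1
      rw [intervalIntegral.integral_eq_sub_of_hasDerivAt (fun x _ => hED x)
        (hdc.intervalIntegrable _ _)] at h1
      have h2 := hs.field_periodic t 0 ht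
      rw [zero_add] at h2
      rw [h2, sub_self] at h1
      exact (mul_eq_zero.1 h1.symm).resolve_left two_pi_ne_zero
    have hFD : ∀ x, HasDerivAt (field W t) (trigSeries d x) x := fun x =>
      hd.hasDerivAt_field t x hd0 fun l hl => by simp [hdd, hW, equilibriumCoeff, hl]
    -- Both fields have the same derivative, and the normalisation to mean zero fixes the constant.
    have hdiff : ∀ x, HasDerivAt (fun x => field W t x - E t x) 0 x := fun x =>
      ((hFD x).sub (hED x)).congr_deriv (sub_self _)
    have hconst : ∀ x, field W t x - E t x = field W t 0 - E t 0 := fun x =>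
      is_const_of_deriv_eq_zero (fun x => (hdiff x).differentiableAt) (fun x => (hdiff x).deriv) x 0
    have hcE : Continuous (E t) := continuous_iff_continuousAt.2 fun x => (hED x).continuousAt
    have hcF : Continuous (field W t) := continuous_iff_continuousAt.2 fun x => (hFD x).continuousAt
    have hi : ∫ x in (0 : ℝ)..(2 * Real.pi), (field W t x - E t x) = 0 := by
      rw [intervalIntegral.integral_sub (hcF.intervalIntegrable _ _) (hcE.intervalIntegrable _ _),
        hd.integral_field, hs.field_mean t ht, sub_self]
    simp only [hconst, intervalIntegral.integral_const, sub_zero] at hi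
    have := (smul_eq_zero.1 hi).resolve_left (by positivity)
    exact sub_eq_zero.1 ((hconst x).trans this)
  refine ⟨W, ⟨hd, fun t j ξ ht => ?_⟩, fun t x v ht => ⟨hWf t x v ht, hE t x ht⟩⟩
  obtain ⟨ft, fx, fv, hft, hfx, hfv, hpde⟩ := hs.vlasov
  have hμd : ∀ v, HasDerivAt (fun w => ((μ w : ℝ) : ℂ)) ((deriv μ v : ℝ) : ℂ) v := fun v =>
    ((hμ.analytic v (mem_univ v)).differentiableAt.hasDerivAt).ofReal_comp
  have hfvW : ∀ t x v, 0 ≤ t → fv t x v + ((deriv μ v : ℝ) : ℂ) =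
      distr (fun t j ξ => Complex.I * ((ξ - j * max t 0 : ℝ) : ℂ) * W t j ξ) t x v :=
    fun t x v ht => by
      have h1 := ((hpde t x v ht).2.2.1).add (hμd v)
      have h2 := hd.hasDerivAt_distr_v ht x v
      refine h1.unique (h2.congr_of_eventuallyEq (Eventually.of_forall fun w => ?_))
      simp [hWf t x w ht]
  -- Along the free flow the term `v ∂ₓ f` disappears, and at fixed `(x, v)` the equation becomes an
  -- ordinary differential equation for the synthesis.
  have hchar : ∀ x v s, 0 ≤ s → HasDerivWithinAt (fun s => synth (W s) x v)
      (synth (transport W W s) x v) (Ici 0) s := by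
    intro x v s hs0
    have h1 := hasDerivWithinAt_freeFlow hfx (fun t x v ht => (hpde t x v ht).1)
      (fun t x v ht => (hpde t x v ht).2.1) hs0 x v
    have h2 := (hpde s (x + s * v) v hs0).2.2.2
    have h3 := distr_transport hd hd hs0 (x + s * v) v
    rw [← hfvW s _ v hs0, hE s _ hs0] at h3
    unfold distr at h3
    rw [add_sub_cancel_right] at h3
    rw [h3]
    have e : ∀ s, 0 ≤ s → synth (W s) x v = f s (x + s * v) v + μ v := fun s hs0 => by
      rw [← hWf s _ v hs0, distr, add_sub_cancel_right]
    refine ((h1.add_const (μ v : ℂ)).congr (fun s hs0 => e s hs0) (e s hs0)).congr_deriv ?_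
    linear_combination h2
  have hint : ∀ x v, synth (W t) x v - synth (W 0) x v =
      synth (fun j ξ => ∫ s in (0 : ℝ)..t, transport W W s j ξ) x v := by
    intro x v
    rw [← hN.integral_synth ht]
    have hNc : Continuous fun s => synth (transport W W s) x v := by
      have h := hN.continuous_distr.comp
        (by fun_prop : Continuous fun s : ℝ => ((s, x + s * v, v) : ℝ × ℝ × ℝ))
      refine h.congr fun s => ?_
      simp [distr]
    refine (intervalIntegral.integral_eq_sub_of_hasDeriv_right
      (f := fun s => synth (W s) x v) ?_ (fun s hs0 => ?_) (hNc.intervalIntegrable _ _)).symm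
    · intro s hs0
      rw [uIcc_of_le ht] at hs0
      exact ((hchar x v s hs0.1).continuousWithinAt).mono fun u hu => by
        rw [uIcc_of_le ht] at hu; exact hu.1
    · rw [min_eq_left ht, max_eq_right ht] at hs0
      exact (hchar x v s hs0.1.le).mono fun u hu => hs0.1.le.trans (le_of_lt hu)
  obtain ⟨B, b, hB, hb, hBb⟩ := hN.bound (t + 1) (by positivity)
  obtain ⟨A, a, hA, ha', hAb⟩ := (hd.bound (t + 1) (by positivity))
  set r := min a b with hr
  have hr0 : 0 < r := lt_min ha' hb
  have hcI : ∀ j, Continuous fun ξ => ∫ s in (0 : ℝ)..t, transport W W s j ξ := fun j =>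
    intervalIntegral.continuous_parametric_intervalIntegral_of_continuous'
      (hN.continuous_swap j) 0 t
  have hbI : ∀ (j : ℤ) (ξ : ℝ), ‖∫ s in (0 : ℝ)..t, transport W W s j ξ‖ ≤
      B * Real.exp (-(b * (|(j : ℝ)| + |ξ|))) * |t - 0| := fun j ξ => by
    refine intervalIntegral.norm_integral_le_of_norm_le_const fun u hu => hBb u ?_ j ξ
    rw [uIoc_of_le ht] at hu
    linarith [hu.2]
  have hbD : ∀ (j : ℤ) (ξ : ℝ), ‖W t j ξ - W 0 j ξ - ∫ s in (0 : ℝ)..t, transport W W s j ξ‖ ≤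
      (A + A + B * |t - 0|) * Real.exp (-(r * (|(j : ℝ)| + |ξ|))) := fun j ξ => by
    have e1 : Real.exp (-(a * (|(j : ℝ)| + |ξ|))) ≤ Real.exp (-(r * (|(j : ℝ)| + |ξ|))) := by
      gcongr; exact min_le_left _ _
    have e2 : Real.exp (-(b * (|(j : ℝ)| + |ξ|))) ≤ Real.exp (-(r * (|(j : ℝ)| + |ξ|))) := by
      gcongr; exact min_le_right _ _
    rw [add_mul, add_mul]
    refine (norm_sub_le _ _).trans (add_le_add ((norm_sub_le _ _).trans (add_le_add ?_ ?_)) ?_)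
    · exact (hAb t (by linarith) j ξ).trans (by gcongr)
    · exact (hAb 0 (by linarith) j ξ).trans (by gcongr)
    · refine (hbI j ξ).trans ?_
      rw [mul_right_comm]
      gcongr
  -- The time-integrated equation holds after synthesis for all `(x, v)`, hence for the
  -- coefficients.
  have key := eq_zero_of_synth_eq_zero
    (Φ := fun j ξ => W t j ξ - W 0 j ξ - ∫ s in (0 : ℝ)..t, transport W W s j ξ)
    (fun j => ((hd.continuous_right t j).sub (hd.continuous_right 0 j)).sub (hcI j)) hr0 hbD ?_ j ξ
  · linear_combination key
  · intro x v
    have i1 := hd.integrable t x v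
    have i2 := hd.integrable 0 x v
    have i3 : Integrable (fun X : ℤ × ℝ => (∫ s in (0 : ℝ)..t, transport W W s X.1 X.2) *
        wave x v X.1 X.2) freqMeasure := by
      refine integrable_freq (A := fun j ξ => (∫ s in (0 : ℝ)..t, transport W W s j ξ) *
        wave x v j ξ) (C := B * |t - 0|)
        (fun j => (hcI j).mul (continuous_wave_right x v j)) hb fun j ξ => ?_
      rw [norm_mul, norm_wave, mul_one]
      exact (hbI j ξ).trans (le_of_eq (by ring))
    have h := hint x v
    unfold synth at h ⊢
    simp only [sub_mul]
    have e := integral_sub (i1.sub i2) i3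
    simp only [Pi.sub_apply] at e
    rw [e, integral_sub i1 i2]
    linear_combination h

end

/-! ### Uniqueness of analytic solutions -/

section

variable {V W : ℝ → ℤ → ℝ → ℂ} {C r T : ℝ}

theorem transport_sub_transport (hV : IsDecaying V) (hW : IsDecaying W) (s : ℝ) (j : ℤ) (ξ : ℝ) :
    HasSum (fun l => transportTerm (fun t j ξ => V t j ξ - W t j ξ) V s j ξ l +
      transportTerm W (fun t j ξ => V t j ξ - W t j ξ) s j ξ l)
      (transport V V s j ξ - transport W W s j ξ) := by
  have h := (summable_transportTerm hV hV s j ξ).hasSum.sub (summable_transportTerm hW hW s j ξ).hasSum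
  refine h.congr_fun fun l => ?_
  unfold transportTerm
  ring

/-- The transport nonlinearity is Lipschitz in spaces of analytic functions, with the loss of one
derivative. -/
theorem norm_transport_sub_le (hV : IsDecaying V) (hW : IsDecaying W) (hr : 0 < r) (hT : 0 ≤ T)
    {s ρ M : ℝ} (hs : s ≤ T) (hρ : 0 ≤ ρ) (hρr : ρ ≤ r / 2) (hM : 0 ≤ M) (hC : 0 ≤ C)
    (hVb : ∀ (j : ℤ) (ξ : ℝ), ‖V s j ξ‖ ≤ C * Real.exp (-(r * (|(j : ℝ)| + |ξ|))))
    (hWb : ∀ (j : ℤ) (ξ : ℝ), ‖W s j ξ‖ ≤ C * Real.exp (-(r * (|(j : ℝ)| + |ξ|))))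
    (hD : ∀ (j : ℤ) (ξ : ℝ), ‖V s j ξ - W s j ξ‖ ≤ M * Real.exp (-(ρ * (1 + |(j : ℝ)| + |ξ|))))
    (j : ℤ) (ξ : ℝ) : ‖transport V V s j ξ - transport W W s j ξ‖ ≤
      M * (2 * C * (1 + T) * ∑' l : ℤ, Real.exp (-(r / 2 * |(l : ℝ)|))) *
        ((1 + |(j : ℝ)| + |ξ|) * Real.exp (-(ρ * (1 + |(j : ℝ)| + |ξ|)))) := by
  have hS := (summable_exp_neg_mul_abs_int (half_pos hr)).hasSum
  have hS2 := (Equiv.subLeft j).hasSum_iff.2 hS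
  have h0 : 0 ≤ max s 0 := le_max_right _ _
  have hm : max s 0 ≤ T := max_le hs hT
  set z := 1 + |(j : ℝ)| + |ξ| with hz
  have hz0 : 0 ≤ z := by positivity
  have hzz : |(j : ℝ)| + |ξ| ≤ z := by rw [hz]; linarith
  set X := (1 + T) * z * (M * C * Real.exp (-(ρ * z))) with hX
  have hX0 : 0 ≤ X := by positivity
  have key : ∀ l : ℤ, ‖transportTerm (fun t j ξ => V t j ξ - W t j ξ) V s j ξ l +
      transportTerm W (fun t j ξ => V t j ξ - W t j ξ) s j ξ l‖ ≤
      X * (Real.exp (-(r / 2 * |((j - l : ℤ) : ℝ)|)) + Real.exp (-(r / 2 * |(l : ℝ)|))) := by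
    intro l
    have h1 := norm_transportTerm_le (U := fun t j ξ => V t j ξ - W t j ξ) (V := V) s j ξ l
    have h2 := norm_transportTerm_le (U := W) (V := fun t j ξ => V t j ξ - W t j ξ) s j ξ l
    have b1 := hD l (l * max s 0)
    have b2 := hVb (j - l) (ξ - l * max s 0)
    have b3 := hWb l (l * max s 0)
    have b4 := hD (j - l) (ξ - l * max s 0)
    have h3 := abs_add_abs_le_split j l ξ (l * max s 0)
    rw [add_assoc] at b1 b4
    have hlx : |(l : ℝ)| ≤ |(l : ℝ)| + |(l * max s 0 : ℝ)| := le_add_of_nonneg_right (abs_nonneg _)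
    have hly : |((j - l : ℤ) : ℝ)| ≤ |((j - l : ℤ) : ℝ)| + |ξ - l * max s 0| :=
      le_add_of_nonneg_right (abs_nonneg _)
    set x := |(l : ℝ)| + |(l * max s 0 : ℝ)| with hx
    set y := |((j - l : ℤ) : ℝ)| + |ξ - l * max s 0| with hy
    have hx0 : 0 ≤ x := by positivity
    have hy0 : 0 ≤ y := by positivity
    have hzxy : z ≤ 1 + (x + y) := by rw [hz]; linarith
    have i0 : ρ * z ≤ ρ + ρ * x + ρ * y := by
      calc ρ * z ≤ ρ * (1 + (x + y)) := by gcongr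
        _ = _ := by ring
    have e1 : Real.exp (-(ρ * (1 + x))) * Real.exp (-(r * y)) ≤
        Real.exp (-(ρ * z)) * Real.exp (-(r / 2 * |((j - l : ℤ) : ℝ)|)) := by
      rw [← Real.exp_add, ← Real.exp_add]
      refine Real.exp_le_exp.2 ?_
      have i1 : ρ * y ≤ r / 2 * y := by gcongr
      have i2 : r / 2 * |((j - l : ℤ) : ℝ)| ≤ r / 2 * y := by gcongr
      linarith
    have e2 : Real.exp (-(r * x)) * Real.exp (-(ρ * (1 + y))) ≤
        Real.exp (-(ρ * z)) * Real.exp (-(r / 2 * |(l : ℝ)|)) := by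
      rw [← Real.exp_add, ← Real.exp_add]
      refine Real.exp_le_exp.2 ?_
      have i1 : ρ * x ≤ r / 2 * x := by gcongr
      have i2 : r / 2 * |(l : ℝ)| ≤ r / 2 * x := by gcongr
      linarith
    rw [mul_add]
    refine (norm_add_le _ _).trans (add_le_add (h1.trans ?_) (h2.trans ?_))
    · calc _ ≤ (1 + T) * z * ((M * Real.exp (-(ρ * (1 + x)))) * (C * Real.exp (-(r * y)))) := by
            gcongr
        _ = (1 + T) * z * (M * C) * (Real.exp (-(ρ * (1 + x))) * Real.exp (-(r * y))) := by ring
        _ ≤ (1 + T) * z * (M * C) *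
            (Real.exp (-(ρ * z)) * Real.exp (-(r / 2 * |((j - l : ℤ) : ℝ)|))) := by gcongr
        _ = _ := by rw [hX]; ring
    · calc _ ≤ (1 + T) * z * ((C * Real.exp (-(r * x))) * (M * Real.exp (-(ρ * (1 + y))))) := by
            gcongr
        _ = (1 + T) * z * (M * C) * (Real.exp (-(r * x)) * Real.exp (-(ρ * (1 + y)))) := by ring
        _ ≤ (1 + T) * z * (M * C) *
            (Real.exp (-(ρ * z)) * Real.exp (-(r / 2 * |(l : ℝ)|))) := by gcongr
        _ = _ := by rw [hX]; ring
  have hsum : HasSum (fun l : ℤ => X * (Real.exp (-(r / 2 * |((j - l : ℤ) : ℝ)|)) +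
      Real.exp (-(r / 2 * |(l : ℝ)|)))) (X * ((∑' l : ℤ, Real.exp (-(r / 2 * |(l : ℝ)|))) +
        ∑' l : ℤ, Real.exp (-(r / 2 * |(l : ℝ)|)))) := (hS2.add hS).mul_left X
  rw [← (transport_sub_transport hV hW s j ξ).tsum_eq]
  refine (tsum_of_norm_bounded hsum key).trans (le_of_eq ?_)
  rw [hX]
  ring

/-- A Cauchy–Kovalevskaya argument: the difference is measured with the radius `r / 2 - β (s - t₀)`.
The lost derivative is the time derivative of this weight divided by `β`, so inserting a bound into
the integral equation multiplies it by `Q / β ≤ 1 / 2`. Iteration forces the difference to vanish as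
long as the radius is nonnegative. -/
theorem IsFourierSolution.eq_of_eq_on_short (hV : IsFourierSolution V) (hW : IsFourierSolution W)
    (hr : 0 < r) (hC : 0 < C)
    (hVb : ∀ s ≤ T, ∀ (j : ℤ) (ξ : ℝ), ‖V s j ξ‖ ≤ C * Real.exp (-(r * (|(j : ℝ)| + |ξ|))))
    (hWb : ∀ s ≤ T, ∀ (j : ℤ) (ξ : ℝ), ‖W s j ξ‖ ≤ C * Real.exp (-(r * (|(j : ℝ)| + |ξ|))))
    {β t₀ : ℝ} (hβ : 0 < β)
    (hβC : 2 * (2 * C * (1 + T) * ∑' l : ℤ, Real.exp (-(r / 2 * |(l : ℝ)|))) ≤ β)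
    (ht₀ : 0 ≤ t₀) (hT : 0 ≤ T) (heq : ∀ j ξ, V t₀ j ξ = W t₀ j ξ) {t : ℝ} (ht : t₀ ≤ t) (htT : t ≤ T)
    (htβ : β * (t - t₀) ≤ r / 2) (j : ℤ) (ξ : ℝ) : V t j ξ = W t j ξ := by
  have hdV := hV.decaying
  have hdW := hW.decaying
  set Q := 2 * C * (1 + T) * ∑' l : ℤ, Real.exp (-(r / 2 * |(l : ℝ)|)) with hQ
  have hQ0 : 0 ≤ Q := by
    have : 0 ≤ ∑' l : ℤ, Real.exp (-(r / 2 * |(l : ℝ)|)) := tsum_nonneg fun l => (Real.exp_pos _).le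
    positivity
  have hiV : ∀ (j : ℤ) (ξ a b : ℝ), IntervalIntegrable (fun s => transport V V s j ξ) volume a b :=
    fun j ξ a b => ((isDecaying_transport hdV hdV).continuous_left j ξ).intervalIntegrable _ _
  have hiW : ∀ (j : ℤ) (ξ a b : ℝ), IntervalIntegrable (fun s => transport W W s j ξ) volume a b :=
    fun j ξ a b => ((isDecaying_transport hdW hdW).continuous_left j ξ).intervalIntegrable _ _
  have hdiff : ∀ s, t₀ ≤ s → ∀ j ξ, V s j ξ - W s j ξ =
      ∫ u in t₀..s, (transport V V u j ξ - transport W W u j ξ) := by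
    intro s hs j ξ
    rw [intervalIntegral.integral_sub (hiV j ξ _ _) (hiW j ξ _ _),
      ← intervalIntegral.integral_interval_sub_left (hiV j ξ 0 s) (hiV j ξ 0 t₀),
      ← intervalIntegral.integral_interval_sub_left (hiW j ξ 0 s) (hiW j ξ 0 t₀)]
    have e1 := hV.eq s j ξ (ht₀.trans hs)
    have e2 := hV.eq t₀ j ξ ht₀
    have e3 := hW.eq s j ξ (ht₀.trans hs)
    have e4 := hW.eq t₀ j ξ ht₀
    linear_combination e1 - e2 - e3 + e4 + heq j ξ
  have main : ∀ n : ℕ, ∀ s, t₀ ≤ s → s ≤ t → ∀ (j : ℤ) (ξ : ℝ), ‖V s j ξ - W s j ξ‖ ≤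
      (2 * C * Real.exp (r / 2) * (1 / 2) ^ n) *
        Real.exp (-((r / 2 - β * (s - t₀)) * (1 + |(j : ℝ)| + |ξ|))) := by
    intro n
    induction n with
    | zero =>
      intro s hs hst j ξ
      have h1 := hVb s (hst.trans htT) j ξ
      have h2 := hWb s (hst.trans htT) j ξ
      have e : Real.exp (-(r * (|(j : ℝ)| + |ξ|))) ≤ Real.exp (r / 2) *
          Real.exp (-((r / 2 - β * (s - t₀)) * (1 + |(j : ℝ)| + |ξ|))) := by
        rw [← Real.exp_add]
        refine Real.exp_le_exp.2 ?_
        have i1 : 0 ≤ β * (s - t₀) * (1 + |(j : ℝ)| + |ξ|) :=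
          mul_nonneg (mul_nonneg hβ.le (by linarith)) (by positivity)
        have i2 : 0 ≤ r * (|(j : ℝ)| + |ξ|) := by positivity
        nlinarith
      refine (norm_sub_le _ _).trans ((add_le_add h1 h2).trans ?_)
      rw [pow_zero, mul_one]
      calc _ = 2 * C * Real.exp (-(r * (|(j : ℝ)| + |ξ|))) := by ring
        _ ≤ 2 * C * (Real.exp (r / 2) *
          Real.exp (-((r / 2 - β * (s - t₀)) * (1 + |(j : ℝ)| + |ξ|)))) := by gcongr
        _ = _ := by ring
    | succ n ih =>
      intro s hs hst j ξ
      set M := 2 * C * Real.exp (r / 2) * (1 / 2) ^ n with hM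
      have hM0 : 0 ≤ M := by positivity
      set z := 1 + |(j : ℝ)| + |ξ| with hz
      have hz0 : 0 < z := by positivity
      have hder : ∀ u : ℝ, HasDerivAt (fun u => M * Q / β * Real.exp (-((r / 2 - β * (u - t₀)) * z)))
          (M * Q * (z * Real.exp (-((r / 2 - β * (u - t₀)) * z)))) u := fun u => by
        have h1 : HasDerivAt (fun u : ℝ => -((r / 2 - β * (u - t₀)) * z)) (β * z) u := by
          have := ((((hasDerivAt_id u).sub_const t₀).const_mul β).const_sub (r / 2)).mul_const z
          exact this.neg.congr_deriv (by ring)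
        refine (h1.exp.const_mul _).congr_deriv ?_
        field_simp
      have hgc : Continuous fun u => M * Q * (z * Real.exp (-((r / 2 - β * (u - t₀)) * z))) := by
        fun_prop
      have hN : ∀ u ∈ Ioc t₀ s, ‖transport V V u j ξ - transport W W u j ξ‖ ≤
          M * Q * (z * Real.exp (-((r / 2 - β * (u - t₀)) * z))) := by
        intro u hu
        have hut : u ≤ t := hu.2.trans hst
        refine norm_transport_sub_le hdV hdW hr hT (hut.trans htT) ?_ ?_ hM0 hC.le
          (hVb u (hut.trans htT)) (hWb u (hut.trans htT)) (ih u hu.1.le hut) j ξ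
        · have : β * (u - t₀) ≤ β * (t - t₀) := by gcongr
          linarith
        · have : 0 ≤ β * (u - t₀) := mul_nonneg hβ.le (by linarith [hu.1])
          linarith
      rw [hdiff s hs]
      refine (intervalIntegral.norm_integral_le_of_norm_le hs (Eventually.of_forall hN)
        (hgc.intervalIntegrable _ _)).trans ?_
      rw [intervalIntegral.integral_eq_sub_of_hasDerivAt (fun u _ => hder u)
        (hgc.intervalIntegrable _ _)]
      have hpos : 0 ≤ M * Q / β * Real.exp (-((r / 2 - β * (t₀ - t₀)) * z)) := by positivity
      have hq : M * Q / β ≤ 2 * C * Real.exp (r / 2) * (1 / 2) ^ (n + 1) := by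
        have e : 2 * C * Real.exp (r / 2) * (1 / 2) ^ (n + 1) = M * (1 / 2) := by rw [hM]; ring
        have e1 : M * Q ≤ M * (β / 2) := mul_le_mul_of_nonneg_left (by linarith) hM0
        rw [e, div_le_iff₀ hβ]
        linarith
      calc _ ≤ M * Q / β * Real.exp (-((r / 2 - β * (s - t₀)) * z)) := by linarith
        _ ≤ _ := by gcongr
  have hlim : Tendsto (fun n : ℕ => (2 * C * Real.exp (r / 2) * (1 / 2) ^ n) *
      Real.exp (-((r / 2 - β * (t - t₀)) * (1 + |(j : ℝ)| + |ξ|)))) atTop (𝓝 0) := by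
    have := ((tendsto_pow_atTop_nhds_zero_of_lt_one (r := (1 / 2 : ℝ)) (by norm_num)
      (by norm_num)).const_mul (2 * C * Real.exp (r / 2))).mul_const
      (Real.exp (-((r / 2 - β * (t - t₀)) * (1 + |(j : ℝ)| + |ξ|))))
    simpa using this
  have h0 := ge_of_tendsto' hlim fun n => main n t ht le_rfl j ξ
  exact sub_eq_zero.1 (norm_le_zero_iff.1 h0)

/-- Solutions on the Fourier side are determined by their initial data. -/
theorem IsFourierSolution.unique (hV : IsFourierSolution V) (hW : IsFourierSolution W)
    (h0 : ∀ j ξ, V 0 j ξ = W 0 j ξ) {t : ℝ} (ht : 0 ≤ t) (j : ℤ) (ξ : ℝ) : V t j ξ = W t j ξ := by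
  have hT : 0 < t + 1 := by positivity
  obtain ⟨A, a, hA, ha, hVb⟩ := hV.decaying.bound (t + 1) hT
  obtain ⟨B, b, hB, hb, hWb⟩ := hW.decaying.bound (t + 1) hT
  set C := max A B
  set r := min a b
  have hr : 0 < r := lt_min ha hb
  have hC : 0 < C := hA.trans_le (le_max_left _ _)
  have hVb' : ∀ s ≤ t + 1, ∀ (j : ℤ) (ξ : ℝ), ‖V s j ξ‖ ≤
      C * Real.exp (-(r * (|(j : ℝ)| + |ξ|))) := fun s hs j ξ => (hVb s hs j ξ).trans (by
    gcongr
    · exact le_max_left _ _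
    · exact min_le_left _ _)
  have hWb' : ∀ s ≤ t + 1, ∀ (j : ℤ) (ξ : ℝ), ‖W s j ξ‖ ≤
      C * Real.exp (-(r * (|(j : ℝ)| + |ξ|))) := fun s hs j ξ => (hWb s hs j ξ).trans (by
    gcongr
    · exact le_max_right _ _
    · exact min_le_right _ _)
  set β := 2 * (2 * C * (1 + (t + 1)) * ∑' l : ℤ, Real.exp (-(r / 2 * |(l : ℝ)|))) + 1 with hβ
  have hβ0 : 0 < β := by
    have : 0 ≤ ∑' l : ℤ, Real.exp (-(r / 2 * |(l : ℝ)|)) := tsum_nonneg fun l => (Real.exp_pos _).le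
    positivity
  -- `C`, `r` and `β` serve the whole interval `[0, t + 1]`, so every step has the same length `r /
  -- (2 β)` and finitely many reach `t`.
  have main : ∀ n : ℕ, ∀ s, 0 ≤ s → s ≤ t → s ≤ n * (r / 2 / β) → ∀ j ξ, V s j ξ = W s j ξ := by
    intro n
    induction n with
    | zero =>
      intro s hs _ hsn j ξ
      have : s = 0 := le_antisymm (by simpa using hsn) hs
      rw [this, h0]
    | succ n ih =>
      intro s hs hst hsn j ξ
      rcases le_total s (n * (r / 2 / β)) with h | h
      · exact ih s hs hst h j ξ
      · have hn0 : 0 ≤ n * (r / 2 / β) := by positivity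
        refine hV.eq_of_eq_on_short hW hr hC hVb' hWb' hβ0 (by rw [hβ]; linarith) hn0 hT.le
          (ih _ hn0 (h.trans hst) le_rfl) h (by linarith) ?_ j ξ
        push_cast at hsn
        have : s - n * (r / 2 / β) ≤ r / 2 / β := by linarith
        rw [le_div_iff₀ hβ0] at this
        linarith
  obtain ⟨n, hn⟩ := exists_nat_ge (t / (r / 2 / β))
  rw [div_le_iff₀ (by positivity)] at hn
  exact main n t ht le_rfl hn j ξ

end

/-! ### Summation of the echo expansion -/

/-- The weight of a term of the echo expansion. -/
def expWeight (lam : ℝ) (m : ℤ × ℕ) : ℝ := Real.exp (-(lam * (|(m.1 : ℝ)| + m.2)))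

theorem expWeight_pos (lam : ℝ) (m : ℤ × ℕ) : 0 < expWeight lam m := Real.exp_pos _

theorem summable_expWeight {lam : ℝ} (hl : 0 < lam) : Summable (expWeight lam) := by
  have h1 : Summable fun n : ℕ => Real.exp (-(lam * (n : ℝ))) := by
    refine (Real.summable_exp_nat_mul_iff (a := -lam)|>.2 (by linarith)).congr fun n => ?_
    congr 1; ring
  refine ((summable_exp_neg_mul_abs_int hl).mul_of_nonneg h1 (fun _ => (Real.exp_pos _).le)
    fun _ => (Real.exp_pos _).le).congr fun m => ?_
  rw [← Real.exp_add]
  unfold expWeight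
  ring_nf

/-- A summable solution of the hierarchy of equations for the coefficients `H k η n` of the echo
expansion, with densities `P k η n` and quadratic forcing `F k η n`. -/
structure EchoSeries (K : ℕ) (L lam A : ℝ) (h : ℝ → ℂ) (P : ℤ → ℤ → ℕ → ℝ → ℂ)
    (H F : ℤ → ℤ → ℕ → ℝ → ℝ → ℂ) : Prop where
  one_le_K : 1 ≤ K
  lam_pos : 0 < lam
  L_pos : 0 < L
  P_continuous : ∀ k η n, Continuous (P k η n)
  H_continuous : ∀ k η n, Continuous fun z : ℝ × ℝ => H k η n z.1 z.2
  F_continuous : ∀ k η n, Continuous fun z : ℝ × ℝ => F k η n z.1 z.2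
  H_max_zero : ∀ k η n t ξ, H k η n (max t 0) ξ = H k η n t ξ
  H_bound : ∀ (k η : ℤ) (n : ℕ) (t ξ : ℝ),
    ‖H k η n t ξ‖ ≤ Real.exp (-(lam * (|(k : ℝ)| + |ξ|))) * expWeight lam (η, n)
  P_bound : ∀ (k η : ℤ) (n : ℕ) (t : ℝ), 0 ≤ t →
    ‖P k η n t‖ ≤ A * Real.exp (-(lam * |(k : ℝ)|)) * expWeight lam (η, n)
  F_bound : ∀ (k η : ℤ) (n : ℕ) (s ξ : ℝ), 0 ≤ s → ‖F k η n s ξ‖ ≤ A * expWeight lam (η, n)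
  H_resFreq : ∀ k η n t, H k η n t (resFreq K L k η t) = P k η n t
  F_zero : ∀ k η s ξ, F k η 0 s ξ = 0
  F_succ : ∀ k η n s ξ, F k η (n + 1) s ξ = ∑ i : Fin (n + 1),
    interaction K L (fun k η => P k η i) (fun k η => H k η (n - i)) k η s ξ
  h_continuous : Continuous h
  h_bound : ∀ ζ, ‖h ζ‖ ≤ A
  eq : ∀ k η n t ξ, 0 ≤ t → H k η n t ξ = H k η n 0 ξ +
    ∫ s in (0 : ℝ)..t, (F k η n s ξ + linearTerm K L h (fun k η => P k η n) k η s ξ)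

/-- The Fourier coefficients of an echo expansion. -/
def echoCoeff (K : ℕ) (L : ℝ) (H : ℤ → ℤ → ℕ → ℝ → ℝ → ℂ) (t : ℝ) (j : ℤ) (ξ : ℝ) : ℂ :=
  if (K : ℤ) ∣ j then ∑' m : ℤ × ℕ, H (j / K) m.1 m.2 t (ξ - L * m.1) else 0

section

variable {K : ℕ} {L lam A : ℝ} {h : ℝ → ℂ} {P : ℤ → ℤ → ℕ → ℝ → ℂ} {H F : ℤ → ℤ → ℕ → ℝ → ℝ → ℂ}

theorem echoCoeff_mul (hK : 1 ≤ K) (t : ℝ) (k : ℤ) (ξ : ℝ) :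
    echoCoeff K L H t (K * k) ξ = ∑' m : ℤ × ℕ, H k m.1 m.2 t (ξ - L * m.1) := by
  have hK0 : (K : ℤ) ≠ 0 := by exact_mod_cast (by omega : K ≠ 0)
  unfold echoCoeff
  rw [if_pos (dvd_mul_right _ _), Int.mul_ediv_cancel_left k hK0]

theorem echoCoeff_of_not_dvd {j : ℤ} (hj : ¬(K : ℤ) ∣ j) (t ξ : ℝ) : echoCoeff K L H t j ξ = 0 :=
  if_neg hj

theorem EchoSeries.norm_H_le (hE : EchoSeries K L lam A h P H F) (k η : ℤ) (n : ℕ) (t ξ : ℝ) :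
    ‖H k η n t ξ‖ ≤ expWeight lam (η, n) := by
  refine (hE.H_bound k η n t ξ).trans (mul_le_of_le_one_left (expWeight_pos _ _).le ?_)
  rw [Real.exp_le_one_iff, neg_nonpos]
  have := hE.lam_pos
  positivity

theorem EchoSeries.A_nonneg (hE : EchoSeries K L lam A h P H F) : 0 ≤ A :=
  (norm_nonneg _).trans (hE.h_bound 0)

theorem EchoSeries.hasSum_H (hE : EchoSeries K L lam A h P H F) (t : ℝ) (k : ℤ) (ξ : ℝ) :
    HasSum (fun m : ℤ × ℕ => H k m.1 m.2 t (ξ - L * m.1)) (echoCoeff K L H t (K * k) ξ) := by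
  rw [echoCoeff_mul hE.one_le_K]
  exact (Summable.of_norm_bounded (summable_expWeight hE.lam_pos)
    fun m => hE.norm_H_le k m.1 m.2 t _).hasSum

theorem EchoSeries.hasSum_P (hE : EchoSeries K L lam A h P H F) (t : ℝ) (k : ℤ) :
    HasSum (fun m : ℤ × ℕ => P k m.1 m.2 t) (echoCoeff K L H t (K * k) (K * k * max t 0)) := by
  refine (hE.hasSum_H t k _).congr_fun fun m => ?_
  rw [← hE.H_resFreq]
  rfl

theorem EchoSeries.isDecaying (hE : EchoSeries K L lam A h P H F) : IsDecaying (echoCoeff K L H) := by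
  have hl := hE.lam_pos
  refine ⟨fun j => ?_, fun t j ξ => ?_, fun T _ => ?_⟩
  · unfold echoCoeff
    split_ifs
    · exact continuous_tsum (fun m => (hE.H_continuous _ m.1 m.2).comp
        (by fun_prop : Continuous fun z : ℝ × ℝ => (z.1, z.2 - L * m.1)))
        (summable_expWeight hl) fun m z => hE.norm_H_le _ _ _ _ _
    · exact continuous_const
  · unfold echoCoeff
    simp only [hE.H_max_zero]
  · have hs := summable_expWeight (half_pos hl)
    have hLp := hE.L_pos
    -- Half of the weight pays for the sum over `(η, n)`. The other half controls the physical
    -- frequencies through `K |k| + |ξ| ≤ (1 + K + L) (|k| + |ξ - L η| + |η|)`. This rate depends on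
    -- `K` and `L`, which is harmless because it is only used qualitatively.
    refine ⟨∑' m, expWeight (lam / 2) m, lam / (2 * (1 + K + L)),
      hs.tsum_pos (fun m => (expWeight_pos _ m).le) (0, 0) (expWeight_pos _ _), by positivity,
      fun t _ j ξ => ?_⟩
    by_cases hj : (K : ℤ) ∣ j
    · obtain ⟨k, rfl⟩ := hj
      rw [echoCoeff_mul hE.one_le_K]
      refine tsum_of_norm_bounded (f := fun m : ℤ × ℕ => H k m.1 m.2 t (ξ - L * m.1))
        (hs.hasSum.mul_right _) fun m => (hE.H_bound k m.1 m.2 t _).trans ?_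
      unfold expWeight
      rw [← Real.exp_add, ← Real.exp_add]
      refine Real.exp_le_exp.2 ?_
      set r := lam / (2 * (1 + K + L)) with hr
      have hr0 : 0 < r := by positivity
      have e0 : r * (1 + K + L) = lam / 2 := by rw [hr]; field_simp
      push_cast
      rw [abs_mul, Nat.abs_cast]
      have h1 : |ξ| ≤ |ξ - L * m.1| + L * |(m.1 : ℝ)| := by
        have := abs_add_le (ξ - L * m.1) (L * m.1)
        rwa [sub_add_cancel, abs_mul L, abs_of_pos hLp] at this
      have h2 : r * (K * |(k : ℝ)| + |ξ|) ≤
          r * (1 + K + L) * (|(k : ℝ)| + |ξ - L * m.1| + |(m.1 : ℝ)|) := by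
        rw [mul_assoc]
        refine mul_le_mul_of_nonneg_left ?_ hr0.le
        have hKn : (0 : ℝ) ≤ K := Nat.cast_nonneg K
        have a1 := mul_nonneg hKn (abs_nonneg (ξ - L * m.1))
        have a2 := mul_nonneg hKn (abs_nonneg (m.1 : ℝ))
        have a3 := mul_nonneg hLp.le (abs_nonneg (ξ - L * m.1))
        have a4 := mul_nonneg hLp.le (abs_nonneg (k : ℝ))
        have a5 := abs_nonneg (k : ℝ)
        have a6 := abs_nonneg (m.1 : ℝ)
        linarith
      rw [e0] at h2
      have h3 : 0 ≤ lam / 2 * (|(k : ℝ)| + |ξ - L * m.1|) := by positivity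
      have h4 : 0 ≤ lam / 2 * (m.2 : ℝ) := by positivity
      linarith
    · rw [echoCoeff_of_not_dvd hj, norm_zero]
      have : 0 ≤ ∑' m, expWeight (lam / 2) m := tsum_nonneg fun m => (expWeight_pos _ m).le
      positivity

/-- One term of the quadratic nonlinearity of the echo expansion. -/
def echoTerm (K : ℕ) (L : ℝ) (P : ℤ → ℤ → ℕ → ℝ → ℂ) (H : ℤ → ℤ → ℕ → ℝ → ℝ → ℂ) (s : ℝ) (k : ℤ)
    (ξ : ℝ) (x : ℤ × ((ℤ × ℕ) × (ℤ × ℕ))) : ℂ :=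
  -(P x.1 x.2.1.1 x.2.1.2 s / (K * x.1)) * ((ξ - K * k * max s 0 : ℝ) : ℂ) *
    H (k - x.1) x.2.2.1 x.2.2.2 s (ξ - K * x.1 * max s 0 - L * x.2.2.1)

theorem EchoSeries.summable_echoTerm (hE : EchoSeries K L lam A h P H F) {s : ℝ} (hs : 0 ≤ s) (k : ℤ)
    (ξ : ℝ) : Summable (echoTerm K L P H s k ξ) := by
  have hl := hE.lam_pos
  have hw := summable_expWeight hl
  have hA := hE.A_nonneg
  have hbound := ((summable_exp_neg_mul_abs_int hl).mul_of_nonneg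
    (hw.mul_of_nonneg hw (fun m => (expWeight_pos _ m).le) fun m => (expWeight_pos _ m).le)
    (fun _ => (Real.exp_pos _).le)
    fun m => mul_nonneg (expWeight_pos _ _).le (expWeight_pos _ _).le).mul_left
    (A * |ξ - K * k * max s 0|)
  refine .of_norm_bounded hbound fun x => ?_
  unfold echoTerm
  have h1 := hE.P_bound x.1 x.2.1.1 x.2.1.2 s hs
  have h2 := hE.norm_H_le (k - x.1) x.2.2.1 x.2.2.2 s (ξ - K * x.1 * max s 0 - L * x.2.2.1)
  have h3 : ‖P x.1 x.2.1.1 x.2.1.2 s / (K * x.1)‖ ≤ ‖P x.1 x.2.1.1 x.2.1.2 s‖ := by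
    have := norm_div_intCast_le (P x.1 x.2.1.1 x.2.1.2 s) (K * x.1)
    simpa using this
  rw [norm_mul, norm_mul, norm_neg, Complex.norm_real, Real.norm_eq_abs]
  calc _ ≤ (A * Real.exp (-(lam * |(x.1 : ℝ)|)) * expWeight lam x.2.1) * |ξ - K * k * max s 0| *
        expWeight lam x.2.2 := by
        have := h3.trans h1
        gcongr
        have := expWeight_pos lam x.2.1
        positivity
    _ = _ := by ring

/-- The reindexing of the quadratic terms by the mode that they contribute to. -/
def echoIndex (y : Σ m : ℤ × ℕ, Fin (m.2 + 1) × (ℤ × ℤ)) : ℤ × ((ℤ × ℕ) × (ℤ × ℕ)) :=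
  (y.2.2.1, (y.2.2.2, y.2.1), (y.1.1 - y.2.2.2, y.1.2 - y.2.1))

theorem bijective_echoIndex : Function.Bijective echoIndex := by
  constructor
  · rintro ⟨⟨η, n⟩, ⟨i, hi⟩, l, η₁⟩ ⟨⟨η', n'⟩, ⟨i', hi'⟩, l', η₁'⟩ he
    simp only [echoIndex, Prod.mk.injEq] at he
    obtain ⟨rfl, ⟨rfl, rfl⟩, h1, h2⟩ := he
    obtain rfl : η = η' := by linarith
    obtain rfl : n = n' := by simp only at hi hi' h2; omega
    rfl
  · rintro ⟨l, ⟨η₁, a⟩, ⟨η₂, b⟩⟩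
    refine ⟨⟨(η₁ + η₂, a + b), ⟨a, by simp only; omega⟩, l, η₁⟩, ?_⟩
    simp [echoIndex]

/-- A rearrangement of the absolutely convergent double series: `echoIndex` groups the pairs of
modes by their total `η` and total order. Two factors of orders `i` and `n - i` contribute to order
`n + 1`, and order zero has no quadratic forcing, which accounts for the shift at the end. -/
theorem EchoSeries.hasSum_F (hE : EchoSeries K L lam A h P H F) {s : ℝ} (hs : 0 ≤ s) (k : ℤ) (ξ : ℝ) :
    HasSum (fun m : ℤ × ℕ => F k m.1 m.2 s (ξ - L * m.1)) (∑' x, echoTerm K L P H s k ξ x) := by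
  have hT := (hE.summable_echoTerm hs k ξ).hasSum
  rw [← (Equiv.ofBijective echoIndex bijective_echoIndex).hasSum_iff] at hT
  have hfib : ∀ m : ℤ × ℕ, HasSum (fun c : Fin (m.2 + 1) × (ℤ × ℤ) =>
      echoTerm K L P H s k ξ (echoIndex ⟨m, c⟩)) (F k m.1 (m.2 + 1) s (ξ - L * m.1)) := by
    intro m
    have hsum : Summable fun c : Fin (m.2 + 1) × (ℤ × ℤ) =>
        echoTerm K L P H s k ξ (echoIndex ⟨m, c⟩) := hT.summable.sigma_factor m
    have h1 := hsum.hasSum.prod_fiberwise fun i => (hsum.prod_factor i).hasSum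
    have h2 : F k m.1 (m.2 + 1) s (ξ - L * m.1) =
        ∑ i : Fin (m.2 + 1), ∑' c, echoTerm K L P H s k ξ (echoIndex ⟨m, (i, c)⟩) := by
      rw [hE.F_succ]
      refine Finset.sum_congr rfl fun i _ => tsum_congr fun c => ?_
      unfold interactionTerm echoTerm echoIndex resFreq
      simp only
      rw [show ξ - L * m.1 - (K * k * max s 0 - L * m.1) = ξ - K * k * max s 0 by ring,
        show ξ - L * m.1 - (K * c.1 * max s 0 - L * c.2) =
          ξ - K * c.1 * max s 0 - L * ((m.1 - c.2 : ℤ) : ℝ) by push_cast; ring]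
      simp
    rw [h2, (hasSum_fintype _).unique h1]
    exact hsum.hasSum
  have h3 := hT.sigma hfib
  have hinj : Function.Injective fun m : ℤ × ℕ => (m.1, m.2 + 1) := fun a b hab => by
    simp only [Prod.mk.injEq, add_left_inj] at hab
    exact Prod.ext hab.1 hab.2
  refine (hinj.hasSum_iff fun m hm => ?_).1 h3
  obtain ⟨η, n⟩ := m
  cases n with
  | zero => exact hE.F_zero _ _ _ _
  | succ n => exact absurd ⟨(η, n), rfl⟩ hm

theorem EchoSeries.hasSum_linearTerm (hE : EchoSeries K L lam A h P H F) (s : ℝ) (k : ℤ) (ξ : ℝ) :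
    HasSum (fun m : ℤ × ℕ => linearTerm K L h (fun k η => P k η m.2) k m.1 s (ξ - L * m.1))
      (-(echoCoeff K L H s (K * k) (K * k * max s 0) / (K * k)) * ((ξ - K * k * max s 0 : ℝ) : ℂ) *
        h (ξ - K * k * max s 0)) := by
  have h1 := (((hE.hasSum_P s k).div_const ((K : ℂ) * k)).neg.mul_right
    ((ξ - K * k * max s 0 : ℝ) : ℂ)).mul_right (h (ξ - K * k * max s 0))
  refine h1.congr_fun fun m => ?_
  unfold linearTerm resFreq
  rw [show ξ - L * m.1 - (K * k * max s 0 - L * m.1) = ξ - K * k * max s 0 by ring]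
  push_cast
  rfl

end

/-! ### The echo expansion together with the equilibrium -/

section

variable {K : ℕ} {L lam A : ℝ} {P : ℤ → ℤ → ℕ → ℝ → ℂ} {H F : ℤ → ℤ → ℕ → ℝ → ℝ → ℂ} {μ : ℝ → ℝ}
  {θ₀ C₀ : ℝ}

/-- The Fourier coefficients of the equilibrium and an echo expansion. -/
def totalCoeff (μ : ℝ → ℝ) (K : ℕ) (L : ℝ) (H : ℤ → ℤ → ℕ → ℝ → ℝ → ℂ) (t : ℝ) (j : ℤ) (ξ : ℝ) : ℂ :=
  echoCoeff K L H t j ξ + equilibriumCoeff μ t j ξ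

theorem transport_totalCoeff_of_not_dvd {j : ℤ} (hj : ¬(K : ℤ) ∣ j) (s ξ : ℝ) :
    transport (totalCoeff μ K L H) (totalCoeff μ K L H) s j ξ = 0 := by
  unfold transport
  rw [← tsum_zero (L := .unconditional ℤ)]
  refine tsum_congr fun l => ?_
  have hvan : ∀ {i : ℤ}, ¬(K : ℤ) ∣ i → ∀ ζ, totalCoeff μ K L H s i ζ = 0 := fun {i} hi ζ => by
    have hi0 : i ≠ 0 := fun h => hi (h ▸ dvd_zero _)
    simp [totalCoeff, echoCoeff_of_not_dvd hi, equilibriumCoeff, hi0]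
  unfold transportTerm
  by_cases hl : (K : ℤ) ∣ l
  · have h2 : ¬(K : ℤ) ∣ j - l := fun h => hj (by have := dvd_add h hl; rwa [sub_add_cancel] at this)
    rw [hvan h2, mul_zero]
  · rw [hvan hl, zero_div, neg_zero, zero_mul, zero_mul]

theorem EchoSeries.hasSum_echoTerm_factor {h : ℝ → ℂ} (hE : EchoSeries K L lam A h P H F) {s : ℝ}
    (hs : 0 ≤ s) (k : ℤ) (ξ : ℝ) (l : ℤ) : HasSum (fun c => echoTerm K L P H s k ξ (l, c))
      (-(echoCoeff K L H s (K * l) (K * l * max s 0) / (K * l)) * ((ξ - K * k * max s 0 : ℝ) : ℂ) *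
        echoCoeff K L H s (K * (k - l)) (ξ - K * l * max s 0)) := by
  have h1 : HasSum (fun a : ℤ × ℕ => -(P l a.1 a.2 s / (K * l)) * ((ξ - K * k * max s 0 : ℝ) : ℂ))
      (-(echoCoeff K L H s (K * l) (K * l * max s 0) / (K * l)) *
        ((ξ - K * k * max s 0 : ℝ) : ℂ)) :=
    ((hE.hasSum_P s l).div_const ((K : ℂ) * l)).neg.mul_right ((ξ - K * k * max s 0 : ℝ) : ℂ)
  have h2 := hE.hasSum_H s (k - l) (ξ - K * l * max s 0)
  have hT := (hE.summable_echoTerm hs k ξ).prod_factor l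
  have h3 := HasSum.mul h1 h2 (by simpa only [echoTerm] using hT)
  simpa only [echoTerm] using h3

/-- The equilibrium occupies only the mode zero. It generates no field, so it enters through the
second factor alone, and there only for `l = k`. -/
theorem transportTerm_totalCoeff (hK : 1 ≤ K) (s : ℝ) (k : ℤ) (ξ : ℝ) (l : ℤ) :
    transportTerm (totalCoeff μ K L H) (totalCoeff μ K L H) s (K * k) ξ (K * l) =
      -(echoCoeff K L H s (K * l) (K * l * max s 0) / (K * l)) * ((ξ - K * k * max s 0 : ℝ) : ℂ) *
        echoCoeff K L H s (K * (k - l)) (ξ - K * l * max s 0) +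
      if l = k then -(echoCoeff K L H s (K * k) (K * k * max s 0) / (K * k)) *
        ((ξ - K * k * max s 0 : ℝ) : ℂ) * equilibriumHat μ (ξ - K * k * max s 0) else 0 := by
  have hK0 : K ≠ 0 := by omega
  unfold transportTerm totalCoeff
  rcases eq_or_ne l 0 with hl | hl
  · subst hl
    by_cases hk : 0 = k
    · subst hk; simp
    · simp [hk]
  · have e1 : equilibriumCoeff μ s ((K : ℤ) * l) (((K * l : ℤ) : ℝ) * max s 0) = 0 := by
      simp [equilibriumCoeff, hK0, hl]
    rw [e1, add_zero, ← mul_sub, mul_add]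
    push_cast
    congr 1
    by_cases hlk : l = k
    · subst hlk
      simp [equilibriumCoeff]
    · have : k - l ≠ 0 := sub_ne_zero.2 (Ne.symm hlk)
      simp [equilibriumCoeff, hlk, this, hK0]

theorem EchoSeries.transport_totalCoeff {h : ℝ → ℂ} (hE : EchoSeries K L lam A h P H F) {s : ℝ}
    (hs : 0 ≤ s) (k : ℤ) (ξ : ℝ) :
    transport (totalCoeff μ K L H) (totalCoeff μ K L H) s (K * k) ξ =
      ∑' x, echoTerm K L P H s k ξ x +
      -(echoCoeff K L H s (K * k) (K * k * max s 0) / (K * k)) *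
        ((ξ - K * k * max s 0 : ℝ) : ℂ) * equilibriumHat μ (ξ - K * k * max s 0) := by
  have hK0 : (K : ℤ) ≠ 0 := by exact_mod_cast (by have := hE.one_le_K; omega : K ≠ 0)
  have hsum := ((hE.summable_echoTerm hs k ξ).hasSum.prod_fiberwise
    (hE.hasSum_echoTerm_factor hs k ξ)).add (hasSum_ite_eq k
      (-(echoCoeff K L H s (K * k) (K * k * max s 0) / (K * k)) *
        ((ξ - K * k * max s 0 : ℝ) : ℂ) * equilibriumHat μ (ξ - K * k * max s 0)))
  have hinj : Function.Injective fun l : ℤ => (K : ℤ) * l := mul_right_injective₀ hK0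
  have hterm := hsum.congr_fun fun l => transportTerm_totalCoeff (μ := μ) hE.one_le_K s k ξ l
  refine ((hinj.hasSum_iff (f := fun l =>
    transportTerm (totalCoeff μ K L H) (totalCoeff μ K L H) s (K * k) ξ l) fun l hl => ?_).1
      hterm).tsum_eq
  have hd : ¬(K : ℤ) ∣ l := fun ⟨c, hc⟩ => hl ⟨c, hc.symm⟩
  have hl0 : l ≠ 0 := fun h => hd (h ▸ dvd_zero _)
  simp [transportTerm, totalCoeff, echoCoeff_of_not_dvd hd, equilibriumCoeff, hl0]

theorem EchoSeries.hasSum_transport (hE : EchoSeries K L lam A (equilibriumHat μ) P H F) {s : ℝ}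
    (hs : 0 ≤ s) (k : ℤ) (ξ : ℝ) :
    HasSum (fun m : ℤ × ℕ => F k m.1 m.2 s (ξ - L * m.1) +
      linearTerm K L (equilibriumHat μ) (fun k η => P k η m.2) k m.1 s (ξ - L * m.1))
      (transport (totalCoeff μ K L H) (totalCoeff μ K L H) s (K * k) ξ) := by
  rw [hE.transport_totalCoeff hs]
  exact (hE.hasSum_F hs k ξ).add (hE.hasSum_linearTerm s k ξ)

theorem EchoSeries.continuous_linearTerm_left {h : ℝ → ℂ} (hE : EchoSeries K L lam A h P H F)
    (k : ℤ) (ξ : ℝ) (m : ℤ × ℕ) :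
    Continuous fun s => linearTerm K L h (fun k η => P k η m.2) k m.1 s (ξ - L * m.1) := by
  unfold linearTerm
  have h1 := hE.P_continuous k m.1 m.2
  have h2 := continuous_resFreq K L k m.1
  have h3 := hE.h_continuous
  exact ((h1.div_const _).neg.mul (Complex.continuous_ofReal.comp (continuous_const.sub h2))).mul
    (h3.comp (continuous_const.sub h2))

/-- The sum of an echo expansion solves the Vlasov–Poisson system. -/
theorem EchoSeries.isFourierSolution (hE : EchoSeries K L lam A (equilibriumHat μ) P H F)
    (hμ : IsAnalyticEquilibrium μ θ₀ C₀) (hθ₀ : 0 < θ₀) (hC₀ : 0 < C₀) :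
    IsFourierSolution (totalCoeff μ K L H) := by
  refine ⟨hE.isDecaying.add (hμ.isDecaying hθ₀ hC₀), fun t j ξ ht => ?_⟩
  have hl := hE.lam_pos
  have hA := hE.A_nonneg
  by_cases hj : (K : ℤ) ∣ j
  · obtain ⟨k, rfl⟩ := hj
    have hFc : ∀ m : ℤ × ℕ, Continuous fun s => F k m.1 m.2 s (ξ - L * m.1) := fun m =>
      (hE.F_continuous k m.1 m.2).comp (by fun_prop : Continuous fun s : ℝ => (s, ξ - L * m.1))
    have hint : HasSum (fun m : ℤ × ℕ => ∫ s in (0 : ℝ)..t, (F k m.1 m.2 s (ξ - L * m.1) +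
        linearTerm K L (equilibriumHat μ) (fun k η => P k η m.2) k m.1 s (ξ - L * m.1)))
        (∫ s in (0 : ℝ)..t, transport (totalCoeff μ K L H) (totalCoeff μ K L H) s (K * k) ξ) := by
      refine intervalIntegral.hasSum_integral_of_dominated_convergence
        (fun m _ => (A + A * (|ξ| + K * |(k : ℝ)| * t) * A) * expWeight lam m)
        (fun m => ((hFc m).add (hE.continuous_linearTerm_left k ξ m)).aestronglyMeasurable)
        (fun m => Eventually.of_forall fun s hs => ?_)
        (Eventually.of_forall fun s _ => (summable_expWeight hl).mul_left _)
        (by simp) (Eventually.of_forall fun s hs => ?_)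
      · rw [uIoc_of_le ht] at hs
        have h1 := hE.F_bound k m.1 m.2 s (ξ - L * m.1) hs.1.le
        have h2 := hE.P_bound k m.1 m.2 s hs.1.le
        have h3 : ‖P k m.1 m.2 s / (K * k)‖ ≤ A * expWeight lam m := by
          have e := norm_div_intCast_le (P k m.1 m.2 s) (K * k)
          push_cast at e
          refine e.trans (h2.trans ?_)
          have : Real.exp (-(lam * |(k : ℝ)|)) ≤ 1 := by
            rw [Real.exp_le_one_iff, neg_nonpos]; positivity
          have hw := (expWeight_pos lam m).le
          exact mul_le_mul_of_nonneg_right (mul_le_of_le_one_right hA this) hw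
        rw [add_mul]
        refine (norm_add_le _ _).trans (add_le_add h1 ?_)
        unfold linearTerm
        rw [norm_mul, norm_mul, norm_neg, Complex.norm_real, Real.norm_eq_abs]
        have h4 : |ξ - L * m.1 - resFreq K L k m.1 s| ≤ |ξ| + K * |(k : ℝ)| * t := by
          unfold resFreq
          rw [show ξ - L * m.1 - (K * k * max s 0 - L * m.1) = ξ - K * k * max s 0 by ring,
            max_eq_left hs.1.le]
          refine (abs_sub _ _).trans (add_le_add le_rfl ?_)
          rw [abs_mul, abs_mul, Nat.abs_cast, abs_of_pos hs.1]
          have := hs.2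
          gcongr
        have hw := (expWeight_pos lam m).le
        calc _ ≤ (A * expWeight lam m) * (|ξ| + K * |(k : ℝ)| * t) * A := by
              gcongr
              · exact h3
              · exact hE.h_bound _
          _ = _ := by ring
      · rw [uIoc_of_le ht] at hs
        exact hE.hasSum_transport hs.1.le k ξ
    have h := (hE.hasSum_H 0 k ξ).add hint
    have h2 : HasSum (fun m : ℤ × ℕ => H k m.1 m.2 t (ξ - L * m.1)) _ :=
      h.congr_fun fun m => (hE.eq k m.1 m.2 t _ ht)
    unfold totalCoeff
    rw [(hE.hasSum_H t k ξ).unique h2, add_right_comm]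
    rfl
  · simp only [transport_totalCoeff_of_not_dvd hj, intervalIntegral.integral_zero, add_zero]
    simp [totalCoeff, echoCoeff_of_not_dvd hj, equilibriumCoeff]

end

/-! ### The echo series of the Vlasov–Poisson system -/

section

variable {lam C₀ θ₀ θ₁ M L A₁ A₂ B ε : ℝ} {K : ℕ} {h : ℝ → ℂ} {G : ℤ → ℝ → ℂ}
  {data : ℤ → ℤ → ℝ → ℂ}

theorem interaction_mul (K L : ℝ) (a b : ℂ) (P : ℤ → ℤ → ℝ → ℂ) (H : ℤ → ℤ → ℝ → ℝ → ℂ) (k η : ℤ)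
    (s ξ : ℝ) : interaction K L (fun k η s => a * P k η s) (fun k η s ξ => b * H k η s ξ) k η s ξ =
      a * b * interaction K L P H k η s ξ := by
  unfold interaction
  rw [← tsum_mul_left]
  refine tsum_congr fun m => ?_
  unfold interactionTerm
  ring

theorem linearTerm_mul (K L : ℝ) (a : ℂ) (P : ℤ → ℤ → ℝ → ℂ) (k η : ℤ) (s ξ : ℝ) :
    linearTerm K L h (fun k η s => a * P k η s) k η s ξ = a * linearTerm K L h P k η s ξ := by
  unfold linearTerm
  ring

theorem weight_le_exp (hl : 0 < lam) (t : ℝ) {x : ℝ} (hx : 0 ≤ x) :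
    weight lam t x ≤ Real.exp (-(lam * x)) := by
  unfold weight
  have h1 : ((1 + x) ^ 20)⁻¹ ≤ 1 := inv_le_one_of_one_le₀ (one_le_pow₀ (by linarith))
  refine (mul_le_of_le_one_right (Real.exp_pos _).le h1).trans ?_
  have := le_radius hl t
  gcongr

theorem one_add_mul_weight_le_exp (hl : 0 < lam) (t : ℝ) {x : ℝ} (hx : 0 ≤ x) :
    (1 + x) * weight lam t x ≤ Real.exp (-(lam * x)) := by
  unfold weight
  have h1 : (1 + x) * ((1 + x) ^ 20)⁻¹ ≤ 1 := by
    rw [← div_eq_mul_inv, div_le_one (by positivity)]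
    exact le_self_pow₀ (by linarith) (by norm_num)
  rw [mul_left_comm]
  refine (mul_le_of_le_one_right (Real.exp_pos _).le h1).trans ?_
  have := le_radius hl t
  gcongr

theorem exp_freqSize_le (hl : 0 < lam) (k η : ℤ) (n : ℕ) (ξ : ℝ) :
    Real.exp (-(lam * freqSize k η n ξ)) ≤
      Real.exp (-(lam * (|(k : ℝ)| + |ξ|))) * expWeight lam (η, n) := by
  unfold expWeight freqSize
  rw [← Real.exp_add]
  refine Real.exp_le_exp.2 ?_
  simp only
  linarith

/-- With `ε * B ≤ 1` the powers of `ε` cancel the geometric growth, and the exponential weight in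
all frequencies and in the order, endpoint `ε * B = 1` included, makes every series converge. -/
theorem EchoContext.isEchoSeries (ctx : EchoContext lam C₀ θ₀ θ₁ M K L h G data) (hl : 0 < lam)
    (hθ₀ : 0 < θ₀) (hC₀ : 0 < C₀)
    (hb : ∀ n, EchoBound lam K L A₁ A₂ B h G data n) (hA₁ : 0 < A₁) (hA₂ : 0 < A₂) (hA₂' : A₂ ≤ 1)
    (hB : 1 ≤ B) (hε : 0 < ε) (hεB : ε * B ≤ 1) :
    ∃ A, EchoSeries K L lam A h
      (fun k η n t => (ε : ℂ) ^ (n + 1) * echoDensity K L h G data n k η t)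
      (fun k η n t ξ => (ε : ℂ) ^ (n + 1) * echoProfile K L h G data n k η t ξ)
      (fun k η n s ξ => (ε : ℂ) ^ (n + 1) * echoForcing K L h G data n k η s ξ) := by
  have hB0 : 0 < B := by linarith
  have hpow : ∀ n : ℕ, ‖(ε : ℂ) ^ (n + 1)‖ * B ^ (n + 1) ≤ 1 := fun n => by
    rw [norm_pow, Complex.norm_real, Real.norm_of_nonneg hε.le, ← mul_pow]
    exact pow_le_one₀ (by positivity) hεB
  have hΓ : 0 ≤ ∑' n, orderWeight n := tsum_nonneg orderWeight_nonneg
  set D := A₁ * A₂ * (2 ^ 20 * (1 + C₀)) * (2 * ∑' n, orderWeight n) with hD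
  have hD0 : 0 ≤ D := by positivity
  have hbi : ∀ n, ∀ i < n, EchoBound lam K L A₁ A₂ B h G data i := fun n i _ => hb i
  refine ⟨A₁ + D + C₀, ?_⟩
  refine ⟨by exact_mod_cast ctx.one_le_K, hl, ctx.L_pos,
    fun k η n => continuous_const.mul ((hb n).1.continuous k η),
    fun k η n => continuous_const.mul ((hb n).2.continuous k η),
    fun k η n => continuous_const.mul (ctx.continuous_echoForcing hl (hbi n) k η),
    fun k η n t ξ => by rw [(hb n).2.max_zero],
    fun k η n t ξ => ?_, fun k η n t ht => ?_, fun k η n s ξ hs => ?_,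
    fun k η n t => by rw [ctx.echoProfile_resFreq hl hb],
    fun k η s ξ => by simp [echoForcing], fun k η n s ξ => ?_, ctx.h_continuous, fun ζ => ?_,
    fun k η n t ξ ht => ?_⟩
  · rw [norm_mul, ← (hb n).2.max_zero]
    have h1 := (hb n).2.bound k η (max t 0) ξ (le_max_right _ _)
    have h2 := weight_le_exp hl (max t 0) (freqSize_pos k η n ξ).le
    have h3 := exp_freqSize_le hl k η n ξ
    have hw := weight_pos (lam := lam) (max t 0) (freqSize_pos k η n ξ).le
    calc _ ≤ ‖(ε : ℂ) ^ (n + 1)‖ * (A₂ * B ^ (n + 1) * weight lam (max t 0) (freqSize k η n ξ)) := by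
          gcongr
      _ = ‖(ε : ℂ) ^ (n + 1)‖ * B ^ (n + 1) * A₂ * weight lam (max t 0) (freqSize k η n ξ) := by ring
      _ ≤ 1 * 1 * weight lam (max t 0) (freqSize k η n ξ) := by
          have := hpow n
          gcongr
      _ ≤ _ := by linarith
  · rw [norm_mul]
    have h1 := (hb n).1.bound k η t ht
    set z := freqSize k η n (resFreq K L k η t) with hz
    have h2 := weight_le_exp hl t (freqSize_pos k η n (resFreq K L k η t)).le
    have h3 := exp_freqSize_le hl k η n (resFreq K L k η t)
    have hw := weight_pos (lam := lam) t (freqSize_pos k η n (resFreq K L k η t)).le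
    rw [← hz] at h2 h3 hw
    have hd := densityDecay_pos ht
    have hd1 : densityDecay t ≤ 1 := by
      unfold densityDecay
      exact inv_le_one_of_one_le₀ (one_le_pow₀ (by linarith))
    have h4 : Real.exp (-(lam * (|(k : ℝ)| + |resFreq K L k η t|))) ≤
        Real.exp (-(lam * |(k : ℝ)|)) := by
      gcongr
      exact le_add_of_nonneg_right (abs_nonneg _)
    have hew := (expWeight_pos lam (η, n)).le
    calc _ ≤ ‖(ε : ℂ) ^ (n + 1)‖ * (A₁ * B ^ (n + 1) * (densityDecay t * weight lam t z)) := by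
          gcongr
      _ = (‖(ε : ℂ) ^ (n + 1)‖ * B ^ (n + 1)) * A₁ * (densityDecay t * weight lam t z) := by ring
      _ ≤ 1 * A₁ * (1 * weight lam t z) := by
          have := hpow n
          gcongr
      _ ≤ (A₁ + D + C₀) * (Real.exp (-(lam * |(k : ℝ)|)) * expWeight lam (η, n)) := by
          rw [one_mul, one_mul]
          refine mul_le_mul (by linarith) (h2.trans (h3.trans ?_)) hw.le (by positivity)
          gcongr
      _ = _ := by ring
  · rw [norm_mul]
    have h1 := ctx.norm_echoForcing_le hl (hbi n) hA₁.le hA₂.le hB0.le hC₀ k η hs ξ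
    set z := freqSize k η n ξ with hz
    have hz0 : 0 < z := freqSize_pos k η n ξ
    have h2 := one_add_mul_weight_le_exp hl s hz0.le
    have h3 := exp_freqSize_le hl k η n ξ
    have h4 : Real.exp (-(lam * (|(k : ℝ)| + |ξ|))) ≤ 1 := by
      rw [Real.exp_le_one_iff, neg_nonpos]; positivity
    have h5 : ((1 + s) ^ 2)⁻¹ ≤ 1 := inv_le_one_of_one_le₀ (one_le_pow₀ (by linarith))
    have hew := (expWeight_pos lam (η, n)).le
    have hw := weight_pos (lam := lam) s hz0.le
    have h6 : ((1 + s) ^ 2)⁻¹ * ((1 + z) * weight lam s z) ≤ expWeight lam (η, n) := by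
      refine (mul_le_of_le_one_left (by positivity) h5).trans (h2.trans (h3.trans ?_))
      exact mul_le_of_le_one_left hew h4
    calc _ ≤ ‖(ε : ℂ) ^ (n + 1)‖ * (A₁ * A₂ * B ^ (n + 1) * (2 ^ 20 * (1 + C₀)) *
          (2 * ∑' n, orderWeight n) * (((1 + s) ^ 2)⁻¹ * ((1 + z) * weight lam s z))) :=
          mul_le_mul_of_nonneg_left h1 (norm_nonneg _)
      _ = (‖(ε : ℂ) ^ (n + 1)‖ * B ^ (n + 1)) * D *
          (((1 + s) ^ 2)⁻¹ * ((1 + z) * weight lam s z)) := by rw [hD]; ring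
      _ ≤ 1 * D * expWeight lam (η, n) := by
          refine mul_le_mul (mul_le_mul_of_nonneg_right (hpow n) hD0) h6 (by positivity)
            (by positivity)
      _ ≤ _ := by
          rw [one_mul]
          refine mul_le_mul_of_nonneg_right ?_ hew
          linarith
  · simp only [echoForcing]
    rw [Finset.mul_sum]
    refine Finset.sum_congr rfl fun i _ => ?_
    rw [interaction_mul, ← pow_add]
    congr 2
    omega
  · refine (ctx.h_bound ζ).trans ?_
    have : Real.exp (-(θ₀ * |ζ|)) ≤ 1 := by
      rw [Real.exp_le_one_iff, neg_nonpos]; positivity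
    nlinarith
  · have h0 : echoProfile K L h G data n k η 0 ξ = echoInit data n k η ξ := by
      rw [echoProfile_eq]; simp [profile]
    have h1 : echoProfile K L h G data n k η t ξ = echoInit data n k η ξ + ∫ s in (0 : ℝ)..t,
        (echoForcing K L h G data n k η s ξ +
          linearTerm K L h (echoDensity K L h G data n) k η s ξ) := by
      rw [echoProfile_eq]; simp [profile, max_eq_left ht]
    rw [h0, h1, mul_add, ← intervalIntegral.integral_const_mul]
    congr 1
    refine intervalIntegral.integral_congr fun s _ => ?_
    simp only [linearTerm_mul, mul_add]

end

/-! ### Sobolev norms of the electric field -/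

theorem integrableOn_abs_rpow {a R : ℝ} (ha : -1 < a) (hR : 0 ≤ R) :
    IntegrableOn (fun y : ℝ => |y| ^ a) (Ioc (-R) R) := by
  have h1 : IntervalIntegrable (fun y : ℝ => |y| ^ a) volume 0 R :=
    (intervalIntegral.intervalIntegrable_rpow' ha).congr fun y hy => by
      rw [uIoc_of_le hR] at hy
      simp only [abs_of_pos hy.1]
  have h2 : IntervalIntegrable (fun y : ℝ => |y| ^ a) volume (-R) 0 := by
    have := (intervalIntegrable_iff_integrableOn_Ioc_of_le (by linarith)).1 h1
    have := h1.comp_sub_left 0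
    simp only [zero_sub, abs_neg, sub_zero] at this
    exact this.symm
  exact (intervalIntegrable_iff_integrableOn_Ioc_of_le (by linarith)).1 (h2.trans h1)

/-- For a Lipschitz function the Slobodeckij quotient is bounded by this power. Its `q`-th power is
`|y| ^ (q (1 - σ) - 1)`, which is integrable at zero exactly because `σ < 1`; for `q = ∞` the
exponent is positive and the function is bounded. -/
theorem memLp_abs_rpow {σ R : ℝ} {q : ℝ≥0∞} (hσ : σ < 1) (hq : 1 ≤ q) (hR : 0 ≤ R) :
    MemLp (fun y : ℝ => |y| ^ (1 - (σ + (1 / q).toReal))) q (volume.restrict (Ioc (-R) R)) := by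
  have hm : AEStronglyMeasurable (fun y : ℝ => |y| ^ (1 - (σ + (1 / q).toReal)))
      (volume.restrict (Ioc (-R) R)) :=
    (by fun_prop : Measurable fun y : ℝ => |y| ^ (1 - (σ + (1 / q).toReal))).aestronglyMeasurable
  rcases eq_or_ne q ⊤ with rfl | hq'
  · refine memLp_top_of_bound hm (R ^ (1 - σ)) ((ae_restrict_iff' measurableSet_Ioc).2
      (Eventually.of_forall fun y hy => ?_))
    have h0 : 0 ≤ |y| := abs_nonneg y
    have h1 : |y| ≤ R := abs_le.2 ⟨hy.1.le, hy.2⟩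
    simp only [one_div, ENNReal.inv_top, ENNReal.toReal_zero, add_zero]
    rw [Real.norm_of_nonneg (by positivity)]
    exact Real.rpow_le_rpow h0 h1 (by linarith)
  · have hq0 : q ≠ 0 := fun h => by simp [h] at hq
    have hqr : 0 < q.toReal := ENNReal.toReal_pos hq0 hq'
    refine (integrable_norm_rpow_iff hm hq0 hq').1 ?_
    have e : ∀ y : ℝ, ‖|y| ^ (1 - (σ + (1 / q).toReal))‖ ^ q.toReal =
        |y| ^ (q.toReal * (1 - σ) - 1) := fun y => by
      rw [Real.norm_of_nonneg (by positivity), ← Real.rpow_mul (abs_nonneg y)]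
      congr 1
      rw [one_div, ENNReal.toReal_inv]
      field_simp
      ring
    simp only [e]
    exact integrableOn_abs_rpow (by nlinarith) hR

theorem norm_iteratedDeriv_add_sub_le {g : ℝ → ℂ} {A : ℝ} {j : ℕ} (hg : ContDiff ℝ ∞ g)
    (hA : ∀ x, ‖iteratedDeriv (j + 1) g x‖ ≤ A) (x y : ℝ) :
    ‖iteratedDeriv j g (x + y) - iteratedDeriv j g x‖ ≤ A * |y| := by
  have hd : Differentiable ℝ (iteratedDeriv j g) :=
    hg.differentiable_iteratedDeriv j (by exact_mod_cast ENat.natCast_lt_top j)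
  have := convex_univ.norm_image_sub_le_of_norm_deriv_le (fun z _ => hd z)
    (fun z _ => by rw [← iteratedDeriv_succ]; exact hA z) (mem_univ x) (mem_univ (x + y))
  simpa using this

/-- The Sobolev norm is bounded by the suprema of finitely many derivatives. -/
theorem exists_sobolevNorm_le (s : ℝ) {q : ℝ≥0∞} (hq : 1 ≤ q) : ∃ N : ℝ≥0∞, N ≠ ⊤ ∧
    ∀ (g : ℝ → ℂ) (A : ℝ), ContDiff ℝ ∞ g → 0 ≤ A →
      (∀ j ≤ ⌊s⌋₊ + 1, ∀ x, ‖iteratedDeriv j g x‖ ≤ A) → sobolevNorm s q g ≤ N * ENNReal.ofReal A := by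
  set ν : Measure ℝ := volume.restrict (Ioc 0 (2 * Real.pi)) with hν
  set ν' : Measure ℝ := volume.restrict (Ioc (-Real.pi) Real.pi) with hν'
  set w : ℝ × ℝ → ℝ := fun z => |z.2| ^ (1 - (Int.fract s + (1 / q).toReal)) with hw
  have hwp : MemLp w q (ν.prod ν') :=
    (memLp_abs_rpow (Int.fract_lt_one s) hq Real.pi_pos.le).comp_snd ν
  refine ⟨(⌊s⌋₊ + 1) * ν univ ^ q.toReal⁻¹ + eLpNorm w q (ν.prod ν'), ?_, fun g A hg hA hb => ?_⟩
  · refine ENNReal.add_ne_top.2 ⟨ENNReal.mul_ne_top (by finiteness) ?_, hwp.eLpNorm_ne_top⟩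
    exact ENNReal.rpow_ne_top_of_nonneg (by positivity) (measure_ne_top _ _)
  · unfold sobolevNorm
    rw [add_mul]
    refine add_le_add ?_ ?_
    · calc _ ≤ ∑ j ∈ Finset.range (⌊s⌋₊ + 1), ν univ ^ q.toReal⁻¹ * ENNReal.ofReal A := by
            refine Finset.sum_le_sum fun j hj => ?_
            exact eLpNorm_le_of_ae_bound (Eventually.of_forall
              (hb j (by have := Finset.mem_range.1 hj; omega)))
        _ = _ := by
            rw [Finset.sum_const, Finset.card_range, nsmul_eq_mul, ← mul_assoc]
            push_cast
            rfl
    · split_ifs with hs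
      · exact zero_le
      · have hσ : 0 < Int.fract s := lt_of_le_of_ne (Int.fract_nonneg s) (Ne.symm hs)
        calc _ ≤ eLpNorm (A • w) q (ν.prod ν') := by
              refine eLpNorm_mono_real fun z => ?_
              set e := Int.fract s + (1 / q).toReal with he
              have he0 : 0 < e := add_pos_of_pos_of_nonneg hσ ENNReal.toReal_nonneg
              rw [norm_div, norm_norm, Real.norm_of_nonneg (by positivity : 0 ≤ |z.2| ^ e)]
              have h1 := norm_iteratedDeriv_add_sub_le hg (hb (⌊s⌋₊ + 1) le_rfl) z.1 z.2
              simp only [Pi.smul_apply, smul_eq_mul, hw]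
              rcases eq_or_ne z.2 0 with h0 | h0
              · rw [h0]
                simp only [add_zero, sub_self, norm_zero, zero_div]
                positivity
              · have hp : 0 < |z.2| := abs_pos.2 h0
                rw [Real.rpow_sub hp, Real.rpow_one, ← mul_div_assoc]
                gcongr
          _ = _ := by
              rw [eLpNorm_const_smul, Real.enorm_of_nonneg hA, mul_comm]

theorem exists_norm_iteratedDeriv_trigSeries_le {r : ℝ} (hr : 0 < r) (n : ℕ) : ∃ D : ℝ, 0 < D ∧
    ∀ (c : ℤ → ℂ) (C : ℝ), 0 ≤ C → (∀ l, ‖c l‖ ≤ C * Real.exp (-(r * |(l : ℝ)|))) →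
      ∀ j ≤ n, ∀ x, ‖iteratedDeriv j (trigSeries c) x‖ ≤ C * D := by
  have hS : 0 < ∑' l : ℤ, Real.exp (-(r / 2 * |(l : ℝ)|)) :=
    (summable_exp_neg_mul_abs_int (half_pos hr)).tsum_pos (fun _ => (Real.exp_pos _).le) 0
      (Real.exp_pos _)
  set S := ∑' l : ℤ, Real.exp (-(r / 2 * |(l : ℝ)|)) with hSd
  choose D hD hDb using fun j => exists_norm_pow_mul_le hr j
  refine ⟨∑ j ∈ Finset.range (n + 1), D j * S, Finset.sum_pos (fun j _ => mul_pos (hD j) hS)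
    ⟨0, by simp⟩, fun c C hC hc j hj x => ?_⟩
  rw [iteratedDeriv_trigSeries hr hC hc]
  refine (norm_trigSeries_le (half_pos hr) (hDb j c C hC hc) x).trans ?_
  rw [mul_assoc]
  refine mul_le_mul_of_nonneg_left ?_ hC
  exact Finset.single_le_sum (f := fun j => D j * S) (fun i _ => (mul_pos (hD i) hS).le)
    (Finset.mem_range.2 (by omega))

/-- Exponential decay in time of the Sobolev norms of trigonometric series. -/
theorem exists_sobolevNorm_trigSeries_le {r D c : ℝ} (hr : 0 < r) (hD : 0 ≤ D) {u : ℝ → ℤ → ℂ}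
    (hu : ∀ t, 0 ≤ t → ∀ l, ‖u t l‖ ≤ D * Real.exp (-(c * t)) * Real.exp (-(r * |(l : ℝ)|)))
    (s : ℝ) {q : ℝ≥0∞} (hq : 1 ≤ q) : ∃ C : ℝ, ∀ t, 0 ≤ t →
      sobolevNorm s q (trigSeries (u t)) ≤ ENNReal.ofReal (C * Real.exp (-(c * t))) := by
  obtain ⟨N, hN, hNb⟩ := exists_sobolevNorm_le s hq
  obtain ⟨A, hA, hAb⟩ := exists_norm_iteratedDeriv_trigSeries_le hr (⌊s⌋₊ + 1)
  refine ⟨N.toReal * (D * A), fun t ht => ?_⟩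
  have h0 : 0 ≤ D * Real.exp (-(c * t)) := by positivity
  refine (hNb _ (D * Real.exp (-(c * t)) * A) (contDiff_trigSeries hr h0 (hu t ht)) (by positivity)
    (hAb _ _ h0 (hu t ht))).trans ?_
  nth_rw 1 [← ENNReal.ofReal_toReal hN]
  rw [← ENNReal.ofReal_mul ENNReal.toReal_nonneg]
  refine ENNReal.ofReal_le_ofReal (le_of_eq ?_)
  ring

/-! ### Exponential decay of the density and of the field coefficients -/

section

variable {K : ℕ} {L lam A C₀ : ℝ} {h : ℝ → ℂ} {P : ℤ → ℤ → ℕ → ℝ → ℂ}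
  {H F : ℤ → ℤ → ℕ → ℝ → ℝ → ℂ} {μ : ℝ → ℝ}

/-- Half of the weight in `η` and `ξ` becomes decay in time, since non-resonance gives `t ≤ |k t| ≤
(1 + C₀) (|η| + |resFreq|)`. The other half of the weight keeps the series summable. -/
theorem EchoSeries.norm_P_le (hE : EchoSeries K L lam A h P H F) (hLK : L ≤ C₀ * K) (hC₀ : 0 < C₀)
    {k : ℤ} (hk : k ≠ 0) (η : ℤ) (n : ℕ) {t : ℝ} (ht : 0 ≤ t) :
    ‖P k η n t‖ ≤ Real.exp (-(lam / (2 * (1 + C₀)) * t)) * Real.exp (-(lam * |(k : ℝ)|)) *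
      expWeight (lam / 2) (η, n) := by
  have hl := hE.lam_pos
  rw [← hE.H_resFreq]
  refine (hE.H_bound k η n t _).trans ?_
  have h1 := abs_le_of_resonance (by exact_mod_cast hE.one_le_K) hE.L_pos hLK (k * t) η
  rw [show K * (k * t) - L * η = resFreq K L k η t by
    unfold resFreq; rw [max_eq_left ht]; ring] at h1
  set y := resFreq K L k η t with hy
  have h2 : t ≤ |(k : ℝ) * t| := by
    rw [abs_mul, abs_of_nonneg ht]
    refine le_mul_of_one_le_left ht ?_
    exact_mod_cast Int.one_le_abs hk
  have h3 : lam / (2 * (1 + C₀)) * t ≤ lam / 2 * (|(η : ℝ)| + |y|) := by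
    have e : lam / 2 * (|(η : ℝ)| + |y|) =
        lam / (2 * (1 + C₀)) * ((1 + C₀) * (|(η : ℝ)| + |y|)) := by field_simp
    rw [e]
    exact mul_le_mul_of_nonneg_left (h2.trans h1) (by positivity)
  unfold expWeight
  rw [← Real.exp_add, ← Real.exp_add, ← Real.exp_add]
  refine Real.exp_le_exp.2 ?_
  have h4 : 0 ≤ lam / 2 * |y| := by positivity
  have h5 : 0 ≤ lam / 2 * (n : ℝ) := by positivity
  simp only
  linarith

/-- The spatial rate `lam / K` reflects that only multiples `K k` occur. The rate in time is free of
`K` and `L`. -/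
theorem EchoSeries.norm_fieldCoeff_le (hE : EchoSeries K L lam A h P H F) (hLK : L ≤ C₀ * K)
    (hC₀ : 0 < C₀) {t : ℝ} (ht : 0 ≤ t) (l : ℤ) : ‖fieldCoeff (totalCoeff μ K L H) t l‖ ≤
      (∑' m, expWeight (lam / 2) m) * Real.exp (-(lam / (2 * (1 + C₀)) * t)) *
        Real.exp (-(lam / K * |(l : ℝ)|)) := by
  have hS : 0 ≤ ∑' m, expWeight (lam / 2) m := tsum_nonneg fun m => (expWeight_pos _ m).le
  have hK : 0 < K := hE.one_le_K
  have hs := summable_expWeight (half_pos hE.lam_pos)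
  unfold fieldCoeff
  rcases eq_or_ne l 0 with rfl | hl
  · simp only [Int.cast_zero, mul_zero, div_zero, norm_zero]
    positivity
  by_cases hd : (K : ℤ) ∣ l
  · obtain ⟨k, rfl⟩ := hd
    have hk : k ≠ 0 := right_ne_zero_of_mul hl
    have h1 : totalCoeff μ K L H t (K * k) (((K * k : ℤ) : ℝ) * max t 0) =
        echoCoeff K L H t (K * k) (K * k * max t 0) := by
      simp [totalCoeff, equilibriumCoeff, hK.ne', hk]
    have h2 : ‖echoCoeff K L H t (K * k) (K * k * max t 0)‖ ≤ (∑' m, expWeight (lam / 2) m) *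
        Real.exp (-(lam / (2 * (1 + C₀)) * t)) * Real.exp (-(lam * |(k : ℝ)|)) := by
      rw [← (hE.hasSum_P t k).tsum_eq, mul_assoc]
      refine tsum_of_norm_bounded (hs.hasSum.mul_right _) fun m => ?_
      rw [mul_comm]
      exact hE.norm_P_le hLK hC₀ hk m.1 m.2 ht
    rw [h1]
    have h3 := norm_div_intCast_le (echoCoeff K L H t (K * k) (K * k * max t 0)) (K * k)
    rw [norm_div] at h3
    rw [norm_div, norm_mul, Complex.norm_I, one_mul]
    refine h3.trans (h2.trans (le_of_eq ?_))
    congr 3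
    push_cast
    rw [abs_mul, Nat.abs_cast]
    field_simp
  · simp only [totalCoeff, echoCoeff_of_not_dvd hd, equilibriumCoeff, if_neg hl, add_zero, zero_div,
      norm_zero]
    positivity

end

/-! ### The inverse Fourier transform in the velocity -/

/-- The inverse Fourier transform. -/
def fourierVInv (Φ : ℝ → ℂ) (v : ℝ) : ℂ :=
  (2 * Real.pi : ℂ)⁻¹ * ∫ η : ℝ, Φ η * Complex.exp (Complex.I * η * v)

theorem fourierVInv_const_mul (c : ℂ) (Φ : ℝ → ℂ) (v : ℝ) :
    fourierVInv (fun η => c * Φ η) v = c * fourierVInv Φ v := by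
  unfold fourierVInv
  simp only [mul_assoc c]
  rw [integral_const_mul, mul_left_comm]

section

variable {Φ : ℝ → ℂ} {C r : ℝ}

theorem integrable_of_norm_le_exp (hΦ : Continuous Φ) (hr : 0 < r)
    (hb : ∀ η, ‖Φ η‖ ≤ C * Real.exp (-(r * |η|))) : Integrable Φ :=
  ((integrable_exp_neg_mul_abs hr).const_mul C).mono' hΦ.aestronglyMeasurable
    (Eventually.of_forall hb)

theorem isFourierTransform_fourierVInv (hΦ : Continuous Φ) (hr : 0 < r)
    (hb : ∀ η, ‖Φ η‖ ≤ C * Real.exp (-(r * |η|))) : IsFourierTransform (fourierVInv Φ) Φ :=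
  ⟨hΦ, integrable_of_norm_le_exp hΦ hr hb, fun _ => rfl⟩

theorem norm_exp_I_mul_mul_le {η R : ℝ} {z : ℂ} (hz : |z.im| ≤ R) :
    ‖Complex.exp (Complex.I * η * z)‖ ≤ Real.exp (R * |η|) := by
  rw [Complex.norm_exp]
  refine Real.exp_le_exp.2 ?_
  have : (Complex.I * η * z).re = -(η * z.im) := by simp
  rw [this]
  calc _ ≤ |η * z.im| := neg_le_abs _
    _ = |z.im| * |η| := by rw [abs_mul, mul_comm]
    _ ≤ _ := mul_le_mul_of_nonneg_right hz (abs_nonneg _)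

/-- The inverse Fourier transform of an exponentially decaying function is analytic. -/
theorem analyticOnNhd_fourierVInv (hΦ : Continuous Φ) (hr : 0 < r)
    (hb : ∀ η, ‖Φ η‖ ≤ C * Real.exp (-(r * |η|))) : AnalyticOnNhd ℝ (fourierVInv Φ) univ := by
  have hC : 0 ≤ C := nonneg_of_mul_nonneg_left ((norm_nonneg _).trans (hb 0)) (Real.exp_pos _)
  -- On this strip `e^{i η z}` grows at most like `e^{r |η| / 2}`, half of the available decay, so
  -- the integral is holomorphic there.
  set S : Set ℂ := {z | |z.im| < r / 2} with hS
  have hSo : IsOpen S := isOpen_lt (by fun_prop) continuous_const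
  obtain ⟨D, hD, hDb⟩ := exists_one_add_pow_mul_exp_le 1 (show 0 < r / 4 by positivity)
  have hdiff : DifferentiableOn ℂ (fun z : ℂ => ∫ η : ℝ, Φ η * Complex.exp (Complex.I * η * z)) S := by
    intro z hz
    have hexp : ∀ (η : ℝ) {w : ℂ}, w ∈ S →
        ‖Φ η * Complex.exp (Complex.I * η * w)‖ ≤ C * Real.exp (-(r / 2 * |η|)) := fun η w hw => by
      rw [norm_mul]
      calc _ ≤ C * Real.exp (-(r * |η|)) * Real.exp (r / 2 * |η|) := by
            gcongr
            · exact hb η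
            · exact norm_exp_I_mul_mul_le (le_of_lt hw)
        _ = _ := by rw [mul_assoc, ← Real.exp_add]; ring_nf
    have h := hasDerivAt_integral_of_dominated_loc_of_deriv_le (μ := volume)
      (F := fun (z : ℂ) (η : ℝ) => Φ η * Complex.exp (Complex.I * η * z))
      (F' := fun (z : ℂ) (η : ℝ) => Φ η * (Complex.exp (Complex.I * η * z) * (Complex.I * η)))
      (x₀ := z) (s := S) (bound := fun η => C * D * Real.exp (-(r / 4 * |η|)))
      (hSo.mem_nhds hz)
      (Eventually.of_forall fun w => (by fun_prop : Continuous fun η : ℝ =>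
        Φ η * Complex.exp (Complex.I * η * w)).aestronglyMeasurable)
      (integrable_of_norm_le_exp (r := r / 2) (C := C) (by fun_prop) (by positivity)
        fun η => hexp η hz)
      ((by fun_prop : Continuous fun η : ℝ =>
        Φ η * (Complex.exp (Complex.I * η * z) * (Complex.I * η))).aestronglyMeasurable)
      (Eventually.of_forall fun η w hw => ?_)
      ((integrable_exp_neg_mul_abs (by positivity)).const_mul _)
      (Eventually.of_forall fun η w hw => ?_)
    · exact h.2.differentiableAt.differentiableWithinAt
    · rw [← mul_assoc, norm_mul, norm_mul Complex.I, Complex.norm_I, one_mul, Complex.norm_real,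
        Real.norm_eq_abs]
      have h1 := hDb |η| (abs_nonneg _)
      rw [pow_one] at h1
      calc _ ≤ C * Real.exp (-(r / 2 * |η|)) * (1 + |η|) :=
            mul_le_mul (hexp η hw) (by linarith) (abs_nonneg _) (by positivity)
        _ = C * Real.exp (-(r / 4 * |η|)) * ((1 + |η|) * Real.exp (-(r / 4 * |η|))) := by
            rw [show -(r / 2 * |η|) = -(r / 4 * |η|) + -(r / 4 * |η|) by ring, Real.exp_add]; ring
        _ ≤ C * Real.exp (-(r / 4 * |η|)) * D :=
            mul_le_mul_of_nonneg_left h1 (by positivity)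
        _ = _ := by ring
    · have h1 : HasDerivAt (fun w : ℂ => Complex.I * η * w) (Complex.I * η) w := by
        simpa using (hasDerivAt_id w).const_mul (Complex.I * (η : ℂ))
      exact h1.cexp.const_mul (Φ η)
  intro v _
  have hv : (v : ℂ) ∈ S := by simpa [hS] using hr
  have ha := ((hdiff.analyticAt (hSo.mem_nhds hv)).restrictScalars (𝕜 := ℝ))
  have ho : AnalyticAt ℝ (fun x : ℝ => (x : ℂ)) v := Complex.ofRealCLM.analyticAt v
  exact analyticAt_const.mul (ha.fun_comp ho)

end

/-! ### Absolutely convergent expansions -/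

/-- Absolute summability and the value of the sum come from different sources: the first from bounds
on the terms, the second by summing over `(η, n)` first. -/
theorem hasSum_prod_of_fiberwise {α β : Type*} {T : α × β → ℂ} {S : α → ℂ} {a : ℂ}
    (hT : Summable T) (hS : ∀ k, HasSum (fun m => T (k, m)) (S k)) (ha : HasSum S a) :
    HasSum T a := by
  have h := hT.hasSum.prod_fiberwise hS
  rw [ha.unique h]
  exact hT.hasSum

section

variable {K : ℕ} {L lam A C₀ : ℝ} {h : ℝ → ℂ} {P : ℤ → ℤ → ℕ → ℝ → ℂ}
  {H F : ℤ → ℤ → ℕ → ℝ → ℝ → ℂ} {μ : ℝ → ℝ}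

/-- The echo expansion of the distribution function. -/
theorem EchoSeries.hasSum_distr (hE : EchoSeries K L lam A h P H F) (t x v : ℝ) :
    HasSum (fun m : ℤ × (ℤ × ℕ) => fourierVInv (H m.1 m.2.1 m.2.2 t) v *
      Complex.exp (Complex.I * (K * m.1 * x + (L * m.2.1 - K * m.1 * t) * v)))
      (distr (echoCoeff K L H) t x v) := by
  have hl := hE.lam_pos
  have hK0 : (K : ℤ) ≠ 0 := by exact_mod_cast (by have := hE.one_le_K; omega : K ≠ 0)
  have hHc : ∀ (k : ℤ) (m : ℤ × ℕ), Continuous (H k m.1 m.2 t) := fun k m =>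
    (hE.H_continuous k m.1 m.2).comp (by fun_prop : Continuous fun ξ : ℝ => (t, ξ))
  have hHb : ∀ (k : ℤ) (m : ℤ × ℕ) (ξ : ℝ), ‖H k m.1 m.2 t ξ‖ ≤
      Real.exp (-(lam * |(k : ℝ)|)) * expWeight lam m * Real.exp (-(lam * |ξ|)) := fun k m ξ => by
    refine (hE.H_bound k m.1 m.2 t ξ).trans (le_of_eq ?_)
    rw [mul_add, neg_add, Real.exp_add]
    ring
  have hint := integrable_exp_neg_mul_abs hl
  set J := ∫ ξ : ℝ, Real.exp (-(lam * |ξ|)) with hJ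
  have hnorm : ∀ (k : ℤ) (m : ℤ × ℕ), ∫ ξ, ‖H k m.1 m.2 t ξ‖ ≤
      Real.exp (-(lam * |(k : ℝ)|)) * expWeight lam m * J := fun k m => by
    rw [hJ, ← integral_const_mul]
    exact integral_mono (integrable_of_norm_le_exp (hHc k m) hl (hHb k m)).norm
      (hint.const_mul _) (hHb k m)
  have hterm : ∀ (k : ℤ) (m : ℤ × ℕ), (2 * Real.pi : ℂ)⁻¹ *
      ∫ ξ, H k m.1 m.2 t (ξ - L * m.1) * wave (x - t * v) v (K * k) ξ =
      fourierVInv (H k m.1 m.2 t) v *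
        Complex.exp (Complex.I * (K * k * x + (L * m.1 - K * k * t) * v)) := fun k m => by
    unfold fourierVInv
    rw [mul_assoc, ← integral_mul_const, ← integral_add_right_eq_self _ (L * (m.1 : ℝ))]
    congr 1
    refine integral_congr_ae (Eventually.of_forall fun ξ => ?_)
    simp only [wave, add_sub_cancel_right]
    rw [mul_assoc, ← Complex.exp_add]
    congr 2
    push_cast
    ring
  refine hasSum_prod_of_fiberwise (S := fun k : ℤ => (2 * Real.pi : ℂ)⁻¹ *
    ∫ ξ, echoCoeff K L H t (K * k) ξ * wave (x - t * v) v (K * k) ξ) ?_ (fun k => ?_) ?_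
  · have hs := ((summable_exp_neg_mul_abs_int hl).mul_of_nonneg (summable_expWeight hl)
      (fun _ => (Real.exp_pos _).le) fun m => (expWeight_pos _ m).le).mul_right (J * (2 * Real.pi)⁻¹)
    refine .of_norm_bounded hs fun m => ?_
    have hexp : ‖Complex.exp (Complex.I * (K * m.1 * x + (L * m.2.1 - K * m.1 * t) * v))‖ = 1 := by
      have := Complex.norm_exp_I_mul_ofReal (K * m.1 * x + (L * m.2.1 - K * m.1 * t) * v)
      push_cast at this
      exact this
    rw [norm_mul, hexp, mul_one]
    unfold fourierVInv
    rw [norm_mul, norm_inv, norm_mul, Complex.norm_two, Complex.norm_real,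
      Real.norm_of_nonneg Real.pi_pos.le, mul_comm, ← mul_assoc]
    refine mul_le_mul_of_nonneg_right ?_ (by positivity)
    refine (norm_integral_le_integral_norm _).trans (le_trans (le_of_eq ?_) (hnorm m.1 m.2))
    refine integral_congr_ae (Eventually.of_forall fun ξ => ?_)
    simp only [norm_mul _ (Complex.exp _), norm_exp_I_mul, mul_one]
  · have hw : ∀ ξ, ‖wave (x - t * v) v (K * k) ξ‖ = 1 := fun ξ => norm_wave _ _ _ _
    have hi : ∀ m : ℤ × ℕ, Integrable fun ξ =>
        H k m.1 m.2 t (ξ - L * m.1) * wave (x - t * v) v (K * k) ξ := fun m => by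
      refine ((integrable_of_norm_le_exp (hHc k m) hl (hHb k m)).comp_sub_right
        (L * (m.1 : ℝ))).mono ?_ (Eventually.of_forall fun ξ => ?_)
      · have := hHc k m
        have := continuous_wave_right (x - t * v) v (K * k)
        exact (by fun_prop : Continuous fun ξ =>
          H k m.1 m.2 t (ξ - L * m.1) * wave (x - t * v) v (K * k) ξ).aestronglyMeasurable
      · rw [norm_mul, hw, mul_one]
    have hs : Summable fun m : ℤ × ℕ => ∫ ξ, ‖H k m.1 m.2 t (ξ - L * m.1) *
        wave (x - t * v) v (K * k) ξ‖ := by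
      refine .of_nonneg_of_le (fun m => integral_nonneg fun ξ => norm_nonneg _) (fun m => ?_)
        (((summable_expWeight hl).mul_left (Real.exp (-(lam * |(k : ℝ)|)))).mul_right J)
      simp only [norm_mul, hw, mul_one]
      rw [integral_sub_right_eq_self (fun ξ => ‖H k m.1 m.2 t ξ‖)]
      exact hnorm k m
    have h1 := (hasSum_integral_of_summable_integral_norm hi hs).mul_left (2 * Real.pi : ℂ)⁻¹
    have h2 : ∀ ξ, ∑' m : ℤ × ℕ, H k m.1 m.2 t (ξ - L * m.1) * wave (x - t * v) v (K * k) ξ =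
        echoCoeff K L H t (K * k) ξ * wave (x - t * v) v (K * k) ξ := fun ξ =>
      ((hE.hasSum_H t k ξ).mul_right _).tsum_eq
    simp only [h2] at h1
    exact h1.congr_fun fun m => (hterm k m).symm
  · have h1 := hasSum_synth hE.isDecaying t (x - t * v) v
    have hinj : Function.Injective fun l : ℤ => (K : ℤ) * l := mul_right_injective₀ hK0
    refine (hinj.hasSum_iff (f := fun j : ℤ => (2 * Real.pi : ℂ)⁻¹ *
      ∫ ξ, echoCoeff K L H t j ξ * wave (x - t * v) v j ξ) fun j hj => ?_).2 h1
    have hd : ¬(K : ℤ) ∣ j := fun ⟨c, hc⟩ => hj ⟨c, hc.symm⟩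
    simp [echoCoeff_of_not_dvd hd]

/-- The echo expansion of the electric field. -/
theorem EchoSeries.hasSum_field (hE : EchoSeries K L lam A (equilibriumHat μ) P H F) {t : ℝ}
    (ht : 0 ≤ t) (hd : IsDecaying (totalCoeff μ K L H)) (x : ℝ) :
    HasSum (fun m : {k : ℤ // k ≠ 0} × (ℤ × ℕ) => P m.1 m.2.1 m.2.2 t *
      (Complex.exp (Complex.I * (K * (m.1 : ℤ) * x)) / (Complex.I * K * (m.1 : ℤ))))
      (field (totalCoeff μ K L H) t x) := by
  have hl := hE.lam_pos
  have hA := hE.A_nonneg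
  have hK1 : K ≠ 0 := by have := hE.one_le_K; omega
  have hK0 : (K : ℤ) ≠ 0 := by exact_mod_cast hK1
  refine hasSum_prod_of_fiberwise (S := fun k : {k : ℤ // k ≠ 0} =>
    fieldCoeff (totalCoeff μ K L H) t (K * k) * Complex.exp (Complex.I * ((K * k : ℤ) : ℂ) * x)) ?_
    (fun k => ?_) ?_
  · have hs := ((((summable_exp_neg_mul_abs_int hl).subtype {k | k ≠ 0}).mul_of_nonneg
      (summable_expWeight hl) (fun _ => (Real.exp_pos _).le)
      fun m => (expWeight_pos _ m).le).mul_left A)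
    refine .of_norm_bounded hs fun m => ?_
    have hexp : ‖Complex.exp (Complex.I * (K * (m.1 : ℤ) * x))‖ = 1 := by
      have := Complex.norm_exp_I_mul_ofReal (K * (m.1 : ℤ) * x)
      push_cast at this
      exact this
    have h1 := hE.P_bound m.1 m.2.1 m.2.2 t ht
    have h2 := norm_div_intCast_le (P m.1 m.2.1 m.2.2 t) (K * m.1)
    rw [norm_mul, norm_div, hexp, mul_assoc, norm_mul Complex.I, Complex.norm_I, one_mul,
      mul_one_div, ← norm_div]
    push_cast at h2
    refine h2.trans (h1.trans (le_of_eq (mul_assoc _ _ _)))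
  · have h1 : totalCoeff μ K L H t (K * k) (((K * k : ℤ) : ℝ) * max t 0) =
        echoCoeff K L H t (K * k) (K * k * max t 0) := by
      simp [totalCoeff, equilibriumCoeff, hK1, k.2]
    unfold fieldCoeff
    rw [h1]
    refine (((hE.hasSum_P t k).div_const _).mul_right _).congr_fun fun m => ?_
    push_cast
    rw [mul_assoc Complex.I, mul_assoc Complex.I]
    ring
  · have h1 := hd.hasSum_field t x
    have hinj : Function.Injective fun k : {k : ℤ // k ≠ 0} => (K : ℤ) * k :=
      (mul_right_injective₀ hK0).comp Subtype.val_injective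
    refine (hinj.hasSum_iff (f := fun l : ℤ => fieldCoeff (totalCoeff μ K L H) t l *
      Complex.exp (Complex.I * l * x)) fun l hl => ?_).2 h1
    unfold fieldCoeff
    rcases eq_or_ne l 0 with rfl | h0
    · simp
    · have hd : ¬(K : ℤ) ∣ l := fun ⟨c, hc⟩ =>
        hl ⟨⟨c, fun h => h0 (by rw [hc, h, mul_zero])⟩, hc.symm⟩
      simp [totalCoeff, echoCoeff_of_not_dvd hd, equilibriumCoeff, h0]

end

/-! ### Bounds in terms of the bracket and the data of the expansion -/

section

variable {lam C₀ θ₀ θ₁ M L A₁ A₂ B ε : ℝ} {K : ℕ} {h : ℝ → ℂ} {G : ℤ → ℝ → ℂ}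
  {data : ℤ → ℤ → ℝ → ℂ}

theorem sqrt_bracket_le (k η : ℤ) (n : ℕ) (ξ : ℝ) :
    √(1 + (k : ℝ) ^ 2 + (η : ℝ) ^ 2 + ((n + 1 : ℕ) : ℝ) ^ 2 + ξ ^ 2) ≤ 1 + freqSize k η n ξ := by
  have hp := (freqSize_pos k η n ξ).le
  refine Real.sqrt_le_iff.2 ⟨by linarith, ?_⟩
  unfold freqSize at hp ⊢
  push_cast
  rw [← sq_abs (k : ℝ), ← sq_abs (η : ℝ), ← sq_abs ξ]
  have h1 := abs_nonneg (k : ℝ)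
  have h2 := abs_nonneg (η : ℝ)
  have h3 := abs_nonneg ξ
  have h4 : (0 : ℝ) ≤ n + 1 := by positivity
  generalize |(k : ℝ)| = a at *
  generalize |(η : ℝ)| = b at *
  generalize |ξ| = c at *
  generalize (n : ℝ) + 1 = d at *
  have e : (1 + (a + b + d + c)) ^ 2 = 1 + a ^ 2 + b ^ 2 + d ^ 2 + c ^ 2 +
    2 * (a + b + d + c + a * b + a * d + a * c + b * d + b * c + d * c) := by ring
  rw [e]
  have : 0 ≤ 2 * (a + b + d + c + a * b + a * d + a * c + b * d + b * c + d * c) := by positivity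
  linarith

/-- The bracket is at most one plus the size, and the additional one costs `e^{lam}`, which is put
into the geometric constant. -/
theorem norm_echoProfile_le (hl : 0 < lam) {n : ℕ} {K : ℝ} (hb : EchoBound lam K L A₁ A₂ B h G data n)
    (hA₂' : A₂ ≤ 1) (hB : 1 ≤ B) (k η : ℤ) {t : ℝ} (ht : 0 ≤ t) (ξ : ℝ) :
    ‖echoProfile K L h G data n k η t ξ‖ ≤ (B * Real.exp lam) ^ (n + 1) * Real.exp (-(lam *
      √(1 + (k : ℝ) ^ 2 + (η : ℝ) ^ 2 + ((n + 1 : ℕ) : ℝ) ^ 2 + ξ ^ 2))) := by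
  have h1 := hb.2.bound k η t ξ ht
  have hp := (freqSize_pos k η n ξ).le
  have h2 := weight_le_exp hl t hp
  have h3 : Real.exp (-(lam * freqSize k η n ξ)) ≤ Real.exp lam * Real.exp (-(lam *
      √(1 + (k : ℝ) ^ 2 + (η : ℝ) ^ 2 + ((n + 1 : ℕ) : ℝ) ^ 2 + ξ ^ 2))) := by
    rw [← Real.exp_add]
    refine Real.exp_le_exp.2 ?_
    have := mul_le_mul_of_nonneg_left (sqrt_bracket_le k η n ξ) hl.le
    linarith
  have h4 : Real.exp lam ≤ Real.exp lam ^ (n + 1) :=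
    le_self_pow₀ (Real.one_le_exp hl.le) (Nat.succ_ne_zero n)
  have hw := weight_pos (lam := lam) t hp
  set E := Real.exp (-(lam * √(1 + (k : ℝ) ^ 2 + (η : ℝ) ^ 2 + ((n + 1 : ℕ) : ℝ) ^ 2 + ξ ^ 2)))
  have hE : 0 ≤ E := (Real.exp_pos _).le
  have hBp : 0 ≤ B ^ (n + 1) := by positivity
  calc _ ≤ A₂ * B ^ (n + 1) * weight lam t (freqSize k η n ξ) := h1
    _ ≤ 1 * B ^ (n + 1) * (Real.exp lam ^ (n + 1) * E) := by
        refine mul_le_mul (mul_le_mul_of_nonneg_right hA₂' hBp) (h2.trans (h3.trans ?_)) hw.le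
          (by positivity)
        exact mul_le_mul_of_nonneg_right h4 hE
    _ = _ := by rw [mul_pow]; ring

theorem echoInit_apply (n : ℕ) (k η : ℤ) (ξ : ℝ) :
    echoInit data n k η ξ = if n = 0 then data k η ξ else 0 := by
  unfold echoInit
  split_ifs <;> rfl

theorem echoProfile_zero (n : ℕ) (K : ℝ) (k η : ℤ) (ξ : ℝ) :
    echoProfile K L h G data n k η 0 ξ = echoInit data n k η ξ := by
  rw [echoProfile_eq]; simp [profile]

end

/-- The resolvent of mode `k` is the one at the wave number `K k`. Nothing is assumed about the
coefficients with `k = 0`, which do not occur in the datum and are set to zero. -/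
theorem exists_echoContext {μ : ℝ → ℝ} {θ₀ C₀ θ₁ M lam L : ℝ} {K : ℕ}
    (hμ : IsAnalyticEquilibrium μ θ₀ C₀)
    (hG : ∀ q : ℤ, q ≠ 0 → ∃ G : ℝ → ℂ, Continuous G ∧
      (∀ t, 0 ≤ t → ‖G t‖ ≤ M * |(q : ℝ)| * Real.exp (-(θ₁ * |(q : ℝ)| * t))) ∧
      ∀ t : ℝ, 0 ≤ t → G t + ∫ s in (0 : ℝ)..t,
        ((t - s : ℝ) : ℂ) * equilibriumHat μ (q * (t - s)) * G s =
          -((t : ℂ) * equilibriumHat μ (q * t)))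
    (hK : 1 ≤ K) (hL : 0 < L) (hLK : L ≤ C₀ * K) {aHat : ℤ → ℤ → ℝ → ℂ}
    (hc : ∀ k η : ℤ, k ≠ 0 → Continuous (aHat k η))
    (hb : ∀ (k η : ℤ) (η' : ℝ), k ≠ 0 →
        ‖aHat k η η'‖ ≤ Real.exp (-(2 * lam * √(1 + (k : ℝ) ^ 2 + (η : ℝ) ^ 2 + η' ^ 2)))) :
    ∃ G, EchoContext lam C₀ θ₀ θ₁ M K L (equilibriumHat μ) G
      fun k η ξ => if k = 0 then 0 else aHat k η ξ := by
  have hG' : ∀ k : ℤ, ∃ G : ℝ → ℂ, Continuous G ∧ (k ≠ 0 →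
      (∀ t, 0 ≤ t → ‖G t‖ ≤ M * (K * |(k : ℝ)|) * Real.exp (-(θ₁ * (K * |(k : ℝ)|) * t))) ∧
      ∀ t : ℝ, 0 ≤ t → G t + ∫ s in (0 : ℝ)..t,
        ((t - s : ℝ) : ℂ) * equilibriumHat μ (K * k * (t - s)) * G s =
          -((t : ℂ) * equilibriumHat μ (K * k * t))) := fun k => by
    rcases eq_or_ne k 0 with rfl | hk
    · exact ⟨0, continuous_const, fun h => absurd rfl h⟩
    · obtain ⟨G, h1, h2, h3⟩ := hG (K * k) (mul_ne_zero (by exact_mod_cast (by omega : K ≠ 0)) hk)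
      simp only [Int.cast_mul, Int.cast_natCast, abs_mul, Nat.abs_cast] at h2 h3
      exact ⟨G, h1, fun _ => ⟨h2, h3⟩⟩
  choose G hGc hGb using hG'
  refine ⟨G, by exact_mod_cast hK, hL, hLK, hμ.continuous_equilibriumHat, hμ.norm_equilibriumHat_le,
    hGc, fun k t hk => (hGb k hk).1 t, fun k t hk => (hGb k hk).2 t, fun k η => ?_, fun η ξ => by simp,
    fun k η ξ => ?_⟩
  · split_ifs with hk
    · exact continuous_const
    · exact hc k η hk
  · split_ifs with hk
    · rw [norm_zero]; exact (Real.exp_pos _).le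
    · exact hb k η ξ hk

/-- Solutions with the same initial datum have the same Fourier coefficients. -/
theorem IsFourierSolution.eq_of_distr_eq {V W : ℝ → ℤ → ℝ → ℂ} (hV : IsFourierSolution V)
    (hW : IsFourierSolution W) (h0 : ∀ x v, distr V 0 x v = distr W 0 x v) {t : ℝ} (ht : 0 ≤ t) :
    V t = W t := by
  have hs := hV.decaying.sub hW.decaying
  obtain ⟨C, r, -, hr, hb⟩ := hs.exists_bound 0
  have hz := eq_zero_of_synth_eq_zero (fun j => hs.continuous_right 0 j) hr hb fun x v => by
    have := h0 x v
    simp only [distr, zero_mul, sub_zero] at this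
    rw [synth_sub hV.decaying hW.decaying, this, sub_self]
  ext j ξ
  exact hV.unique hW (fun j ξ => sub_eq_zero.1 (hz j ξ)) ht j ξ

/-- The reindexing of the orders of the echo expansion. -/
def orderEquiv (α : Type*) : α × ℤ × ℕ+ ≃ α × (ℤ × ℕ) :=
  (Equiv.refl α).prodCongr ((Equiv.refl ℤ).prodCongr Equiv.pnatEquivNat)

theorem orderEquiv_symm_apply {α : Type*} (m : α × (ℤ × ℕ)) :
    (orderEquiv α).symm m = (m.1, m.2.1, m.2.2.succPNat) := rfl

end

end VlasovPoisson

/-! ### The main theorem -/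

open VlasovPoisson in
theorem theorem1 (μ : ℝ → ℝ) (θ₀ C₀ κ₀ : ℝ) (hθ₀ : 0 < θ₀) (hC₀ : 0 < C₀) (hκ₀ : 0 < κ₀)
    (hμ : VlasovPoisson.IsAnalyticEquilibrium μ θ₀ C₀)
    (hP : VlasovPoisson.PenroseStable μ κ₀) :
    ∃ lamStar : ℝ, 0 < lamStar ∧ ∀ lam₀ : ℝ, 0 < lam₀ → lam₀ ≤ lamStar →
    ∃ ε₀ C₁ c : ℝ, 0 < ε₀ ∧ 0 < C₁ ∧ 0 < c ∧
    ∀ (K : ℕ) (L : ℝ), 1 ≤ K → 0 < L → L ≤ C₀ * K →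
    -- the coefficients of the initial datum and their Fourier transforms
    ∀ a aHat : ℤ → ℤ → ℝ → ℂ,
      (∀ k η : ℤ, k ≠ 0 → VlasovPoisson.IsFourierTransform (a k η) (aHat k η)) →
      (∀ (k η : ℤ) (η' : ℝ), k ≠ 0 →
        ‖aHat k η η'‖ ≤ Real.exp (-(2 * lam₀ * √(1 + (k : ℝ) ^ 2 + (η : ℝ) ^ 2 + η' ^ 2)))) →
    -- the coefficients of the echo expansion and their Fourier transforms
    ∃ φ φHat : ℤ → ℤ → ℕ+ → ℝ → ℝ → ℂ,
      (∀ (k η : ℤ) (p : ℕ+) (t : ℝ), 0 ≤ t →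
        VlasovPoisson.IsFourierTransform (φ k η p t) (φHat k η p t) ∧
        AnalyticOnNhd ℝ (φ k η p t) univ ∧
        ∀ η' : ℝ, ‖φHat k η p t η'‖ ≤ C₁ ^ (p : ℕ) * Real.exp (-(lam₀ *
          √(1 + (k : ℝ) ^ 2 + (η : ℝ) ^ 2 + ((p : ℕ) : ℝ) ^ 2 + η' ^ 2)))) ∧
      ∀ ε : ℝ, 0 < ε → ε ≤ ε₀ →
      ∀ f₀ : ℝ → ℝ → ℂ,
        (∀ x v : ℝ, HasSum (fun m : {k : ℤ // k ≠ 0} × ℤ =>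
          (ε : ℂ) * a m.1 m.2 v *
            Complex.exp (Complex.I * (K * (m.1 : ℤ) * x + L * m.2 * v))) (f₀ x v)) →
      ∃ (f : ℝ → ℝ → ℝ → ℂ) (E : ℝ → ℝ → ℂ),
        -- existence
        VlasovPoisson.IsSolution μ f₀ f E ∧ VlasovPoisson.IsLocallyUniformlyAnalytic f ∧
        -- uniqueness
        (∀ (g : ℝ → ℝ → ℝ → ℂ) (G : ℝ → ℝ → ℂ),
          VlasovPoisson.IsSolution μ f₀ g G → VlasovPoisson.IsLocallyUniformlyAnalytic g →
          ∀ t x v : ℝ, 0 ≤ t → g t x v = f t x v ∧ G t x = E t x) ∧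
        -- echo expansion of the solution
        (∀ t x v : ℝ, 0 ≤ t → HasSum (fun m : ℤ × ℤ × ℕ+ =>
          (ε : ℂ) ^ (m.2.2 : ℕ) * φ m.1 m.2.1 m.2.2 t v *
            Complex.exp (Complex.I * (K * m.1 * x + (L * m.2.1 - K * m.1 * t) * v)))
          (f t x v)) ∧
        -- echo expansion of the electric field
        (∀ t x : ℝ, 0 ≤ t → HasSum (fun m : {k : ℤ // k ≠ 0} × ℤ × ℕ+ =>
          (ε : ℂ) ^ (m.2.2 : ℕ) *
            φHat m.1 m.2.1 m.2.2 t (K * ((m.1 : ℤ) : ℝ) * t - L * (m.2.1 : ℝ)) *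
            (Complex.exp (Complex.I * (K * (m.1 : ℤ) * x)) / (Complex.I * K * (m.1 : ℤ))))
          (E t x)) ∧
        -- Landau damping
        (∀ t : ℝ, 0 ≤ t → ContDiff ℝ ∞ (E t)) ∧
        (∀ (s : ℝ) (q : ℝ≥0∞), 0 ≤ s → 1 ≤ q → ∃ C : ℝ, ∀ t : ℝ, 0 ≤ t →
          VlasovPoisson.sobolevNorm s q (E t) ≤ ENNReal.ofReal (C * Real.exp (-(c * t)))) := by
  obtain ⟨θ₁, M, hθ₁, hθ₁₀, hM, hG⟩ := exists_density_resolvent hθ₀ hκ₀ hμ hP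
  -- The value for which `11 / 10 * lam ≤ θ₁ / 2`: the largest radius must be at most half the decay
  -- rate of the resolvents. The analogous condition for `θ₀` follows from `θ₁ ≤ θ₀ / 4`.
  refine ⟨5 / 11 * θ₁, by positivity, fun lam hl hlθ => ?_⟩
  obtain ⟨A₁, A₂, B, hA₁, hA₂, hA₂', hB, hEB⟩ := exists_echoBound hl hC₀ hθ₀ hθ₁ hM
    (by linarith) (by linarith)
  have hB0 : 0 < B := by linarith
  -- These come from convergence of the expansion (`ε B ≤ 1`), `norm_echoProfile_le` and
  -- `EchoSeries.norm_P_le`. All of them are fixed before `K` and `L`.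
  refine ⟨B⁻¹, B * Real.exp lam, lam / (2 * (1 + C₀)), by positivity, by positivity, by positivity,
    fun K L hK hL hLK a aHat ha hab => ?_⟩
  obtain ⟨G, ctx⟩ := exists_echoContext hμ hG hK hL hLK (fun k η hk => (ha k η hk).1) hab
  have hb := hEB ctx
  set data : ℤ → ℤ → ℝ → ℂ := fun k η ξ => if k = 0 then 0 else aHat k η ξ with hdata
  set Hn := echoProfile K L (equilibriumHat μ) G data with hHn
  have hcont : ∀ n k η t, Continuous (Hn n k η t) := fun n k η t =>
    ((hb n).2.continuous k η).comp (by fun_prop : Continuous fun ξ : ℝ => (t, ξ))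
  have hdec : ∀ n k η (t : ℝ), 0 ≤ t → ∀ ξ,
      ‖Hn n k η t ξ‖ ≤ (B * Real.exp lam) ^ (n + 1) * Real.exp (-(lam * |ξ|)) :=
    fun n k η t ht ξ => by
      refine (norm_echoProfile_le hl (hb n) hA₂' hB k η ht ξ).trans ?_
      have : |ξ| ≤ √(1 + (k : ℝ) ^ 2 + (η : ℝ) ^ 2 + ((n + 1 : ℕ) : ℝ) ^ 2 + ξ ^ 2) :=
        Real.abs_le_sqrt (le_add_of_nonneg_left (by positivity))
      gcongr
  -- The power `p` of `ε` corresponds to the order `n = p - 1`.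
  refine ⟨fun k η p t => fourierVInv (Hn p.natPred k η t), fun k η p t => Hn p.natPred k η t,
    fun k η p t ht => ⟨isFourierTransform_fourierVInv (hcont _ _ _ _) hl (hdec _ _ _ t ht),
      analyticOnNhd_fourierVInv (hcont _ _ _ _) hl (hdec _ _ _ t ht), fun ξ => ?_⟩,
    fun ε hε hεB f₀ hf₀ => ?_⟩
  · have := norm_echoProfile_le hl (hb p.natPred) hA₂' hB k η ht ξ
    rwa [PNat.natPred_add_one] at this
  have hεB' : ε * B ≤ 1 := (le_inv_mul_iff₀' hB0).1 (by simpa using hεB)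
  obtain ⟨A, hE⟩ := ctx.isEchoSeries hl hθ₀ hC₀ hb hA₁ hA₂ hA₂' hB hε hεB'
  set H : ℤ → ℤ → ℕ → ℝ → ℝ → ℂ := fun k η n t ξ => (ε : ℂ) ^ (n + 1) *
    echoProfile K L (equilibriumHat μ) G data n k η t ξ with hH
  set W := totalCoeff μ K L H with hW
  have hWs : IsFourierSolution W := hE.isFourierSolution hμ hθ₀ hC₀
  have hfW : ∀ t x v, distr (echoCoeff K L H) t x v = distr W t x v - μ v := fun t x v => by
    rw [← hμ.distr_sub hθ₀ hC₀ hWs.decaying]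
    congr 1
    ext t j ξ
    simp [hW, totalCoeff]
  have hexpand : ∀ t x v : ℝ, HasSum (fun m : ℤ × ℤ × ℕ+ =>
      (ε : ℂ) ^ (m.2.2 : ℕ) * fourierVInv (Hn m.2.2.natPred m.1 m.2.1 t) v *
        Complex.exp (Complex.I * (K * m.1 * x + (L * m.2.1 - K * m.1 * t) * v)))
      (distr W t x v - μ v) := fun t x v => by
    rw [← hfW, ← (orderEquiv ℤ).symm.hasSum_iff]
    refine (hE.hasSum_distr t x v).congr_fun fun m => ?_
    rw [Function.comp_apply, orderEquiv_symm_apply]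
    simp only [Nat.natPred_succPNat, Nat.succPNat_coe, Nat.succ_eq_add_one, hH,
      fourierVInv_const_mul, hHn]
  -- Neutrality at time zero: the datum has no mode `k = 0`, so the total charge is that of the
  -- equilibrium.
  have h00 : W 0 0 0 = equilibriumHat μ 0 := by
    have h1 := echoCoeff_mul (L := L) (H := H) hK 0 0 0
    rw [mul_zero] at h1
    have h2 : ∀ m : ℤ × ℕ, H 0 m.1 m.2 0 (0 - L * m.1) = 0 := fun m => by
      simp [hH, echoProfile_zero, echoInit_apply, hdata]
    simp only [hW, totalCoeff, h1, h2, tsum_zero, zero_add, equilibriumCoeff, if_true]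
  -- At time zero the profiles reduce to their initial data, so only the terms with `p = 1` and `k ≠
  -- 0` survive; they are the terms of the given series, and sums are unique.
  have hinit : ∀ x v, f₀ x v = distr W 0 x v - μ v := fun x v => by
    have hzero : ∀ (n : ℕ) (k η : ℤ), Hn n k η 0 = echoInit data n k η := fun n k η => by
      ext ξ
      exact echoProfile_zero n _ k η ξ
    have hinj : Function.Injective fun m : {k : ℤ // k ≠ 0} × ℤ => ((m.1 : ℤ), m.2, (1 : ℕ+)) :=
      fun m m' hm => by
        simp only [Prod.mk.injEq, and_true] at hm
        exact Prod.ext (Subtype.ext hm.1) hm.2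
    refine HasSum.unique ?_ (hexpand 0 x v)
    refine (hinj.hasSum_iff fun m hm => ?_).1 ((hf₀ x v).congr_fun fun m => ?_)
    · have : echoInit data m.2.2.natPred m.1 m.2.1 = 0 := by
        ext ξ
        rw [echoInit_apply]
        split_ifs with h1
        · have h2 : m.2.2 = 1 := by
            rw [← PNat.succPNat_natPred m.2.2, h1]; rfl
          have h3 : m.1 = 0 := by
            by_contra h3
            exact hm ⟨(⟨m.1, h3⟩, m.2.1), by rw [← h2]⟩
          simp [hdata, h3]
        · rfl
      rw [hzero, this]
      simp [fourierVInv]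
    · have h1 : echoInit data (1 : ℕ+).natPred m.1 m.2 = aHat m.1 m.2 := by
        ext ξ
        rw [echoInit_apply, if_pos (by rfl : PNat.natPred 1 = 0)]
        simp [hdata, m.1.2]
      have h2 : a m.1 m.2 v = fourierVInv (aHat m.1 m.2) v := (ha m.1 m.2 m.1.2).2.2 v
      simp only [Function.comp_apply]
      rw [hzero, h1, h2, PNat.one_coe, pow_one]
      simp
  have hsol := hWs.isSolution hμ hθ₀ hC₀ h00
  simp only [← hinit] at hsol
  refine ⟨_, _, hsol, ?_, fun g G' hg hga t x v ht => ?_, fun t x v _ => hexpand t x v,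
    fun t x ht => ?_, fun t ht => ?_, fun s q _ hq => ?_⟩
  · have e : distr (echoCoeff K L H) = fun t x v => distr W t x v - μ v := by
      ext t x v
      exact hfW t x v
    exact e ▸ hE.isDecaying.isLocallyUniformlyAnalytic
  -- A competitor also has Fourier coefficients that solve the integral equation. They agree with
  -- `W` initially, hence at all times, and they determine both the distribution and the field.
  · obtain ⟨V, hV, hVg⟩ := hg.exists_isFourierSolution hμ hθ₀ hC₀ hga
    have h := hV.eq_of_distr_eq hWs (fun x v => by
      rw [(hVg 0 x v le_rfl).1, hg.initial, hinit]; ring) ht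
    constructor
    · have := (hVg t x v ht).1
      unfold distr at this ⊢
      rw [← h, this]; ring
    · rw [← (hVg t x v ht).2, field_eq_trigSeries, field_eq_trigSeries]
      unfold fieldCoeff
      rw [h]
  · rw [← (orderEquiv {k : ℤ // k ≠ 0}).symm.hasSum_iff]
    refine (hE.hasSum_field ht hWs.decaying x).congr_fun fun m => ?_
    rw [Function.comp_apply, orderEquiv_symm_apply]
    have h1 := hE.H_resFreq m.1 m.2.1 m.2.2 t
    unfold resFreq at h1
    rw [max_eq_left ht] at h1
    simp only [Nat.natPred_succPNat, Nat.succPNat_coe, Nat.succ_eq_add_one]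
    rw [← h1]
  · rw [field_eq_trigSeries]
    have hS : 0 ≤ ∑' m, expWeight (lam / 2) m := tsum_nonneg fun m => (expWeight_pos _ m).le
    exact contDiff_trigSeries (r := lam / K) (by positivity) (by positivity)
      (hE.norm_fieldCoeff_le hLK hC₀ ht)
  · have hS : 0 ≤ ∑' m, expWeight (lam / 2) m := tsum_nonneg fun m => (expWeight_pos _ m).le
    exact exists_sobolevNorm_trigSeries_le (r := lam / K) (by positivity) hS
      (fun t ht l => hE.norm_fieldCoeff_le hLK hC₀ ht l) s hq
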